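/- **Setting.** A dyadic interval is $[n2^k,(n+1)2^k)$, $n,k\in\mathbb Z$; $c(I)$ is the midpoint of an interval $I$, $CI$ its dilation by the factor $C$ from its center, $\widetilde\chi_I(x)=(1+|x-c(I)|/|I|)^{-2}$. A tile is a rectangle $P=I_P\times\omega_P$ of area $1$ with $I_P,\omega_P$ dyadic intervals. Fix integers $m,n$ and put $\omega_{P,lower}=(-\infty,\,c(\omega_P)-(m-\tfrac12)|\omega_P|)$ and $\omega_{P,upper}=\omega_P+n|\omega_P|$. Let $\mathbf P$ be a finite collection of tiles such that for every $P\in\mathbf P$ the interval $1000\,\omega_P$ lies strictly between $\omega_{P,lower}$ and $\omega_{P,upper}$, and which is sparse relative to a constant $C_0$: for $Q,R\in\mathbf P$ with $|I_R|/C_0\le|I_Q|\le|I_R|$ we have $|I_Q|=|I_R|$, and either $\omega_Q=\omega_R$ or $C_0\omega_Q\cap C_0\omega_R=\emptyset$. Let $\widetilde\omega_P$ be the convex hull of $50\omega_P\cup 50\omega_{P,upper}$. For each $P\in\mathbf P$ let $\phi_P$ be a smooth function whose Fourier transform $\widehat{\phi_P}(\xi)=(2\pi)^{-1/2}\int\phi_P(x)e^{-ix\xi}dx$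 is supported in $\tfrac54\omega_P$, with $$\Big|\frac{d^a}{dx^a}\big(e^{-ic(\omega_P)x}\phi_P(x)\big)\Big|\le A_{a,b}\,|I_P|^{-a-1}\Big(1+\frac{|x-c(I_P)|}{|I_P|}\Big)^{-b}\qquad (a,b=0,1,2,\dots).$$ Let $K:\mathbb R\to\mathbb N$, $N_0(x)\le N_1(x)\le\cdots$ (real-valued), $d_j:\mathbb R\to\mathbb C$, $\alpha_j:\mathbb R\to[0,\infty]$ and $f:\mathbb R\to\mathbb C$ be measurable, and define for $P\in\mathbf P$ $$T_2f(P)=\int_{\mathbb R} f(x)\,\overline{\sum_{1\le j\le K(x)}d_j(x)\,\phi_P(x)\,1_{N_{j-1}(x)\in\omega_{P,lower}}\,1_{N_j(x)\in\omega_{P,upper}}\,1_{|I_P|\le\alpha_j(x)}}\;dx .$$ **Outer measure space.** A nonempty $E\subset\mathbf P$ is generating with top $(I_E,\xi_E)$, $I_E$ dyadic and $\xi_E\in\mathbb R$, if $I_P\subset I_E$ and $(\xi_E-\frac1{2|I_E|},\xi_E+\frac1{2|I_E|})\subset\widetilde\omega_P$ for all $P\in E$; it is lacunary if moreover $\xi_E\in50\omega_{P,upper}$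 for all $P\in E$, and overlapping if moreover $\xi_E\in\widetilde\omega_P\setminus50\omega_{P,upper}$ for all $P\in E$. For $F\subset\mathbf P$ let $\mu(F)=\inf\sum_j|I_{E_j}|$ over countable coverings of $F$ by generating sets (and over choices of their tops). For $g:\mathbf P\to\mathbb C$, $0<t<\infty$ and $E$ generating, let $S_{t,lac}(g)(E)=\sup_S\big(|I_S|^{-1}\sum_{P\in S}|I_P||g(P)|^t\big)^{1/t}$ over all lacunary $S\subset E$ and all their tops; $S_{t,overlap}$ is defined in the same way with overlapping $S$. For a size $S$ let $\|g\|_{\mathcal L^\infty(\mathbf P,S,\mu)}=\sup_ES(g)(E)$ over generating $E\subset\mathbf P$, let $\mu(S(g)>\lambda)=\inf\{\mu(F):F\subset\mathbf P,\ \|g1_{\mathbf P\setminus F}\|_{\mathcal L^\infty(\mathbf P,S,\mu)}\le\lambda\}$, and for $0<p<\infty$ let $$\|g\|_{\mathcal L^p(\mathbf P,S,\mu)}=\Big(p\int_0^\infty\lambda^{p-1}\mu(S(g)>\lambda)\,d\lambda\Big)^{1/p},\qquad \|g\|_{\mathcal L^{p,\infty}(\mathbf P,S,\mu)}=\sup_{\lambda>0}\lambda\,\mu(S(g)>\lambda)^{1/p}.$$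 For $N\in\mathbb N$ and $h\ge0$ let $M_N(\mathbf P,h)=\sup_{P\in\mathbf P}|I_P|^{-1}\int\widetilde\chi_{I_P}^Nh$. Let $\mathrm{supp}(f)=\{f\ne0\}$. **Theorem.** Let $1\le s<\infty$, $s\ne2$, let $s'$ be the conjugate exponent of $s$ ($s'=s/(s-1)$, and $s'=\infty$ if $s=1$), let $q=\min(2,s')$, and let $q'$ be its conjugate exponent. There is a $C_0\ge 1$ depending only on $m,n$ such that whenever $\mathbf P$ is sparse relative to $C_0$ the following holds. For every $p\in(s,\infty]$, $$\|T_2f\|_{\mathcal L^p(\mathbf P,\,S_{1,overlap}+S_{q',lac},\,\mu)}\le C\,M_N(\mathbf P,1_{\mathrm{supp}(f)})^{1/p'}\,\Big\|f\Big(\sum_{1\le j\le K}|d_j|^s\Big)^{1/s}\Big\|_{L^p(\mathbb R)},$$ and at $p=s$ the weak-type estimate holds: $$\|T_2f\|_{\mathcal L^{s,\infty}(\mathbf P,\,S_{1,overlap}+S_{q',lac},\,\mu)}\le C'\,M_N(\mathbf P,1_{\mathrm{supp}(f)})^{1/s'}\,\Big\|f\Big(\sum_{1\le j\le K}|d_j|^s\Big)^{1/s}\Big\|_{L^s(\mathbb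 R)}.$$ Here $C$ depends only on $m,n,N,s,p$ and the constants $(A_{a,b})$, and $C'$ only on $m,n,N,s$ and $(A_{a,b})$; neither depends on $\mathbf P$, $\phi_P$, $K$, $N_j$, $d_j$, $\alpha_j$ or $f$. -/

import Mathlib

open Set MeasureTheory
open scoped ENNReal NNReal

namespace OuterEmbedding

/-! ### Dyadic intervals and tiles -/

/-- The standard dyadic interval `[pos * 2 ^ scale, (pos + 1) * 2 ^ scale)`. -/
structure DyadicInterval where
  scale : ℤ
  pos : ℤ

namespace DyadicInterval

/-- The length of a dyadic interval. -/
noncomputable def length (J : DyadicInterval) : ℝ := (2 : ℝ) ^ J.scale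

/-- The midpoint of a dyadic interval. -/
noncomputable def center (J : DyadicInterval) : ℝ := ((J.pos : ℝ) + 1 / 2) * J.length

/-- The interval itself, as a set of reals. -/
def toSet (J : DyadicInterval) : Set ℝ :=
  Ico ((J.pos : ℝ) * J.length) (((J.pos : ℝ) + 1) * J.length)

/-- The enlargement `C J`: the dilation of `J` by the factor `C` from its center. -/
def dilate (C : ℝ) (J : DyadicInterval) : Set ℝ :=
  Ico (J.center - C * J.length / 2) (J.center + C * J.length / 2)

/-- The translate `J + n |J|`. -/
def shift (J : DyadicInterval) (n : ℤ) : DyadicInterval := ⟨J.scale, J.pos + n⟩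

/-- The weight `(1 + |x - c(J)| / |J|) ^ (-2)`. -/
noncomputable def chi (J : DyadicInterval) (x : ℝ) : ℝ :=
  ((1 + |x - J.center| / J.length) ^ 2)⁻¹

end DyadicInterval

/-- A tile: a rectangle `I × ω` of area one with dyadic sides. -/
structure Tile where
  I : DyadicInterval
  ω : DyadicInterval
  area : I.length * ω.length = 1

namespace Tile

/-- The half line `(-∞, c(ω) - (m - 1/2) |ω|)`. -/
def lower (m : ℤ) (P : Tile) : Set ℝ :=
  Iio (P.ω.center - ((m : ℝ) - 1 / 2) * P.ω.length)

/-- The dyadic interval `ω + n |ω|`. -/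
def upper (n : ℤ) (P : Tile) : DyadicInterval := P.ω.shift n

/-- The convex hull of `50 ω` and `50 ω_upper`. -/
def omegaTilde (n : ℤ) (P : Tile) : Set ℝ :=
  convexHull ℝ (P.ω.dilate 50 ∪ (P.upper n).dilate 50)

/-- `1000 ω` lies strictly between `ω_lower` and `ω_upper`. -/
def Separated (m n : ℤ) (P : Tile) : Prop :=
  ∀ ξ ∈ P.ω.dilate 1000, (∀ a ∈ P.lower m, a < ξ) ∧ (∀ b ∈ (P.upper n).toSet, ξ < b)

end Tile

/-- Sparse collections of tiles, relative to the constant `C₀`. -/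
def Sparse (C₀ : ℝ) (𝔓 : Set Tile) : Prop :=
  ∀ Q ∈ 𝔓, ∀ R ∈ 𝔓, R.I.length / C₀ ≤ Q.I.length → Q.I.length ≤ R.I.length →
    Q.I.length = R.I.length ∧
      (Q.ω = R.ω ∨ Disjoint (Q.ω.dilate C₀) (R.ω.dilate C₀))

/-! ### Wave packets -/

/-- The Fourier transform `(2π)^(-1/2) ∫ g(x) e^(-ixξ) dx`. -/
noncomputable def fourierHat (g : ℝ → ℂ) (ξ : ℝ) : ℂ :=
  ((Real.sqrt (2 * Real.pi))⁻¹ : ℝ) * ∫ x : ℝ, g x * Complex.exp (-(Complex.I * x * ξ))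

/-- `φ` is a smooth `L¹`-normalized wave packet adapted to the tile `P`, with constants `A`:
`A a b` controls the derivative of order `a` with decay of order `b`. -/
structure IsWavePacket (A : ℕ → ℕ → ℝ) (P : Tile) (φ : ℝ → ℂ) : Prop where
  smooth : ContDiff ℝ (⊤ : ℕ∞) φ
  fourier_support : Function.support (fourierHat φ) ⊆ P.ω.dilate (5 / 4)
  bound : ∀ (a b : ℕ) (x : ℝ),
    ‖iteratedDeriv a (fun y : ℝ => Complex.exp (-(Complex.I * P.ω.center * y)) * φ y) x‖ ≤
      A a b * (P.I.length ^ (a + 1))⁻¹ * ((1 + |x - P.I.center| / P.I.length) ^ b)⁻¹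

/-! ### Outer `L^p` quasi-norms

Here `X` is the underlying set, `μ` the outer measure, `𝓔` the generating sets, `S` the size. -/

section Outer

variable {α : Type*}

/-- The outer supremum of `f`, which is also the outer `L^∞` norm. -/
noncomputable def outsup (𝓔 : Set (Set α)) (S : (α → ℂ) → Set α → ℝ≥0∞) (f : α → ℂ) : ℝ≥0∞ :=
  ⨆ E ∈ 𝓔, S f E

/-- The super level measure `μ(S(f) > lam)`: the infimum of `μ(F)` over the `F ⊆ X` with
`outsup (f 1_(X \ F)) ≤ lam`. -/
noncomputable def superLevel (X : Set α) (μ : Set α → ℝ≥0∞) (𝓔 : Set (Set α))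
    (S : (α → ℂ) → Set α → ℝ≥0∞) (f : α → ℂ) (lam : ℝ≥0∞) : ℝ≥0∞ :=
  ⨅ (F : Set α) (_ : F ⊆ X) (_ : outsup 𝓔 S ((X \ F).indicator f) ≤ lam), μ F

open scoped Classical in
/-- The outer `L^p` quasi-norm, `0 < p ≤ ∞`. -/
noncomputable def outerLp (X : Set α) (μ : Set α → ℝ≥0∞) (𝓔 : Set (Set α))
    (S : (α → ℂ) → Set α → ℝ≥0∞) (p : ℝ≥0∞) (f : α → ℂ) : ℝ≥0∞ :=
  if p = ∞ then outsup 𝓔 S f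
  else (p * ∫⁻ t in Ioi (0 : ℝ),
    ENNReal.ofReal (t ^ (p.toReal - 1)) * superLevel X μ 𝓔 S f (ENNReal.ofReal t)) ^ (1 / p.toReal)

open scoped Classical in
/-- The weak outer `L^p` quasi-norm, `0 < p ≤ ∞`. -/
noncomputable def outerWeakLp (X : Set α) (μ : Set α → ℝ≥0∞) (𝓔 : Set (Set α))
    (S : (α → ℂ) → Set α → ℝ≥0∞) (p : ℝ≥0∞) (f : α → ℂ) : ℝ≥0∞ :=
  if p = ∞ then outsup 𝓔 S f
  else ⨆ (t : ℝ) (_ : 0 < t),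
    ENNReal.ofReal t * superLevel X μ 𝓔 S f (ENNReal.ofReal t) ^ (1 / p.toReal)

end Outer

/-! ### The outer measure space on a collection of tiles -/

/-- `E` is a generating set, with top interval `I` and top frequency `ξ`. -/
def IsGenerating (n : ℤ) (E : Set Tile) (I : DyadicInterval) (ξ : ℝ) : Prop :=
  E.Nonempty ∧ ∀ P ∈ E, P.I.toSet ⊆ I.toSet ∧
    Ioo (ξ - 1 / (2 * I.length)) (ξ + 1 / (2 * I.length)) ⊆ P.omegaTilde n

/-- `E` is a lacunary generating set, with top data `I`, `ξ`. -/
def IsLacunary (n : ℤ) (E : Set Tile) (I : DyadicInterval) (ξ : ℝ) : Prop :=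
  IsGenerating n E I ξ ∧ ∀ P ∈ E, ξ ∈ (P.upper n).dilate 50

/-- `E` is an overlapping generating set, with top data `I`, `ξ`. -/
def IsOverlapping (n : ℤ) (E : Set Tile) (I : DyadicInterval) (ξ : ℝ) : Prop :=
  IsGenerating n E I ξ ∧ ∀ P ∈ E, ξ ∈ P.omegaTilde n \ (P.upper n).dilate 50

/-- The generating subsets of `𝔓`. -/
def generatingSets (n : ℤ) (𝔓 : Set Tile) : Set (Set Tile) :=
  {E | E ⊆ 𝔓 ∧ ∃ I ξ, IsGenerating n E I ξ}

/-- The outer measure: infimum of the sums of top lengths over countable coverings by generating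
subsets of `𝔓`. -/
noncomputable def tileMeasure (n : ℤ) (𝔓 : Set Tile) (F : Set Tile) : ℝ≥0∞ :=
  ⨅ (𝒯 : Set (Set Tile × DyadicInterval × ℝ)) (_ : 𝒯.Countable)
    (_ : ∀ T ∈ 𝒯, T.1 ⊆ 𝔓 ∧ IsGenerating n T.1 T.2.1 T.2.2)
    (_ : F ⊆ ⋃ T ∈ 𝒯, T.1), ∑' T : 𝒯, ENNReal.ofReal T.1.2.1.length

open scoped Classical in
/-- The size with exponent `t` in which the supremum runs over the subsets of `E` (with top data)
that satisfy `Q`; for `t = ∞` it is the supremum of `|f|` over `E`. -/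
noncomputable def treeSize (Q : Set Tile → DyadicInterval → ℝ → Prop) (t : ℝ≥0∞)
    (f : Tile → ℂ) (E : Set Tile) : ℝ≥0∞ :=
  if t = ∞ then ⨆ P ∈ E, ‖f P‖ₑ
  else ⨆ (S : Set Tile) (_ : S ⊆ E) (I : DyadicInterval) (ξ : ℝ) (_ : Q S I ξ),
    ((ENNReal.ofReal I.length)⁻¹ *
      ∑' P : S, ‖f P‖ₑ ^ t.toReal * ENNReal.ofReal P.1.I.length) ^ (1 / t.toReal)

/-- The size `S_{1,overlap} + S_{t,lac}`. -/
noncomputable def embedSize (n : ℤ) (t : ℝ≥0∞) (f : Tile → ℂ) (E : Set Tile) : ℝ≥0∞ :=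
  treeSize (IsOverlapping n) 1 f E + treeSize (IsLacunary n) t f E

/-- The tile maximal average `M_N(𝔓, g)`. -/
noncomputable def tileMax (N : ℕ) (𝔓 : Set Tile) (g : ℝ → ℝ≥0∞) : ℝ≥0∞ :=
  ⨆ P ∈ 𝔓, (ENNReal.ofReal P.I.length)⁻¹ * ∫⁻ x : ℝ, ENNReal.ofReal (P.I.chi x ^ N) * g x

/-! ### The embedding map -/

open scoped Classical in
/-- The modified wave packet
`φ_P(x) 1_{N_{j-1}(x) ∈ ω_{P,lower}} 1_{N_j(x) ∈ ω_{P,upper}}`, for `j ≥ 1`. -/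
noncomputable def modPacket (m n : ℤ) (φ : Tile → ℝ → ℂ) (Nf : ℕ → ℝ → ℝ) (P : Tile) (j : ℕ)
    (x : ℝ) : ℂ :=
  if Nf (j - 1) x ∈ P.lower m ∧ Nf j x ∈ (P.upper n).toSet then φ P x else 0

open scoped Classical in
/-- `T₂ f(P) = ⟨f, ∑_{1 ≤ j ≤ K} d_j φ_{P,j} 1_{|I_P| ≤ α_j}⟩`, where `⟨f, g⟩ = ∫ f conj(g)`. -/
noncomputable def T₂ (m n : ℤ) (φ : Tile → ℝ → ℂ) (K : ℝ → ℕ) (Nf : ℕ → ℝ → ℝ) (d : ℕ → ℝ → ℂ)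
    (α : ℕ → ℝ → ℝ≥0∞) (f : ℝ → ℂ) (P : Tile) : ℂ :=
  ∫ x : ℝ, f x * (starRingEnd ℂ) (∑ j ∈ Finset.Icc 1 (K x),
    if ENNReal.ofReal P.I.length ≤ α j x then d j x * modPacket m n φ Nf P j x else 0)

/-- The function `f (∑_{1 ≤ j ≤ K} |d_j|^s)^{1/s}`. -/
noncomputable def weighted (s : ℝ) (K : ℝ → ℕ) (d : ℕ → ℝ → ℂ) (f : ℝ → ℂ) (x : ℝ) : ℂ :=
  f x * (((∑ j ∈ Finset.Icc 1 (K x), ‖d j x‖ ^ s) ^ (1 / s) : ℝ) : ℂ)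

end OuterEmbedding

open OuterEmbedding

/-!
# The embedding theorem for modified wave packets

Write `w = |f| (∑ |d_j| ^ s) ^ (1 / s)`, and let `M` be the tile maximal average of the support of `f`.
All estimates follow from a single one (`Linearization.exists_superLevel_le`): up to constants, the
super level measure at the level `lam` is at most `lam⁻¹ θ ^ (1 - s) ∫_{w > θ} w ^ s`, where
`θ = lam / M`. Dropping the restriction `w > θ` gives the weak type bound at `p = s`, integrating in
`lam` gives the strong type bound for `s < p < ∞`, and a `θ` above the essential supremum of `w` gives
the bound for `p = ∞`.

*The exceptional set.* A dyadic rectangle `I' × ω'` of area one half in the phase plane is selected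
if the mass `θ ^ (1 - s) |f| ^ s ∑_{N_j ∈ ω'} |d_j| ^ s`, restricted to `w > θ`, has average more than
`lam` over `I'`. The exceptional tiles are those with `I_P` near `I'` and `ω'` inside the convex hull
`ω~_P`, for some selected rectangle. Choosing the longest rectangle for every tile gives disjoint
rectangles, and each is covered by six generating sets; this bounds the outer measure of the
exceptional set (`Linearization.tileMeasure_exceptional_le`).

*Trees of unselected tiles.* It remains to bound the sizes outside the exceptional set by a multiple
of `lam` (`Linearization.exists_outsup_le`). By the abstract tree estimate `tree_estimate`, it is
enough to control linear combinations of the modified wave packets of a tree. There one stops at the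
maximal dyadic intervals that are not near any tile of the tree or in which the support of `f` is
dense. The tiles near the dense intervals are few enough to be absorbed. For any other tile, the part
of the integral over long stopping intervals is summable by the decay of the wave packets; over short
stopping intervals one dualizes. There `w`, with the index `j` restricted to the frequencies that the
longer tiles see, has average at most `C lam`, because the tiles are not exceptional and `M` bounds
the density of the support, so that a majorant of the linear combination which is constant on the
stopping intervals can be integrated against it.

*Linear combinations.* In an overlapping tree only one scale is active at a given point, and the
majorant is trivial (`Linearization.overlapping_estimate`). In a lacunary tree, divided into 51 parts
according to the position of the top frequency relative to the upper frequency intervals, the scales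
at which an index `j` is active form an interval, and the intervals of different indices are disjoint
(`Linearization.exists_scale_intervals`). Hölder's inequality in `j` leaves the `r`-variation of
scale-truncated sums of wave packets, with an `r` that is dual to an exponent at least `s`
(`Linearization.exists_lacunary_estimate`). For `s < 2` one takes `r > 2` and square sums of the
coefficients, for `s > 2` one takes `r = s / (s - 1) < 2` and sums of `r`-th powers.

*Variation.* Since the modulated wave packets of a lacunary tree have mean zero, their partial sums
over scales are, up to square summable errors, the dyadic martingale averages of the full sum. The
jump inequality for martingales, proved by stopping the martingale each time it has moved by a given
amount, yields a weak type bound for the number of jumps (`exists_jump_majorant`), and summation over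
the heights of the jumps yields the variation bounds. For `r < 2` the coefficients are first truncated
at each height. All majorants are built so that they control the sums at every point of a dyadic
interval that is not longer than the scales involved.
-/


namespace OuterEmbedding

/-! ### Dyadic indices -/

/-- The position of the dyadic interval of length `2 ^ k` that contains `x`. -/
noncomputable def dy (k : ℤ) (x : ℝ) : ℤ := ⌊x / (2 : ℝ) ^ k⌋

/-- The dyadic interval of length `2 ^ k` at position `p`. -/
def dyI (k p : ℤ) : Set ℝ := {x | dy k x = p}

lemma two_zpow_pos (k : ℤ) : (0 : ℝ) < 2 ^ k := zpow_pos two_pos k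

lemma two_zpow_mono {k l : ℤ} (h : k ≤ l) : (2 : ℝ) ^ k ≤ 2 ^ l := zpow_le_zpow_right₀ one_le_two h

lemma two_zpow_succ (k : ℤ) : (2 : ℝ) ^ (k + 1) = 2 * 2 ^ k := by
  rw [zpow_add_one₀ two_ne_zero, mul_comm]

lemma dy_eq_iff {k p : ℤ} {x : ℝ} : dy k x = p ↔ (p : ℝ) * 2 ^ k ≤ x ∧ x < (p + 1) * 2 ^ k := by
  rw [dy, Int.floor_eq_iff, le_div_iff₀ (two_zpow_pos k), div_lt_iff₀ (two_zpow_pos k)]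

lemma dyI_eq_Ico (k p : ℤ) : dyI k p = Ico ((p : ℝ) * 2 ^ k) ((p + 1) * 2 ^ k) := by
  ext x; exact dy_eq_iff

lemma mem_dyI_dy (k : ℤ) (x : ℝ) : x ∈ dyI k (dy k x) := rfl

lemma dy_bounds (k : ℤ) (x : ℝ) : (dy k x : ℝ) * 2 ^ k ≤ x ∧ x < (dy k x + 1) * 2 ^ k :=
  dy_eq_iff.1 rfl

lemma measurable_dy (k : ℤ) : Measurable (dy k) := Int.measurable_floor.comp (measurable_id.div_const _)

lemma measurableSet_dyI (k p : ℤ) : MeasurableSet (dyI k p) := by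
  rw [dyI_eq_Ico]; exact measurableSet_Ico

lemma volume_dyI (k p : ℤ) : volume (dyI k p) = ENNReal.ofReal (2 ^ k) := by
  rw [dyI_eq_Ico, Real.volume_Ico]; congr 1; ring

lemma dy_succ (k : ℤ) (x : ℝ) : dy (k + 1) x = dy k x / 2 := by
  have h := two_zpow_pos k
  obtain ⟨h1, h2⟩ := dy_bounds k x
  rw [dy_eq_iff, two_zpow_succ]
  have e1 : 2 * (dy k x / 2) ≤ dy k x := by omega
  have e2 : dy k x + 1 ≤ 2 * (dy k x / 2 + 1) := by omega
  have e1' : 2 * ((dy k x / 2 : ℤ) : ℝ) ≤ dy k x := by exact_mod_cast e1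
  have e2' : (dy k x : ℝ) + 1 ≤ 2 * (((dy k x / 2 : ℤ) : ℝ) + 1) := by exact_mod_cast e2
  constructor
  · nlinarith [mul_le_mul_of_nonneg_right e1' h.le]
  · nlinarith [mul_le_mul_of_nonneg_right e2' h.le]

lemma dy_congr_of_le {k l : ℤ} (h : k ≤ l) {x y : ℝ} (hxy : dy k x = dy k y) : dy l x = dy l y := by
  induction l, h using Int.leInduction with
  | base => exact hxy
  | succ l _ ih => rw [dy_succ, dy_succ, ih]

lemma dy_near_of_le {k l : ℤ} (h : k ≤ l) {x y : ℝ} (hxy : |dy k x - dy k y| ≤ 1) :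
    |dy l x - dy l y| ≤ 1 := by
  induction l, h using Int.leInduction with
  | base => exact hxy
  | succ l _ ih =>
    rw [dy_succ, dy_succ]
    rw [abs_le] at ih ⊢
    omega

lemma abs_sub_lt_of_dy (k : ℤ) (x y : ℝ) : |x - y| < (|((dy k x - dy k y : ℤ) : ℝ)| + 1) * 2 ^ k := by
  have h := two_zpow_pos k
  obtain ⟨h1, h2⟩ := dy_bounds k x
  obtain ⟨h3, h4⟩ := dy_bounds k y
  push_cast
  have := mul_le_mul_of_nonneg_right (le_abs_self ((dy k x : ℝ) - dy k y)) h.le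
  have := mul_le_mul_of_nonneg_right (neg_abs_le ((dy k x : ℝ) - dy k y)) h.le
  rw [abs_lt]
  constructor <;> nlinarith

lemma le_abs_sub_of_dy (k : ℤ) (x y : ℝ) : (|((dy k x - dy k y : ℤ) : ℝ)| - 1) * 2 ^ k ≤ |x - y| := by
  have h := two_zpow_pos k
  obtain ⟨h1, h2⟩ := dy_bounds k x
  obtain ⟨h3, h4⟩ := dy_bounds k y
  push_cast
  rcases le_total 0 ((dy k x : ℝ) - dy k y) with hs | hs
  · rw [abs_of_nonneg hs]; exact le_trans (by nlinarith) (le_abs_self _)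
  · rw [abs_of_nonpos hs]; exact le_trans (by nlinarith) (neg_le_abs _)

lemma abs_sub_lt_of_dy_eq {k : ℤ} {x y : ℝ} (h : dy k x = dy k y) : |x - y| < 2 ^ k := by
  simpa [h] using abs_sub_lt_of_dy k x y

lemma abs_sub_lt_of_dy_near {k : ℤ} {x y : ℝ} (h : |dy k x - dy k y| ≤ 1) :
    |x - y| < 2 * 2 ^ k := by
  have h1 : |((dy k x - dy k y : ℤ) : ℝ)| ≤ 1 := by exact_mod_cast h
  nlinarith [abs_sub_lt_of_dy k x y, two_zpow_pos k]

lemma le_abs_sub_of_not_near {k : ℤ} {x y : ℝ} (h : ¬ |dy k x - dy k y| ≤ 1) :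
    2 ^ k ≤ |x - y| := by
  have h0 : (2 : ℤ) ≤ |dy k x - dy k y| := by omega
  have h1 : (2 : ℝ) ≤ |((dy k x - dy k y : ℤ) : ℝ)| := by exact_mod_cast h0
  nlinarith [le_abs_sub_of_dy k x y, two_zpow_pos k]

lemma iUnion_dyI (k : ℤ) : ⋃ p, dyI k p = univ := by
  ext x; simp [dyI]

lemma pairwise_disjoint_dyI (k : ℤ) : Pairwise (Function.onFun Disjoint (dyI k)) := by
  intro p q h
  refine Set.disjoint_left.2 fun x hx hy => h ?_
  exact hx.symm.trans hy

/-! ### Weights attached to a dyadic interval -/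

namespace DyadicInterval

lemma length_pos (J : DyadicInterval) : 0 < J.length := two_zpow_pos _

lemma toSet_eq (J : DyadicInterval) : J.toSet = dyI J.scale J.pos := by
  rw [dyI_eq_Ico]; rfl

lemma dy_center (J : DyadicInterval) : dy J.scale J.center = J.pos := by
  have h := J.length_pos
  rw [dy_eq_iff]
  simp only [center, length] at *
  constructor <;> nlinarith

lemma chi_pos (J : DyadicInterval) (x : ℝ) : 0 < J.chi x := by
  have := J.length_pos
  unfold chi; positivity

lemma one_le_one_add (J : DyadicInterval) (x : ℝ) : 1 ≤ 1 + |x - J.center| / J.length :=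
  le_add_of_nonneg_right (div_nonneg (abs_nonneg _) J.length_pos.le)

lemma chi_le_one (J : DyadicInterval) (x : ℝ) : J.chi x ≤ 1 :=
  inv_le_one_of_one_le₀ (one_le_pow₀ (J.one_le_one_add x))

lemma chi_pow_le_chi_pow (J : DyadicInterval) (x : ℝ) {a b : ℕ} (h : a ≤ b) :
    J.chi x ^ b ≤ J.chi x ^ a :=
  pow_le_pow_of_le_one (J.chi_pos x).le (J.chi_le_one x) h

lemma chi_pow_eq (J : DyadicInterval) (x : ℝ) (n : ℕ) :
    J.chi x ^ n = ((1 + |x - J.center| / J.length) ^ (2 * n))⁻¹ := by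
  rw [chi, inv_pow, ← pow_mul]

lemma continuous_chi (J : DyadicInterval) : Continuous J.chi := by
  unfold chi
  refine Continuous.inv₀ (by fun_prop) fun x => ?_
  have := J.length_pos
  positivity

/-- The weight is antitone in the distance to the center. -/
lemma chi_le_of_le (J : DyadicInterval) {x : ℝ} {t : ℝ} (ht : 0 ≤ t)
    (h : t * J.length ≤ |x - J.center|) : J.chi x ≤ ((1 + t) ^ 2)⁻¹ := by
  have := J.length_pos
  have h1 : t ≤ |x - J.center| / J.length := by rwa [le_div_iff₀ this]
  unfold chi
  gcongr

lemma le_chi_of_le (J : DyadicInterval) {x : ℝ} {t : ℝ}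
    (h : |x - J.center| ≤ t * J.length) : ((1 + t) ^ 2)⁻¹ ≤ J.chi x := by
  have := J.length_pos
  have h1 : |x - J.center| / J.length ≤ t := by rwa [div_le_iff₀ this]
  unfold chi
  gcongr

/-- The weight is essentially constant at the scale of the interval. -/
lemma chi_le_four_mul (J : DyadicInterval) {x y : ℝ} (h : |x - y| ≤ J.length) :
    J.chi x ≤ 4 * J.chi y := by
  have hl := J.length_pos
  have h1 : |y - J.center| / J.length ≤ |x - J.center| / J.length + 1 := by
    rw [div_add_one hl.ne']
    gcongr
    have : |y - J.center| ≤ |y - x| + |x - J.center| := abs_sub_le _ _ _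
    rw [abs_sub_comm y x] at this
    linarith
  have h0 : 0 ≤ |x - J.center| / J.length := by positivity
  have h0' : 0 ≤ |y - J.center| / J.length := by positivity
  unfold chi
  set a := |x - J.center| / J.length
  set b := |y - J.center| / J.length
  rw [← div_eq_mul_inv, inv_eq_one_div, div_le_div_iff₀ (by positivity) (by positivity)]
  nlinarith

end DyadicInterval

/-- The integral of `(1 + |t|) ^ (-2)`. -/
noncomputable def chiMass : ℝ := ∫ t : ℝ, ((1 + |t|) ^ 2)⁻¹

lemma integrable_chi_aux : Integrable fun t : ℝ => ((1 + |t|) ^ 2)⁻¹ := by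
  have := integrable_one_add_norm (E := ℝ) (μ := volume) (r := 2) (by simp)
  refine this.congr (Filter.Eventually.of_forall fun t => ?_)
  simp only [Real.norm_eq_abs]
  rw [Real.rpow_neg (by positivity)]
  norm_cast

lemma chiMass_nonneg : 0 ≤ chiMass := integral_nonneg fun t => by positivity

namespace DyadicInterval

lemma integrable_chi (J : DyadicInterval) : Integrable J.chi :=
  (integrable_chi_aux.comp_div J.length_pos.ne').comp_sub_right J.center |>.congr
    (Filter.Eventually.of_forall fun x => by
      simp only [chi, abs_div, abs_of_pos J.length_pos])

lemma integral_chi (J : DyadicInterval) : ∫ x, J.chi x = J.length * chiMass := by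
  have h1 : ∀ x, J.chi x = (fun t : ℝ => ((1 + |t / J.length|) ^ 2)⁻¹) (x - J.center) := fun x => by
    simp only [chi, abs_div, abs_of_pos J.length_pos]
  simp_rw [h1]
  rw [integral_sub_right_eq_self (fun t : ℝ => ((1 + |t / J.length|) ^ 2)⁻¹) J.center,
    Measure.integral_comp_div (fun t : ℝ => ((1 + |t|) ^ 2)⁻¹) J.length, abs_of_pos J.length_pos]
  rfl

lemma lintegral_chi (J : DyadicInterval) :
    ∫⁻ x, ENNReal.ofReal (J.chi x) = ENNReal.ofReal (J.length * chiMass) := by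
  rw [← J.integral_chi, ofReal_integral_eq_lintegral_ofReal J.integrable_chi
    (Filter.Eventually.of_forall fun x => (J.chi_pos x).le)]

end DyadicInterval

/-- Four times the sum of `(1 + |n|) ^ (-2)` over the integers. -/
noncomputable def chiSum : ℝ := 4 * ∑' n : ℤ, ((1 + |(n : ℝ)|) ^ 2)⁻¹

lemma summable_chi_int : Summable fun n : ℤ => ((1 + |(n : ℝ)|) ^ 2)⁻¹ := by
  have h : Summable fun n : ℤ => 1 / |(n : ℝ) + 0| ^ (2 : ℝ) := by
    simpa using (Real.summable_one_div_int_add_rpow 0 2).2 (by norm_num)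
  have h' := h.add (summable_of_hasFiniteSupport (f := fun n : ℤ => if n = 0 then (1 : ℝ) else 0)
    ((Set.finite_singleton 0).subset fun n hn => by
      by_contra h0; simp at h0; simp [h0] at hn))
  refine Summable.of_nonneg_of_le (fun n => by positivity) (fun n => ?_) h'
  by_cases hn : n = 0
  · simp [hn]
  · have : 0 < |(n : ℝ)| := by simpa using hn
    simp only [hn, if_false, add_zero, one_div]
    norm_cast at *
    gcongr
    simp

lemma chiSum_nonneg : 0 ≤ chiSum := by
  unfold chiSum
  have : 0 ≤ ∑' n : ℤ, ((1 + |(n : ℝ)|) ^ 2)⁻¹ := tsum_nonneg fun n => by positivity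
  positivity

/-- Distinct dyadic intervals of one length have boundedly overlapping weights. -/
lemma sum_chi_le {ι : Type*} (S : Finset ι) (D : ι → DyadicInterval) (hD : Set.InjOn D S) (l : ℤ)
    (hl : ∀ P ∈ S, (D P).scale = l) (x : ℝ) : ∑ P ∈ S, (D P).chi x ≤ chiSum := by
  classical
  have hL := two_zpow_pos l
  have key : ∀ P ∈ S, (D P).chi x ≤
      4 * ((1 + |(((D P).pos - dy l x : ℤ) : ℝ)|) ^ 2)⁻¹ := by
    intro P hP
    have hlen : (D P).length = 2 ^ l := by rw [DyadicInterval.length, hl P hP]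
    have h1 := le_abs_sub_of_dy l (D P).center x
    have h2 : dy l (D P).center = (D P).pos := by rw [← hl P hP]; exact (D P).dy_center
    rw [h2] at h1
    set n := |(((D P).pos - dy l x : ℤ) : ℝ)|
    have hn : 0 ≤ n := abs_nonneg _
    have h3 : n - 1 ≤ |x - (D P).center| / (2 ^ l) := by
      rw [le_div_iff₀ hL, abs_sub_comm]; exact h1
    have h4 : 0 ≤ |x - (D P).center| / (2 ^ l) := by positivity
    unfold DyadicInterval.chi
    rw [hlen, ← div_eq_mul_inv, inv_eq_one_div, div_le_div_iff₀ (by positivity) (by positivity)]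
    nlinarith
  have hinj : Set.InjOn (fun P => (D P).pos - dy l x) S := by
    intro P hP Q hQ h
    apply hD hP hQ
    have e1 := hl P hP
    have e2 := hl Q hQ
    have e3 : (D P).pos = (D Q).pos := by simpa using h
    cases hp : D P; cases hq : D Q; simp_all
  calc ∑ P ∈ S, (D P).chi x
      ≤ ∑ P ∈ S, 4 * ((1 + |(((D P).pos - dy l x : ℤ) : ℝ)|) ^ 2)⁻¹ := Finset.sum_le_sum key
    _ = 4 * ∑ n ∈ S.image (fun P => (D P).pos - dy l x), ((1 + |(n : ℝ)|) ^ 2)⁻¹ := by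
        rw [← Finset.mul_sum, Finset.sum_image hinj]
    _ ≤ chiSum := by
        unfold chiSum
        gcongr
        exact summable_chi_int.sum_le_tsum _ fun n _ => by positivity

/-! ### Dyadic martingales and the jump inequality -/

lemma lintegral_eq_tsum_dyI (k : ℤ) (h : ℝ → ℝ≥0∞) :
    ∫⁻ x, h x = ∑' p : ℤ, ∫⁻ x in dyI k p, h x := by
  rw [← lintegral_iUnion (measurableSet_dyI k) (pairwise_disjoint_dyI k), iUnion_dyI,
    Measure.restrict_univ]

lemma setLIntegral_dyI_const (k p : ℤ) (c : ℝ≥0∞) :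
    ∫⁻ _ in dyI k p, c = c * ENNReal.ofReal (2 ^ k) := by
  rw [setLIntegral_const, volume_dyI]

lemma setLIntegral_dyI_comp (k p : ℤ) (h : ℤ → ℝ≥0∞) :
    ∫⁻ x in dyI k p, h (dy k x) = h p * ENNReal.ofReal (2 ^ k) := by
  rw [← setLIntegral_dyI_const]
  exact setLIntegral_congr_fun (measurableSet_dyI k p) fun x hx => by rw [show dy k x = p from hx]

lemma dyI_succ (k p : ℤ) : dyI (k + 1) p = dyI k (2 * p) ∪ dyI k (2 * p + 1) := by
  ext x
  simp only [dyI, mem_ofPred_eq, mem_union, dy_succ]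
  omega

lemma disjoint_dyI_children (k p : ℤ) : Disjoint (dyI k (2 * p)) (dyI k (2 * p + 1)) :=
  pairwise_disjoint_dyI k (by omega)

/-- A step function and the averages over pairs of siblings have the same integral. -/
lemma lintegral_comp_dy_succ (k : ℤ) (h h' : ℤ → ℝ≥0∞)
    (H : ∀ p, 2 * h' p = h (2 * p) + h (2 * p + 1)) :
    ∫⁻ x, h' (dy (k + 1) x) = ∫⁻ x, h (dy k x) := by
  rw [lintegral_eq_tsum_dyI (k + 1), lintegral_eq_tsum_dyI (k + 1) fun x => h (dy k x)]
  congr 1; ext p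
  rw [setLIntegral_dyI_comp, dyI_succ, lintegral_union (measurableSet_dyI _ _)
    (disjoint_dyI_children k p), setLIntegral_dyI_comp, setLIntegral_dyI_comp, ← add_mul, ← H,
    two_zpow_succ, ENNReal.ofReal_mul zero_le_two, ENNReal.ofReal_ofNat]
  ring

/-- The average of `G` over the dyadic interval of length `2 ^ k` at position `p`. -/
noncomputable def dyAvg (G : ℝ → ℂ) (k p : ℤ) : ℂ := (((2 : ℝ) ^ k)⁻¹ : ℝ) • ∫ x in dyI k p, G x

lemma dyAvg_succ {G : ℝ → ℂ} (hG : Integrable G) (k p : ℤ) :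
    dyAvg G (k + 1) p = (dyAvg G k (2 * p) + dyAvg G k (2 * p + 1)) / 2 := by
  rw [dyAvg, dyAvg, dyAvg, dyI_succ, setIntegral_union (disjoint_dyI_children k p)
    (measurableSet_dyI _ _) hG.integrableOn hG.integrableOn, two_zpow_succ]
  simp only [Complex.real_smul, mul_inv]
  push_cast
  ring

section Jump

variable (lam : ℝ) (m : ℤ → ℤ → ℂ) (k₁ : ℤ)

open scoped Classical in
/-- The anchor process of a martingale `m` indexed by scale and position: it starts at the value on
the scale `k₁` and, passing to smaller scales, is reset to the current value of the martingale each
time the martingale has moved by at least `lam` from it. -/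
noncomputable def anchor : ℕ → ℤ → ℂ
  | 0, p => m k₁ p
  | i + 1, p => if lam ≤ ‖m (k₁ - (i + 1 : ℕ)) p - anchor i (p / 2)‖ then m (k₁ - (i + 1 : ℕ)) p
      else anchor i (p / 2)

/-- The points at which the anchor process is reset at step `i + 1`. -/
def resets (i : ℕ) : Set ℝ :=
  {x | lam ≤ ‖m (k₁ - (i + 1 : ℕ)) (dy (k₁ - (i + 1 : ℕ)) x) - anchor lam m k₁ i (dy (k₁ - i) x)‖}

lemma measurableSet_resets (i : ℕ) : MeasurableSet (resets lam m k₁ i) := by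
  have h1 : Measurable fun x => m (k₁ - (i + 1 : ℕ)) (dy (k₁ - (i + 1 : ℕ)) x) :=
    (measurable_from_top (f := m (k₁ - (i + 1 : ℕ)))).comp (measurable_dy _)
  have h2 : Measurable fun x => anchor lam m k₁ i (dy (k₁ - i) x) :=
    (measurable_from_top (f := anchor lam m k₁ i)).comp (measurable_dy _)
  exact measurableSet_le measurable_const (h1.sub h2).norm

lemma dy_half (i : ℕ) (x : ℝ) : dy (k₁ - (i + 1 : ℕ)) x / 2 = dy (k₁ - i) x := by
  rw [← dy_succ]; congr 1; push_cast; ring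

lemma anchor_succ_of_mem {i : ℕ} {x : ℝ} (h : x ∈ resets lam m k₁ i) :
    anchor lam m k₁ (i + 1) (dy (k₁ - (i + 1 : ℕ)) x) =
      m (k₁ - (i + 1 : ℕ)) (dy (k₁ - (i + 1 : ℕ)) x) := by
  rw [anchor, dy_half]; exact if_pos h

lemma anchor_succ_of_notMem {i : ℕ} {x : ℝ} (h : x ∉ resets lam m k₁ i) :
    anchor lam m k₁ (i + 1) (dy (k₁ - (i + 1 : ℕ)) x) = anchor lam m k₁ i (dy (k₁ - i) x) := by
  rw [anchor, dy_half]; exact if_neg h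

variable {lam}

lemma norm_sub_anchor_lt (hlam : 0 < lam) (i : ℕ) (x : ℝ) :
    ‖m (k₁ - i) (dy (k₁ - i) x) - anchor lam m k₁ i (dy (k₁ - i) x)‖ < lam := by
  cases i with
  | zero => simpa [anchor] using hlam
  | succ i =>
    by_cases h : x ∈ resets lam m k₁ i
    · rw [anchor_succ_of_mem _ _ _ h]; simpa using hlam
    · rw [anchor_succ_of_notMem _ _ _ h]
      simpa [resets] using h

/-- A movement of the martingale by `2 * lam` forces a reset. -/
lemma exists_mem_resets (hlam : 0 < lam) {i i' : ℕ} (hi : i ≤ i') {x : ℝ}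
    (h : 2 * lam ≤ ‖m (k₁ - i) (dy (k₁ - i) x) - m (k₁ - i') (dy (k₁ - i') x)‖) :
    ∃ n, i ≤ n ∧ n < i' ∧ x ∈ resets lam m k₁ n := by
  by_contra! hcon
  have hconst : ∀ n, i ≤ n → n ≤ i' →
      anchor lam m k₁ n (dy (k₁ - n) x) = anchor lam m k₁ i (dy (k₁ - i) x) := by
    intro n hn
    induction n, hn using Nat.le_induction with
    | base => intro _; rfl
    | succ n hn ih =>
      intro hn'
      rw [anchor_succ_of_notMem _ _ _ (hcon n hn (by omega)), ih (by omega)]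
  have h1 := norm_sub_anchor_lt m k₁ hlam i x
  have h2 := norm_sub_anchor_lt m k₁ hlam i' x
  rw [hconst i' hi le_rfl] at h2
  have h3 := norm_sub_le_norm_sub_add_norm_sub (m (k₁ - i) (dy (k₁ - i) x))
    (anchor lam m k₁ i (dy (k₁ - i) x)) (m (k₁ - i') (dy (k₁ - i') x))
  rw [norm_sub_rev (anchor lam m k₁ i (dy (k₁ - i) x))] at h3
  linarith

/-- Orthogonality of martingale differences, in the form of the parallelogram identity on the two
halves of an interval. -/
lemma orthogonality_aux (u v b : ℂ) :
    2 * ENNReal.ofReal (‖(u + v) / 2 - b‖ ^ 2) +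
        (ENNReal.ofReal (‖u - (u + v) / 2‖ ^ 2) + ENNReal.ofReal (‖v - (u + v) / 2‖ ^ 2)) =
      ENNReal.ofReal (‖u - b‖ ^ 2) + ENNReal.ofReal (‖v - b‖ ^ 2) := by
  rw [show (2 : ℝ≥0∞) = ENNReal.ofReal 2 by simp, ← ENNReal.ofReal_mul zero_le_two,
    ← ENNReal.ofReal_add (by positivity) (by positivity),
    ← ENNReal.ofReal_add (by positivity) (by positivity),
    ← ENNReal.ofReal_add (by positivity) (by positivity)]
  congr 1
  simp only [Complex.sq_norm, Complex.normSq_apply, Complex.sub_re, Complex.sub_im, Complex.add_re,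
    Complex.add_im, Complex.div_ofNat_re, Complex.div_ofNat_im]
  ring

variable (hm : ∀ k p, m (k + 1) p = (m k (2 * p) + m k (2 * p + 1)) / 2)
include hm

/-- The anchor is constant on the intervals of the previous scale, so the martingale difference is
orthogonal to the distance between the martingale and its anchor. -/
lemma lintegral_sub_anchor (i : ℕ) :
    (∫⁻ x, ENNReal.ofReal (‖m (k₁ - i) (dy (k₁ - i) x) - anchor lam m k₁ i (dy (k₁ - i) x)‖ ^ 2)) +
      ∫⁻ x, ENNReal.ofReal (‖m (k₁ - (i + 1 : ℕ)) (dy (k₁ - (i + 1 : ℕ)) x) -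
        m (k₁ - i) (dy (k₁ - i) x)‖ ^ 2) =
    ∫⁻ x, ENNReal.ofReal (‖m (k₁ - (i + 1 : ℕ)) (dy (k₁ - (i + 1 : ℕ)) x) -
      anchor lam m k₁ i (dy (k₁ - i) x)‖ ^ 2) := by
  have hk : k₁ - i = k₁ - (i + 1 : ℕ) + 1 := by push_cast; ring
  set k := k₁ - (i + 1 : ℕ)
  set b := anchor lam m k₁ i
  have e1 : ∀ x, dy (k₁ - i) x = dy k x / 2 := fun x => by rw [hk, dy_succ]
  have e2 := lintegral_comp_dy_succ k
    (fun p => ENNReal.ofReal (‖m k p - m (k + 1) (p / 2)‖ ^ 2))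
    (fun p => (ENNReal.ofReal (‖m k (2 * p) - m (k + 1) p‖ ^ 2) +
      ENNReal.ofReal (‖m k (2 * p + 1) - m (k + 1) p‖ ^ 2)) / 2) (fun p => by
        rw [ENNReal.mul_div_cancel two_ne_zero ENNReal.ofNat_ne_top]
        rw [show (2 * p) / 2 = p by omega, show (2 * p + 1) / 2 = p by omega])
  have e3 := lintegral_comp_dy_succ k
    (fun p => ENNReal.ofReal (‖m k p - b (p / 2)‖ ^ 2))
    (fun p => ENNReal.ofReal (‖m (k + 1) p - b p‖ ^ 2) +
      (ENNReal.ofReal (‖m k (2 * p) - m (k + 1) p‖ ^ 2) +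
      ENNReal.ofReal (‖m k (2 * p + 1) - m (k + 1) p‖ ^ 2)) / 2) (fun p => by
        rw [mul_add, ENNReal.mul_div_cancel two_ne_zero ENNReal.ofNat_ne_top]
        rw [show (2 * p) / 2 = p by omega, show (2 * p + 1) / 2 = p by omega, hm k p]
        exact orthogonality_aux _ _ _)
  have e4 : Measurable fun x => ENNReal.ofReal (‖m (k + 1) (dy (k + 1) x) - b (dy (k + 1) x)‖ ^ 2) :=
    (measurable_from_top (f := fun p => ENNReal.ofReal (‖m (k + 1) p - b p‖ ^ 2))).comp
      (measurable_dy _)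
  rw [lintegral_add_left e4] at e3
  simp only [← dy_succ] at e2 e3
  rw [hk, ← e3, e2]

/-- The jump inequality for martingales. -/
lemma tsum_volume_resets_le (hlam : 0 < lam) :
    ENNReal.ofReal (lam ^ 2) * ∑' i, volume (resets lam m k₁ i) ≤
      ∑' i : ℕ, ∫⁻ x, ENNReal.ofReal (‖m (k₁ - (i + 1 : ℕ)) (dy (k₁ - (i + 1 : ℕ)) x) -
        m (k₁ - i) (dy (k₁ - i) x)‖ ^ 2) := by
  rw [← ENNReal.tsum_mul_left]
  refine ENNReal.tsum_le_of_sum_range_le fun n => ?_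
  refine le_trans ?_ (ENNReal.sum_le_tsum (Finset.range n))
  -- the squared distance to the anchor: it grows by the square of the martingale difference, and a
  -- reset destroys at least `lam ^ 2` of it
  set E : ℕ → ℝ≥0∞ := fun i => ∫⁻ x,
    ENNReal.ofReal (‖m (k₁ - i) (dy (k₁ - i) x) - anchor lam m k₁ i (dy (k₁ - i) x)‖ ^ 2) with hE
  have hstep : ∀ i : ℕ, ENNReal.ofReal (lam ^ 2) * volume (resets lam m k₁ i) + E (i + 1) ≤
      E i + ∫⁻ x, ENNReal.ofReal (‖m (k₁ - (i + 1 : ℕ)) (dy (k₁ - (i + 1 : ℕ)) x) -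
        m (k₁ - i) (dy (k₁ - i) x)‖ ^ 2) := by
    intro i
    rw [hE]; dsimp only
    rw [lintegral_sub_anchor m k₁ hm i, ← lintegral_indicator_const (measurableSet_resets lam m k₁ i),
      ← lintegral_add_left (measurable_const.indicator (measurableSet_resets lam m k₁ i))]
    refine lintegral_mono fun x => ?_
    by_cases h : x ∈ resets lam m k₁ i
    · rw [anchor_succ_of_mem _ _ _ h, indicator_of_mem h]
      simp only [sub_self, norm_zero, ne_eq, OfNat.ofNat_ne_zero, not_false_eq_true, zero_pow,
        ENNReal.ofReal_zero, add_zero]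
      exact ENNReal.ofReal_le_ofReal (pow_le_pow_left₀ hlam.le h 2)
    · rw [anchor_succ_of_notMem _ _ _ h, indicator_of_notMem h, zero_add]
  have hsum : ∑ i ∈ Finset.range n, ENNReal.ofReal (lam ^ 2) * volume (resets lam m k₁ i) + E n ≤
      ∑ i ∈ Finset.range n, ∫⁻ x, ENNReal.ofReal (‖m (k₁ - (i + 1 : ℕ)) (dy (k₁ - (i + 1 : ℕ)) x) -
        m (k₁ - i) (dy (k₁ - i) x)‖ ^ 2) := by
    induction n with
    | zero => simp [hE, anchor]
    | succ n ih =>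
      rw [Finset.sum_range_succ, Finset.sum_range_succ, add_assoc]
      refine (add_le_add_right (hstep n) _).trans ?_
      rw [← add_assoc]
      exact add_le_add_left ih _
  exact le_self_add.trans hsum

end Jump

/-! ### Sums of cancellative wave packets at a single scale -/

/-- A function that is bounded, Lipschitz and decaying at the scale of the dyadic interval `J`, with
mean zero. -/
structure Adapted (C : ℝ) (J : DyadicInterval) (g : ℝ → ℂ) : Prop where
  continuous : Continuous g
  bound : ∀ x, ‖g x‖ ≤ C * J.chi x ^ 2
  lip : ∀ x y, |x - y| ≤ J.length → ‖g x - g y‖ ≤ C * (|x - y| / J.length) * J.chi x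
  integral_eq_zero : ∫ x, g x = 0

namespace Adapted

variable {C : ℝ} {J : DyadicInterval} {g : ℝ → ℂ}

lemma norm_le_chi (h : Adapted C J g) (hC : 0 ≤ C) (x : ℝ) : ‖g x‖ ≤ C * J.chi x := by
  refine (h.bound x).trans (mul_le_mul_of_nonneg_left ?_ hC)
  simpa using J.chi_pow_le_chi_pow x one_le_two

lemma integrable (h : Adapted C J g) (hC : 0 ≤ C) : Integrable g :=
  (J.integrable_chi.const_mul C).mono' h.continuous.aestronglyMeasurable
    (Filter.Eventually.of_forall (h.norm_le_chi hC))

/-- On a set all of whose points are farther from the center than `e`, the integral is controlled by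
the weight at `e`. -/
lemma norm_setIntegral_le (h : Adapted C J g) (hC : 0 ≤ C) {s : Set ℝ} (hs : MeasurableSet s)
    {e : ℝ} (he : ∀ x ∈ s, |e - J.center| ≤ |x - J.center|) :
    ‖∫ x in s, g x‖ ≤ C * (J.length * chiMass) * J.chi e := by
  have h1 : ∀ x ∈ s, ‖g x‖ ≤ C * J.chi e * J.chi x := by
    intro x hx
    refine (h.bound x).trans ?_
    have h2 : J.chi x ≤ J.chi e := by
      have := J.length_pos
      have h3 := he x hx
      have h0 := abs_nonneg (e - J.center)
      unfold DyadicInterval.chi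
      generalize |e - J.center| = u at *
      generalize |x - J.center| = v at *
      have h5 : 0 < 1 + u / J.length := by
        have := div_le_div_of_nonneg_right h0 this.le
        simp only [zero_div] at this
        linarith
      gcongr
    rw [sq, ← mul_assoc]
    exact mul_le_mul_of_nonneg_right (mul_le_mul_of_nonneg_left h2 hC) (J.chi_pos x).le
  calc ‖∫ x in s, g x‖ ≤ ∫ x in s, C * J.chi e * J.chi x :=
        norm_integral_le_of_norm_le (J.integrable_chi.const_mul _).integrableOn
          ((ae_restrict_iff' hs).2 (Filter.Eventually.of_forall h1))
    _ ≤ ∫ x, C * J.chi e * J.chi x :=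
        setIntegral_le_integral (J.integrable_chi.const_mul _)
          (Filter.Eventually.of_forall fun x => by
            have := J.chi_pos e; have := J.chi_pos x; dsimp; positivity)
    _ = C * (J.length * chiMass) * J.chi e := by
        rw [integral_const_mul, J.integral_chi]; ring

lemma norm_integral_Iio_le (h : Adapted C J g) (hC : 0 ≤ C) (e : ℝ) :
    ‖∫ x in Iio e, g x‖ ≤ C * (J.length * chiMass) * J.chi e := by
  rcases le_total e J.center with he | he
  · refine h.norm_setIntegral_le hC measurableSet_Iio fun x (hx : x < e) => ?_
    rw [abs_of_nonpos (by linarith), abs_of_nonpos (by linarith)]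
    linarith
  · have h1 := integral_add_compl (measurableSet_Iio (a := e)) (h.integrable hC)
    rw [h.integral_eq_zero, compl_Iio] at h1
    rw [eq_neg_of_add_eq_zero_left h1, norm_neg]
    refine h.norm_setIntegral_le hC measurableSet_Ici fun x (hx : e ≤ x) => ?_
    rw [abs_of_nonneg (by linarith), abs_of_nonneg (by linarith)]
    linarith

/-- By cancellation, averages over long intervals only see the end points. -/
lemma norm_dyAvg_le (h : Adapted C J g) (hC : 0 ≤ C) (k p : ℤ) :
    ‖dyAvg g k p‖ ≤ C * chiMass * ((2 : ℝ) ^ (J.scale - k) *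
      (J.chi (p * 2 ^ k) + J.chi ((p + 1) * 2 ^ k))) := by
  have hk := two_zpow_pos k
  have h1 : ∫ x in dyI k p, g x =
      (∫ x in Iio (((p : ℝ) + 1) * 2 ^ k), g x) - ∫ x in Iio ((p : ℝ) * 2 ^ k), g x := by
    have hle : (p : ℝ) * 2 ^ k ≤ (p + 1) * 2 ^ k := by nlinarith
    rw [← setIntegral_sdiff measurableSet_Iio (h.integrable hC).integrableOn (Iio_subset_Iio hle),
      dyI_eq_Ico]
    congr 2
    ext x; simp
  rw [dyAvg, norm_smul, h1, Real.norm_of_nonneg (by positivity), zpow_sub₀ two_ne_zero]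
  have h2 := h.norm_integral_Iio_le hC ((p : ℝ) * 2 ^ k)
  have h3 := h.norm_integral_Iio_le hC (((p : ℝ) + 1) * 2 ^ k)
  have h4 := (norm_sub_le (∫ x in Iio (((p : ℝ) + 1) * 2 ^ k), g x)
    (∫ x in Iio ((p : ℝ) * 2 ^ k), g x)).trans (add_le_add h3 h2)
  refine (mul_le_mul_of_nonneg_left h4 (by positivity)).trans (le_of_eq ?_)
  rw [DyadicInterval.length]
  field_simp
  ring

/-- On intervals that are short, the function is close to its averages. -/
lemma norm_sub_dyAvg_le (h : Adapted C J g) (hC : 0 ≤ C) {k : ℤ} (hk : k ≤ J.scale) (x : ℝ) :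
    ‖g x - dyAvg g k (dy k x)‖ ≤ C * ((2 : ℝ) ^ (k - J.scale) * J.chi x) := by
  have hk' := two_zpow_pos k
  have hvol : volume.real (dyI k (dy k x)) = 2 ^ k := by
    rw [Measure.real, volume_dyI, ENNReal.toReal_ofReal hk'.le]
  have hfin : volume (dyI k (dy k x)) < ∞ := by rw [volume_dyI]; exact ENNReal.ofReal_lt_top
  have h1 : g x - dyAvg g k (dy k x) =
      (((2 : ℝ) ^ k)⁻¹ : ℝ) • ∫ z in dyI k (dy k x), (g x - g z) := by
    rw [integral_sub (integrableOn_const (s := dyI k (dy k x)) (C := g x) hfin.ne) (h.integrable hC).integrableOn,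
      setIntegral_const, hvol, smul_sub, smul_smul, inv_mul_cancel₀ hk'.ne', one_smul, dyAvg]
  have h2 : ∀ z ∈ dyI k (dy k x), ‖g x - g z‖ ≤ C * ((2 : ℝ) ^ (k - J.scale) * J.chi x) := by
    intro z hz
    have hxz : |x - z| < 2 ^ k := abs_sub_lt_of_dy_eq hz.symm
    refine (h.lip x z (hxz.le.trans (two_zpow_mono hk))).trans ?_
    rw [← mul_assoc, zpow_sub₀ two_ne_zero]
    have := J.chi_pos x
    have := J.length_pos
    rw [show (2 : ℝ) ^ J.scale = J.length from rfl]
    gcongr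
  have h3 := norm_setIntegral_le_of_norm_le_const hfin h2
  rw [h1, norm_smul, Real.norm_of_nonneg (by positivity)]
  refine (mul_le_mul_of_nonneg_left h3 (by positivity)).trans (le_of_eq ?_)
  rw [hvol]
  field_simp

end Adapted

section Layers

variable {ι : Type*} (S : Finset ι) (D : ι → DyadicInterval) (a : ι → ℂ)

/-- The majorant of the part of `∑ a_P g_P` of scale `l`. -/
noncomputable def layer (l : ℤ) (x : ℝ) : ℝ := ∑ P ∈ S with (D P).scale = l, ‖a P‖ * (D P).chi x

lemma layer_nonneg (l : ℤ) (x : ℝ) : 0 ≤ layer S D a l x :=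
  Finset.sum_nonneg fun P _ => mul_nonneg (norm_nonneg _) ((D P).chi_pos x).le

lemma continuous_layer (l : ℤ) : Continuous (layer S D a l) :=
  continuous_finsetSum _ fun P _ => continuous_const.mul (D P).continuous_chi

lemma layer_le_four_mul {l : ℤ} {x y : ℝ} (h : |x - y| ≤ 2 ^ l) :
    layer S D a l x ≤ 4 * layer S D a l y := by
  unfold layer
  rw [Finset.mul_sum]
  refine Finset.sum_le_sum fun P hP => ?_
  have hl : (D P).length = 2 ^ l := by rw [DyadicInterval.length, (Finset.mem_filter.1 hP).2]
  have := (D P).chi_le_four_mul (x := x) (y := y) (by rwa [hl])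
  nlinarith [norm_nonneg (a P)]

variable (hD : Set.InjOn D S)
include hD

lemma layer_sq_le (l : ℤ) (x : ℝ) : layer S D a l x ^ 2 ≤
    chiSum * ∑ P ∈ S with (D P).scale = l, ‖a P‖ ^ 2 * (D P).chi x := by
  have h1 : layer S D a l x ^ 2 ≤ (∑ P ∈ S with (D P).scale = l, (D P).chi x) *
      ∑ P ∈ S with (D P).scale = l, ‖a P‖ ^ 2 * (D P).chi x := by
    unfold layer
    refine Finset.sum_sq_le_sum_mul_sum_of_sq_le_mul _ (fun P _ => ((D P).chi_pos x).le)
      (fun P _ => by have := (D P).chi_pos x; positivity) fun P _ => le_of_eq (by ring)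
  refine h1.trans (mul_le_mul_of_nonneg_right ?_ ?_)
  · exact sum_chi_le _ D (hD.mono fun P hP => (Finset.mem_filter.1 hP).1) l
      (fun P hP => (Finset.mem_filter.1 hP).2) x
  · exact Finset.sum_nonneg fun P _ => by have := (D P).chi_pos x; positivity

lemma lintegral_layer_sq_le (l : ℤ) : ∫⁻ x, ENNReal.ofReal (layer S D a l x ^ 2) ≤
    ENNReal.ofReal (chiSum * chiMass * ∑ P ∈ S with (D P).scale = l, (D P).length * ‖a P‖ ^ 2) := by
  have hc := chiSum_nonneg
  calc ∫⁻ x, ENNReal.ofReal (layer S D a l x ^ 2)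
      ≤ ∫⁻ x, ENNReal.ofReal (chiSum * ∑ P ∈ S with (D P).scale = l, ‖a P‖ ^ 2 * (D P).chi x) :=
        lintegral_mono fun x => ENNReal.ofReal_le_ofReal (layer_sq_le S D a hD l x)
    _ = ENNReal.ofReal (∫ x, chiSum * ∑ P ∈ S with (D P).scale = l, ‖a P‖ ^ 2 * (D P).chi x) := by
        rw [ofReal_integral_eq_lintegral_ofReal]
        · exact (integrable_finsetSum _ fun P _ => (D P).integrable_chi.const_mul _).const_mul _
        · refine Filter.Eventually.of_forall fun x => mul_nonneg hc
            (Finset.sum_nonneg fun P _ => ?_)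
          have := (D P).chi_pos x; positivity
    _ = _ := by
        rw [integral_const_mul, integral_finsetSum _ fun P _ => (D P).integrable_chi.const_mul _,
          mul_assoc, Finset.mul_sum _ _ chiMass]
        congr 2
        refine Finset.sum_congr rfl fun P _ => ?_
        rw [integral_const_mul, (D P).integral_chi]; ring

end Layers

section Errors

variable {ι : Type*} (S : Finset ι) (D : ι → DyadicInterval) (a : ι → ℂ)

/-- The contribution of the scale `l` to the difference, at the scale `k`, between partial sums and
dyadic averages. -/
noncomputable def layerErr (k l : ℤ) (y : ℝ) : ℝ :=
  if l ≤ k then (2 : ℝ) ^ (l - k) *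
    (layer S D a l (dy k y * 2 ^ k) + layer S D a l ((dy k y + 1) * 2 ^ k))
  else (2 : ℝ) ^ (k - l) * layer S D a l y

lemma layerErr_nonneg (k l : ℤ) (y : ℝ) : 0 ≤ layerErr S D a k l y := by
  have h := layer_nonneg S D a l
  unfold layerErr
  split_ifs
  · exact mul_nonneg (two_zpow_pos _).le (add_nonneg (h _) (h _))
  · exact mul_nonneg (two_zpow_pos _).le (h _)

lemma measurable_layerErr (k l : ℤ) : Measurable (layerErr S D a k l) := by
  unfold layerErr
  have h := (continuous_layer S D a l).measurable
  split_ifs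
  · exact (measurable_from_top (f := fun p : ℤ => (2 : ℝ) ^ (l - k) *
      (layer S D a l (p * 2 ^ k) + layer S D a l ((p + 1) * 2 ^ k)))).comp (measurable_dy k)
  · exact h.const_mul _

/-- The values of a layer at the end points of a long interval are controlled by its mass there. -/
lemma layer_endpoint_sq_le {k l : ℤ} (hlk : l ≤ k) (p : ℤ) {e : ℝ}
    (he : e = p * 2 ^ k ∨ e = (p + 1) * 2 ^ k) :
    ENNReal.ofReal (2 ^ l) * ENNReal.ofReal (layer S D a l e ^ 2) ≤
      16 * ∫⁻ x in dyI k p, ENNReal.ofReal (layer S D a l x ^ 2) := by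
  have hl := two_zpow_pos l
  have hlk' := two_zpow_mono hlk
  obtain ⟨s, hs, hvol, hsub, hdist⟩ : ∃ s : Set ℝ, MeasurableSet s ∧
      volume s = ENNReal.ofReal (2 ^ l) ∧ s ⊆ dyI k p ∧ ∀ x ∈ s, |e - x| ≤ 2 ^ l := by
    rcases he with he | he
    · refine ⟨Ico e (e + 2 ^ l), measurableSet_Ico, by simp, ?_, ?_⟩
      · rw [dyI_eq_Ico]
        exact Ico_subset_Ico he.ge (by rw [he]; linarith)
      · rintro x ⟨h1, h2⟩
        rw [abs_le]; constructor <;> linarith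
    · refine ⟨Ico (e - 2 ^ l) e, measurableSet_Ico, by simp, ?_, ?_⟩
      · rw [dyI_eq_Ico]
        exact Ico_subset_Ico (by rw [he]; linarith) he.le
      · rintro x ⟨h1, h2⟩
        rw [abs_le]; constructor <;> linarith
  calc ENNReal.ofReal (2 ^ l) * ENNReal.ofReal (layer S D a l e ^ 2)
      = ∫⁻ _ in s, ENNReal.ofReal (layer S D a l e ^ 2) := by
        rw [setLIntegral_const, hvol, mul_comm]
    _ ≤ ∫⁻ x in s, 16 * ENNReal.ofReal (layer S D a l x ^ 2) := by
        refine setLIntegral_mono' hs fun x hx => ?_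
        rw [← ENNReal.ofReal_ofNat 16, ← ENNReal.ofReal_mul (by norm_num)]
        refine ENNReal.ofReal_le_ofReal ?_
        have := layer_le_four_mul S D a (hdist x hx)
        nlinarith [layer_nonneg S D a l e, layer_nonneg S D a l x]
    _ ≤ ∫⁻ x in dyI k p, 16 * ENNReal.ofReal (layer S D a l x ^ 2) := lintegral_mono_set hsub
    _ = _ := lintegral_const_mul _
        ((continuous_layer S D a l).measurable.pow_const 2).ennreal_ofReal

lemma lintegral_layerErr_sq_le (k l : ℤ) :
    ∫⁻ y, ENNReal.ofReal (layerErr S D a k l y ^ 2) ≤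
      ENNReal.ofReal (64 * (1 / 2) ^ (k - l).natAbs) *
        ∫⁻ y, ENNReal.ofReal (layer S D a l y ^ 2) := by
  rcases le_or_gt l k with h | h
  · have hpow : ((1 : ℝ) / 2) ^ (k - l).natAbs = 2 ^ l / 2 ^ k := by
      rw [← zpow_sub₀ two_ne_zero, ← zpow_natCast, Int.natAbs_of_nonneg (by omega), one_div,
        inv_zpow, ← zpow_neg, neg_sub]
    rw [lintegral_eq_tsum_dyI k, lintegral_eq_tsum_dyI k fun y => ENNReal.ofReal (layer S D a l y ^ 2),
      ← ENNReal.tsum_mul_left]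
    refine ENNReal.tsum_le_tsum fun p => ?_
    have e1 : ∀ y ∈ dyI k p, ENNReal.ofReal (layerErr S D a k l y ^ 2) ≤
        ENNReal.ofReal (2 * (2 ^ l / 2 ^ k) ^ 2) * (ENNReal.ofReal (layer S D a l (p * 2 ^ k) ^ 2) +
          ENNReal.ofReal (layer S D a l ((p + 1) * 2 ^ k) ^ 2)) := by
      intro y hy
      rw [← ENNReal.ofReal_add (by positivity) (by positivity), ← ENNReal.ofReal_mul (by positivity)]
      refine ENNReal.ofReal_le_ofReal ?_
      rw [layerErr, if_pos h, show dy k y = p from hy, mul_pow, zpow_sub₀ two_ne_zero]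
      rw [mul_comm (2 : ℝ) (_ ^ 2), mul_assoc]
      gcongr
      nlinarith [sq_nonneg (layer S D a l (p * 2 ^ k) - layer S D a l ((p + 1) * 2 ^ k))]
    refine (setLIntegral_mono' (measurableSet_dyI k p) e1).trans ?_
    rw [setLIntegral_dyI_const]
    have e2 := add_le_add (layer_endpoint_sq_le S D a h p (Or.inl rfl))
      (layer_endpoint_sq_le S D a h p (Or.inr rfl))
    rw [← mul_add] at e2
    set X := ENNReal.ofReal (layer S D a l (p * 2 ^ k) ^ 2) +
          ENNReal.ofReal (layer S D a l ((p + 1) * 2 ^ k) ^ 2)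
    set Y := ∫⁻ x in dyI k p, ENNReal.ofReal (layer S D a l x ^ 2)
    have hl := two_zpow_pos l
    have hk := two_zpow_pos k
    calc ENNReal.ofReal (2 * (2 ^ l / 2 ^ k) ^ 2) * X * ENNReal.ofReal (2 ^ k)
        = ENNReal.ofReal (2 * (2 ^ l / 2 ^ k)) * (ENNReal.ofReal (2 ^ l) * X) := by
          rw [mul_right_comm, ← ENNReal.ofReal_mul (by positivity), ← mul_assoc,
            ← ENNReal.ofReal_mul (by positivity)]
          congr 2
          field_simp
      _ ≤ ENNReal.ofReal (2 * (2 ^ l / 2 ^ k)) * (16 * Y + 16 * Y) := by gcongr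
      _ = ENNReal.ofReal (64 * (1 / 2) ^ (k - l).natAbs) * Y := by
          rw [hpow, ← two_mul, ← mul_assoc 2, ← mul_assoc,
            show (2 * 16 : ℝ≥0∞) = ENNReal.ofReal 32 by norm_num,
            ← ENNReal.ofReal_mul (by positivity)]
          congr 2
          ring
  · have hpow : ((1 : ℝ) / 2) ^ (k - l).natAbs = 2 ^ (k - l) := by
      rw [← zpow_natCast, show ((k - l).natAbs : ℤ) = -(k - l) by omega, one_div, inv_zpow, ← zpow_neg,
        neg_neg]
    rw [← lintegral_const_mul _ ((continuous_layer S D a l).measurable.pow_const 2).ennreal_ofReal]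
    refine lintegral_mono fun y => ?_
    rw [← ENNReal.ofReal_mul (by positivity), layerErr, if_neg (by omega), hpow, mul_pow]
    refine ENNReal.ofReal_le_ofReal (mul_le_mul_of_nonneg_right ?_ (by positivity))
    have h1 : (2 : ℝ) ^ (k - l) ≤ 1 := zpow_le_one_of_nonpos₀ one_le_two (by omega)
    nlinarith [two_zpow_pos (k - l)]

end Errors

/-! ### Jumps of scale-truncated sums of wave packets -/

/-- The two-sided geometric series. -/
noncomputable def geomInt (r : ℝ) : ℝ := ∑' n : ℤ, r ^ n.natAbs

lemma summable_geomInt {r : ℝ} (h0 : 0 ≤ r) (h1 : r < 1) : Summable fun n : ℤ => r ^ n.natAbs := by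
  refine Summable.of_nat_of_neg ?_ ?_ <;>
    simpa using summable_geometric_of_lt_one h0 h1

lemma geomInt_nonneg {r : ℝ} (h0 : 0 ≤ r) : 0 ≤ geomInt r := tsum_nonneg fun n => by positivity

lemma sum_geomInt_le {r : ℝ} (h0 : 0 ≤ r) (h1 : r < 1) (L : Finset ℤ) (k : ℤ) :
    ∑ l ∈ L, r ^ (k - l).natAbs ≤ geomInt r := by
  have h2 : Function.Injective fun l : ℤ => k - l := fun a b h => by simpa using h
  rw [← Finset.sum_image (f := fun n : ℤ => r ^ n.natAbs) (g := fun l => k - l) h2.injOn]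
  exact (summable_geomInt h0 h1).sum_le_tsum _ fun n _ => by positivity

lemma tsum_ofReal_geomInt {r : ℝ} (h0 : 0 ≤ r) (h1 : r < 1) (l : ℤ) :
    ∑' k : ℤ, ENNReal.ofReal (r ^ (k - l).natAbs) = ENNReal.ofReal (geomInt r) := by
  rw [geomInt, ENNReal.ofReal_tsum_of_nonneg (fun n => by positivity) (summable_geomInt h0 h1)]
  exact (Equiv.subRight l).tsum_eq fun n => ENNReal.ofReal (r ^ n.natAbs)

section Truncation

variable {ι : Type*} (S : Finset ι) (D : ι → DyadicInterval) (a : ι → ℂ)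

/-- The majorant of the difference between partial sums and dyadic averages at the scale `k`. -/
noncomputable def truncErr (k : ℤ) (y : ℝ) : ℝ :=
  ∑ l ∈ S.image fun P => (D P).scale, layerErr S D a k l y

lemma truncErr_nonneg (k : ℤ) (y : ℝ) : 0 ≤ truncErr S D a k y :=
  Finset.sum_nonneg fun l _ => layerErr_nonneg S D a k l y

lemma measurable_truncErr (k : ℤ) : Measurable (truncErr S D a k) :=
  Finset.measurable_sum _ fun l _ => measurable_layerErr S D a k l

lemma truncErr_eq (k : ℤ) (y : ℝ) : truncErr S D a k y = ∑ P ∈ S, ‖a P‖ *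
    (if (D P).scale ≤ k then (2 : ℝ) ^ ((D P).scale - k) *
      ((D P).chi (dy k y * 2 ^ k) + (D P).chi ((dy k y + 1) * 2 ^ k))
    else (2 : ℝ) ^ (k - (D P).scale) * (D P).chi y) := by
  classical
  rw [truncErr, ← Finset.sum_fiberwise_of_maps_to (t := S.image fun P => (D P).scale)
    (g := fun P => (D P).scale) fun P hP => Finset.mem_image_of_mem _ hP]
  refine Finset.sum_congr rfl fun l _ => ?_
  unfold layerErr layer
  split_ifs with h
  · rw [← Finset.sum_add_distrib, Finset.mul_sum]
    refine Finset.sum_congr rfl fun P hP => ?_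
    rw [(Finset.mem_filter.1 hP).2, if_pos h]
    ring
  · rw [Finset.mul_sum]
    refine Finset.sum_congr rfl fun P hP => ?_
    rw [(Finset.mem_filter.1 hP).2, if_neg h]
    ring

/-- The square function of the truncation errors is bounded, by almost orthogonality of the
scales. -/
lemma exists_tsum_lintegral_truncErr_sq_le : ∃ K : ℝ, 0 ≤ K ∧
    ∀ {ι : Type} (S : Finset ι) (D : ι → DyadicInterval) (a : ι → ℂ), Set.InjOn D S →
    ∑' k : ℤ, ∫⁻ y, ENNReal.ofReal (truncErr S D a k y ^ 2) ≤
      ENNReal.ofReal (K * ∑ P ∈ S, (D P).length * ‖a P‖ ^ 2) := by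
  have hg1 := geomInt_nonneg (r := 3 / 4) (by norm_num)
  have hg2 := geomInt_nonneg (r := 2 / 3) (by norm_num)
  have hc1 := chiSum_nonneg
  have hc2 := chiMass_nonneg
  refine ⟨geomInt (3 / 4) * 64 * geomInt (2 / 3) * (chiSum * chiMass), by positivity, ?_⟩
  intro ι S D a hD
  classical
  set L := S.image fun P => (D P).scale with hL
  have hmeas : ∀ k l : ℤ, Measurable fun y => ENNReal.ofReal ((4 / 3 : ℝ) ^ (k - l).natAbs) *
      ENNReal.ofReal (layerErr S D a k l y ^ 2) := fun k l =>
    (((measurable_layerErr S D a k l).pow_const 2).ennreal_ofReal).const_mul _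
  have h1 : ∀ k : ℤ, ∫⁻ y, ENNReal.ofReal (truncErr S D a k y ^ 2) ≤
      ENNReal.ofReal (geomInt (3 / 4) * 64) * ∑ l ∈ L, ENNReal.ofReal ((2 / 3 : ℝ) ^ (k - l).natAbs) *
        ∫⁻ y, ENNReal.ofReal (layer S D a l y ^ 2) := by
    intro k
    have h2 : ∀ y, ENNReal.ofReal (truncErr S D a k y ^ 2) ≤ ENNReal.ofReal (geomInt (3 / 4)) *
        ∑ l ∈ L, ENNReal.ofReal ((4 / 3 : ℝ) ^ (k - l).natAbs) *
          ENNReal.ofReal (layerErr S D a k l y ^ 2) := by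
      intro y
      have h3 : truncErr S D a k y ^ 2 ≤ (∑ l ∈ L, (3 / 4 : ℝ) ^ (k - l).natAbs) *
          ∑ l ∈ L, (4 / 3 : ℝ) ^ (k - l).natAbs * layerErr S D a k l y ^ 2 := by
        unfold truncErr
        refine Finset.sum_sq_le_sum_mul_sum_of_sq_le_mul _ (fun l _ => by positivity)
          (fun l _ => by positivity) fun l _ => le_of_eq ?_
        rw [← mul_assoc, ← mul_pow]
        norm_num
      simp_rw [← ENNReal.ofReal_mul (show (0 : ℝ) ≤ (4 / 3) ^ _ by positivity)]
      rw [← ENNReal.ofReal_sum_of_nonneg fun l _ => by positivity, ← ENNReal.ofReal_mul hg1]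
      refine ENNReal.ofReal_le_ofReal (h3.trans ?_)
      gcongr
      exact sum_geomInt_le (by norm_num) (by norm_num) L k
    refine (lintegral_mono h2).trans ?_
    rw [lintegral_const_mul _ (Finset.measurable_fun_sum _ fun l _ => hmeas k l),
      lintegral_finsetSum _ fun l _ => hmeas k l, ENNReal.ofReal_mul hg1, mul_assoc, Finset.mul_sum _ _ (ENNReal.ofReal 64)]
    gcongr with l hl
    rw [lintegral_const_mul _ ((measurable_layerErr S D a k l).pow_const 2).ennreal_ofReal]
    refine (mul_le_mul_right (lintegral_layerErr_sq_le S D a k l) _).trans (le_of_eq ?_)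
    rw [← mul_assoc, ← mul_assoc, ← ENNReal.ofReal_mul (by positivity),
      ← ENNReal.ofReal_mul (by positivity)]
    congr 2
    rw [mul_left_comm, ← mul_pow]
    norm_num
  calc ∑' k : ℤ, ∫⁻ y, ENNReal.ofReal (truncErr S D a k y ^ 2)
      ≤ ∑' k : ℤ, ENNReal.ofReal (geomInt (3 / 4) * 64) *
        ∑ l ∈ L, ENNReal.ofReal ((2 / 3 : ℝ) ^ (k - l).natAbs) *
        ∫⁻ y, ENNReal.ofReal (layer S D a l y ^ 2) := ENNReal.tsum_le_tsum h1
    _ = ENNReal.ofReal (geomInt (3 / 4) * 64) * (ENNReal.ofReal (geomInt (2 / 3)) *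
        ∑ l ∈ L, ∫⁻ y, ENNReal.ofReal (layer S D a l y ^ 2)) := by
        rw [ENNReal.tsum_mul_left, Summable.tsum_finsetSum fun _ _ => ENNReal.summable,
          Finset.mul_sum L _ (ENNReal.ofReal (geomInt (2 / 3)))]
        congr 1
        refine Finset.sum_congr rfl fun l _ => ?_
        rw [ENNReal.tsum_mul_right, tsum_ofReal_geomInt (by norm_num) (by norm_num)]
    _ ≤ ENNReal.ofReal (geomInt (3 / 4) * 64) * (ENNReal.ofReal (geomInt (2 / 3)) *
        ∑ l ∈ L, ENNReal.ofReal (chiSum * chiMass *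
          ∑ P ∈ S with (D P).scale = l, (D P).length * ‖a P‖ ^ 2)) := by
        gcongr with l hl
        exact lintegral_layer_sq_le S D a hD l
    _ = _ := by
        have hn : ∀ P, 0 ≤ (D P).length * ‖a P‖ ^ 2 := fun P => by
          have := (D P).length_pos; positivity
        rw [← ENNReal.ofReal_sum_of_nonneg fun l _ =>
          mul_nonneg (mul_nonneg hc1 hc2) (Finset.sum_nonneg fun P _ => hn P), ← Finset.mul_sum,
          hL, Finset.sum_fiberwise_of_maps_to fun P hP => Finset.mem_image_of_mem _ hP,
          ← ENNReal.ofReal_mul (by positivity), ← ENNReal.ofReal_mul (by positivity)]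
        congr 1
        ring

variable {C : ℝ} {g : ι → ℝ → ℂ}

/-- The part of scale larger than `k` of a sum of wave packets is close to the dyadic average of the
whole sum at the scale `k`: the parts of small scale have small averages by cancellation, and the
parts of large scale are almost constant. -/
lemma norm_trunc_sub_dyAvg_le (hC : 0 ≤ C) (hg : ∀ P ∈ S, Adapted C (D P) (g P)) {k k₀ : ℤ}
    (hk : k₀ ≤ k) {x y : ℝ} (hxy : dy k₀ x = dy k₀ y) :
    ‖(∑ P ∈ S with k < (D P).scale, a P * g P x) - dyAvg (fun z => ∑ P ∈ S, a P * g P z) k (dy k x)‖ ≤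
      C * (4 + chiMass) * truncErr S D a k y := by
  have hcm := chiMass_nonneg
  have hxy' : dy k x = dy k y := dy_congr_of_le hk hxy
  have h1 : dyAvg (fun z => ∑ P ∈ S, a P * g P z) k (dy k x) =
      ∑ P ∈ S, a P * dyAvg (g P) k (dy k x) := by
    unfold dyAvg
    rw [integral_finsetSum _ fun P hP => (((hg P hP).integrable hC).const_mul _).integrableOn,
      Finset.smul_sum]
    refine Finset.sum_congr rfl fun P _ => ?_
    rw [integral_const_mul, mul_smul_comm]
  rw [h1, Finset.sum_filter, ← Finset.sum_sub_distrib, truncErr_eq, Finset.mul_sum]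
  refine (norm_sum_le _ _).trans (Finset.sum_le_sum fun P hP => ?_)
  have hx := (D P).chi_pos
  rcases le_or_gt (D P).scale k with h | h
  · rw [if_neg (by omega), if_pos h, zero_sub, norm_neg, norm_mul]
    have h2 := (hg P hP).norm_dyAvg_le hC k (dy k x)
    rw [hxy'] at h2 ⊢
    calc ‖a P‖ * ‖dyAvg (g P) k (dy k y)‖ ≤ ‖a P‖ * (C * chiMass * ((2 : ℝ) ^ ((D P).scale - k) *
          ((D P).chi (dy k y * 2 ^ k) + (D P).chi ((dy k y + 1) * 2 ^ k)))) := by gcongr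
      _ ≤ ‖a P‖ * (C * (4 + chiMass) * ((2 : ℝ) ^ ((D P).scale - k) *
          ((D P).chi (dy k y * 2 ^ k) + (D P).chi ((dy k y + 1) * 2 ^ k)))) := by
        have := hx (dy k y * 2 ^ k)
        have := hx ((dy k y + 1) * 2 ^ k)
        gcongr
        linarith
      _ = _ := by ring
  · rw [if_pos h, if_neg (by omega), ← mul_sub, norm_mul]
    have h2 := (hg P hP).norm_sub_dyAvg_le hC h.le x
    have h3 : (D P).chi x ≤ 4 * (D P).chi y := (D P).chi_le_four_mul
      ((abs_sub_lt_of_dy_eq hxy').le.trans (two_zpow_mono h.le))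
    have := hx y
    calc ‖a P‖ * ‖g P x - dyAvg (g P) k (dy k x)‖
        ≤ ‖a P‖ * (C * ((2 : ℝ) ^ (k - (D P).scale) * (D P).chi x)) := by gcongr
      _ ≤ ‖a P‖ * (C * ((2 : ℝ) ^ (k - (D P).scale) * (4 * (D P).chi y))) := by gcongr
      _ = ‖a P‖ * (C * 4 * ((2 : ℝ) ^ (k - (D P).scale) * (D P).chi y)) := by ring
      _ ≤ ‖a P‖ * (C * (4 + chiMass) * ((2 : ℝ) ^ (k - (D P).scale) * (D P).chi y)) := by
        gcongr; linarith
      _ = _ := by ring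

end Truncation

section Truncation

variable {ι : Type*} (S : Finset ι) (D : ι → DyadicInterval) (a : ι → ℂ)

/-- The part of `∑ a_P g_P` whose scales lie in `(α, β]`. -/
noncomputable def scaleSum (g : ι → ℝ → ℂ) (α β : ℤ) (x : ℝ) : ℂ :=
  ∑ P ∈ S with α < (D P).scale ∧ (D P).scale ≤ β, a P * g P x

lemma scaleSum_eq_sub (g : ι → ℝ → ℂ) {α β : ℤ} (h : α ≤ β) (x : ℝ) :
    scaleSum S D a g α β x = (∑ P ∈ S with α < (D P).scale, a P * g P x) -
      ∑ P ∈ S with β < (D P).scale, a P * g P x := by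
  rw [scaleSum, Finset.sum_filter, Finset.sum_filter, Finset.sum_filter, ← Finset.sum_sub_distrib]
  refine Finset.sum_congr rfl fun P _ => ?_
  split_ifs <;> first | omega | simp

lemma norm_scaleSum_le {C : ℝ} (hC : 0 ≤ C) {g : ι → ℝ → ℂ}
    (hg : ∀ P ∈ S, Adapted C (D P) (g P)) (α β : ℤ) (x : ℝ) :
    ‖scaleSum S D a g α β x‖ ≤
      C * ∑ P ∈ S with α < (D P).scale ∧ (D P).scale ≤ β, ‖a P‖ * (D P).chi x := by
  rw [scaleSum, Finset.mul_sum]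
  refine (norm_sum_le _ _).trans (Finset.sum_le_sum fun P hP => ?_)
  rw [norm_mul, mul_left_comm]
  exact mul_le_mul_of_nonneg_left ((hg P (Finset.mem_filter.1 hP).1).norm_le_chi hC x)
    (norm_nonneg _)

lemma layer_le_two_mul_truncErr (k : ℤ) (y : ℝ) :
    layer S D a (k + 1) y ≤ 2 * truncErr S D a k y := by
  classical
  by_cases h : k + 1 ∈ S.image fun P => (D P).scale
  · have h1 : layerErr S D a k (k + 1) y ≤ truncErr S D a k y :=
      Finset.single_le_sum (f := fun l => layerErr S D a k l y)
        (fun l _ => layerErr_nonneg S D a k l y) h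
    rw [layerErr, if_neg (by omega), show k - (k + 1) = -1 by ring] at h1
    norm_num at h1
    linarith
  · have h1 : layer S D a (k + 1) y = 0 := by
      unfold layer
      rw [Finset.filter_eq_empty_iff.2, Finset.sum_empty]
      intro P hP hP'
      exact h (Finset.mem_image.2 ⟨P, hP, hP'⟩)
    rw [h1]
    have := truncErr_nonneg S D a k y
    positivity

end Truncation

/-- Partial sums of cancellative wave packets behave like martingales: the number of disjoint ranges
of scales over which they move by `lam` has a majorant whose integral is at most a multiple of
`lam ^ (-2)` times the square sum of the coefficients. The majorant is insensitive to moving the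
point inside a dyadic interval that is not longer than any of the scales involved. -/
theorem exists_jump_majorant {C : ℝ} (hC : 0 ≤ C) : ∃ K : ℝ, 0 ≤ K ∧
    ∀ {ι : Type} (S : Finset ι) (D : ι → DyadicInterval) (a : ι → ℂ) (g : ι → ℝ → ℂ) (k₁ : ℤ),
    Set.InjOn D S → (∀ P ∈ S, Adapted C (D P) (g P)) → ∀ lam : ℝ, 0 < lam →
    ∃ Nc : ℝ → ℝ≥0∞, Measurable Nc ∧
      ∫⁻ y, Nc y ≤ ENNReal.ofReal (K / lam ^ 2 * ∑ P ∈ S, (D P).length * ‖a P‖ ^ 2) ∧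
      ∀ (k₀ : ℤ) (x y : ℝ), dy k₀ x = dy k₀ y → ∀ (T : Finset ℕ) (α β : ℕ → ℤ),
        (∀ j ∈ T, k₀ ≤ α j ∧ α j ≤ β j ∧ β j ≤ k₁) →
        (∀ i ∈ T, ∀ j ∈ T, i ≠ j → Disjoint (Ioc (α i) (β i)) (Ioc (α j) (β j))) →
        (∀ j ∈ T, lam ≤ ‖scaleSum S D a g (α j) (β j) x‖) → (T.card : ℝ≥0∞) ≤ Nc y := by
  obtain ⟨K₀, hK₀, hsq⟩ := exists_tsum_lintegral_truncErr_sq_le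
  have hcm := chiMass_nonneg
  set C' := C * (4 + chiMass) with hC'
  have hC'0 : 0 ≤ C' := by positivity
  refine ⟨(16 * 36 + 32) * C' ^ 2 * K₀, by positivity, ?_⟩
  intro ι S D a g k₁ hD hg lam hlam
  classical
  set G : ℝ → ℂ := fun z => ∑ P ∈ S, a P * g P z with hG
  have hGint : Integrable G :=
    integrable_finsetSum _ fun P hP => ((hg P hP).integrable hC).const_mul _
  set m := dyAvg G with hm
  have hmart : ∀ k p, m (k + 1) p = (m k (2 * p) + m k (2 * p + 1)) / 2 := dyAvg_succ hGint
  set R := truncErr S D a with hR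
  have hRm : ∀ k, Measurable fun y => ENNReal.ofReal (R k y ^ 2) := fun k =>
    ((measurable_truncErr S D a k).pow_const 2).ennreal_ofReal
  have hR0 : ∀ k y, 0 ≤ R k y := truncErr_nonneg S D a
  set A := ∑ P ∈ S, (D P).length * ‖a P‖ ^ 2 with hA
  have hA0 : 0 ≤ A := Finset.sum_nonneg fun P _ => by have := (D P).length_pos; positivity
  have hsq' := hsq S D a hD
  have herr : ∀ {k k₀ : ℤ}, k₀ ≤ k → ∀ {x y : ℝ}, dy k₀ x = dy k₀ y →
      ‖(∑ P ∈ S with k < (D P).scale, a P * g P x) - m k (dy k y)‖ ≤ C' * R k y := by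
    intro k k₀ hk x y hxy
    rw [← dy_congr_of_le hk hxy]
    exact norm_trunc_sub_dyAvg_le S D a hC hg hk hxy
  -- martingale differences are controlled by the truncation errors
  have hdiff : ∀ (k : ℤ) (y : ℝ), ENNReal.ofReal (‖m k (dy k y) - m (k + 1) (dy (k + 1) y)‖ ^ 2) ≤
      ENNReal.ofReal (18 * C' ^ 2) *
        (ENNReal.ofReal (R k y ^ 2) + ENNReal.ofReal (R (k + 1) y ^ 2)) := by
    intro k y
    rw [← ENNReal.ofReal_add (by positivity) (by positivity), ← ENNReal.ofReal_mul (by positivity)]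
    refine ENNReal.ofReal_le_ofReal ?_
    have h1 := herr (le_refl k) (x := y) (y := y) rfl
    have h2 := herr (le_refl (k + 1)) (x := y) (y := y) rfl
    have h3 := scaleSum_eq_sub S D a g (show k ≤ k + 1 by omega) y
    have h4 := norm_scaleSum_le S D a hC hg k (k + 1) y
    have h5 : (∑ P ∈ S with k < (D P).scale ∧ (D P).scale ≤ k + 1, ‖a P‖ * (D P).chi y) =
        layer S D a (k + 1) y := by
      unfold layer
      refine Finset.sum_congr (Finset.filter_congr fun P _ => by omega) fun _ _ => rfl
    rw [h5] at h4
    have h6 := layer_le_two_mul_truncErr S D a k y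
    set u := ∑ P ∈ S with k < (D P).scale, a P * g P y
    set v := ∑ P ∈ S with k + 1 < (D P).scale, a P * g P y
    have h7 : m k (dy k y) - m (k + 1) (dy (k + 1) y) =
        scaleSum S D a g k (k + 1) y - (u - m k (dy k y)) + (v - m (k + 1) (dy (k + 1) y)) := by
      rw [h3]; ring
    have h8 : ‖m k (dy k y) - m (k + 1) (dy (k + 1) y)‖ ≤ 3 * C' * (R k y + R (k + 1) y) := by
      rw [h7]
      have h9 := norm_add_le (scaleSum S D a g k (k + 1) y - (u - m k (dy k y)))
        (v - m (k + 1) (dy (k + 1) y))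
      have h10 := norm_sub_le (scaleSum S D a g k (k + 1) y) (u - m k (dy k y))
      have h11 : C * layer S D a (k + 1) y ≤ 2 * C' * R k y := by
        have : C ≤ C' := by rw [hC']; nlinarith
        have h12 := hR0 k y
        calc C * layer S D a (k + 1) y ≤ C * (2 * R k y) := by gcongr
          _ ≤ C' * (2 * R k y) := by gcongr
          _ = _ := by ring
      have h13 : 0 ≤ C' * R (k + 1) y := mul_nonneg hC'0 (hR0 _ _)
      nlinarith
    calc ‖m k (dy k y) - m (k + 1) (dy (k + 1) y)‖ ^ 2 ≤ (3 * C' * (R k y + R (k + 1) y)) ^ 2 := by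
          gcongr
      _ ≤ _ := by
          have := mul_nonneg (sq_nonneg C') (sq_nonneg (R k y - R (k + 1) y))
          nlinarith
  have hinj : Function.Injective fun i : ℕ => k₁ - (i + 1 : ℕ) := fun i j h => by
    simp only at h; omega
  have hinj' : Function.Injective fun i : ℕ => k₁ - (i + 1 : ℕ) + 1 := fun i j h => by
    simp only at h; omega
  -- a movement by `lam` makes the martingale move by `lam / 2`, and so forces a reset of the anchor
  -- process with the parameter `lam / 4`, unless the error at one of the two end points is large
  have hlam' : 0 < lam / 4 := by positivity
  have hjump := tsum_volume_resets_le m k₁ hmart hlam'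
  have hresets : ∑' i, volume (resets (lam / 4) m k₁ i) ≤
      ENNReal.ofReal (16 * 36 * C' ^ 2 * K₀ / lam ^ 2 * A) := by
    have h1 : ∑' i : ℕ, ∫⁻ x, ENNReal.ofReal (‖m (k₁ - (i + 1 : ℕ)) (dy (k₁ - (i + 1 : ℕ)) x) -
        m (k₁ - i) (dy (k₁ - i) x)‖ ^ 2) ≤ ENNReal.ofReal (36 * C' ^ 2 * (K₀ * A)) := by
      calc _ ≤ ∑' i : ℕ, (ENNReal.ofReal (18 * C' ^ 2) *
              (∫⁻ y, ENNReal.ofReal (R (k₁ - (i + 1 : ℕ)) y ^ 2)) +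
            ENNReal.ofReal (18 * C' ^ 2) *
              ∫⁻ y, ENNReal.ofReal (R (k₁ - (i + 1 : ℕ) + 1) y ^ 2)) := by
            refine ENNReal.tsum_le_tsum fun i => ?_
            rw [← lintegral_const_mul _ (hRm _), ← lintegral_const_mul _ (hRm _),
              ← lintegral_add_left ((hRm _).const_mul _)]
            refine lintegral_mono fun y => ?_
            have := hdiff (k₁ - (i + 1 : ℕ)) y
            rw [show k₁ - (i : ℤ) = k₁ - (i + 1 : ℕ) + 1 by push_cast; ring, ← mul_add]
            exact this
        _ ≤ ENNReal.ofReal (18 * C' ^ 2) * ENNReal.ofReal (K₀ * A) +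
            ENNReal.ofReal (18 * C' ^ 2) * ENNReal.ofReal (K₀ * A) := by
            rw [ENNReal.tsum_add, ENNReal.tsum_mul_left, ENNReal.tsum_mul_left]
            gcongr
            · exact (ENNReal.tsum_comp_le_tsum_of_injective hinj
                fun k => ∫⁻ y, ENNReal.ofReal (R k y ^ 2)).trans hsq'
            · exact (ENNReal.tsum_comp_le_tsum_of_injective hinj'
                fun k => ∫⁻ y, ENNReal.ofReal (R k y ^ 2)).trans hsq'
        _ = _ := by
            rw [← ENNReal.ofReal_mul (by positivity), ← ENNReal.ofReal_add (by positivity)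
              (by positivity)]
            congr 1; ring
    have h2 := hjump.trans h1
    rw [mul_comm, ← ENNReal.le_div_iff_mul_le (Or.inl (by positivity))
      (Or.inl ENNReal.ofReal_ne_top), ← ENNReal.ofReal_div_of_pos (by positivity)] at h2
    refine h2.trans (le_of_eq ?_)
    congr 1
    field_simp
    ring
  refine ⟨fun y => (∑' i : ℕ, (resets (lam / 4) m k₁ i).indicator 1 y) +
    ENNReal.ofReal (32 * C' ^ 2 / lam ^ 2) * ∑' k : ℤ, ENNReal.ofReal (R k y ^ 2), ?_, ?_, ?_⟩
  · exact (Measurable.tsum fun i =>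
      measurable_one.indicator (measurableSet_resets _ _ _ _)).add
      ((Measurable.tsum hRm).const_mul _)
  · rw [lintegral_add_left (Measurable.tsum fun i =>
      measurable_one.indicator (measurableSet_resets _ _ _ _)),
      lintegral_const_mul _ (Measurable.tsum hRm),
      lintegral_tsum fun k => (hRm k).aemeasurable,
      lintegral_tsum fun i => (measurable_one.indicator
        (measurableSet_resets _ _ _ _)).aemeasurable]
    simp_rw [lintegral_indicator_one (measurableSet_resets (lam / 4) m k₁ _)]
    refine (add_le_add hresets (mul_le_mul_right hsq' _)).trans (le_of_eq ?_)
    rw [← ENNReal.ofReal_mul (by positivity), ← ENNReal.ofReal_add (by positivity) (by positivity)]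
    congr 1
    ring
  · intro k₀ x y hxy T α β hαβ hdisj hT
    have hlt : ∀ j ∈ T, α j < β j := by
      intro j hj
      by_contra hcon
      have h1 : α j = β j := le_antisymm (hαβ j hj).2.1 (not_lt.1 hcon)
      have h2 := hT j hj
      rw [scaleSum_eq_sub S D a g (hαβ j hj).2.1, h1, sub_self, norm_zero] at h2
      linarith
    have hcase : ∀ j ∈ T, (∃ n : ℕ, k₁ - β j ≤ n ∧ (n : ℤ) < k₁ - α j ∧
        y ∈ resets (lam / 4) m k₁ n) ∨ lam / 4 ≤ C' * R (α j) y ∨ lam / 4 ≤ C' * R (β j) y := by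
      intro j hj
      by_contra! hcon
      obtain ⟨c1, c2, c3⟩ := hcon
      obtain ⟨h1, h2, h3⟩ := hαβ j hj
      have h4 := hT j hj
      rw [scaleSum_eq_sub S D a g h2] at h4
      have h5 := herr h1 hxy
      have h6 := herr (h1.trans h2) hxy
      set u := ∑ P ∈ S with α j < (D P).scale, a P * g P x
      set v := ∑ P ∈ S with β j < (D P).scale, a P * g P x
      have h7 : ‖m (β j) (dy (β j) y) - m (α j) (dy (α j) y)‖ < 2 * (lam / 4) := by
        by_contra! hcon2
        obtain ⟨n, hn1, hn2, hn3⟩ := exists_mem_resets m k₁ hlam' (i := (k₁ - β j).toNat)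
          (i' := (k₁ - α j).toNat) (by omega) (x := y) (by
            rw [show k₁ - ((k₁ - β j).toNat : ℤ) = β j by omega,
              show k₁ - ((k₁ - α j).toNat : ℤ) = α j by omega]
            exact hcon2)
        exact c1 n (by omega) (by omega) hn3
      have h8 : u - v = (u - m (α j) (dy (α j) y)) - (v - m (β j) (dy (β j) y)) -
          (m (β j) (dy (β j) y) - m (α j) (dy (α j) y)) := by ring
      rw [h8] at h4
      have h9 := norm_sub_le ((u - m (α j) (dy (α j) y)) - (v - m (β j) (dy (β j) y)))
        (m (β j) (dy (β j) y) - m (α j) (dy (α j) y))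
      have h10 := norm_sub_le (u - m (α j) (dy (α j) y)) (v - m (β j) (dy (β j) y))
      linarith
    set T₁ := T.filter fun j => ∃ n : ℕ, k₁ - β j ≤ n ∧ (n : ℤ) < k₁ - α j ∧
        y ∈ resets (lam / 4) m k₁ n with hT₁
    set T₂ := T.filter fun j => lam / 4 ≤ C' * R (α j) y with hT₂
    set T₃ := T.filter fun j => lam / 4 ≤ C' * R (β j) y with hT₃
    have hcov : T ⊆ T₁ ∪ (T₂ ∪ T₃) := by
      intro j hj
      simp only [hT₁, hT₂, hT₃, Finset.mem_union, Finset.mem_filter]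
      rcases hcase j hj with h | h | h
      · exact Or.inl ⟨hj, h⟩
      · exact Or.inr (Or.inl ⟨hj, h⟩)
      · exact Or.inr (Or.inr ⟨hj, h⟩)
    have hcard : (T.card : ℝ≥0∞) ≤ T₁.card + (T₂.card + T₃.card) := by
      have h1 := (Finset.card_le_card hcov).trans ((Finset.card_union_le _ _).trans
        (Nat.add_le_add_left (Finset.card_union_le _ _) _))
      exact_mod_cast h1
    -- disjoint ranges of scales contain different resets
    have hb1 : (T₁.card : ℝ≥0∞) ≤ ∑' i : ℕ, (resets (lam / 4) m k₁ i).indicator 1 y := by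
      have hex : ∀ j ∈ T₁, ∃ n : ℕ, k₁ - β j ≤ n ∧ (n : ℤ) < k₁ - α j ∧
        y ∈ resets (lam / 4) m k₁ n := fun j hj => (Finset.mem_filter.1 hj).2
      choose! n hn1 hn2 hn3 using hex
      have hninj : Set.InjOn n T₁ := by
        intro i hi j hj hij
        by_contra hne
        have hi' : i ∈ T := (Finset.mem_filter.1 hi).1
        have hj' : j ∈ T := (Finset.mem_filter.1 hj).1
        have h1 := hn1 i hi
        have h2 := hn2 i hi
        have h3 := hn1 j hj
        have h4 := hn2 j hj
        exact (hdisj i hi' j hj' hne).notMem_of_mem_left (a := k₁ - n i) ⟨by omega, by omega⟩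
          ⟨by omega, by omega⟩
      calc (T₁.card : ℝ≥0∞) = ∑ i ∈ T₁.image n, 1 := by
            rw [Finset.sum_const, Finset.card_image_of_injOn hninj]; simp
        _ = ∑ i ∈ T₁.image n, (resets (lam / 4) m k₁ i).indicator 1 y := by
            refine Finset.sum_congr rfl fun i hi => ?_
            obtain ⟨j, hj, rfl⟩ := Finset.mem_image.1 hi
            rw [indicator_of_mem (hn3 j hj)]; rfl
        _ ≤ _ := ENNReal.sum_le_tsum _
    have hb : ∀ (T' : Finset ℕ) (γ : ℕ → ℤ), Set.InjOn γ T' →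
        (∀ j ∈ T', lam / 4 ≤ C' * R (γ j) y) → (T'.card : ℝ≥0∞) ≤
          ENNReal.ofReal (16 * C' ^ 2 / lam ^ 2) * ∑' k : ℤ, ENNReal.ofReal (R k y ^ 2) := by
      intro T' γ hγ hT'
      calc (T'.card : ℝ≥0∞) = ∑ j ∈ T', 1 := by simp
        _ ≤ ∑ j ∈ T', ENNReal.ofReal (16 * C' ^ 2 / lam ^ 2) * ENNReal.ofReal (R (γ j) y ^ 2) := by
            refine Finset.sum_le_sum fun j hj => ?_
            rw [← ENNReal.ofReal_mul (by positivity), ENNReal.one_le_ofReal, div_mul_eq_mul_div,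
              le_div_iff₀ (by positivity)]
            have h1 := pow_le_pow_left₀ hlam'.le (hT' j hj) 2
            nlinarith
        _ = ENNReal.ofReal (16 * C' ^ 2 / lam ^ 2) *
            ∑ k ∈ T'.image γ, ENNReal.ofReal (R k y ^ 2) := by
            rw [Finset.sum_image hγ, Finset.mul_sum]
        _ ≤ _ := by gcongr; exact ENNReal.sum_le_tsum _
    have hb2 := hb T₂ α (by
      intro i hi j hj hij
      by_contra hne
      have hi' : i ∈ T := (Finset.mem_filter.1 hi).1
      have hj' : j ∈ T := (Finset.mem_filter.1 hj).1
      have h1 := hlt i hi'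
      have h2 := hlt j hj'
      exact (hdisj i hi' j hj' hne).notMem_of_mem_left (a := α i + 1) ⟨by omega, by omega⟩
          ⟨by omega, by omega⟩) fun j hj => (Finset.mem_filter.1 hj).2
    have hb3 := hb T₃ β (by
      intro i hi j hj hij
      by_contra hne
      have hi' : i ∈ T := (Finset.mem_filter.1 hi).1
      have hj' : j ∈ T := (Finset.mem_filter.1 hj).1
      have h1 := hlt i hi'
      have h2 := hlt j hj'
      exact (hdisj i hi' j hj' hne).notMem_of_mem_left (a := β i) ⟨by omega, by omega⟩
          ⟨by omega, by omega⟩) fun j hj => (Finset.mem_filter.1 hj).2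
    refine hcard.trans ((add_le_add hb1 (add_le_add hb2 hb3)).trans (le_of_eq ?_))
    rw [← add_mul, ← ENNReal.ofReal_add (by positivity) (by positivity)]
    congr 3
    ring

/-! ### Variation bounds -/

/-- A geometric sum over the powers of two below `η` is comparable to its largest term. -/
lemma exists_tsum_two_zpow_rpow_le {γ : ℝ} (hγ : 0 < γ) : ∃ K : ℝ, 0 ≤ K ∧ ∀ η : ℝ, 0 < η →
    ∑' i : ℤ, (if (2 : ℝ) ^ i ≤ η then ENNReal.ofReal (((2 : ℝ) ^ i) ^ γ) else 0) ≤
      ENNReal.ofReal (K * η ^ γ) := by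
  set ρ : ℝ := (2 : ℝ) ^ (-γ) with hρ
  have hρ0 : 0 ≤ ρ := by positivity
  have hρ1 : ρ < 1 := Real.rpow_lt_one_of_one_lt_of_neg one_lt_two (by linarith)
  refine ⟨geomInt ρ, geomInt_nonneg hρ0, fun η hη => ?_⟩
  obtain ⟨n, hn1, hn2⟩ := exists_mem_Ico_zpow hη one_lt_two
  calc ∑' i : ℤ, (if (2 : ℝ) ^ i ≤ η then ENNReal.ofReal (((2 : ℝ) ^ i) ^ γ) else 0)
      ≤ ∑' i : ℤ, ENNReal.ofReal (η ^ γ) * ENNReal.ofReal (ρ ^ (i - n).natAbs) := by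
        refine ENNReal.tsum_le_tsum fun i => ?_
        split_ifs with h
        · rw [← ENNReal.ofReal_mul (by positivity)]
          refine ENNReal.ofReal_le_ofReal ?_
          have hin : i ≤ n := by
            by_contra hcon
            have := two_zpow_mono (show n + 1 ≤ i by omega)
            linarith
          have e1 : ((2 : ℝ) ^ i) ^ γ = ((2 : ℝ) ^ n) ^ γ * ρ ^ (i - n).natAbs := by
            rw [hρ, ← Real.rpow_intCast, ← Real.rpow_intCast, ← Real.rpow_natCast,
              ← Real.rpow_mul two_pos.le, ← Real.rpow_mul two_pos.le, ← Real.rpow_mul two_pos.le,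
              ← Real.rpow_add two_pos]
            congr 1
            have : ((i - n).natAbs : ℝ) = n - i := by
              have h1 : ((i - n).natAbs : ℤ) = n - i := by omega
              rw [← Int.cast_natCast, h1, Int.cast_sub]
            rw [this]; ring
          rw [e1]
          gcongr
        · exact zero_le
    _ = _ := by
        rw [ENNReal.tsum_mul_left, tsum_ofReal_geomInt hρ0 hρ1, ← ENNReal.ofReal_mul (by positivity),
          mul_comm]

/-- A geometric sum over the powers of two above `η` is comparable to its largest term. -/
lemma exists_tsum_two_zpow_rpow_neg_le {γ : ℝ} (hγ : 0 < γ) : ∃ K : ℝ, 0 ≤ K ∧ ∀ η : ℝ, 0 < η →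
    ∑' i : ℤ, (if η ≤ (2 : ℝ) ^ i then ENNReal.ofReal (((2 : ℝ) ^ i) ^ (-γ)) else 0) ≤
      ENNReal.ofReal (K * η ^ (-γ)) := by
  obtain ⟨K, hK, h⟩ := exists_tsum_two_zpow_rpow_le hγ
  refine ⟨K, hK, fun η hη => ?_⟩
  have h1 := h η⁻¹ (by positivity)
  rw [← (Equiv.neg ℤ).tsum_eq] at h1
  rw [Real.rpow_neg hη.le, ← Real.inv_rpow hη.le]
  refine le_trans (le_of_eq (tsum_congr fun i => ?_)) h1
  simp only [Equiv.neg_apply, zpow_neg]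
  simp only [inv_le_inv₀ (two_zpow_pos i) hη, Real.inv_rpow (two_zpow_pos i).le,
    Real.rpow_neg (two_zpow_pos i).le]

/-- Sums over a family of positive numbers, by dyadic level sets. -/
lemma sum_le_tsum_levels (T : Finset ℕ) (t : ℕ → ℝ) (ht : ∀ j ∈ T, 0 ≤ t j) (Nn : ℤ → ℝ≥0∞)
    (hN : ∀ i : ℤ, ((T.filter fun j => (2 : ℝ) ^ i ≤ t j).card : ℝ≥0∞) ≤ Nn i) (v : ℕ → ℝ≥0∞)
    (ψ : ℤ → ℝ≥0∞) (hv0 : ∀ j ∈ T, t j = 0 → v j = 0)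
    (hv : ∀ j ∈ T, ∀ i : ℤ, (2 : ℝ) ^ i ≤ t j → t j < 2 ^ (i + 1) → v j ≤ ψ i) :
    ∑ j ∈ T, v j ≤ ∑' i, ψ i * Nn i := by
  classical
  set T' := T.filter fun j => t j ≠ 0 with hT'
  have hsub : ∀ j ∈ T', j ∈ T ∧ t j ≠ 0 := fun j hj => Finset.mem_filter.1 hj
  have hex : ∀ j ∈ T', ∃ i : ℤ, (2 : ℝ) ^ i ≤ t j ∧ t j < 2 ^ (i + 1) := fun j hj =>
    exists_mem_Ico_zpow ((ht j (hsub j hj).1).lt_of_ne' (hsub j hj).2) one_lt_two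
  choose! e he1 he2 using hex
  calc ∑ j ∈ T, v j = ∑ j ∈ T', v j := by
        refine (Finset.sum_subset (Finset.filter_subset _ _) fun j hj hj' => hv0 j hj ?_).symm
        by_contra h
        exact hj' (Finset.mem_filter.2 ⟨hj, h⟩)
    _ ≤ ∑ j ∈ T', ψ (e j) :=
        Finset.sum_le_sum fun j hj => hv j (hsub j hj).1 _ (he1 j hj) (he2 j hj)
    _ = ∑ i ∈ T'.image e, ∑ j ∈ T' with e j = i, ψ (e j) :=
        (Finset.sum_fiberwise_of_maps_to (fun j hj => Finset.mem_image_of_mem e hj) _).symm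
    _ ≤ ∑ i ∈ T'.image e, ψ i * Nn i := by
        refine Finset.sum_le_sum fun i _ => ?_
        have h1 : ∑ j ∈ T' with e j = i, ψ (e j) = ψ i * (T'.filter fun j => e j = i).card := by
          rw [Finset.sum_congr rfl fun j hj => by rw [(Finset.mem_filter.1 hj).2],
            Finset.sum_const, nsmul_eq_mul, mul_comm]
        rw [h1]
        gcongr
        refine le_trans ?_ (hN i)
        norm_cast
        refine Finset.card_le_card fun j hj => ?_
        obtain ⟨hj1, hj2⟩ := Finset.mem_filter.1 hj
        exact Finset.mem_filter.2 ⟨(hsub j hj1).1, hj2 ▸ he1 j hj1⟩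
    _ ≤ _ := ENNReal.sum_le_tsum _

/-- `t ≤ η + η ^ (1 - r) * t ^ r`: a substitute for Hölder's inequality. -/
lemma le_add_rpow_mul {t η r : ℝ} (ht : 0 ≤ t) (hη : 0 < η) (hr : 1 ≤ r) :
    t ≤ η + η ^ (1 - r) * t ^ r := by
  rcases le_or_gt t η with h | h
  · have : 0 ≤ η ^ (1 - r) * t ^ r := by positivity
    linarith
  · have ht' : 0 < t := hη.trans h
    have h1 : t ^ (1 - r) ≤ η ^ (1 - r) :=
      Real.rpow_le_rpow_of_nonpos hη h.le (by linarith)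
    have h2 : t ^ (1 - r) * t ^ r = t := by
      rw [← Real.rpow_add ht']; simp
    have h3 : 0 ≤ t ^ r := by positivity
    nlinarith

/-- A family of numbers `t j`, in a sequence space norm with exponent `r ≥ 1`, is controlled by the
number `η` and by sums without exponents over the small and over the large members. -/
lemma sum_rpow_rpow_le {T : Finset ℕ} {t : ℕ → ℝ} (ht : ∀ j ∈ T, 0 ≤ t j) {η r : ℝ} (hη : 0 < η)
    (hr : 1 ≤ r) : (∑ j ∈ T, t j ^ r) ^ (1 / r) ≤
      η + η ^ (1 - r) * (∑ j ∈ T with t j ≤ η, t j ^ r) + ∑ j ∈ T with ¬ t j ≤ η, t j := by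
  have hr0 : 0 < r := by linarith
  set Y := ∑ j ∈ T with ¬ t j ≤ η, t j with hY
  have hY0 : 0 ≤ Y := Finset.sum_nonneg fun j hj => ht j (Finset.mem_filter.1 hj).1
  set X := ∑ j ∈ T with t j ≤ η, t j ^ r with hX
  have hX0 : 0 ≤ X := Finset.sum_nonneg fun j hj => by
    have := ht j (Finset.mem_filter.1 hj).1; positivity
  have h1 : ∑ j ∈ T with ¬ t j ≤ η, t j ^ r ≤ Y ^ r := by
    have h2 : ∀ j ∈ T.filter fun j => ¬ t j ≤ η, t j ^ r ≤ Y ^ (r - 1) * t j := by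
      intro j hj
      have h0 := ht j (Finset.mem_filter.1 hj).1
      have hpos : 0 < t j := hη.trans (not_le.1 (Finset.mem_filter.1 hj).2)
      have hle : t j ≤ Y := Finset.single_le_sum (f := t)
        (fun j hj => ht j (Finset.mem_filter.1 hj).1) hj
      calc t j ^ r = t j ^ (r - 1) * t j := by
            rw [← Real.rpow_add_one hpos.ne']; ring_nf
        _ ≤ Y ^ (r - 1) * t j := by
            gcongr
    refine (Finset.sum_le_sum h2).trans ?_
    rw [← Finset.mul_sum, ← hY]
    rcases hY0.eq_or_lt with h | h
    · rw [← h]; simp; positivity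
    · rw [← Real.rpow_add_one h.ne']; simp
  have h3 : X ≤ (η + η ^ (1 - r) * X) ^ r := by
    have h4 := le_add_rpow_mul (t := X ^ (1 / r)) (by positivity) hη hr
    rw [← Real.rpow_mul hX0, one_div_mul_cancel hr0.ne', Real.rpow_one] at h4
    calc X = (X ^ (1 / r)) ^ r := by
          rw [← Real.rpow_mul hX0, one_div_mul_cancel hr0.ne', Real.rpow_one]
      _ ≤ _ := by gcongr
  have hZ0 : 0 ≤ η + η ^ (1 - r) * X := by positivity
  calc (∑ j ∈ T, t j ^ r) ^ (1 / r) = (X + ∑ j ∈ T with ¬ t j ≤ η, t j ^ r) ^ (1 / r) := by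
        rw [hX, Finset.sum_filter_add_sum_filter_not]
    _ ≤ ((η + η ^ (1 - r) * X) ^ r + Y ^ r) ^ (1 / r) := by
        gcongr
        exact add_nonneg hX0 (Finset.sum_nonneg fun j hj => by
          have := ht j (Finset.mem_filter.1 hj).1; positivity)
    _ ≤ (((η + η ^ (1 - r) * X) + Y) ^ r) ^ (1 / r) := by
        gcongr
        exact Real.add_rpow_le_rpow_add hZ0 hY0 hr
    _ = _ := by
        rw [← Real.rpow_mul (by positivity), mul_one_div_cancel hr0.ne', Real.rpow_one]

/-- `W` dominates the `r`-variation of the scale-truncated sums `∑ a_P g_P`, and is insensitive to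
moving the point inside a dyadic interval that is not longer than the scales involved. -/
def IsVariationMajorant {ι : Type} (S : Finset ι) (D : ι → DyadicInterval) (a : ι → ℂ)
    (g : ι → ℝ → ℂ) (r : ℝ) (k₁ : ℤ) (W : ℝ → ℝ≥0∞) : Prop :=
  ∀ (k₀ : ℤ) (x y : ℝ), dy k₀ x = dy k₀ y → ∀ (T : Finset ℕ) (α β : ℕ → ℤ),
    (∀ j ∈ T, k₀ ≤ α j ∧ α j ≤ β j ∧ β j ≤ k₁) →
    (∀ i ∈ T, ∀ j ∈ T, i ≠ j → Disjoint (Ioc (α i) (β i)) (Ioc (α j) (β j))) →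
    ENNReal.ofReal ((∑ j ∈ T, ‖scaleSum S D a g (α j) (β j) x‖ ^ r) ^ (1 / r)) ≤ W y

/-- The `r`-variation for `r > 2` has a majorant that is bounded by the square sum of the
coefficients: count the movements of size `2 ^ i` by the jump inequality, in `ℓ^r` for `2 ^ i ≤ η` and
in `ℓ^1` above. -/
theorem exists_variation_majorant_of_two_lt {C : ℝ} (hC : 0 ≤ C) {r : ℝ} (hr : 2 < r) :
    ∃ K : ℝ, 0 ≤ K ∧
    ∀ {ι : Type} (S : Finset ι) (D : ι → DyadicInterval) (a : ι → ℂ) (g : ι → ℝ → ℂ) (k₁ : ℤ),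
    Set.InjOn D S → (∀ P ∈ S, Adapted C (D P) (g P)) → ∀ η : ℝ, 0 < η →
    ∃ W : ℝ → ℝ≥0∞, Measurable W ∧ IsVariationMajorant S D a g r k₁ (fun y => ENNReal.ofReal η + W y) ∧
      ∫⁻ y, W y ≤ ENNReal.ofReal (K * (η ^ (1 - 2 : ℝ) * ∑ P ∈ S, (D P).length * ‖a P‖ ^ (2 : ℝ))) := by
  obtain ⟨K₀, hK₀, hjump⟩ := exists_jump_majorant hC
  obtain ⟨K₁, hK₁, hgeo₁⟩ := exists_tsum_two_zpow_rpow_le (γ := r - 2) (by linarith)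
  obtain ⟨K₂, hK₂, hgeo₂⟩ := exists_tsum_two_zpow_rpow_neg_le (γ := 1) one_pos
  refine ⟨2 ^ r * K₁ * K₀ + 4 * K₂ * K₀, by positivity, ?_⟩
  intro ι S D a g k₁ hD hg η hη
  have hex : ∀ i : ℤ, ∃ Nc : ℝ → ℝ≥0∞, _ := fun i => hjump S D a g k₁ hD hg (2 ^ i) (two_zpow_pos i)
  choose Nc hNm hNint hN using hex
  set A := ∑ P ∈ S, (D P).length * ‖a P‖ ^ 2 with hA
  have hA0 : 0 ≤ A := Finset.sum_nonneg fun P _ => by have := (D P).length_pos; positivity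
  set ψ₁ : ℤ → ℝ≥0∞ := fun i => if (2 : ℝ) ^ i ≤ η then ENNReal.ofReal (((2 : ℝ) ^ (i + 1)) ^ r) else 0
    with hψ₁
  set ψ₂ : ℤ → ℝ≥0∞ := fun i => if η ≤ (2 : ℝ) ^ (i + 1) then ENNReal.ofReal ((2 : ℝ) ^ (i + 1)) else 0
    with hψ₂
  refine ⟨fun y => ENNReal.ofReal (η ^ (1 - r)) * (∑' i, ψ₁ i * Nc i y) + ∑' i, ψ₂ i * Nc i y,
    ((Measurable.tsum fun i => (hNm i).const_mul _).const_mul _).add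
      (Measurable.tsum fun i => (hNm i).const_mul _), ?_, ?_⟩
  · intro k₀ x y hxy T α β hαβ hdisj
    set t : ℕ → ℝ := fun j => ‖scaleSum S D a g (α j) (β j) x‖ with ht
    have ht0 : ∀ j, 0 ≤ t j := fun j => norm_nonneg _
    have hcount : ∀ T' ⊆ T, ∀ i : ℤ,
        ((T'.filter fun j => (2 : ℝ) ^ i ≤ t j).card : ℝ≥0∞) ≤ Nc i y := by
      intro T' hT' i
      have hsub : ∀ j ∈ T'.filter fun j => (2 : ℝ) ^ i ≤ t j, j ∈ T := fun j hj =>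
        hT' (Finset.mem_filter.1 hj).1
      exact hN i k₀ x y hxy _ α β (fun j hj => hαβ j (hsub j hj))
        (fun i hi j hj => hdisj i (hsub i hi) j (hsub j hj)) fun j hj => (Finset.mem_filter.1 hj).2
    have h1 := sum_rpow_rpow_le (T := T) (fun j _ => ht0 j) hη (show 1 ≤ r by linarith)
    have h2 : ENNReal.ofReal (∑ j ∈ T with t j ≤ η, t j ^ r) ≤ ∑' i, ψ₁ i * Nc i y := by
      rw [ENNReal.ofReal_sum_of_nonneg fun j _ => by have := ht0 j; positivity]
      refine sum_le_tsum_levels _ t (fun j _ => ht0 j) (fun i => Nc i y)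
        (hcount _ (Finset.filter_subset _ _)) _ ψ₁
        (fun j _ h => by rw [h, Real.zero_rpow (by linarith), ENNReal.ofReal_zero]) ?_
      intro j hj i hi1 hi2
      rw [hψ₁]; dsimp only
      rw [if_pos (hi1.trans (Finset.mem_filter.1 hj).2)]
      exact ENNReal.ofReal_le_ofReal (Real.rpow_le_rpow (ht0 j) hi2.le (by linarith))
    have h3 : ENNReal.ofReal (∑ j ∈ T with ¬ t j ≤ η, t j) ≤ ∑' i, ψ₂ i * Nc i y := by
      rw [ENNReal.ofReal_sum_of_nonneg fun j _ => ht0 j]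
      refine sum_le_tsum_levels _ t (fun j _ => ht0 j) (fun i => Nc i y)
        (hcount _ (Finset.filter_subset _ _)) _ ψ₂
        (fun j _ h => by rw [h, ENNReal.ofReal_zero]) ?_
      intro j hj i hi1 hi2
      rw [hψ₂]; dsimp only
      rw [if_pos ((not_le.1 (Finset.mem_filter.1 hj).2).le.trans hi2.le)]
      exact ENNReal.ofReal_le_ofReal hi2.le
    refine (ENNReal.ofReal_le_ofReal h1).trans ?_
    have h4 : 0 ≤ ∑ j ∈ T with t j ≤ η, t j ^ r :=
      Finset.sum_nonneg fun j _ => by have := ht0 j; positivity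
    have h5 : 0 ≤ ∑ j ∈ T with ¬ t j ≤ η, t j := Finset.sum_nonneg fun j _ => ht0 j
    rw [ENNReal.ofReal_add (by positivity) h5, ENNReal.ofReal_add hη.le (by positivity),
      ENNReal.ofReal_mul (by positivity), add_assoc]
    exact add_le_add le_rfl (add_le_add (mul_le_mul_right h2 _) h3)
  · have e1 : ∀ ψ : ℤ → ℝ≥0∞, ∫⁻ y, ∑' i, ψ i * Nc i y ≤
        (∑' i, ψ i * ENNReal.ofReal (((2 : ℝ) ^ i) ^ (-2 : ℝ))) * ENNReal.ofReal (K₀ * A) := by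
      intro ψ
      rw [lintegral_tsum fun i => ((hNm i).const_mul _).aemeasurable, ← ENNReal.tsum_mul_right]
      refine ENNReal.tsum_le_tsum fun i => ?_
      rw [lintegral_const_mul _ (hNm i), mul_assoc, ← ENNReal.ofReal_mul (by positivity)]
      refine mul_le_mul_right ((hNint i).trans (ENNReal.ofReal_le_ofReal (le_of_eq ?_))) _
      rw [Real.rpow_neg (two_zpow_pos i).le, Real.rpow_two]
      ring
    have e2 : ∑' i, ψ₁ i * ENNReal.ofReal (((2 : ℝ) ^ i) ^ (-2 : ℝ)) ≤
        ENNReal.ofReal (2 ^ r * (K₁ * η ^ (r - 2))) := by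
      rw [ENNReal.ofReal_mul (by positivity)]
      refine le_trans (le_of_eq ?_) (mul_le_mul_right (hgeo₁ η hη) _)
      rw [← ENNReal.tsum_mul_left]
      refine tsum_congr fun i => ?_
      rw [hψ₁]; dsimp only
      split_ifs
      · have := two_zpow_pos i
        rw [← ENNReal.ofReal_mul (by positivity), ← ENNReal.ofReal_mul (by positivity),
          two_zpow_succ, Real.mul_rpow two_pos.le this.le, mul_assoc, ← Real.rpow_add this]
        ring_nf
      · simp
    have e3 : ∑' i, ψ₂ i * ENNReal.ofReal (((2 : ℝ) ^ i) ^ (-2 : ℝ)) ≤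
        ENNReal.ofReal (2 * (K₂ * (η / 2) ^ (-1 : ℝ))) := by
      rw [ENNReal.ofReal_mul (by positivity)]
      refine le_trans (le_of_eq ?_) (mul_le_mul_right (hgeo₂ (η / 2) (by positivity)) _)
      rw [← ENNReal.tsum_mul_left]
      refine tsum_congr fun i => ?_
      rw [hψ₂]; dsimp only
      have h2 : η ≤ (2 : ℝ) ^ (i + 1) ↔ η / 2 ≤ (2 : ℝ) ^ i := by
        rw [two_zpow_succ]; constructor <;> intro h <;> linarith
      have := two_zpow_pos i
      by_cases h : η / 2 ≤ (2 : ℝ) ^ i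
      · rw [if_pos (h2.2 h), if_pos h, ← ENNReal.ofReal_mul (by positivity),
          ← ENNReal.ofReal_mul (by positivity), two_zpow_succ, mul_assoc,
          show (-2 : ℝ) = -1 + -1 by norm_num, Real.rpow_add this, Real.rpow_neg_one]
        congr 1
        field_simp
      · rw [if_neg (mt h2.1 h), if_neg h]; simp
    rw [lintegral_add_left ((Measurable.tsum fun i => (hNm i).const_mul _).const_mul _),
      lintegral_const_mul _ (Measurable.tsum fun i => (hNm i).const_mul _)]
    refine (add_le_add (mul_le_mul_right ((e1 ψ₁).trans (mul_le_mul_left e2 _)) _)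
      ((e1 ψ₂).trans (mul_le_mul_left e3 _))).trans (le_of_eq ?_)
    rw [← ENNReal.ofReal_mul (by positivity), ← ENNReal.ofReal_mul (by positivity),
      ← ENNReal.ofReal_mul (by positivity), ← ENNReal.ofReal_add (by positivity) (by positivity)]
    simp only [Real.rpow_two]
    rw [← hA]
    congr 1
    have h1 : η ^ (1 - r) * η ^ (r - 2) = η ^ (1 - 2 : ℝ) := by
      rw [← Real.rpow_add hη]; ring_nf
    have h2 : (η / 2) ^ (-1 : ℝ) = 2 * η ^ (1 - 2 : ℝ) := by
      norm_num [Real.rpow_neg_one]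
      ring
    rw [h2]
    linear_combination 2 ^ r * K₁ * K₀ * A * h1

/-- Over disjoint ranges of scales, the total movement of a sum of wave packets is at most the sum of
the absolute values. -/
lemma sum_norm_scaleSum_le {ι : Type} (S : Finset ι) (D : ι → DyadicInterval) (a : ι → ℂ)
    {g : ι → ℝ → ℂ} {C : ℝ} (hC : 0 ≤ C) (hg : ∀ P ∈ S, Adapted C (D P) (g P)) {k₀ : ℤ} {x y : ℝ}
    (hxy : dy k₀ x = dy k₀ y) (T : Finset ℕ) (α β : ℕ → ℤ) (hα : ∀ j ∈ T, k₀ ≤ α j)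
    (hdisj : ∀ i ∈ T, ∀ j ∈ T, i ≠ j → Disjoint (Ioc (α i) (β i)) (Ioc (α j) (β j))) :
    ∑ j ∈ T, ‖scaleSum S D a g (α j) (β j) x‖ ≤ 4 * C * ∑ P ∈ S, ‖a P‖ * (D P).chi y := by
  classical
  calc ∑ j ∈ T, ‖scaleSum S D a g (α j) (β j) x‖
      ≤ ∑ j ∈ T, C * ∑ P ∈ S with α j < (D P).scale ∧ (D P).scale ≤ β j, ‖a P‖ * (D P).chi x :=
        Finset.sum_le_sum fun j _ => norm_scaleSum_le S D a hC hg _ _ x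
    _ = C * ∑ P ∈ S, ∑ j ∈ T, if α j < (D P).scale ∧ (D P).scale ≤ β j then ‖a P‖ * (D P).chi x
          else 0 := by
        rw [← Finset.mul_sum, Finset.sum_comm]
        simp_rw [Finset.sum_filter]
    _ ≤ C * ∑ P ∈ S, 4 * (‖a P‖ * (D P).chi y) := by
        gcongr with P hP
        have hy := (D P).chi_pos y
        by_cases h : ∃ j ∈ T, α j < (D P).scale ∧ (D P).scale ≤ β j
        · obtain ⟨j, hj, hj1, hj2⟩ := h
          rw [Finset.sum_eq_single_of_mem j hj fun i hi hij => if_neg fun (hcon : α i < (D P).scale ∧ (D P).scale ≤ β i) =>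
            (hdisj i hi j hj hij).notMem_of_mem_left (a := (D P).scale) hcon ⟨hj1, hj2⟩,
            if_pos ⟨hj1, hj2⟩]
          have h1 : (D P).chi x ≤ 4 * (D P).chi y := (D P).chi_le_four_mul
            ((abs_sub_lt_of_dy_eq hxy).le.trans (two_zpow_mono ((hα j hj).trans hj1.le)))
          nlinarith [norm_nonneg (a P)]
        · rw [Finset.sum_eq_zero fun j hj => if_neg fun hcon => h ⟨j, hj, hcon⟩]
          positivity
    _ = _ := by rw [← Finset.mul_sum]; ring

/-- The `q`-variation for `1 < q < 2` has a majorant that is bounded by the sum of the `q`-th powers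
of the coefficients. At each height the large coefficients are summed trivially, and the jump
inequality is applied to the small ones. -/
theorem exists_variation_majorant_of_lt_two {C : ℝ} (hC : 0 ≤ C) {q : ℝ} (hq1 : 1 < q) (hq2 : q < 2) :
    ∃ K : ℝ, 0 ≤ K ∧
    ∀ {ι : Type} (S : Finset ι) (D : ι → DyadicInterval) (a : ι → ℂ) (g : ι → ℝ → ℂ) (k₁ : ℤ),
    Set.InjOn D S → (∀ P ∈ S, Adapted C (D P) (g P)) → ∀ η : ℝ, 0 < η →
    ∃ W : ℝ → ℝ≥0∞, Measurable W ∧ IsVariationMajorant S D a g q k₁ (fun y => ENNReal.ofReal η + W y) ∧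
      ∫⁻ y, W y ≤ ENNReal.ofReal (K * (η ^ (1 - q) * ∑ P ∈ S, (D P).length * ‖a P‖ ^ q)) := by
  obtain ⟨K₀, hK₀, hjump⟩ := exists_jump_majorant hC
  obtain ⟨K₁, hK₁, hgeo₁⟩ := exists_tsum_two_zpow_rpow_neg_le (γ := 2 - q) (by linarith)
  obtain ⟨K₂, hK₂, hgeo₂⟩ := exists_tsum_two_zpow_rpow_le (γ := q - 1) (by linarith)
  have hcm := chiMass_nonneg
  refine ⟨2 ^ q * (4 * K₀ * K₁ + 8 * C * chiMass * K₂), by positivity, ?_⟩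
  intro ι S D a g k₁ hD hg η hη
  classical
  have hq0 : 0 < q := by linarith
  -- the small and the large coefficients at height `2 ^ i`
  set sm : ℤ → ι → ℂ := fun i P => if ‖a P‖ ≤ (2 : ℝ) ^ i then a P else 0 with hsm
  set bg : ℤ → ι → ℂ := fun i P => if ‖a P‖ ≤ (2 : ℝ) ^ i then 0 else a P with hbg
  have hex : ∀ i : ℤ, ∃ Nc : ℝ → ℝ≥0∞, _ := fun i =>
    hjump S D (sm i) g k₁ hD hg (2 ^ i / 2) (half_pos (two_zpow_pos i))
  choose Nc hNm hNint hN using hex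
  set B : ℤ → ℝ → ℝ := fun i y => ∑ P ∈ S, ‖bg i P‖ * (D P).chi y with hB
  have hB0 : ∀ i y, 0 ≤ B i y := fun i y => Finset.sum_nonneg fun P _ => by
    have := (D P).chi_pos y; positivity
  have hBint : ∀ i, Integrable (B i) := fun i =>
    integrable_finsetSum _ fun P _ => (D P).integrable_chi.const_mul _
  have hBm : ∀ i, Measurable (B i) := fun i =>
    Finset.measurable_fun_sum _ fun P _ => (D P).continuous_chi.measurable.const_mul _
  set Mj : ℤ → ℝ → ℝ≥0∞ := fun i y => Nc i y + ENNReal.ofReal (8 * C / 2 ^ i * B i y) with hMj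
  have hMm : ∀ i, Measurable (Mj i) := fun i =>
    (hNm i).add ((hBm i).const_mul _).ennreal_ofReal
  refine ⟨fun y => ENNReal.ofReal (η ^ (1 - q)) *
    ∑' i : ℤ, ENNReal.ofReal (((2 : ℝ) ^ (i + 1)) ^ q) * Mj i y,
    (Measurable.tsum fun i => (hMm i).const_mul _).const_mul _, ?_, ?_⟩
  · intro k₀ x y hxy T α β hαβ hdisj
    set t : ℕ → ℝ := fun j => ‖scaleSum S D a g (α j) (β j) x‖ with ht
    have ht0 : ∀ j, 0 ≤ t j := fun j => norm_nonneg _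
    have hcount : ∀ i : ℤ, ((T.filter fun j => (2 : ℝ) ^ i ≤ t j).card : ℝ≥0∞) ≤ Mj i y := by
      intro i
      have hi := two_zpow_pos i
      set T₁ := T.filter fun j => (2 : ℝ) ^ i / 2 ≤ ‖scaleSum S D (sm i) g (α j) (β j) x‖ with hT₁
      set T₂ := T.filter fun j => (2 : ℝ) ^ i / 2 ≤ ‖scaleSum S D (bg i) g (α j) (β j) x‖ with hT₂
      have hcov : (T.filter fun j => (2 : ℝ) ^ i ≤ t j) ⊆ T₁ ∪ T₂ := by
        intro j hj
        obtain ⟨hj1, hj2⟩ := Finset.mem_filter.1 hj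
        simp only [hT₁, hT₂, Finset.mem_union, Finset.mem_filter, hj1, true_and]
        by_contra! hcon
        have h1 : scaleSum S D a g (α j) (β j) x =
            scaleSum S D (sm i) g (α j) (β j) x + scaleSum S D (bg i) g (α j) (β j) x := by
          unfold scaleSum
          rw [← Finset.sum_add_distrib]
          refine Finset.sum_congr rfl fun P _ => ?_
          simp only [hsm, hbg]
          split_ifs <;> simp
        have h2 := norm_add_le (scaleSum S D (sm i) g (α j) (β j) x)
          (scaleSum S D (bg i) g (α j) (β j) x)
        rw [← h1] at h2
        linarith [hj2]
      have hcard : ((T.filter fun j => (2 : ℝ) ^ i ≤ t j).card : ℝ≥0∞) ≤ T₁.card + T₂.card := by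
        have h1 := (Finset.card_le_card hcov).trans (Finset.card_union_le _ _)
        exact_mod_cast h1
      refine hcard.trans (add_le_add ?_ ?_)
      · have hsub : ∀ j ∈ T₁, j ∈ T := fun j hj => (Finset.mem_filter.1 hj).1
        exact hN i k₀ x y hxy T₁ α β (fun j hj => hαβ j (hsub j hj))
          (fun i hi j hj => hdisj i (hsub i hi) j (hsub j hj)) fun j hj => (Finset.mem_filter.1 hj).2
      · have hsub : ∀ j ∈ T₂, j ∈ T := fun j hj => (Finset.mem_filter.1 hj).1
        have h1 := sum_norm_scaleSum_le S D (bg i) hC hg hxy T₂ α β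
          (fun j hj => (hαβ j (hsub j hj)).1)
          (fun i hi j hj => hdisj i (hsub i hi) j (hsub j hj))
        have h2 : (T₂.card : ℝ) * (2 ^ i / 2) ≤
            ∑ j ∈ T₂, ‖scaleSum S D (bg i) g (α j) (β j) x‖ := by
          rw [← nsmul_eq_mul]
          exact Finset.card_nsmul_le_sum _ _ _ fun j hj => (Finset.mem_filter.1 hj).2
        rw [← ENNReal.ofReal_natCast]
        refine ENNReal.ofReal_le_ofReal ?_
        rw [div_mul_eq_mul_div, le_div_iff₀ hi]
        have h3 := h2.trans h1
        simp only [hB]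
        linarith
    have h1 : ENNReal.ofReal (∑ j ∈ T, t j ^ q) ≤
        ∑' i : ℤ, ENNReal.ofReal (((2 : ℝ) ^ (i + 1)) ^ q) * Mj i y := by
      rw [ENNReal.ofReal_sum_of_nonneg fun j _ => by have := ht0 j; positivity]
      refine sum_le_tsum_levels T t (fun j _ => ht0 j) (fun i => Mj i y) hcount _ _
        (fun j _ h => by rw [h, Real.zero_rpow hq0.ne', ENNReal.ofReal_zero]) ?_
      intro j hj i hi1 hi2
      exact ENNReal.ofReal_le_ofReal (Real.rpow_le_rpow (ht0 j) hi2.le hq0.le)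
    have h2 : 0 ≤ ∑ j ∈ T, t j ^ q := Finset.sum_nonneg fun j _ => by have := ht0 j; positivity
    have h3 := le_add_rpow_mul (t := (∑ j ∈ T, t j ^ q) ^ (1 / q)) (by positivity) hη hq1.le
    rw [← Real.rpow_mul h2, one_div_mul_cancel hq0.ne', Real.rpow_one] at h3
    refine (ENNReal.ofReal_le_ofReal h3).trans ?_
    rw [ENNReal.ofReal_add hη.le (by positivity), ENNReal.ofReal_mul (by positivity)]
    exact add_le_add le_rfl (mul_le_mul_right h1 _)
  · have e1 : ∀ i : ℤ, ENNReal.ofReal (((2 : ℝ) ^ (i + 1)) ^ q) * ∫⁻ y, Mj i y ≤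
        ∑ P ∈ S, (ENNReal.ofReal (2 ^ q * (4 * K₀) * ((D P).length * ‖a P‖ ^ 2)) *
            (if ‖a P‖ ≤ (2 : ℝ) ^ i then ENNReal.ofReal (((2 : ℝ) ^ i) ^ (-(2 - q))) else 0) +
          ENNReal.ofReal (2 ^ q * (8 * C * chiMass) * ((D P).length * ‖a P‖)) *
            (if (2 : ℝ) ^ i ≤ ‖a P‖ then ENNReal.ofReal (((2 : ℝ) ^ i) ^ (q - 1)) else 0)) := by
      intro i
      have hi := two_zpow_pos i
      have h1 : ∫⁻ y, Mj i y ≤ ENNReal.ofReal (K₀ / (2 ^ i / 2) ^ 2 *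
          (∑ P ∈ S, (D P).length * ‖sm i P‖ ^ 2) + 8 * C / 2 ^ i *
            (∑ P ∈ S, ‖bg i P‖ * ((D P).length * chiMass))) := by
        rw [lintegral_add_left (hNm i), ENNReal.ofReal_add]
        · refine add_le_add (hNint i) (le_of_eq ?_)
          rw [← ofReal_integral_eq_lintegral_ofReal ((hBint i).const_mul _)
            (Filter.Eventually.of_forall fun y => by have := hB0 i y; dsimp; positivity)]
          rw [integral_const_mul, integral_finsetSum _ fun P _ => (D P).integrable_chi.const_mul _]
          simp_rw [integral_const_mul, DyadicInterval.integral_chi]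
        · exact mul_nonneg (by positivity) (Finset.sum_nonneg fun P _ => by
            have := (D P).length_pos; positivity)
        · exact mul_nonneg (by positivity) (Finset.sum_nonneg fun P _ => by
            have := (D P).length_pos; positivity)
      refine (mul_le_mul_right h1 _).trans ?_
      rw [← ENNReal.ofReal_mul (by positivity), Finset.mul_sum, Finset.mul_sum,
        ← Finset.sum_add_distrib, Finset.mul_sum, ENNReal.ofReal_sum_of_nonneg fun P _ => by
          have := (D P).length_pos; positivity]
      refine Finset.sum_le_sum fun P _ => ?_
      have hl := (D P).length_pos
      have hr1 : ((2 : ℝ) ^ (i + 1)) ^ q = 2 ^ q * (2 ^ i) ^ q := by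
        rw [two_zpow_succ, Real.mul_rpow two_pos.le hi.le]
      have hr2 : ((2 : ℝ) ^ i) ^ (-(2 - q)) = (2 ^ i) ^ q / (2 ^ i) ^ 2 := by
        rw [neg_sub, Real.rpow_sub hi, Real.rpow_two]
      have hr3 : ((2 : ℝ) ^ i) ^ (q - 1) = (2 ^ i) ^ q / 2 ^ i := by
        rw [Real.rpow_sub_one hi.ne']
      by_cases h : ‖a P‖ ≤ (2 : ℝ) ^ i
      · have hs : sm i P = a P := if_pos h
        have hb : bg i P = 0 := if_pos h
        rw [hs, hb, if_pos h, norm_zero, zero_mul, mul_zero, add_zero, hr1, hr2,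
          ← ENNReal.ofReal_mul (by positivity)]
        refine le_trans (le_of_eq ?_) le_self_add
        congr 1
        field_simp
        ring
      · have hs : sm i P = 0 := if_neg h
        have hb : bg i P = a P := if_neg h
        rw [hs, hb, if_neg h, norm_zero, if_pos (not_le.1 h).le, hr1, hr3, mul_zero, zero_add,
          ← ENNReal.ofReal_mul (by positivity)]
        refine le_of_eq ?_
        congr 1
        field_simp
        ring
    have e2 : ∫⁻ y, ∑' i : ℤ, ENNReal.ofReal (((2 : ℝ) ^ (i + 1)) ^ q) * Mj i y ≤
        ENNReal.ofReal (2 ^ q * (4 * K₀ * K₁ + 8 * C * chiMass * K₂) *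
          ∑ P ∈ S, (D P).length * ‖a P‖ ^ q) := by
      rw [lintegral_tsum fun i => ((hMm i).const_mul _).aemeasurable]
      refine (ENNReal.tsum_le_tsum fun i =>
        ((lintegral_const_mul _ (hMm i)).le.trans (e1 i))).trans ?_
      rw [Summable.tsum_finsetSum fun _ _ => ENNReal.summable, Finset.mul_sum,
        ENNReal.ofReal_sum_of_nonneg fun P _ => by have := (D P).length_pos; positivity]
      refine Finset.sum_le_sum fun P _ => ?_
      have hl := (D P).length_pos
      rw [ENNReal.tsum_add, ENNReal.tsum_mul_left, ENNReal.tsum_mul_left]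
      rcases (norm_nonneg (a P)).eq_or_lt with h | h
      · rw [← h]; simp
      · refine (add_le_add (mul_le_mul_right (hgeo₁ _ h) _) (mul_le_mul_right (hgeo₂ _ h) _)).trans
          (le_of_eq ?_)
        rw [← ENNReal.ofReal_mul (by positivity), ← ENNReal.ofReal_mul (by positivity),
          ← ENNReal.ofReal_add (by positivity) (by positivity)]
        congr 1
        rw [neg_sub, Real.rpow_sub h, Real.rpow_sub_one h.ne', Real.rpow_two]
        field_simp
    rw [lintegral_const_mul _ (Measurable.tsum fun i => (hMm i).const_mul _)]
    refine (mul_le_mul_right e2 _).trans (le_of_eq ?_)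
    rw [← ENNReal.ofReal_mul (by positivity)]
    congr 1
    ring

/-! ### The tree estimate -/

/-- The spatial interval of `P` is contained in the dyadic interval of length `2 ^ k` at position
`p` or in one of its two neighbours. -/
def Tile.Near (P : Tile) (k p : ℤ) : Prop := P.I.scale ≤ k ∧ |dy k P.I.center - p| ≤ 1

lemma Tile.Near.mono {P : Tile} {k l : ℤ} (hkl : k ≤ l) {x : ℝ} (h : P.Near k (dy k x)) :
    P.Near l (dy l x) := ⟨h.1.trans hkl, dy_near_of_le hkl h.2⟩

lemma Tile.Near.abs_sub_lt {P : Tile} {k : ℤ} {x : ℝ} (h : P.Near k (dy k x)) :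
    |x - P.I.center| < 2 * 2 ^ k := by
  rw [abs_sub_comm]; exact abs_sub_lt_of_dy_near h.2

/-- The hypotheses of the tree estimate, for the coefficients `∫ f conj(ψ_P)` of a finite set `S` of
tiles: `u k` is the part of the weighted function that tiles of scale larger than `k` see, `lam` is
the size to be proved, and `M` is the density of the support of `f`. -/
structure TreeHyp (K lam θ M τ : ℝ) (S : Finset Tile) (f : ℝ → ℂ) (ψ : Tile → ℝ → ℂ)
    (u : ℤ → ℝ → ℝ≥0∞) : Prop where
  injOn : Set.InjOn Tile.I S
  measurable_f : Measurable f
  integrable : ∀ P ∈ S, Integrable fun x => f x * (starRingEnd ℂ) (ψ P x)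
  measurable_u : ∀ k, Measurable (u k)
  /-- control of the visible mass near the tiles of `S` -/
  mass : ∀ k p, (∃ P ∈ S, P.Near (k + 1) p) → ∫⁻ x in dyI (k + 1) p, u k x ≤
    ENNReal.ofReal θ * volume (Function.support f ∩ dyI (k + 1) p) +
      ENNReal.ofReal (K * lam * 2 ^ (k + 1))
  /-- control of the tails of a single coefficient -/
  tail : ∀ P ∈ S, ∀ (E : Set ℝ) (ε : ℝ), MeasurableSet E → 0 ≤ ε → (∀ x ∈ E, P.I.chi x ^ 3 ≤ ε) →
    ∫⁻ x in E, ‖f x‖ₑ * ‖ψ P x‖ₑ ≤ ENNReal.ofReal (K * lam * ε)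
  /-- the density of the support of `f` near the tiles of `S` -/
  density : ∀ P ∈ S, volume (Function.support f ∩ {x | |x - P.I.center| ≤ 4 * 2 ^ P.I.scale}) ≤
    ENNReal.ofReal (K * M * 2 ^ P.I.scale)
  /-- linear combinations of the `ψ_P` of large scale have a majorant that is essentially constant at
  smaller scales -/
  main : ∀ (t : Tile → ℝ) (a : Tile → ℂ), (∀ P, 0 ≤ t P) → (∀ P ∈ S, ‖a P‖ ≤ t P ^ (τ - 1)) →
    ∀ η : ℝ, 0 < η → ∃ W : ℝ → ℝ≥0∞, Measurable W ∧
      ∫⁻ y, W y ≤ ENNReal.ofReal (K * (η⁻¹ * ∑ P ∈ S, 2 ^ P.I.scale * t P ^ τ)) ∧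
      ∀ (k : ℤ) (x y : ℝ), dy k x = dy k y →
        ‖f x‖ₑ * ‖∑ P ∈ S with k < P.I.scale, a P * ((2 : ℝ) ^ P.I.scale : ℝ) * ψ P x‖ₑ ≤
          u k x * (ENNReal.ofReal (K * η ^ (τ - 1)) + W y)

/-- A packing condition at the intervals of the tiles implies it at all dyadic intervals. -/
lemma sum_le_of_packing (S : Finset Tile) (v : Tile → ℝ) (B : ℝ) (hB : 0 ≤ B)
    (h : ∀ P₀ ∈ S, ∑ P ∈ S with P.I.scale ≤ P₀.I.scale ∧
      dy P₀.I.scale P.I.center = dy P₀.I.scale P₀.I.center, v P ≤ B * 2 ^ P₀.I.scale) (k p : ℤ) :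
    ∑ P ∈ S with P.I.scale ≤ k ∧ dy k P.I.center = p, v P ≤ B * 2 ^ k := by
  classical
  obtain ⟨k₀, hk₀⟩ : ∃ k₀ : ℤ, ∀ P ∈ S, k₀ < P.I.scale := by
    obtain ⟨b, hb⟩ := (S.image fun P => P.I.scale).bddBelow
    exact ⟨b - 1, fun P hP => by
      have := hb (Finset.mem_coe.2 (Finset.mem_image_of_mem (fun P : Tile => P.I.scale) hP))
      omega⟩
  have hsmall : ∀ k ≤ k₀, ∀ p, ∑ P ∈ S with P.I.scale ≤ k ∧ dy k P.I.center = p, v P ≤ B * 2 ^ k := by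
    intro k hk p
    rw [Finset.filter_eq_empty_iff.2 fun P hP hcon => by have := hk₀ P hP; omega, Finset.sum_empty]
    have := two_zpow_pos k
    positivity
  rcases le_total k k₀ with hk | hk
  · exact hsmall k hk p
  · induction k, hk using Int.leInduction generalizing p with
    | base => exact hsmall k₀ le_rfl p
    | succ k hk ih =>
      by_cases hex : ∃ P₀ ∈ S, P₀.I.scale = k + 1 ∧ dy (k + 1) P₀.I.center = p
      · obtain ⟨P₀, hP₀, h1, h2⟩ := hex
        have := h P₀ hP₀
        rwa [h1, h2] at this
      · have hsplit : (S.filter fun P => P.I.scale ≤ k + 1 ∧ dy (k + 1) P.I.center = p) ⊆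
            (S.filter fun P => P.I.scale ≤ k ∧ dy k P.I.center = 2 * p) ∪
            (S.filter fun P => P.I.scale ≤ k ∧ dy k P.I.center = 2 * p + 1) := by
          intro P hP
          obtain ⟨hP1, hP2, hP3⟩ := Finset.mem_filter.1 hP
          have h4 : P.I.scale ≤ k := by
            by_contra hcon
            exact hex ⟨P, hP1, by omega, hP3⟩
          rw [dy_succ] at hP3
          simp only [Finset.mem_union, Finset.mem_filter, hP1, h4, true_and]
          omega
        have heq : (S.filter fun P => P.I.scale ≤ k + 1 ∧ dy (k + 1) P.I.center = p) =
            (S.filter fun P => P.I.scale ≤ k ∧ dy k P.I.center = 2 * p) ∪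
            (S.filter fun P => P.I.scale ≤ k ∧ dy k P.I.center = 2 * p + 1) := by
          refine Finset.Subset.antisymm hsplit fun P hP => ?_
          simp only [Finset.mem_union, Finset.mem_filter] at hP ⊢
          rw [dy_succ]
          rcases hP with ⟨h1, h2, h3⟩ | ⟨h1, h2, h3⟩ <;> refine ⟨h1, by omega, by omega⟩
        rw [heq, Finset.sum_union (Finset.disjoint_left.2 fun P h1 h2 => by
          have h1 := (Finset.mem_filter.1 h1).2.2
          have h2 := (Finset.mem_filter.1 h2).2.2
          omega), two_zpow_succ]
        linarith [ih (2 * p), ih (2 * p + 1)]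

/-- A stopping scale: the largest scale in `[k₀, k₁]` at which a given condition holds. It is
constant on the dyadic intervals that it selects. -/
lemma exists_stopping_scale {k₀ k₁ : ℤ} (cond : ℤ → ℤ → Prop) (h01 : k₀ ≤ k₁)
    (h₀ : ∀ p, cond k₀ p) : ∃ κ : ℝ → ℤ, (∀ x, k₀ ≤ κ x ∧ κ x ≤ k₁ ∧ cond (κ x) (dy (κ x) x) ∧
      ∀ k, κ x < k → k ≤ k₁ → ¬ cond k (dy k x)) ∧
      (∀ x y, dy (κ x) x = dy (κ x) y → κ y = κ x) ∧ Measurable κ := by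
  classical
  have hex : ∀ x : ℝ, ∃ k, k₀ ≤ k ∧ k ≤ k₁ ∧ cond k (dy k x) ∧
      ∀ l, k < l → l ≤ k₁ → ¬ cond l (dy l x) := by
    intro x
    set s := (Finset.Icc k₀ k₁).filter fun k => cond k (dy k x)
    have hs : s.Nonempty := ⟨k₀, Finset.mem_filter.2 ⟨Finset.mem_Icc.2 ⟨le_rfl, h01⟩, h₀ _⟩⟩
    have h1 := Finset.mem_filter.1 (s.max'_mem hs)
    have h2 := Finset.mem_Icc.1 h1.1
    refine ⟨s.max' hs, h2.1, h2.2, h1.2, fun l hl hl' hcon => ?_⟩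
    have := s.le_max' l (Finset.mem_filter.2 ⟨Finset.mem_Icc.2 ⟨by omega, hl'⟩, hcon⟩)
    omega
  choose κ hκ using hex
  have hconst : ∀ x y, dy (κ x) x = dy (κ x) y → κ y = κ x := by
    intro x y hxy
    obtain ⟨a1, a2, a3, a4⟩ := hκ x
    obtain ⟨b1, b2, b3, b4⟩ := hκ y
    rcases lt_trichotomy (κ y) (κ x) with h | h | h
    · exact absurd (hxy ▸ a3) (b4 _ h a2)
    · exact h
    · exact absurd ((dy_congr_of_le h.le hxy) ▸ b3) (a4 _ h b2)
  refine ⟨κ, hκ, hconst, measurable_to_countable' fun k => ?_⟩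
  have : κ ⁻¹' {k} = dy k ⁻¹' {p | ∃ x, dy k x = p ∧ κ x = k} := by
    ext x
    simp only [mem_preimage, mem_singleton_iff, mem_ofPred_eq]
    refine ⟨fun h => ⟨x, rfl, h⟩, ?_⟩
    rintro ⟨y, h1, h2⟩
    rw [← h2, hconst y x (by rw [h2, h1])]
  rw [this]
  exact measurable_dy k (MeasurableSet.of_discrete)

section FarPart

variable {κ : ℝ → ℤ} (hκ : ∀ x y, dy (κ x) x = dy (κ x) y → κ y = κ x)
  (J : DyadicInterval) (G : Finset Tile) (hinj : Set.InjOn Tile.I (G : Set Tile))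
  (htop : ∀ P ∈ G, P.I.scale ≤ J.scale ∧ |P.I.center - J.center| ≤ J.length)
  (hgood : ∀ P ∈ G, ∀ x, ¬ P.Near (κ x) (dy (κ x) x))

/-- At a point whose stopping interval is longer than, and far from, the intervals of the tiles, the
weights of these tiles have a small sum. -/
lemma sum_chi_cube_le (x : ℝ)
    (hinj : Set.InjOn Tile.I (G : Set Tile))
    (htop : ∀ P ∈ G, P.I.scale ≤ J.scale ∧ |P.I.center - J.center| ≤ J.length)
    (hgood : ∀ P ∈ G, ∀ x, ¬ P.Near (κ x) (dy (κ x) x)) :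
    ∑ P ∈ G with P.I.scale ≤ κ x, P.I.chi x ^ 3 ≤ 4 * chiSum * geomInt (1 / 2) * J.chi x := by
  classical
  have hJ := J.chi_pos x
  have hcs := chiSum_nonneg
  have h1 : ∀ P ∈ G.filter fun P => P.I.scale ≤ κ x, P.I.chi x ^ 3 ≤
      4 * J.chi x * ((1 / 2) ^ (κ x - P.I.scale).natAbs * P.I.chi x) := by
    intro P hP
    obtain ⟨hP1, hP2⟩ := Finset.mem_filter.1 hP
    have hl := P.I.length_pos
    have hlJ := J.length_pos
    have hc := P.I.chi_pos x
    have e1 : P.I.chi x ≤ 4 * J.chi x := by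
      obtain ⟨t1, t2⟩ := htop P hP1
      have hle : P.I.length ≤ J.length := two_zpow_mono t1
      have e2 : |x - J.center| / J.length ≤ |x - P.I.center| / P.I.length + 1 := by
        rw [div_le_iff₀ hlJ, add_mul, one_mul]
        have e3 : |x - J.center| ≤ |x - P.I.center| + |P.I.center - J.center| := abs_sub_le _ _ _
        have e4 : |x - P.I.center| ≤ |x - P.I.center| / P.I.length * J.length := by
          rw [div_mul_eq_mul_div, le_div_iff₀ hl]
          gcongr
        linarith
      have e5 : 0 ≤ |x - J.center| / J.length := by positivity
      have e6 : 0 ≤ |x - P.I.center| / P.I.length := by positivity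
      unfold DyadicInterval.chi
      rw [← div_eq_mul_inv, inv_eq_one_div, div_le_div_iff₀ (by positivity) (by positivity)]
      nlinarith
    have e7 : P.I.chi x ≤ (1 / 2) ^ (κ x - P.I.scale).natAbs := by
      have hnear : ¬ |dy (κ x) P.I.center - dy (κ x) x| ≤ 1 := fun hcon => hgood P hP1 x ⟨hP2, hcon⟩
      have hdist := le_abs_sub_of_not_near hnear
      rw [abs_sub_comm] at hdist
      set n := (κ x - P.I.scale).natAbs with hn
      have hpow : (2 : ℝ) ^ n * P.I.length = 2 ^ κ x := by
        rw [DyadicInterval.length, ← zpow_natCast, ← zpow_add₀ two_ne_zero]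
        congr 1; omega
      refine (P.I.chi_le_of_le (t := 2 ^ n) (by positivity) (by rw [hpow]; exact hdist)).trans ?_
      rw [one_div, inv_pow]
      have : (1 : ℝ) ≤ 2 ^ n := one_le_pow₀ one_le_two
      gcongr
      nlinarith
    calc P.I.chi x ^ 3 = P.I.chi x * (P.I.chi x * P.I.chi x) := by ring
      _ ≤ (4 * J.chi x) * ((1 / 2) ^ (κ x - P.I.scale).natAbs * P.I.chi x) := by gcongr
  refine (Finset.sum_le_sum h1).trans ?_
  rw [← Finset.mul_sum]
  have h2 : ∑ P ∈ G with P.I.scale ≤ κ x, (1 / 2 : ℝ) ^ (κ x - P.I.scale).natAbs * P.I.chi x ≤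
      geomInt (1 / 2) * chiSum := by
    set L := (G.filter fun P => P.I.scale ≤ κ x).image fun P => P.I.scale
    rw [← Finset.sum_fiberwise_of_maps_to (t := L) (g := fun P : Tile => P.I.scale)
      fun P hP => Finset.mem_image_of_mem _ hP]
    calc _ ≤ ∑ l ∈ L, (1 / 2 : ℝ) ^ (κ x - l).natAbs * chiSum := by
          refine Finset.sum_le_sum fun l _ => ?_
          rw [Finset.sum_congr rfl fun P hP => by rw [(Finset.mem_filter.1 hP).2], ← Finset.mul_sum]
          gcongr
          exact sum_chi_le _ Tile.I (hinj.mono fun P hP =>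
            (Finset.mem_filter.1 (Finset.mem_filter.1 hP).1).1) l
            (fun P hP => (Finset.mem_filter.1 hP).2) x
      _ ≤ _ := by
          rw [← Finset.sum_mul]
          gcongr
          exact sum_geomInt_le (by norm_num) (by norm_num) L (κ x)
  calc _ ≤ 4 * J.chi x * (geomInt (1 / 2) * chiSum) := by gcongr
    _ = _ := by ring

include hκ hinj htop hgood in
/-- The contribution of the stopping intervals that are not shorter than the interval of the tile. They
are far from the tile, so that the decay of the weights makes this summable without any
orthogonality. -/
lemma sum_far_le (hκm : Measurable κ) {Kl τ : ℝ} (hKl : 0 ≤ Kl) (hτ : 1 ≤ τ) (X : Tile → ℝ)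
    (hX0 : ∀ P ∈ G, 0 ≤ X P)
    (hX : ∀ P ∈ G, ∀ ε : ℝ, 0 ≤ ε → (∀ x, P.I.scale ≤ κ x → P.I.chi x ^ 3 ≤ ε) → X P ≤ Kl * ε) :
    ∑ P ∈ G, 2 ^ P.I.scale * X P ^ τ ≤
      Kl ^ τ * (256 * chiSum * geomInt (1 / 2) * chiMass) * 2 ^ J.scale := by
  classical
  have hcs := chiSum_nonneg
  have hg := geomInt_nonneg (r := 1 / 2) (by norm_num)
  set far : Tile → Set ℝ := fun P => {x | P.I.scale ≤ κ x} with hfar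
  have hfarm : ∀ P, MeasurableSet (far P) := fun P => hκm (MeasurableSet.of_discrete (s := Ici P.I.scale))
  have hint : ∀ P : Tile, Integrable fun x => P.I.chi x ^ 3 := fun P =>
    P.I.integrable_chi.mono' (P.I.continuous_chi.pow 3).aestronglyMeasurable
      (Filter.Eventually.of_forall fun x => by
        rw [Real.norm_of_nonneg (pow_nonneg (P.I.chi_pos x).le 3)]
        simpa using P.I.chi_pow_le_chi_pow x (show 1 ≤ 3 by norm_num))
  set Y : Tile → ℝ := fun P => ∫ x in far P, P.I.chi x ^ 3 with hY
  have hY0 : ∀ P, 0 ≤ Y P := fun P => integral_nonneg fun x => pow_nonneg (P.I.chi_pos x).le 3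
  have h1 : ∀ P ∈ G, 2 ^ P.I.scale * X P ^ τ ≤ Kl ^ τ * (64 * Y P) := by
    intro P hP
    have hl := two_zpow_pos P.I.scale
    set ε := min 1 (64 * Y P / 2 ^ P.I.scale) with hε
    have hε0 : 0 ≤ ε := le_min zero_le_one (by have := hY0 P; positivity)
    have hεX : X P ≤ Kl * ε := by
      refine hX P hP ε hε0 fun x hx => le_min (pow_le_one₀ (P.I.chi_pos x).le (P.I.chi_le_one x)) ?_
      rw [le_div_iff₀ hl]
      -- the interval of length `|I_P|` around `x` lies in the far set
      have hsub : dyI P.I.scale (dy P.I.scale x) ⊆ far P := by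
        intro z hz
        have : dy (κ x) x = dy (κ x) z := dy_congr_of_le hx (show dy P.I.scale z = _ from hz).symm
        change P.I.scale ≤ κ z
        rw [hκ x z this]; exact hx
      have h2 : ∀ z ∈ dyI P.I.scale (dy P.I.scale x), P.I.chi x ^ 3 ≤ 64 * P.I.chi z ^ 3 := by
        intro z hz
        have h3 := P.I.chi_le_four_mul (x := x) (y := z) (abs_sub_lt_of_dy_eq
          (show dy P.I.scale z = _ from hz).symm).le
        calc P.I.chi x ^ 3 ≤ (4 * P.I.chi z) ^ 3 := by
              have := P.I.chi_pos x
              gcongr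
          _ = _ := by ring
      have hvol : volume.real (dyI P.I.scale (dy P.I.scale x)) = 2 ^ P.I.scale := by
        rw [Measure.real, volume_dyI, ENNReal.toReal_ofReal hl.le]
      have hfin : volume (dyI P.I.scale (dy P.I.scale x)) ≠ ∞ := by
        rw [volume_dyI]; exact ENNReal.ofReal_ne_top
      calc P.I.chi x ^ 3 * 2 ^ P.I.scale
          = ∫ _ in dyI P.I.scale (dy P.I.scale x), P.I.chi x ^ 3 := by
            rw [setIntegral_const, hvol, smul_eq_mul, mul_comm]
        _ ≤ ∫ z in dyI P.I.scale (dy P.I.scale x), 64 * P.I.chi z ^ 3 :=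
            setIntegral_mono_on (integrableOn_const hfin) ((hint P).const_mul _).integrableOn
              (measurableSet_dyI _ _) h2
        _ ≤ ∫ z in far P, 64 * P.I.chi z ^ 3 :=
            setIntegral_mono_set ((hint P).const_mul _).integrableOn
              (Filter.Eventually.of_forall fun z => by have := P.I.chi_pos z; dsimp; positivity)
              hsub.eventuallyLE
        _ = 64 * Y P := by rw [integral_const_mul]
    calc 2 ^ P.I.scale * X P ^ τ ≤ 2 ^ P.I.scale * (Kl * ε) ^ τ := by
          have := hX0 P hP
          gcongr
      _ = Kl ^ τ * (2 ^ P.I.scale * ε ^ τ) := by rw [Real.mul_rpow hKl hε0]; ring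
      _ ≤ Kl ^ τ * (2 ^ P.I.scale * ε) := by
          gcongr
          have := Real.rpow_le_rpow_of_exponent_ge' hε0 (min_le_left _ _) zero_le_one hτ
          rwa [Real.rpow_one] at this
      _ ≤ Kl ^ τ * (64 * Y P) := by
          refine mul_le_mul_of_nonneg_left ?_ (by positivity)
          rw [← le_div_iff₀' hl]
          exact min_le_right _ _
  have h2 : ∑ P ∈ G, Y P ≤ 4 * chiSum * geomInt (1 / 2) * (J.length * chiMass) := by
    have e1 : ∀ P, Y P = ∫ x, (far P).indicator (fun x => P.I.chi x ^ 3) x := fun P =>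
      (integral_indicator (hfarm P)).symm
    simp_rw [e1]
    rw [← integral_finsetSum _ fun P _ => (hint P).indicator (hfarm P), ← J.integral_chi,
      ← integral_const_mul]
    refine integral_mono (integrable_finsetSum _ fun P _ => (hint P).indicator (hfarm P))
      (J.integrable_chi.const_mul _) fun x => ?_
    refine le_trans (le_of_eq ?_) (sum_chi_cube_le J G x hinj htop hgood)
    rw [Finset.sum_filter]
    refine Finset.sum_congr rfl fun P _ => ?_
    rw [indicator_apply]
    exact if_congr Iff.rfl rfl rfl
  calc ∑ P ∈ G, 2 ^ P.I.scale * X P ^ τ ≤ ∑ P ∈ G, Kl ^ τ * (64 * Y P) := Finset.sum_le_sum h1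
    _ = Kl ^ τ * 64 * ∑ P ∈ G, Y P := by rw [Finset.mul_sum]; congr 1; ext P; ring
    _ ≤ Kl ^ τ * 64 * (4 * chiSum * geomInt (1 / 2) * (J.length * chiMass)) := by gcongr
    _ = _ := by rw [DyadicInterval.length]; ring

end FarPart

section NearPart

variable {K lam θ M τ A : ℝ} {S : Finset Tile} {f : ℝ → ℂ} {ψ : Tile → ℝ → ℂ} {u : ℤ → ℝ → ℝ≥0∞}
  (H : TreeHyp K lam θ M τ S f ψ u) {κ : ℝ → ℤ}
  (hκ : ∀ x y, dy (κ x) x = dy (κ x) y → κ y = κ x) (hκm : Measurable κ)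
  {J : DyadicInterval}
  (hparent : ∀ x, κ x < J.scale →
    (∃ P ∈ S, P.Near (κ x + 1) (dy (κ x + 1) x) ∧ |P.I.center - J.center| ≤ J.length) ∧
    volume (Function.support f ∩ dyI (κ x + 1) (dy (κ x + 1) x)) ≤ ENNReal.ofReal (A * M * 2 ^ (κ x + 1)))

include H hparent in
/-- On a stopping interval the visible mass is under control, because its parent is not a candidate
for stopping. -/
lemma lintegral_visible_le (hK : 0 ≤ K) (hlam : 0 ≤ lam) (hθ : 0 ≤ θ) (hA : 0 ≤ A)
    (hθM : θ * M ≤ lam) {x : ℝ} (hx : κ x < J.scale) :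
    ∫⁻ z in dyI (κ x) (dy (κ x) x), u (κ x) z ≤ ENNReal.ofReal (2 * (A + K) * lam * 2 ^ κ x) := by
  obtain ⟨⟨P, hP, hnear, -⟩, hden⟩ := hparent x hx
  have hsub : dyI (κ x) (dy (κ x) x) ⊆ dyI (κ x + 1) (dy (κ x + 1) x) := fun z hz =>
    dy_congr_of_le (by omega) (show dy (κ x) z = _ from hz)
  have hk := two_zpow_pos (κ x)
  calc ∫⁻ z in dyI (κ x) (dy (κ x) x), u (κ x) z
      ≤ ∫⁻ z in dyI (κ x + 1) (dy (κ x + 1) x), u (κ x) z := lintegral_mono_set hsub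
    _ ≤ _ := H.mass _ _ ⟨P, hP, hnear⟩
    _ ≤ ENNReal.ofReal θ * ENNReal.ofReal (A * M * 2 ^ (κ x + 1)) +
        ENNReal.ofReal (K * lam * 2 ^ (κ x + 1)) := by gcongr
    _ ≤ ENNReal.ofReal (A * lam * 2 ^ (κ x + 1)) + ENNReal.ofReal (K * lam * 2 ^ (κ x + 1)) := by
        rw [← ENNReal.ofReal_mul hθ]
        gcongr ENNReal.ofReal ?_ + _
        have := mul_le_mul_of_nonneg_left hθM (mul_nonneg hA (two_zpow_pos (κ x + 1)).le)
        linarith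
    _ = _ := by
        have := two_zpow_pos (κ x + 1)
        rw [← ENNReal.ofReal_add (by positivity) (by positivity), two_zpow_succ]
        congr 1; ring

include H hκ hκm hparent in
/-- The contribution of the stopping intervals that are shorter than the interval of the tile. -/
lemma sum_near_le (hK : 0 < K) (hlam : 0 < lam) (hθ : 0 ≤ θ) (hA : 0 ≤ A) (hθM : θ * M ≤ lam)
    (hτ : 1 ≤ τ) (G : Finset Tile) (hGS : G ⊆ S) (hGJ : ∀ P ∈ G, P.I.scale ≤ J.scale) :
    ∑ P ∈ G, 2 ^ P.I.scale *
      ‖∫ x in {x | κ x < P.I.scale}, f x * (starRingEnd ℂ) (ψ P x)‖ ^ τ ≤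
      16 * (2 * (A + K) * K) * (2 * (2 * (A + K) * K)) ^ (τ - 1) * lam ^ τ * 2 ^ J.scale := by
  classical
  set E : Tile → Set ℝ := fun P => {x | κ x < P.I.scale} with hE
  have hEm : ∀ P, MeasurableSet (E P) := fun P =>
    hκm (MeasurableSet.of_discrete (s := Iio P.I.scale))
  set X : Tile → ℂ := fun P => ∫ x in E P, f x * (starRingEnd ℂ) (ψ P x) with hX
  set t : Tile → ℝ := fun P => if P ∈ G then ‖X P‖ else 0 with ht
  have ht0 : ∀ P, 0 ≤ t P := fun P => by simp only [ht]; split_ifs <;> simp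
  -- the coefficients that realize the `ℓ^τ` norm by duality
  set a : Tile → ℂ := fun P => if P ∈ G then X P / ‖X P‖ * (t P ^ (τ - 1) : ℝ) else 0 with ha
  have ha0 : ∀ P, P ∉ G → a P = 0 := fun P hP => if_neg hP
  have hat : ∀ P ∈ S, ‖a P‖ ≤ t P ^ (τ - 1) := by
    intro P _
    have h0 : 0 ≤ t P ^ (τ - 1) := Real.rpow_nonneg (ht0 P) _
    simp only [ha]
    split_ifs with h
    · rw [norm_mul, norm_div, Complex.norm_real, Complex.norm_real, Real.norm_of_nonneg h0, norm_norm]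
      exact mul_le_of_le_one_left h0 (div_self_le_one _)
    · simpa using h0
  have haX : ∀ P ∈ S, (starRingEnd ℂ) (a P) * X P = ((t P ^ τ : ℝ) : ℂ) := by
    intro P _
    by_cases h : P ∈ G
    · have htP : t P = ‖X P‖ := if_pos h
      simp only [ha, if_pos h]
      rw [map_mul, Complex.conj_ofReal, map_div₀, Complex.conj_ofReal, htP]
      rcases eq_or_ne (X P) 0 with h0 | h0
      · rw [h0]; simp [Real.zero_rpow (show τ ≠ 0 by linarith)]
      · have hn : 0 < ‖X P‖ := norm_pos_iff.2 h0
        have e1 : (starRingEnd ℂ) (X P) * X P = ((‖X P‖ * ‖X P‖ : ℝ) : ℂ) := by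
          rw [← Complex.normSq_eq_conj_mul_self, Complex.normSq_eq_norm_sq, sq]
        have hn' : (‖X P‖ : ℂ) ≠ 0 := by exact_mod_cast hn.ne'
        calc (starRingEnd ℂ) (X P) / ‖X P‖ * ((‖X P‖ ^ (τ - 1) : ℝ) : ℂ) * X P
            = (starRingEnd ℂ) (X P) * X P / ‖X P‖ * ((‖X P‖ ^ (τ - 1) : ℝ) : ℂ) := by ring
          _ = ‖X P‖ * ((‖X P‖ ^ (τ - 1) : ℝ) : ℂ) := by
              rw [e1]; push_cast; field_simp
          _ = ((‖X P‖ ^ τ : ℝ) : ℂ) := by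
              rw [← Complex.ofReal_mul, mul_comm, ← Real.rpow_add_one hn.ne']; ring_nf
    · have htP : t P = 0 := if_neg h
      rw [ha0 P h, htP, Real.zero_rpow (by linarith)]; simp
  set Xs := ∑ P ∈ S, 2 ^ P.I.scale * t P ^ τ with hXs
  have hXs0 : 0 ≤ Xs := Finset.sum_nonneg fun P _ =>
    mul_nonneg (two_zpow_pos _).le (Real.rpow_nonneg (ht0 P) _)
  have hgoal : ∑ P ∈ G, 2 ^ P.I.scale * ‖X P‖ ^ τ = Xs := by
    rw [hXs, ← Finset.sum_subset hGS]
    · refine Finset.sum_congr rfl fun P hP => ?_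
      rw [show t P = ‖X P‖ from if_pos hP]
    · intro P _ hP
      rw [show t P = 0 from if_neg hP, Real.zero_rpow (by linarith), mul_zero]
  change ∑ P ∈ G, 2 ^ P.I.scale * ‖X P‖ ^ τ ≤ _
  rw [hgoal]
  set Φ : ℝ → ℝ≥0∞ := fun x => ‖f x‖ₑ *
    ‖∑ P ∈ S with κ x < P.I.scale, a P * ((2 : ℝ) ^ P.I.scale : ℝ) * ψ P x‖ₑ with hΦ
  -- exchange the sum and the integral: at `x` only the tiles of scale larger than `κ x` contribute
  have hdual : ENNReal.ofReal Xs ≤ ∫⁻ x, Φ x := by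
    have e1 : (Xs : ℂ) = ∫ x, ∑ P ∈ S, (E P).indicator
        (fun x => (starRingEnd ℂ) (a P) * ((2 : ℝ) ^ P.I.scale : ℝ) *
          (f x * (starRingEnd ℂ) (ψ P x))) x := by
      rw [integral_finsetSum _ fun P hP => ((H.integrable P hP).const_mul _).indicator (hEm P), hXs]
      push_cast
      refine Finset.sum_congr rfl fun P hP => ?_
      rw [integral_indicator (hEm P), integral_const_mul]
      have := haX P hP
      simp only [hX] at this
      rw [← this]
      ring
    have e2 : ENNReal.ofReal Xs = ‖(Xs : ℂ)‖ₑ := by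
      rw [← ofReal_norm, Complex.norm_real, Real.norm_of_nonneg hXs0]
    rw [e2, e1]
    refine (enorm_integral_le_lintegral_enorm _).trans (lintegral_mono fun x => le_of_eq ?_)
    have e3 : ∑ P ∈ S, (E P).indicator (fun x => (starRingEnd ℂ) (a P) * ((2 : ℝ) ^ P.I.scale : ℝ) *
        (f x * (starRingEnd ℂ) (ψ P x))) x = f x * (starRingEnd ℂ)
        (∑ P ∈ S with κ x < P.I.scale, a P * ((2 : ℝ) ^ P.I.scale : ℝ) * ψ P x) := by
      rw [Finset.sum_filter, map_sum, Finset.mul_sum]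
      refine Finset.sum_congr rfl fun P _ => ?_
      by_cases h : κ x < P.I.scale
      · rw [indicator_of_mem (show x ∈ E P from h), if_pos h, map_mul, map_mul, Complex.conj_ofReal]
        ring
      · rw [indicator_of_notMem (show x ∉ E P from h), if_neg h]; simp
    rw [e3, enorm_mul, hΦ]
    congr 1
    rw [← ofReal_norm, ← ofReal_norm, RCLike.norm_conj]
  set C₁ := 2 * (A + K) * K with hC₁
  have hC₁0 : 0 < C₁ := by positivity
  -- with this choice the part of the majorant that is bounded by the left side is absorbed
  set η := 2 * C₁ * lam with hη
  have hη0 : 0 < η := by positivity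
  obtain ⟨W, hWm, hWint, hW⟩ := H.main t a ht0 hat η hη0
  set Hf : ℝ → ℝ≥0∞ := fun y => ENNReal.ofReal (K * η ^ (τ - 1)) + W y with hHf
  have hHm : Measurable Hf := measurable_const.add hWm
  set ball : Set ℝ := {x | |x - J.center| ≤ 4 * 2 ^ J.scale} with hball
  have hballm : MeasurableSet ball := measurableSet_le (by fun_prop) measurable_const
  have hballv : volume ball = ENNReal.ofReal (8 * 2 ^ J.scale) := by
    have : ball = Icc (J.center - 4 * 2 ^ J.scale) (J.center + 4 * 2 ^ J.scale) := by
      ext x; simp only [hball, mem_ofPred_eq, mem_Icc, abs_le]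
      constructor <;> rintro ⟨h1, h2⟩ <;> constructor <;> linarith
    rw [this, Real.volume_Icc]; congr 1; ring
  -- decompose the line into the stopping intervals
  set cell : ℤ × ℤ → Set ℝ := fun kp => {x | κ x = kp.1 ∧ dy kp.1 x = kp.2} with hcell
  have hcellm : ∀ kp, MeasurableSet (cell kp) := fun kp =>
    (hκm (MeasurableSet.of_discrete (s := {kp.1}))).inter (measurableSet_dyI _ _)
  have hcelld : Pairwise (Function.onFun Disjoint cell) := by
    intro i j hij
    refine Set.disjoint_left.2 fun x hx hy => hij ?_
    obtain ⟨h1, h2⟩ := hx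
    obtain ⟨h3, h4⟩ := hy
    have h5 : i.1 = j.1 := h1.symm.trans h3
    exact Prod.ext h5 (by rw [← h2, ← h4, h5])
  have hcellu : ⋃ kp, cell kp = univ := by
    ext x; simp only [mem_iUnion, mem_univ, iff_true]
    exact ⟨(κ x, dy (κ x) x), rfl, rfl⟩
  have hpart : ∀ h : ℝ → ℝ≥0∞, ∫⁻ x, h x = ∑' kp, ∫⁻ x in cell kp, h x := fun h => by
    rw [← lintegral_iUnion hcellm hcelld, hcellu, Measure.restrict_univ]
  have hmain : ∫⁻ x, Φ x ≤ ENNReal.ofReal (2 * (A + K) * lam) * ∫⁻ y in ball, Hf y := by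
    rw [← lintegral_indicator hballm, hpart, hpart (ball.indicator Hf), ← ENNReal.tsum_mul_left]
    refine ENNReal.tsum_le_tsum fun kp => ?_
    obtain ⟨k, p⟩ := kp
    rcases (cell (k, p)).eq_empty_or_nonempty with hemp | ⟨x₀, hx₀⟩
    · rw [hemp]; simp
    have hk₀ : κ x₀ = k := hx₀.1
    have hp₀ : dy k x₀ = p := hx₀.2
    have hcelleq : cell (k, p) = dyI k p := by
      refine Subset.antisymm (fun x hx => hx.2) fun x hx => ⟨?_, hx⟩
      rw [← hk₀]
      exact hκ x₀ x (by rw [hk₀, hp₀]; exact hx.symm)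
    rcases le_or_gt J.scale k with hJk | hJk
    · have : ∀ x ∈ cell (k, p), Φ x = 0 := by
        intro x hx
        have hsum : ∑ P ∈ S with κ x < P.I.scale, a P * ((2 : ℝ) ^ P.I.scale : ℝ) * ψ P x = 0 := by
          refine Finset.sum_eq_zero fun P hP => ?_
          have h1 := (Finset.mem_filter.1 hP).2
          rw [hx.1] at h1
          rw [ha0 P fun hPG => by have := hGJ P hPG; simp only at h1; omega]
          simp
        simp only [hΦ, hsum, enorm_zero, mul_zero]
      rw [setLIntegral_congr_fun (hcellm _) this]
      simp
    · have hu := lintegral_visible_le H hparent hK.le hlam.le hθ hA hθM (x := x₀) (by rw [hk₀]; exact hJk)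
      rw [hk₀, hp₀] at hu
      have hpow := two_zpow_pos k
      have hin : dyI k p ⊆ ball := by
        intro x hx
        have hxc : κ x = k := (hcelleq ▸ hx : x ∈ cell (k, p)).1
        obtain ⟨⟨P, hP, hnear, hPJ⟩, -⟩ := hparent x (by rw [hxc]; exact hJk)
        have h1 := hnear.abs_sub_lt
        have h2 : (2 : ℝ) ^ (κ x + 1) ≤ 2 ^ J.scale := two_zpow_mono (by omega)
        have h3 := abs_sub_le x P.I.center J.center
        change |x - J.center| ≤ 4 * 2 ^ J.scale
        rw [DyadicInterval.length] at hPJ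
        linarith [two_zpow_pos J.scale]
      have hpt : ∀ y ∈ dyI k p, ∫⁻ x in dyI k p, Φ x ≤
          ENNReal.ofReal (2 * (A + K) * lam * 2 ^ k) * Hf y := by
        intro y hy
        calc ∫⁻ x in dyI k p, Φ x ≤ ∫⁻ x in dyI k p, u k x * Hf y := by
              refine setLIntegral_mono' (measurableSet_dyI k p) fun x hx => ?_
              have hxc : κ x = k := (hcelleq ▸ hx : x ∈ cell (k, p)).1
              have := hW k x y ((show dy k x = p from hx).trans (show dy k y = p from hy).symm)
              simp only [hΦ, hxc]
              exact this
          _ = (∫⁻ x in dyI k p, u k x) * Hf y := lintegral_mul_const _ (H.measurable_u k)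
          _ ≤ _ := by gcongr
      rw [hcelleq]
      -- the pointwise bound holds for every `y` in the stopping interval; average over `y`
      have hav : (∫⁻ x in dyI k p, Φ x) * ENNReal.ofReal (2 ^ k) ≤
          (ENNReal.ofReal (2 * (A + K) * lam) * ∫⁻ y in dyI k p, ball.indicator Hf y) *
            ENNReal.ofReal (2 ^ k) := by
        calc (∫⁻ x in dyI k p, Φ x) * ENNReal.ofReal (2 ^ k)
            = ∫⁻ _ in dyI k p, (∫⁻ x in dyI k p, Φ x) := (setLIntegral_dyI_const _ _ _).symm
          _ ≤ ∫⁻ y in dyI k p, ENNReal.ofReal (2 * (A + K) * lam * 2 ^ k) * ball.indicator Hf y := by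
              refine setLIntegral_mono' (measurableSet_dyI k p) fun y hy => ?_
              rw [indicator_of_mem (hin hy)]
              exact hpt y hy
          _ = _ := by
              rw [lintegral_const_mul _ (hHm.indicator hballm), ENNReal.ofReal_mul (by positivity)]
              ring
      exact (ENNReal.mul_le_mul_iff_left (by simpa using hpow) ENNReal.ofReal_ne_top).1 hav
  have hfinal : ENNReal.ofReal Xs ≤ ENNReal.ofReal (2 * (A + K) * lam *
      (K * η ^ (τ - 1) * (8 * 2 ^ J.scale) + K * (η⁻¹ * Xs))) := by
    refine (hdual.trans hmain).trans ?_
    have hJ := two_zpow_pos J.scale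
    rw [ENNReal.ofReal_mul (show 0 ≤ 2 * (A + K) * lam by positivity),
      ENNReal.ofReal_add (by positivity) (by positivity)]
    gcongr
    rw [lintegral_add_left measurable_const, setLIntegral_const, hballv,
      ENNReal.ofReal_mul (show 0 ≤ K * η ^ (τ - 1) by positivity)]
    gcongr
    exact (setLIntegral_le_lintegral _ _).trans hWint
  have hJ := two_zpow_pos J.scale
  rw [ENNReal.ofReal_le_ofReal_iff (by positivity)] at hfinal
  have e1 : 2 * (A + K) * lam * (K * η ^ (τ - 1) * (8 * 2 ^ J.scale) + K * (η⁻¹ * Xs)) =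
      8 * C₁ * lam * η ^ (τ - 1) * 2 ^ J.scale + Xs / 2 := by
    rw [hη, hC₁]
    field_simp
  rw [e1] at hfinal
  have e2 : η ^ (τ - 1) = (2 * C₁) ^ (τ - 1) * lam ^ (τ - 1) := by
    rw [hη, Real.mul_rpow (by positivity) hlam.le]
  have e3 : lam * lam ^ (τ - 1) = lam ^ τ := by
    rw [mul_comm, ← Real.rpow_add_one hlam.ne']; ring_nf
  calc Xs ≤ 16 * C₁ * lam * η ^ (τ - 1) * 2 ^ J.scale := by linarith
    _ = 16 * C₁ * (2 * C₁) ^ (τ - 1) * (lam * lam ^ (τ - 1)) * 2 ^ J.scale := by rw [e2]; ring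
    _ = _ := by rw [e3]

end NearPart

section TreeEstimate

lemma add_rpow_le_two_rpow_mul {a b τ : ℝ} (ha : 0 ≤ a) (hb : 0 ≤ b) (hτ : 0 ≤ τ) :
    (a + b) ^ τ ≤ 2 ^ τ * (a ^ τ + b ^ τ) := by
  have h1 : a + b ≤ 2 * max a b := by linarith [le_max_left a b, le_max_right a b]
  calc (a + b) ^ τ ≤ (2 * max a b) ^ τ := by gcongr
    _ = 2 ^ τ * max a b ^ τ := Real.mul_rpow zero_le_two (le_max_of_le_left ha)
    _ ≤ _ := by
        gcongr
        have h2 := Real.rpow_nonneg ha τ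
        have h3 := Real.rpow_nonneg hb τ
        rcases max_cases a b with ⟨h, -⟩ | ⟨h, -⟩ <;> rw [h] <;> linarith

/-- The constant in the tree estimate. -/
noncomputable def treeConst (K τ : ℝ) : ℝ :=
  2 * (2 ^ τ * (16 * (2 * (6 * K + K) * K) * (2 * (2 * (6 * K + K) * K)) ^ (τ - 1) +
    K ^ τ * (256 * chiSum * geomInt (1 / 2) * chiMass)))

/-- A tile is near at most three dyadic intervals of a given scale. -/
lemma sum_near_le_of_packing (S : Finset Tile) (v : Tile → ℝ) (hv : ∀ P, 0 ≤ v P) {B : ℝ} (k p : ℤ)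
    (h : ∀ p, ∑ P ∈ S with P.I.scale ≤ k ∧ dy k P.I.center = p, v P ≤ B * 2 ^ k)
    [DecidablePred fun P : Tile => P.Near k p] :
    ∑ P ∈ S with P.Near k p, v P ≤ 3 * B * 2 ^ k := by
  classical
  have hsub : (S.filter fun P => P.Near k p) ⊆
      ((S.filter fun P => P.I.scale ≤ k ∧ dy k P.I.center = p - 1) ∪
      (S.filter fun P => P.I.scale ≤ k ∧ dy k P.I.center = p)) ∪
      (S.filter fun P => P.I.scale ≤ k ∧ dy k P.I.center = p + 1) := by
    intro P hP
    obtain ⟨hP1, hP2, hP3⟩ := Finset.mem_filter.1 hP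
    simp only [Finset.mem_union, Finset.mem_filter, hP1, hP2, true_and]
    rw [abs_le] at hP3
    omega
  refine (Finset.sum_le_sum_of_subset_of_nonneg hsub fun P _ _ => hv P).trans ?_
  rw [Finset.sum_union, Finset.sum_union]
  · linarith [h (p - 1), h p, h (p + 1)]
  · refine Finset.disjoint_left.2 fun P h1 h2 => ?_
    have h1 := (Finset.mem_filter.1 h1).2.2
    have h2 := (Finset.mem_filter.1 h2).2.2
    omega
  · refine Finset.disjoint_left.2 fun P h1 h2 => ?_
    have h2 := (Finset.mem_filter.1 h2).2.2
    rcases Finset.mem_union.1 h1 with h1 | h1 <;>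
    · have h1 := (Finset.mem_filter.1 h1).2.2
      omega

/-- The tree estimate: the `ℓ^τ` Carleson packing condition for the coefficients `∫ f conj(ψ_P)`. -/
theorem tree_estimate {K lam θ M τ : ℝ} {S : Finset Tile} {f : ℝ → ℂ} {ψ : Tile → ℝ → ℂ}
    {u : ℤ → ℝ → ℝ≥0∞} (H : TreeHyp K lam θ M τ S f ψ u) (hK : 0 < K) (hlam : 0 < lam) (hθ : 0 ≤ θ)
    (hM : 0 < M) (hθM : θ * M ≤ lam) (hτ : 1 ≤ τ) (k p : ℤ) :
    ∑ P ∈ S with P.I.scale ≤ k ∧ dy k P.I.center = p,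
      2 ^ P.I.scale * ‖∫ x, f x * (starRingEnd ℂ) (ψ P x)‖ ^ τ ≤ treeConst K τ * lam ^ τ * 2 ^ k := by
  classical
  set T : Tile → ℂ := fun P => ∫ x, f x * (starRingEnd ℂ) (ψ P x) with hT
  set v : Tile → ℝ := fun P => 2 ^ P.I.scale * ‖T P‖ ^ τ with hv
  have hv0 : ∀ P, 0 ≤ v P := fun P =>
    mul_nonneg (two_zpow_pos _).le (Real.rpow_nonneg (norm_nonneg _) _)
  set Cn := 16 * (2 * (6 * K + K) * K) * (2 * (2 * (6 * K + K) * K)) ^ (τ - 1) with hCn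
  set Cf := K ^ τ * (256 * chiSum * geomInt (1 / 2) * chiMass) with hCf
  have hC : treeConst K τ = 2 * (2 ^ τ * (Cn + Cf)) := rfl
  have hC0 : 0 ≤ treeConst K τ := by
    have h1 := chiSum_nonneg
    have h2 := geomInt_nonneg (r := 1 / 2) (by norm_num)
    have h3 := chiMass_nonneg
    unfold treeConst
    positivity
  rcases S.eq_empty_or_nonempty with rfl | hSne
  · have := two_zpow_pos k
    simp only [Finset.filter_empty, Finset.sum_empty]
    positivity
  -- the interval of a tile for which the ratio in the packing condition is extremal
  set sub : Tile → Finset Tile := fun P₀ => S.filter fun P => P.I.scale ≤ P₀.I.scale ∧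
    dy P₀.I.scale P.I.center = dy P₀.I.scale P₀.I.center with hsub
  obtain ⟨P₀, hP₀, hmax⟩ := Finset.exists_max_image S (fun P₀ => (∑ P ∈ sub P₀, v P) / 2 ^ P₀.I.scale) hSne
  set B := (∑ P ∈ sub P₀, v P) / 2 ^ P₀.I.scale with hB
  have hB0 : 0 ≤ B := div_nonneg (Finset.sum_nonneg fun P _ => hv0 P) (two_zpow_pos _).le
  have hpack := sum_le_of_packing S v B hB0 fun P hP => by
    have := hmax P hP
    rwa [div_le_iff₀ (two_zpow_pos _)] at this
  refine (hpack k p).trans ?_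
  refine mul_le_mul_of_nonneg_right ?_ (two_zpow_pos k).le
  -- it remains to bound the extremal ratio
  set J := P₀.I with hJ
  have hJpos := two_zpow_pos J.scale
  set S' := sub P₀ with hS'
  have hS'S : S' ⊆ S := Finset.filter_subset _ _
  have hS'J : ∀ P ∈ S', P.I.scale ≤ J.scale ∧ |P.I.center - J.center| ≤ J.length := fun P hP =>
    ⟨(Finset.mem_filter.1 hP).2.1, (abs_sub_lt_of_dy_eq (Finset.mem_filter.1 hP).2.2).le⟩
  obtain ⟨k₀, hk₀⟩ : ∃ k₀ : ℤ, ∀ P ∈ S, k₀ < P.I.scale := by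
    obtain ⟨b, hb⟩ := (S.image fun P => P.I.scale).bddBelow
    exact ⟨b - 1, fun P hP => by
      have := hb (Finset.mem_coe.2 (Finset.mem_image_of_mem (fun P : Tile => P.I.scale) hP))
      omega⟩
  -- stop at the intervals that are not near any tile or in which the support of `f` is dense
  set cond : ℤ → ℤ → Prop := fun k p => (∀ P ∈ S', ¬ P.Near k p) ∨
    ENNReal.ofReal (6 * K * M * 2 ^ k) < volume (Function.support f ∩ dyI k p) with hcond
  obtain ⟨κ, hκ1, hκ, hκm⟩ := exists_stopping_scale (k₀ := k₀) (k₁ := J.scale) cond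
    (hk₀ P₀ hP₀).le fun p => Or.inl fun P hP hn => absurd hn.1 (not_le.2 (hk₀ P (hS'S hP)))
  have hparent : ∀ x, κ x < J.scale →
      (∃ P ∈ S, P.Near (κ x + 1) (dy (κ x + 1) x) ∧ |P.I.center - J.center| ≤ J.length) ∧
      volume (Function.support f ∩ dyI (κ x + 1) (dy (κ x + 1) x)) ≤
        ENNReal.ofReal (6 * K * M * 2 ^ (κ x + 1)) := by
    intro x hx
    have h := (hκ1 x).2.2.2 (κ x + 1) (by omega) (by omega)
    simp only [hcond, not_or, not_forall, not_not, not_lt] at h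
    obtain ⟨⟨P, hP, hn⟩, h2⟩ := h
    exact ⟨⟨P, hS'S hP, hn, (hS'J P hP).2⟩, h2⟩
  set G := S'.filter fun P => ∀ x, ¬ P.Near (κ x) (dy (κ x) x) with hG
  have hGS' : G ⊆ S' := Finset.filter_subset _ _
  -- the dense stopping intervals have total length at most a sixth of the length of `J`, so that the
  -- tiles near them are absorbed, by the packing condition with the extremal ratio
  have hbad : ∑ P ∈ S' with ¬ ∀ x, ¬ P.Near (κ x) (dy (κ x) x), v P ≤ B / 2 * 2 ^ J.scale := by
    set bad := S'.filter fun P => ¬ ∀ x, ¬ P.Near (κ x) (dy (κ x) x) with hbad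
    have hex : ∀ P : Tile, ∃ x, P ∈ bad → P.Near (κ x) (dy (κ x) x) := by
      intro P
      by_cases h : P ∈ bad
      · obtain ⟨x, hx⟩ := not_forall.1 (Finset.mem_filter.1 h).2
        exact ⟨x, fun _ => not_not.1 hx⟩
      · exact ⟨0, fun h' => absurd h' h⟩
    choose z hz using hex
    set 𝓑 := bad.image fun P => (κ (z P), dy (κ (z P)) (z P)) with h𝓑
    have h𝓑1 : ∀ b ∈ 𝓑, ENNReal.ofReal (6 * K * M * 2 ^ b.1) ≤
        volume (Function.support f ∩ dyI b.1 b.2) ∧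
        dyI b.1 b.2 ⊆ {x | |x - J.center| ≤ 4 * 2 ^ J.scale} ∧ ∀ x ∈ dyI b.1 b.2, κ x = b.1 := by
      intro b hb
      obtain ⟨P, hP, rfl⟩ := Finset.mem_image.1 hb
      have hPS' := (Finset.mem_filter.1 hP).1
      have hn := hz P hP
      refine ⟨?_, fun x hx => ?_, fun x hx => ?_⟩
      · rcases (hκ1 (z P)).2.2.1 with h | h
        · exact absurd hn (h P hPS')
        · exact h.le
      · have e1 : dy (κ (z P)) x = dy (κ (z P)) (z P) := hx
        rw [← e1] at hn
        have e2 := hn.abs_sub_lt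
        have e3 : (2 : ℝ) ^ (κ (z P)) ≤ 2 ^ J.scale := two_zpow_mono (hκ1 _).2.1
        have e4 := (hS'J P hPS').2
        rw [DyadicInterval.length] at e4
        change |x - J.center| ≤ _
        linarith [abs_sub_le x P.I.center J.center]
      · exact hκ (z P) x (show dy _ x = _ from hx).symm
    have h𝓑2 : (∑ b ∈ 𝓑, (2 : ℝ) ^ b.1) * 6 ≤ 2 ^ J.scale := by
      have e1 : ∑ b ∈ 𝓑, ENNReal.ofReal (6 * K * M * 2 ^ b.1) ≤ ENNReal.ofReal (K * M * 2 ^ J.scale) := by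
        refine (Finset.sum_le_sum fun b hb => (h𝓑1 b hb).1).trans ?_
        rw [← measure_biUnion_finset]
        · refine (measure_mono ?_).trans (H.density P₀ hP₀)
          refine iUnion₂_subset fun b hb => inter_subset_inter_right _ (h𝓑1 b hb).2.1
        · intro b hb b' hb' hne
          refine Set.disjoint_left.2 fun x hx hx' => hne ?_
          have e1 := (h𝓑1 b hb).2.2 x hx.2
          have e2 := (h𝓑1 b' hb').2.2 x hx'.2
          have e3 : dy b.1 x = b.2 := hx.2
          have e4 : dy b'.1 x = b'.2 := hx'.2
          exact Prod.ext (e1.symm.trans e2) (by rw [← e3, ← e4, ← e1, ← e2])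
        · intro b _
          exact (measurableSet_support H.measurable_f).inter (measurableSet_dyI _ _)
      rw [← ENNReal.ofReal_sum_of_nonneg fun b _ => by have := two_zpow_pos b.1; positivity,
        ENNReal.ofReal_le_ofReal_iff (by positivity), ← Finset.mul_sum] at e1
      have hKM : 0 < K * M := by positivity
      have : K * M * ((∑ b ∈ 𝓑, (2 : ℝ) ^ b.1) * 6) ≤ K * M * 2 ^ J.scale := by linarith
      exact le_of_mul_le_mul_left this hKM
    calc ∑ P ∈ bad, v P ≤ ∑ P ∈ bad, ∑ b ∈ 𝓑, if P.Near b.1 b.2 then v P else 0 := by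
          refine Finset.sum_le_sum fun P hP => ?_
          have h1 := Finset.single_le_sum (s := 𝓑) (f := fun b => if P.Near b.1 b.2 then v P else 0)
            (fun b _ => by have := hv0 P; split_ifs <;> simp [this])
            (Finset.mem_image_of_mem (fun P => (κ (z P), dy (κ (z P)) (z P))) hP)
          simp only [if_pos (hz P hP)] at h1
          exact h1
      _ = ∑ b ∈ 𝓑, ∑ P ∈ bad with P.Near b.1 b.2, v P := by
          rw [Finset.sum_comm]
          exact Finset.sum_congr rfl fun b _ => (Finset.sum_filter _ _).symm
      _ ≤ ∑ b ∈ 𝓑, 3 * B * 2 ^ b.1 := by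
          refine Finset.sum_le_sum fun b _ => ?_
          refine (Finset.sum_le_sum_of_subset_of_nonneg ?_ fun P _ _ => hv0 P).trans
            (sum_near_le_of_packing S v hv0 b.1 b.2 fun p => hpack b.1 p)
          exact Finset.filter_subset_filter _ ((Finset.filter_subset _ _).trans hS'S)
      _ = B / 2 * ((∑ b ∈ 𝓑, (2 : ℝ) ^ b.1) * 6) := by rw [← Finset.mul_sum]; ring
      _ ≤ _ := by gcongr
  -- for the other tiles, split the integral where the stopping scale passes the scale of the tile
  have hgoodsum : ∑ P ∈ G, v P ≤ 2 ^ τ * (Cn + Cf) * lam ^ τ * 2 ^ J.scale := by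
    have hnear := sum_near_le H hκ hκm (A := 6 * K) hparent hK hlam hθ (by positivity) hθM hτ G
      (hGS'.trans hS'S) fun P hP => (hS'J P (hGS' hP)).1
    have hfarm : ∀ P : Tile, MeasurableSet {x | P.I.scale ≤ κ x} := fun P =>
      hκm (MeasurableSet.of_discrete (s := Ici P.I.scale))
    have hfar := sum_far_le hκ J G (H.injOn.mono fun P hP => hS'S (hGS' hP))
      (fun P hP => hS'J P (hGS' hP)) (fun P hP => (Finset.mem_filter.1 hP).2) hκm
      (Kl := K * lam) (by positivity) hτ
      (fun P => ‖∫ x in {x | P.I.scale ≤ κ x}, f x * (starRingEnd ℂ) (ψ P x)‖)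
      (fun P _ => norm_nonneg _) (by
        intro P hP ε hε h
        have h1 := H.tail P (hS'S (hGS' hP)) {x | P.I.scale ≤ κ x} ε (hfarm P) hε h
        have h2 : ‖∫ x in {x | P.I.scale ≤ κ x}, f x * (starRingEnd ℂ) (ψ P x)‖ₑ ≤
            ENNReal.ofReal (K * lam * ε) := by
          refine (enorm_integral_le_lintegral_enorm _).trans (le_trans (le_of_eq ?_) h1)
          refine lintegral_congr fun x => ?_
          rw [enorm_mul]
          congr 1
          rw [← ofReal_norm, ← ofReal_norm, RCLike.norm_conj]
        rw [← ofReal_norm, ENNReal.ofReal_le_ofReal_iff (by positivity)] at h2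
        exact h2)
    calc ∑ P ∈ G, v P ≤ ∑ P ∈ G, 2 ^ τ * (2 ^ P.I.scale *
          ‖∫ x in {x | κ x < P.I.scale}, f x * (starRingEnd ℂ) (ψ P x)‖ ^ τ +
          2 ^ P.I.scale * ‖∫ x in {x | P.I.scale ≤ κ x}, f x * (starRingEnd ℂ) (ψ P x)‖ ^ τ) := by
          refine Finset.sum_le_sum fun P hP => ?_
          have hcompl : {x | κ x < P.I.scale}ᶜ = {x | P.I.scale ≤ κ x} := by
            ext x; simp
          have h1 := integral_add_compl (μ := volume) (s := {x | κ x < P.I.scale})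
            (hκm (MeasurableSet.of_discrete (s := Iio P.I.scale)))
            (H.integrable P (hS'S (hGS' hP)))
          rw [hcompl] at h1
          have h2 : ‖T P‖ ≤ ‖∫ x in {x | κ x < P.I.scale}, f x * (starRingEnd ℂ) (ψ P x)‖ +
              ‖∫ x in {x | P.I.scale ≤ κ x}, f x * (starRingEnd ℂ) (ψ P x)‖ := by
            simp only [hT]
            rw [← h1]; exact norm_add_le _ _
          have hp := two_zpow_pos P.I.scale
          calc v P ≤ 2 ^ P.I.scale * (‖∫ x in {x | κ x < P.I.scale}, f x * (starRingEnd ℂ) (ψ P x)‖ +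
              ‖∫ x in {x | P.I.scale ≤ κ x}, f x * (starRingEnd ℂ) (ψ P x)‖) ^ τ := by
                simp only [hv]; gcongr
            _ ≤ 2 ^ P.I.scale * (2 ^ τ * (‖∫ x in {x | κ x < P.I.scale}, f x * (starRingEnd ℂ) (ψ P x)‖ ^ τ +
              ‖∫ x in {x | P.I.scale ≤ κ x}, f x * (starRingEnd ℂ) (ψ P x)‖ ^ τ)) := by
                gcongr
                exact add_rpow_le_two_rpow_mul (norm_nonneg _) (norm_nonneg _) (by linarith)
            _ = _ := by ring
      _ ≤ 2 ^ τ * (Cn * lam ^ τ * 2 ^ J.scale + (K * lam) ^ τ *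
            (256 * chiSum * geomInt (1 / 2) * chiMass) * 2 ^ J.scale) := by
          rw [← Finset.mul_sum, Finset.sum_add_distrib]
          gcongr
      _ = _ := by rw [Real.mul_rpow hK.le hlam.le, hCf]; ring
  have hsum : B * 2 ^ J.scale ≤ B / 2 * 2 ^ J.scale + 2 ^ τ * (Cn + Cf) * lam ^ τ * 2 ^ J.scale := by
    have h1 : B * 2 ^ J.scale = ∑ P ∈ S', v P := by rw [hB]; field_simp
    rw [h1, ← Finset.sum_filter_add_sum_filter_not S' fun P => ∀ x, ¬ P.Near (κ x) (dy (κ x) x)]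
    linarith
  rw [hC]
  have : B ≤ B / 2 + 2 ^ τ * (Cn + Cf) * lam ^ τ := by
    rw [← add_mul] at hsum
    exact le_of_mul_le_mul_right hsum hJpos
  linarith

end TreeEstimate

/-! ### The linearizing functions and their local masses -/

/-- The data that define the embedding map: the linearizing functions `K`, `N_j`, `d_j`, `α_j` and
the function `f`. -/
structure Linearization where
  K : ℝ → ℕ
  Nf : ℕ → ℝ → ℝ
  d : ℕ → ℝ → ℂ
  α : ℕ → ℝ → ℝ≥0∞
  f : ℝ → ℂ
  measurable_K : Measurable K
  measurable_Nf : ∀ j, Measurable (Nf j)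
  monotone_Nf : ∀ x, Monotone fun j => Nf j x
  measurable_d : ∀ j, Measurable (d j)
  measurable_α : ∀ j, Measurable (α j)
  measurable_f : Measurable f

namespace Linearization

variable (L : Linearization) (s : ℝ)

/-- Sums over the index range `1 ≤ j ≤ K(x)` are measurable. -/
lemma measurable_sum {E : Type*} [AddCommMonoid E] [MeasurableSpace E] [MeasurableAdd₂ E]
    {g : ℕ → ℝ → E} (hg : ∀ j, Measurable (g j)) :
    Measurable fun x => ∑ j ∈ Finset.Icc 1 (L.K x), g j x := by
  have h : Measurable fun z : ℕ × ℝ => ∑ j ∈ Finset.Icc 1 z.1, g j z.2 :=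
    measurable_from_prod_countable_right fun k =>
      Finset.measurable_fun_sum (Finset.Icc 1 k) fun j _ => hg j
  exact h.comp (L.measurable_K.prodMk measurable_id)

/-- The sum of `|d_j| ^ s` over the indices `j` with `N_j ∈ Ω`. -/
noncomputable def freqSum (Ω : Set ℝ) (x : ℝ) : ℝ≥0∞ :=
  ∑ j ∈ Finset.Icc 1 (L.K x), Ω.indicator (fun _ => ‖L.d j x‖ₑ ^ s) (L.Nf j x)

/-- The part of `|f| (∑ |d_j| ^ s) ^ (1 / s)` that is seen through the frequency window `Ω`. -/
noncomputable def visible (Ω : Set ℝ) (x : ℝ) : ℝ≥0∞ :=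
  ‖L.f x‖ₑ * L.freqSum s Ω x ^ (1 / s)

/-- The normalized `s`-th power of the visible part, restricted to the set where the weighted function
exceeds `θ`. -/
noncomputable def mass (θ : ℝ) (Ω : Set ℝ) (x : ℝ) : ℝ≥0∞ :=
  {x | ENNReal.ofReal θ < L.visible s univ x}.indicator
    (fun x => ENNReal.ofReal (θ ^ (1 - s)) * (‖L.f x‖ₑ ^ s * L.freqSum s Ω x)) x

variable {s}

lemma measurable_freqSum {Ω : Set ℝ} (hΩ : MeasurableSet Ω) : Measurable (L.freqSum s Ω) := by
  refine L.measurable_sum (g := fun j x => Ω.indicator (fun _ => ‖L.d j x‖ₑ ^ s) (L.Nf j x)) fun j => ?_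
  have : (fun x => Ω.indicator (fun _ => ‖L.d j x‖ₑ ^ s) (L.Nf j x)) =
      (L.Nf j ⁻¹' Ω).indicator fun x => ‖L.d j x‖ₑ ^ s := by
    ext x; by_cases hx : L.Nf j x ∈ Ω <;> simp [indicator, hx]
  rw [this]
  exact ((L.measurable_d j).enorm.pow_const s).indicator (L.measurable_Nf j hΩ)

lemma measurable_visible {Ω : Set ℝ} (hΩ : MeasurableSet Ω) : Measurable (L.visible s Ω) :=
  L.measurable_f.enorm.mul ((L.measurable_freqSum hΩ).pow_const _)

lemma measurable_mass (θ : ℝ) {Ω : Set ℝ} (hΩ : MeasurableSet Ω) : Measurable (L.mass s θ Ω) :=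
  (((L.measurable_f.enorm.pow_const s).mul (L.measurable_freqSum hΩ)).const_mul _).indicator
    (measurableSet_lt measurable_const (L.measurable_visible MeasurableSet.univ))

lemma freqSum_mono {Ω Ω' : Set ℝ} (h : Ω ⊆ Ω') (x : ℝ) : L.freqSum s Ω x ≤ L.freqSum s Ω' x :=
  Finset.sum_le_sum fun _ _ => indicator_le_indicator_of_subset h (fun _ => zero_le) _

lemma visible_mono (hs : 1 ≤ s) {Ω Ω' : Set ℝ} (h : Ω ⊆ Ω') (x : ℝ) :
    L.visible s Ω x ≤ L.visible s Ω' x := by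
  have := L.freqSum_mono (s := s) h x
  unfold visible
  gcongr

lemma mass_mono (θ : ℝ) {Ω Ω' : Set ℝ} (h : Ω ⊆ Ω') (x : ℝ) : L.mass s θ Ω x ≤ L.mass s θ Ω' x := by
  refine indicator_le_indicator ?_
  have := L.freqSum_mono (s := s) h x
  gcongr

lemma freqSum_biUnion_le {ι : Type*} (R : Finset ι) (Ω : ι → Set ℝ) (x : ℝ) :
    L.freqSum s (⋃ r ∈ R, Ω r) x ≤ ∑ r ∈ R, L.freqSum s (Ω r) x := by
  classical
  unfold freqSum
  rw [Finset.sum_comm]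
  refine Finset.sum_le_sum fun j _ => ?_
  by_cases h : L.Nf j x ∈ ⋃ r ∈ R, Ω r
  · obtain ⟨r, hr, hx⟩ := mem_iUnion₂.1 h
    rw [indicator_of_mem h]
    refine le_trans (le_of_eq ?_) (Finset.single_le_sum (f := fun r => (Ω r).indicator
      (fun _ => ‖L.d j x‖ₑ ^ s) (L.Nf j x)) (fun _ _ => zero_le) hr)
    exact (indicator_of_mem hx fun _ => ‖L.d j x‖ₑ ^ s).symm
  · rw [indicator_of_notMem h]; exact zero_le

lemma mass_biUnion_le {ι : Type*} (θ : ℝ) (R : Finset ι) (Ω : ι → Set ℝ) (x : ℝ) :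
    L.mass s θ (⋃ r ∈ R, Ω r) x ≤ ∑ r ∈ R, L.mass s θ (Ω r) x := by
  unfold mass
  by_cases h : ENNReal.ofReal θ < L.visible s univ x
  · have h' : x ∈ {x | ENNReal.ofReal θ < L.visible s univ x} := h
    simp only [indicator_of_mem h']
    rw [← Finset.mul_sum, ← Finset.mul_sum]
    have := L.freqSum_biUnion_le (s := s) R Ω x
    gcongr
  · have h' : x ∉ {x | ENNReal.ofReal θ < L.visible s univ x} := h
    simp only [indicator_of_notMem h']
    exact zero_le

lemma visible_rpow (hs : 1 ≤ s) (Ω : Set ℝ) (x : ℝ) :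
    L.visible s Ω x ^ s = ‖L.f x‖ₑ ^ s * L.freqSum s Ω x := by
  rw [visible, ENNReal.mul_rpow_of_nonneg _ _ (by linarith), ← ENNReal.rpow_mul,
    one_div_mul_cancel (by linarith), ENNReal.rpow_one]

lemma mass_univ (hs : 1 ≤ s) (θ : ℝ) (x : ℝ) : L.mass s θ univ x = ENNReal.ofReal (θ ^ (1 - s)) *
    {x | ENNReal.ofReal θ < L.visible s univ x}.indicator (fun x => L.visible s univ x ^ s) x := by
  unfold mass
  by_cases h : x ∈ {x | ENNReal.ofReal θ < L.visible s univ x}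
  · rw [indicator_of_mem h, indicator_of_mem h, L.visible_rpow hs]
  · rw [indicator_of_notMem h, indicator_of_notMem h, mul_zero]

/-- The visible part is either at most `θ` or controlled by the mass. -/
lemma visible_le (hs : 1 ≤ s) {θ : ℝ} (hθ : 0 < θ) (Ω : Set ℝ) (x : ℝ) : L.visible s Ω x ≤
    ENNReal.ofReal θ * (Function.support L.f).indicator 1 x + L.mass s θ Ω x := by
  rcases eq_or_ne (L.f x) 0 with hf | hf
  · simp [visible, hf]
  rw [indicator_of_mem (show x ∈ Function.support L.f from hf), Pi.one_apply, mul_one]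
  rcases le_or_gt (L.visible s Ω x) (ENNReal.ofReal θ) with h | h
  · exact h.trans (self_le_add_right _ _)
  · have h1 : x ∈ {x | ENNReal.ofReal θ < L.visible s univ x} :=
      h.trans_le (L.visible_mono hs (subset_univ Ω) x)
    refine le_trans ?_ (self_le_add_left _ _)
    rw [mass, indicator_of_mem h1, ← L.visible_rpow hs]
    set v := L.visible s Ω x
    have hθ' : ENNReal.ofReal θ ≠ 0 := by simpa using hθ
    rw [← ENNReal.ofReal_rpow_of_pos hθ]
    calc v = ENNReal.ofReal θ ^ (1 - s) * (ENNReal.ofReal θ ^ (s - 1) * v) := by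
          rw [← mul_assoc, ← ENNReal.rpow_add _ _ hθ' ENNReal.ofReal_ne_top]; simp
      _ ≤ ENNReal.ofReal θ ^ (1 - s) * (v ^ (s - 1) * v) := by
          have : 0 ≤ s - 1 := by linarith
          gcongr
      _ = ENNReal.ofReal θ ^ (1 - s) * v ^ s := by
          have hv : v ≠ 0 := (lt_of_le_of_lt zero_le h).ne'
          congr 1
          calc v ^ (s - 1) * v = v ^ (s - 1) * v ^ (1 : ℝ) := by rw [ENNReal.rpow_one]
            _ = v ^ (s - 1 + 1) := (ENNReal.rpow_add_of_nonneg _ _ (by linarith) zero_le_one).symm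
            _ = v ^ s := by ring_nf

lemma enorm_mul_le_visible (hs : 1 ≤ s) {Ω : Set ℝ} {x : ℝ} {j : ℕ} (hj : j ∈ Finset.Icc 1 (L.K x))
    (hΩ : L.Nf j x ∈ Ω) : ‖L.f x‖ₑ * ‖L.d j x‖ₑ ≤ L.visible s Ω x := by
  unfold visible
  gcongr
  have h := Finset.single_le_sum (f := fun j => Ω.indicator (fun _ => ‖L.d j x‖ₑ ^ s) (L.Nf j x))
    (fun _ _ => zero_le) hj
  simp only [indicator_of_mem hΩ] at h
  calc ‖L.d j x‖ₑ = (‖L.d j x‖ₑ ^ s) ^ (1 / s) := by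
        rw [← ENNReal.rpow_mul, mul_one_div_cancel (by linarith), ENNReal.rpow_one]
    _ ≤ _ := by
        have : 0 ≤ 1 / s := by positivity
        gcongr
        exact h

/-- A space-frequency rectangle of area one half is selected if its mass is large. -/
def Selected (s θ lam : ℝ) (k p r : ℤ) : Prop :=
  ENNReal.ofReal (lam * 2 ^ k) < ∫⁻ x in dyI k p, L.mass s θ (dyI (-k - 1) r) x

end Linearization

/-! ### The frequency intervals of a tile -/

lemma mem_Ico_iff_dy (k a b : ℤ) (x : ℝ) :
    x ∈ Ico ((a : ℝ) * 2 ^ k) (b * 2 ^ k) ↔ a ≤ dy k x ∧ dy k x < b := by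
  have hk := two_zpow_pos k
  rw [dy, Int.le_floor, Int.floor_lt, le_div_iff₀ hk, div_lt_iff₀ hk, mem_Ico]

lemma dy_sub_one_eq (k : ℤ) (x : ℝ) : dy (k - 1) x / 2 = dy k x := by
  have := dy_succ (k - 1) x
  rw [sub_add_cancel] at this
  exact this.symm

lemma convexHull_Ico_union_Ico {a b c d : ℝ} (hab : a < b) (hcd : c < d) (hac : a ≤ c) (hbd : b ≤ d) :
    convexHull ℝ (Ico a b ∪ Ico c d) = Ico a d := by
  refine Subset.antisymm (convexHull_min ?_ (convex_Ico a d)) fun y hy => ?_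
  · rintro y (hy | hy)
    · exact ⟨hy.1, hy.2.trans_le hbd⟩
    · exact ⟨hac.trans hy.1, hy.2⟩
  · rcases lt_or_ge y b with h1 | h1
    · exact subset_convexHull ℝ _ (Or.inl ⟨hy.1, h1⟩)
    rcases le_or_gt c y with h2 | h2
    · exact subset_convexHull ℝ _ (Or.inr ⟨h2, hy.2⟩)
    · have h3 : segment ℝ a c ⊆ convexHull ℝ (Ico a b ∪ Ico c d) :=
        segment_subset_convexHull (Or.inl ⟨le_rfl, hab⟩) (Or.inr ⟨le_rfl, hcd⟩)
      refine h3 ?_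
      rw [segment_eq_Icc hac]
      exact ⟨hy.1, h2.le⟩

namespace Tile

variable (P : Tile) (m n : ℤ)

lemma ω_scale : P.ω.scale = -P.I.scale := by
  have h := P.area
  rw [DyadicInterval.length, DyadicInterval.length, ← zpow_add₀ two_ne_zero,
    zpow_eq_one_iff_right₀ zero_le_two (by norm_num)] at h
  omega

lemma ω_length : P.ω.length = 2 ^ (-P.I.scale) := by rw [DyadicInterval.length, ω_scale]

lemma ω_length_eq : P.ω.length = 2 * 2 ^ (-P.I.scale - 1) := by
  rw [ω_length, ← two_zpow_succ, sub_add_cancel]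

lemma upper_toSet : (P.upper n).toSet = dyI (-P.I.scale) (P.ω.pos + n) := by
  rw [DyadicInterval.toSet_eq, upper, DyadicInterval.shift, ω_scale]

lemma mem_upper {y : ℝ} : y ∈ (P.upper n).toSet ↔ dy (-P.I.scale) y = P.ω.pos + n := by
  rw [upper_toSet]; rfl

lemma mem_lower {y : ℝ} : y ∈ P.lower m ↔ y < (P.ω.pos + 1 - m) * 2 ^ (-P.I.scale) := by
  rw [lower, mem_Iio, DyadicInterval.center, ω_length]
  ring_nf

lemma dilate_eq : P.ω.dilate 50 = Ico (((2 * P.ω.pos - 49 : ℤ) : ℝ) * 2 ^ (-P.I.scale - 1))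
    (((2 * P.ω.pos + 51 : ℤ) : ℝ) * 2 ^ (-P.I.scale - 1)) := by
  rw [DyadicInterval.dilate, DyadicInterval.center, ω_length_eq]
  push_cast
  ring_nf

lemma dilate_upper_eq : (P.upper n).dilate 50 =
    Ico (((2 * (P.ω.pos + n) - 49 : ℤ) : ℝ) * 2 ^ (-P.I.scale - 1))
      (((2 * (P.ω.pos + n) + 51 : ℤ) : ℝ) * 2 ^ (-P.I.scale - 1)) := by
  have h : (P.upper n).length = 2 * 2 ^ (-P.I.scale - 1) := P.ω_length_eq
  have h' : (P.upper n).pos = P.ω.pos + n := rfl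
  rw [DyadicInterval.dilate, DyadicInterval.center, h, h']
  push_cast
  ring_nf

lemma mem_dilate_upper {y : ℝ} : y ∈ (P.upper n).dilate 50 ↔
    2 * (P.ω.pos + n) - 49 ≤ dy (-P.I.scale - 1) y ∧
      dy (-P.I.scale - 1) y < 2 * (P.ω.pos + n) + 51 := by
  rw [dilate_upper_eq, mem_Ico_iff_dy]

variable {m n}

lemma mem_omegaTilde (hn : 0 ≤ n) {y : ℝ} : y ∈ P.omegaTilde n ↔
    2 * P.ω.pos - 49 ≤ dy (-P.I.scale - 1) y ∧
      dy (-P.I.scale - 1) y < 2 * (P.ω.pos + n) + 51 := by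
  have hu := two_zpow_pos (-P.I.scale - 1)
  have hn' : (0 : ℝ) ≤ n := by exact_mod_cast hn
  rw [omegaTilde, dilate_eq, dilate_upper_eq, convexHull_Ico_union_Ico, mem_Ico_iff_dy]
  all_goals
    push_cast
    first
      | apply mul_lt_mul_of_pos_right _ hu
      | apply mul_le_mul_of_nonneg_right _ hu.le
    linarith

/-- The convex hull of the two enlarged frequency intervals is a union of dyadic intervals of half
the length. -/
lemma dyI_subset_omegaTilde (hn : 0 ≤ n) {l r : ℤ} (hl : l ≤ -P.I.scale - 1) {z : ℝ} (hz : dy l z = r)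
    (hz' : z ∈ P.omegaTilde n) : dyI l r ⊆ P.omegaTilde n := by
  intro y hy
  rw [mem_omegaTilde P hn] at hz' ⊢
  rwa [dy_congr_of_le hl ((show dy l y = r from hy).trans hz.symm)]

lemma Separated.bounds {P : Tile} (h : P.Separated m n) : 501 ≤ m ∧ 501 ≤ n := by
  have hu := two_zpow_pos (-P.I.scale)
  have hξ : P.ω.center - 500 * P.ω.length ∈ P.ω.dilate 1000 := by
    rw [DyadicInterval.dilate, ω_length]
    constructor <;> linarith
  constructor
  · have h1 := (h _ hξ).1
    rw [DyadicInterval.center, ω_length] at h1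
    have h2 : ((P.ω.pos : ℝ) + 1 - m) * 2 ^ (-P.I.scale) ≤
        (P.ω.pos + 1 / 2) * 2 ^ (-P.I.scale) - 500 * 2 ^ (-P.I.scale) :=
      le_of_forall_lt fun a ha => h1 a ((P.mem_lower m).2 ha)
    have h3 : ((P.ω.pos : ℝ) + 1 - m) * 2 ^ (-P.I.scale) ≤
        (P.ω.pos + 1 / 2 - 500) * 2 ^ (-P.I.scale) := by linarith
    have h4 := le_of_mul_le_mul_right h3 hu
    have h5 : (500 : ℝ) < m := by linarith
    have : (500 : ℤ) < m := by exact_mod_cast h5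
    omega
  · by_contra hcon
    have h1 : ((n : ℤ) : ℝ) ≤ 500 := by exact_mod_cast (show n ≤ 500 by omega)
    set ξ := (P.ω.center + 500 * P.ω.length) - P.ω.length / 4
    have hξ' : ξ ∈ P.ω.dilate 1000 := by
      rw [DyadicInterval.dilate]
      have := P.ω.length_pos
      constructor <;> simp only [ξ] <;> linarith
    have h2 := (h ξ hξ').2 ((P.ω.pos + n : ℤ) * 2 ^ (-P.I.scale)) (by
      rw [mem_upper, dy_eq_iff]
      constructor
      · exact le_rfl
      · push_cast; nlinarith)
    simp only [ξ] at h2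
    rw [DyadicInterval.center, ω_length] at h2
    push_cast at h2
    nlinarith

lemma ext_of_I_of_ω {P Q : Tile} (hI : P.I = Q.I) (hω : P.ω = Q.ω) : P = Q := by
  cases P; cases Q; simp only at hI hω; subst hI; subst hω; rfl

end Tile

/-- In a sparse collection, tiles with intervals of different lengths have very different lengths. -/
lemma Sparse.lt_of_scale_lt {C₀ : ℝ} (hC₀ : 1 ≤ C₀) {𝔓 : Set Tile} (h : Sparse C₀ 𝔓) {P Q : Tile}
    (hP : P ∈ 𝔓) (hQ : Q ∈ 𝔓) (hPQ : P.I.scale < Q.I.scale) :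
    C₀ * 2 ^ (-Q.I.scale) < 2 ^ (-P.I.scale) := by
  by_contra hcon
  have h1 := two_zpow_pos P.I.scale
  have h2 := two_zpow_pos Q.I.scale
  have h3 : (2 : ℝ) ^ P.I.scale < 2 ^ Q.I.scale := zpow_lt_zpow_right₀ one_lt_two hPQ
  have h4 : Q.I.length / C₀ ≤ P.I.length := by
    rw [DyadicInterval.length, DyadicInterval.length, div_le_iff₀ (by linarith)]
    rw [zpow_neg, zpow_neg, not_lt, inv_eq_one_div, ← div_eq_mul_inv,
      div_le_div_iff₀ h1 h2] at hcon
    linarith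
  have h5 := (h P hP Q hQ h4 h3.le).1
  exact h3.ne h5

/-- In a sparse collection, frequency intervals of equal length that are close coincide. -/
lemma Sparse.eq_of_scale_eq {C₀ : ℝ} (hC₀ : 1 ≤ C₀) {𝔓 : Set Tile} (h : Sparse C₀ 𝔓) {P Q : Tile}
    (hP : P ∈ 𝔓) (hQ : Q ∈ 𝔓) (hPQ : P.I.scale = Q.I.scale)
    (hpos : (|((P.ω.pos - Q.ω.pos : ℤ) : ℝ)|) < C₀) : P.ω = Q.ω := by
  have hlen : P.I.length = Q.I.length := by rw [DyadicInterval.length, DyadicInterval.length, hPQ]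
  have h1 := (h P hP Q hQ (by rw [hlen]; exact div_le_self Q.I.length_pos.le hC₀) hlen.le).2
  refine h1.resolve_right fun hdis => ?_
  have hu := two_zpow_pos (-Q.I.scale)
  push_cast at hpos
  rw [abs_lt] at hpos
  refine hdis.notMem_of_mem_left (a := (P.ω.center + Q.ω.center) / 2) ?_ ?_ <;>
  · rw [DyadicInterval.dilate, DyadicInterval.center, DyadicInterval.center, Tile.ω_length,
      Tile.ω_length, hPQ]
    constructor <;> nlinarith

/-! ### Local masses near unselected tiles -/

lemma abs_dy_sub_le_of_le {k l : ℤ} (h : k ≤ l) (x y : ℝ) : |dy l x - dy l y| ≤ |dy k x - dy k y| := by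
  induction l, h using Int.leInduction with
  | base => exact le_rfl
  | succ l _ ih =>
    refine le_trans ?_ ih
    rw [dy_succ, dy_succ, abs_le]
    rcases abs_cases (dy l x - dy l y) with ⟨h, _⟩ | ⟨h, _⟩ <;> rw [h] <;> omega

/-- A dyadic interval is the union of its dyadic subintervals of a given generation. -/
lemma dyI_eq_biUnion (k a : ℤ) (i : ℕ) :
    dyI k a = ⋃ r ∈ Finset.Ico (a * 2 ^ i) ((a + 1) * 2 ^ i), dyI (k - i) r := by
  have h : (2 : ℝ) ^ k = 2 ^ i * 2 ^ (k - i) := by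
    rw [← zpow_natCast, ← zpow_add₀ two_ne_zero]; congr 1; omega
  ext x
  simp only [mem_iUnion, Finset.mem_Ico, exists_prop]
  rw [dyI_eq_Ico, h, ← mul_assoc, ← mul_assoc]
  have h2 := mem_Ico_iff_dy (k - i) (a * 2 ^ i) ((a + 1) * 2 ^ i) x
  push_cast at h2
  rw [h2]
  constructor
  · exact fun hx => ⟨dy (k - i) x, hx, rfl⟩
  · rintro ⟨r, hr, hx⟩
    rwa [show dy (k - i) x = r from hx]

/-- The squared weight of a dyadic interval is controlled by the indicators of its dyadic
neighbourhoods. -/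
lemma chi_sq_le_tsum (J : DyadicInterval) (x : ℝ) : ENNReal.ofReal (J.chi x ^ 2) ≤
    ∑' i : ℕ, ENNReal.ofReal (16 * (1 / 16) ^ i) *
      {x | |dy (J.scale + i) J.center - dy (J.scale + i) x| ≤ 1}.indicator 1 x := by
  classical
  have hex : ∃ i : ℕ, |dy (J.scale + i) J.center - dy (J.scale + i) x| ≤ 1 := by
    obtain ⟨i, hi⟩ := pow_unbounded_of_one_lt (|J.center - x| / J.length) one_lt_two
    refine ⟨i, ?_⟩
    by_contra hcon
    have h1 := le_abs_sub_of_not_near hcon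
    rw [div_lt_iff₀ J.length_pos, DyadicInterval.length] at hi
    rw [zpow_add₀ two_ne_zero, zpow_natCast] at h1
    linarith
  have hi := Nat.find_spec hex
  have hmin := fun j => Nat.find_min (m := j) hex
  set i := Nat.find hex
  refine le_trans ?_ (ENNReal.le_tsum i)
  rw [indicator_of_mem (show x ∈ {x | |dy (J.scale + i) J.center - dy (J.scale + i) x| ≤ 1} from hi),
    Pi.one_apply, mul_one]
  refine ENNReal.ofReal_le_ofReal ?_
  have hpos := J.chi_pos x
  rcases Nat.eq_zero_or_pos i with h0 | h0
  · rw [h0, pow_zero, mul_one]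
    have := pow_le_one₀ (n := 2) hpos.le (J.chi_le_one x)
    linarith
  · obtain ⟨j, hj⟩ : ∃ j, i = j + 1 := ⟨i - 1, by omega⟩
    have h1 := le_abs_sub_of_not_near (hmin j (by omega))
    rw [abs_sub_comm, zpow_add₀ two_ne_zero, zpow_natCast] at h1
    have h2 : J.chi x ≤ ((1 + 2 ^ j) ^ 2)⁻¹ :=
      J.chi_le_of_le (by positivity) (by rw [DyadicInterval.length]; linarith)
    have h3 : ((1 + (2 : ℝ) ^ j) ^ 2)⁻¹ ≤ ((2 ^ j) ^ 2)⁻¹ := by gcongr; linarith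
    calc J.chi x ^ 2 ≤ (((2 ^ j) ^ 2)⁻¹) ^ 2 := by gcongr; exact h2.trans h3
      _ = (1 / 16) ^ j := by
          rw [← pow_mul, inv_pow, ← pow_mul, one_div, inv_pow, show (16 : ℝ) = 2 ^ 4 by norm_num,
            ← pow_mul]
          congr 2; ring
      _ = 16 * (1 / 16) ^ i := by rw [hj, pow_succ]; ring

/-- No selected rectangle is near the tile with its frequency interval inside the convex hull of the
enlarged frequency intervals of the tile. -/
def Linearization.Unselected (L : Linearization) (n : ℤ) (s θ lam : ℝ) (P : Tile) : Prop :=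
  ∀ k p r, P.Near k p → dyI (-k - 1) r ⊆ P.omegaTilde n → ¬ L.Selected s θ lam k p r

namespace Linearization

variable {L : Linearization} {n : ℤ} {s θ lam : ℝ}

lemma Unselected.lintegral_mass_le {P : Tile} (h : L.Unselected n s θ lam P) {k p r : ℤ}
    (hn : P.Near k p) (hr : dyI (-k - 1) r ⊆ P.omegaTilde n) :
    ∫⁻ x in dyI k p, L.mass s θ (dyI (-k - 1) r) x ≤ ENNReal.ofReal (lam * 2 ^ k) :=
  not_lt.1 (h k p r hn hr)

/-- The weighted mass of an unselected tile. -/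
lemma Unselected.lintegral_chi_mass_le {P : Tile} (hn : 0 ≤ n) (hlam : 0 ≤ lam)
    (h : L.Unselected n s θ lam P) :
    ∫⁻ x, ENNReal.ofReal (P.I.chi x ^ 2) * L.mass s θ (P.upper n).toSet x ≤
      ENNReal.ofReal (128 * lam * 2 ^ P.I.scale) := by
  set σ := P.I.scale
  have hσ := two_zpow_pos σ
  set c := P.I.center
  have hup : (P.upper n).toSet ⊆ P.omegaTilde n := by
    intro y hy
    rw [P.mem_upper] at hy
    rw [P.mem_omegaTilde hn]
    have := dy_sub_one_eq (-P.I.scale) y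
    omega
  set near : ℕ → Set ℝ := fun i => {x | |dy (σ + i) c - dy (σ + i) x| ≤ 1} with hnear
  have hnearm : ∀ i, MeasurableSet (near i) := fun i =>
    (measurable_dy (σ + i)) (MeasurableSet.of_discrete (s := {z | |dy (σ + i) c - z| ≤ 1}))
  have hMm := L.measurable_mass (s := s) θ (Ω := (P.upper n).toSet)
    (by rw [P.upper_toSet]; exact measurableSet_dyI _ _)
  have hlocal : ∀ i : ℕ, ∫⁻ x in near i, L.mass s θ (P.upper n).toSet x ≤
      ENNReal.ofReal (6 * lam * 2 ^ σ * 4 ^ i) := by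
    intro i
    have hsub : near i ⊆ ⋃ p ∈ Finset.Icc (dy (σ + i) c - 1) (dy (σ + i) c + 1), dyI (σ + i) p := by
      intro x hx
      have hx' : |dy (σ + i) c - dy (σ + i) x| ≤ 1 := hx
      rw [abs_le] at hx'
      exact mem_biUnion (x := dy (σ + i) x) (by simp; omega) (mem_dyI_dy _ _)
    have hdec := dyI_eq_biUnion (-σ) (P.ω.pos + n) (i + 1)
    rw [← P.upper_toSet] at hdec
    have hl : -σ - ((i + 1 : ℕ) : ℤ) = -(σ + i) - 1 := by push_cast; ring
    rw [hl] at hdec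
    set R := Finset.Ico ((P.ω.pos + n) * 2 ^ (i + 1)) ((P.ω.pos + n + 1) * 2 ^ (i + 1))
    have hR : R.card = 2 ^ (i + 1) := by
      simp only [R, Int.card_Ico]
      have : (P.ω.pos + n + 1) * 2 ^ (i + 1) - (P.ω.pos + n) * 2 ^ (i + 1) = ((2 ^ (i + 1) : ℕ) : ℤ) := by
        push_cast; ring
      rw [this, Int.toNat_natCast]
    have hone : ∀ p ∈ Finset.Icc (dy (σ + i) c - 1) (dy (σ + i) c + 1),
        ∫⁻ x in dyI (σ + i) p, L.mass s θ (P.upper n).toSet x ≤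
          ENNReal.ofReal (2 ^ (i + 1) * (lam * 2 ^ (σ + i))) := by
      intro p hp
      have hPn : P.Near (σ + i) p := by
        rw [Finset.mem_Icc] at hp
        exact ⟨by omega, show |dy (σ + i) c - p| ≤ 1 by rw [abs_le]; omega⟩
      calc ∫⁻ x in dyI (σ + i) p, L.mass s θ (P.upper n).toSet x
          ≤ ∫⁻ x in dyI (σ + i) p, ∑ r ∈ R, L.mass s θ (dyI (-(σ + i) - 1) r) x := by
            refine lintegral_mono fun x => ?_
            rw [hdec]
            exact L.mass_biUnion_le θ R _ x
        _ = ∑ r ∈ R, ∫⁻ x in dyI (σ + i) p, L.mass s θ (dyI (-(σ + i) - 1) r) x :=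
            lintegral_finsetSum _ fun r _ => L.measurable_mass θ (measurableSet_dyI _ _)
        _ ≤ ∑ r ∈ R, ENNReal.ofReal (lam * 2 ^ (σ + i)) := by
            refine Finset.sum_le_sum fun r hr => h.lintegral_mass_le hPn (subset_trans ?_ hup)
            rw [hdec]
            exact subset_biUnion_of_mem (u := fun r => dyI (-(σ + i) - 1) r) hr
        _ = _ := by
            rw [Finset.sum_const, hR, nsmul_eq_mul,
              ENNReal.ofReal_mul (p := 2 ^ (i + 1)) (by positivity), ENNReal.ofReal_pow zero_le_two]
            simp
    calc ∫⁻ x in near i, L.mass s θ (P.upper n).toSet x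
        ≤ ∫⁻ x in ⋃ p ∈ Finset.Icc (dy (σ + i) c - 1) (dy (σ + i) c + 1), dyI (σ + i) p,
            L.mass s θ (P.upper n).toSet x := lintegral_mono_set hsub
      _ ≤ ∑ p ∈ Finset.Icc (dy (σ + i) c - 1) (dy (σ + i) c + 1), ∫⁻ x in dyI (σ + i) p,
            L.mass s θ (P.upper n).toSet x := by
          rw [lintegral_biUnion_finset (fun p _ q _ hpq => pairwise_disjoint_dyI _ hpq)
            fun p _ => measurableSet_dyI _ _]
      _ ≤ ∑ p ∈ Finset.Icc (dy (σ + i) c - 1) (dy (σ + i) c + 1),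
            ENNReal.ofReal (2 ^ (i + 1) * (lam * 2 ^ (σ + i))) := Finset.sum_le_sum hone
      _ = _ := by
          rw [Finset.sum_const, Int.card_Icc,
            show (dy (σ + i) c + 1 + 1 - (dy (σ + i) c - 1)).toNat = 3 by omega, nsmul_eq_mul,
            show ((3 : ℕ) : ℝ≥0∞) = ENNReal.ofReal 3 by simp, ← ENNReal.ofReal_mul (by norm_num)]
          congr 1
          rw [zpow_add₀ two_ne_zero, zpow_natCast, pow_succ, show (4 : ℝ) = 2 * 2 by norm_num, mul_pow]
          ring
  calc ∫⁻ x, ENNReal.ofReal (P.I.chi x ^ 2) * L.mass s θ (P.upper n).toSet x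
      ≤ ∫⁻ x, ∑' i : ℕ, ENNReal.ofReal (16 * (1 / 16) ^ i) *
          (near i).indicator (L.mass s θ (P.upper n).toSet) x := by
        refine lintegral_mono fun x => ?_
        refine (mul_le_mul_left (chi_sq_le_tsum P.I x) _).trans (le_of_eq ?_)
        rw [← ENNReal.tsum_mul_right]
        refine tsum_congr fun i => ?_
        rw [mul_assoc]
        congr 1
        by_cases hx : x ∈ near i
        · rw [indicator_of_mem hx, indicator_of_mem (by exact hx), Pi.one_apply, one_mul]
        · rw [indicator_of_notMem hx, indicator_of_notMem (by exact hx), zero_mul]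
    _ = ∑' i : ℕ, ENNReal.ofReal (16 * (1 / 16) ^ i) * ∫⁻ x in near i, L.mass s θ (P.upper n).toSet x := by
        rw [lintegral_tsum fun i => ((hMm.indicator (hnearm i)).const_mul _).aemeasurable]
        refine tsum_congr fun i => ?_
        rw [lintegral_const_mul _ (hMm.indicator (hnearm i)), lintegral_indicator (hnearm i)]
    _ ≤ ∑' i : ℕ, ENNReal.ofReal (96 * lam * 2 ^ σ * (1 / 4) ^ i) := by
        refine ENNReal.tsum_le_tsum fun i => ?_
        refine (mul_le_mul_right (hlocal i) _).trans (le_of_eq ?_)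
        rw [← ENNReal.ofReal_mul (by positivity)]
        congr 1
        have : (1 / 16 : ℝ) ^ i * 4 ^ i = (1 / 4) ^ i := by rw [← mul_pow]; norm_num
        rw [← this]; ring
    _ = _ := by
        have hsum : Summable fun i : ℕ => (1 / 4 : ℝ) ^ i :=
          summable_geometric_of_lt_one (by norm_num) (by norm_num)
        rw [← ENNReal.ofReal_tsum_of_nonneg (fun i => by positivity) (hsum.mul_left _), tsum_mul_left,
          tsum_geometric_of_lt_one (by norm_num) (by norm_num)]
        congr 1; ring

end Linearization

/-! ### The coefficients of the modified wave packets -/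

namespace Linearization

variable {L : Linearization} {m n : ℤ} {s θ lam : ℝ}

/-- The index `j` contributes to the coefficient of the tile `P` at the point `x`. -/
def Active (L : Linearization) (m n : ℤ) (P : Tile) (j : ℕ) (x : ℝ) : Prop :=
  ENNReal.ofReal P.I.length ≤ L.α j x ∧ L.Nf (j - 1) x ∈ P.lower m ∧ L.Nf j x ∈ (P.upper n).toSet

open scoped Classical in
/-- The coefficient of `φ_P` in the modified wave packet of the tile `P`. -/
noncomputable def coeff (L : Linearization) (m n : ℤ) (P : Tile) (x : ℝ) : ℂ :=
  ∑ j ∈ Finset.Icc 1 (L.K x), if L.Active m n P j x then L.d j x else 0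

lemma T₂_eq (L : Linearization) (m n : ℤ) (φ : Tile → ℝ → ℂ) (P : Tile) :
    T₂ m n φ L.K L.Nf L.d L.α L.f P =
      ∫ x, L.f x * (starRingEnd ℂ) (L.coeff m n P x * φ P x) := by
  unfold T₂ coeff
  refine integral_congr_ae (Filter.Eventually.of_forall fun x => ?_)
  dsimp only
  congr 2
  rw [Finset.sum_mul]
  refine Finset.sum_congr rfl fun j _ => ?_
  unfold modPacket Active
  by_cases h1 : ENNReal.ofReal P.I.length ≤ L.α j x <;>
    by_cases h2 : L.Nf (j - 1) x ∈ P.lower m ∧ L.Nf j x ∈ (P.upper n).toSet <;> simp [h1, h2]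

lemma measurable_coeff (P : Tile) : Measurable (L.coeff m n P) := by
  classical
  unfold coeff
  refine L.measurable_sum (g := fun j x => if L.Active m n P j x then L.d j x else 0) fun j => ?_
  refine Measurable.ite ?_ (L.measurable_d j) measurable_const
  have hup : MeasurableSet (P.upper n).toSet := by rw [P.upper_toSet]; exact measurableSet_dyI _ _
  change MeasurableSet ({x | ENNReal.ofReal P.I.length ≤ L.α j x} ∩
    (L.Nf (j - 1) ⁻¹' P.lower m ∩ L.Nf j ⁻¹' (P.upper n).toSet))
  exact (measurableSet_le measurable_const (L.measurable_α j)).inter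
    ((L.measurable_Nf (j - 1) measurableSet_Iio).inter (L.measurable_Nf j hup))

lemma _root_.OuterEmbedding.Tile.lt_of_mem_lower_of_mem_upper {P : Tile} (hmn : 1 ≤ m + n) {y z : ℝ} (hy : y ∈ P.lower m)
    (hz : z ∈ (P.upper n).toSet) : y < z := by
  rw [P.mem_lower] at hy
  rw [P.mem_upper, dy_eq_iff] at hz
  have hu := two_zpow_pos (-P.I.scale)
  have h1 : (1 : ℝ) ≤ m + n := by exact_mod_cast hmn
  push_cast at hz
  nlinarith [hz.1]

/-- At most one index is active. -/
lemma Active.unique (hmn : 1 ≤ m + n) {P : Tile} {x : ℝ} {i j : ℕ} (hi : L.Active m n P i x)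
    (hj : L.Active m n P j x) : i = j := by
  have key : ∀ {i j : ℕ}, L.Active m n P i x → L.Active m n P j x → ¬ i < j := by
    intro i j hi hj hij
    have h1 := Tile.lt_of_mem_lower_of_mem_upper hmn hj.2.1 hi.2.2
    have h2 := L.monotone_Nf x (show i ≤ j - 1 by omega)
    exact absurd h1 (not_lt.2 h2)
  have h1 := key hi hj
  have h2 := key hj hi
  omega

lemma coeff_cases (hmn : 1 ≤ m + n) (P : Tile) (x : ℝ) :
    (∃ j ∈ Finset.Icc 1 (L.K x), L.Active m n P j x ∧ L.coeff m n P x = L.d j x) ∨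
      L.coeff m n P x = 0 := by
  classical
  by_cases h : ∃ j ∈ Finset.Icc 1 (L.K x), L.Active m n P j x
  · obtain ⟨j, hj, ha⟩ := h
    refine Or.inl ⟨j, hj, ha, ?_⟩
    unfold coeff
    rw [Finset.sum_eq_single_of_mem j hj fun i _ hij => if_neg fun hi => hij (hi.unique hmn ha),
      if_pos ha]
  · refine Or.inr (Finset.sum_eq_zero fun j hj => if_neg fun ha => h ⟨j, hj, ha⟩)

lemma enorm_mul_coeff_le (hmn : 1 ≤ m + n) (hs : 1 ≤ s) {P : Tile} {Ω : Set ℝ}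
    (hΩ : (P.upper n).toSet ⊆ Ω) (x : ℝ) : ‖L.f x‖ₑ * ‖L.coeff m n P x‖ₑ ≤ L.visible s Ω x := by
  rcases L.coeff_cases hmn P x with ⟨j, hj, ha, h⟩ | h
  · rw [h]; exact L.enorm_mul_le_visible hs hj (hΩ ha.2.2)
  · rw [h]; simp

end Linearization

/-! ### Decay of wave packets -/

lemma IsWavePacket.norm_le {A : ℕ → ℕ → ℝ} {P : Tile} {φ : ℝ → ℂ} (h : IsWavePacket A P φ) (b : ℕ)
    (x : ℝ) : ‖φ x‖ ≤ |A 0 (2 * b)| * (P.I.length)⁻¹ * P.I.chi x ^ b := by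
  have h1 := h.bound 0 (2 * b) x
  rw [iteratedDeriv_zero, norm_mul, zero_add, pow_one, ← P.I.chi_pow_eq] at h1
  have h2 : ‖Complex.exp (-(Complex.I * P.ω.center * x))‖ = 1 := by
    rw [show -(Complex.I * P.ω.center * x) = ((-(P.ω.center * x) : ℝ) : ℂ) * Complex.I by
      push_cast; ring]
    exact Complex.norm_exp_ofReal_mul_I _
  rw [h2, one_mul] at h1
  refine h1.trans ?_
  have := P.I.length_pos
  have := P.I.chi_pos x
  gcongr
  exact le_abs_self _

/-- The average of the support of `f` with respect to the tile `P` is at most `M`. -/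
def Tile.DensityLE (P : Tile) (N : ℕ) (f : ℝ → ℂ) (M : ℝ) : Prop :=
  ∫⁻ x, ENNReal.ofReal (P.I.chi x ^ N) * (Function.support f).indicator 1 x ≤
    ENNReal.ofReal (M * 2 ^ P.I.scale)

lemma Tile.DensityLE.volume_le {P : Tile} {N : ℕ} {f : ℝ → ℂ} {M : ℝ}
    (h : P.DensityLE N f M) (hf : Measurable f) :
    volume (Function.support f ∩ {x | |x - P.I.center| ≤ 4 * 2 ^ P.I.scale}) ≤
      ENNReal.ofReal (25 ^ N * M * 2 ^ P.I.scale) := by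
  set B : Set ℝ := {x | |x - P.I.center| ≤ 4 * 2 ^ P.I.scale} with hB
  have hBm : MeasurableSet B := measurableSet_le (by fun_prop) measurable_const
  have hFm : MeasurableSet (Function.support f) := measurableSet_support hf
  have h1 : ∀ x, (Function.support f ∩ B).indicator 1 x ≤
      ENNReal.ofReal (25 ^ N) * (ENNReal.ofReal (P.I.chi x ^ N) * (Function.support f).indicator 1 x) := by
    intro x
    by_cases hx : x ∈ Function.support f ∩ B
    · rw [indicator_of_mem hx, indicator_of_mem hx.1, Pi.one_apply, mul_one,
        ← ENNReal.ofReal_mul (by positivity), ← mul_pow]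
      have h2 : ((1 + 4 : ℝ) ^ 2)⁻¹ ≤ P.I.chi x := P.I.le_chi_of_le (show _ ≤ 4 * P.I.length from hx.2)
      norm_num at h2
      exact ENNReal.one_le_ofReal.2 (one_le_pow₀ (by linarith))
    · rw [indicator_of_notMem hx]; exact zero_le
  calc volume (Function.support f ∩ B) = ∫⁻ x, (Function.support f ∩ B).indicator 1 x :=
        (lintegral_indicator_one (hFm.inter hBm)).symm
    _ ≤ ∫⁻ x, ENNReal.ofReal (25 ^ N) *
          (ENNReal.ofReal (P.I.chi x ^ N) * (Function.support f).indicator 1 x) := lintegral_mono h1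
    _ = ENNReal.ofReal (25 ^ N) *
          ∫⁻ x, ENNReal.ofReal (P.I.chi x ^ N) * (Function.support f).indicator 1 x :=
        lintegral_const_mul _ ((((P.I.continuous_chi.pow N).measurable).ennreal_ofReal).mul
          (measurable_one.indicator hFm))
    _ ≤ ENNReal.ofReal (25 ^ N) * ENNReal.ofReal (M * 2 ^ P.I.scale) := by gcongr; exact h
    _ = _ := by rw [← ENNReal.ofReal_mul (by positivity)]; ring_nf

namespace Linearization

variable {L : Linearization} {m n : ℤ} {s θ lam M : ℝ} {A : ℕ → ℕ → ℝ} {P : Tile} {φ : ℝ → ℂ} {N : ℕ}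

/-- The tail of the coefficient of an unselected tile. -/
lemma lintegral_tail_le (hn : 0 ≤ n) (hmn : 1 ≤ m + n) (hs : 1 ≤ s) (hθ : 0 < θ) (hlam : 0 ≤ lam)
    (hM : 0 ≤ M) (hθM : θ * M ≤ lam) (hN : 2 ≤ N) (hP : L.Unselected n s θ lam P)
    (hd : P.DensityLE N L.f M) (hφ : IsWavePacket A P φ) {E : Set ℝ} {ε : ℝ} (hE : MeasurableSet E)
    (hε : 0 ≤ ε) (hEε : ∀ x ∈ E, P.I.chi x ^ 3 ≤ ε) :
    ∫⁻ x in E, ‖L.f x‖ₑ * ‖L.coeff m n P x * φ x‖ₑ ≤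
      ENNReal.ofReal (129 * |A 0 (2 * (N + 3))| * lam * ε) := by
  set a := |A 0 (2 * (N + 3))|
  set Ω := (P.upper n).toSet
  have hΩm : MeasurableSet Ω := by simp only [Ω]; rw [P.upper_toSet]; exact measurableSet_dyI _ _
  have hl := two_zpow_pos P.I.scale
  have hχ : ∀ k, Measurable fun x => ENNReal.ofReal (P.I.chi x ^ k) := fun k =>
    ((P.I.continuous_chi.pow k).measurable).ennreal_ofReal
  have hpt : ∀ x ∈ E, ‖L.f x‖ₑ * ‖L.coeff m n P x * φ x‖ₑ ≤ ENNReal.ofReal (a * (2 ^ P.I.scale)⁻¹ * ε) *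
      (ENNReal.ofReal θ * (ENNReal.ofReal (P.I.chi x ^ N) * (Function.support L.f).indicator 1 x) +
        ENNReal.ofReal (P.I.chi x ^ 2) * L.mass s θ Ω x) := by
    intro x hx
    have hc := P.I.chi_pos x
    have h1 : ‖φ x‖ₑ ≤ ENNReal.ofReal (a * (2 ^ P.I.scale)⁻¹ * ε) * ENNReal.ofReal (P.I.chi x ^ N) := by
      rw [← ofReal_norm, ← ENNReal.ofReal_mul (by positivity)]
      refine ENNReal.ofReal_le_ofReal ((hφ.norm_le (N + 3) x).trans ?_)
      rw [pow_add, DyadicInterval.length]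
      calc a * (2 ^ P.I.scale)⁻¹ * (P.I.chi x ^ N * P.I.chi x ^ 3)
          ≤ a * (2 ^ P.I.scale)⁻¹ * (P.I.chi x ^ N * ε) := by
            have := hEε x hx
            gcongr
        _ = _ := by ring
    have h2 := L.enorm_mul_coeff_le hmn hs (P := P) subset_rfl x
    have h3 := L.visible_le hs hθ Ω x
    have h4 : ENNReal.ofReal (P.I.chi x ^ N) ≤ ENNReal.ofReal (P.I.chi x ^ 2) :=
      ENNReal.ofReal_le_ofReal (P.I.chi_pow_le_chi_pow x hN)
    rw [enorm_mul, ← mul_assoc]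
    calc ‖L.f x‖ₑ * ‖L.coeff m n P x‖ₑ * ‖φ x‖ₑ
        ≤ (ENNReal.ofReal θ * (Function.support L.f).indicator 1 x + L.mass s θ Ω x) *
          (ENNReal.ofReal (a * (2 ^ P.I.scale)⁻¹ * ε) * ENNReal.ofReal (P.I.chi x ^ N)) :=
          mul_le_mul' (h2.trans h3) h1
      _ = ENNReal.ofReal (a * (2 ^ P.I.scale)⁻¹ * ε) *
          (ENNReal.ofReal θ * (ENNReal.ofReal (P.I.chi x ^ N) * (Function.support L.f).indicator 1 x) +
            ENNReal.ofReal (P.I.chi x ^ N) * L.mass s θ Ω x) := by ring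
      _ ≤ _ := by gcongr
  have hm1 : Measurable fun x => ENNReal.ofReal (P.I.chi x ^ N) *
      (Function.support L.f).indicator (1 : ℝ → ℝ≥0∞) x :=
    (hχ N).mul (measurable_one.indicator (measurableSet_support L.measurable_f))
  have hm2 : Measurable fun x => ENNReal.ofReal (P.I.chi x ^ 2) * L.mass s θ Ω x :=
    (hχ 2).mul (L.measurable_mass θ hΩm)
  calc ∫⁻ x in E, ‖L.f x‖ₑ * ‖L.coeff m n P x * φ x‖ₑ
      ≤ ∫⁻ x in E, ENNReal.ofReal (a * (2 ^ P.I.scale)⁻¹ * ε) *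
        (ENNReal.ofReal θ * (ENNReal.ofReal (P.I.chi x ^ N) * (Function.support L.f).indicator 1 x) +
        ENNReal.ofReal (P.I.chi x ^ 2) * L.mass s θ Ω x) := setLIntegral_mono' hE hpt
    _ ≤ ∫⁻ x, ENNReal.ofReal (a * (2 ^ P.I.scale)⁻¹ * ε) *
        (ENNReal.ofReal θ * (ENNReal.ofReal (P.I.chi x ^ N) * (Function.support L.f).indicator 1 x) +
        ENNReal.ofReal (P.I.chi x ^ 2) * L.mass s θ Ω x) := setLIntegral_le_lintegral _ _
    _ = ENNReal.ofReal (a * (2 ^ P.I.scale)⁻¹ * ε) * (ENNReal.ofReal θ *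
        (∫⁻ x, ENNReal.ofReal (P.I.chi x ^ N) * (Function.support L.f).indicator 1 x) +
        ∫⁻ x, ENNReal.ofReal (P.I.chi x ^ 2) * L.mass s θ Ω x) := by
        have hm : Measurable fun x => ENNReal.ofReal θ * (ENNReal.ofReal (P.I.chi x ^ N) *
            (Function.support L.f).indicator (1 : ℝ → ℝ≥0∞) x) +
            ENNReal.ofReal (P.I.chi x ^ 2) * L.mass s θ Ω x := (hm1.const_mul _).add hm2
        rw [lintegral_const_mul _ hm, lintegral_add_left (hm1.const_mul _), lintegral_const_mul _ hm1]
    _ ≤ ENNReal.ofReal (a * (2 ^ P.I.scale)⁻¹ * ε) * (ENNReal.ofReal θ *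
        ENNReal.ofReal (M * 2 ^ P.I.scale) + ENNReal.ofReal (128 * lam * 2 ^ P.I.scale)) := by
        have h1 := hP.lintegral_chi_mass_le hn hlam
        have h2 : ∫⁻ x, ENNReal.ofReal (P.I.chi x ^ N) * (Function.support L.f).indicator 1 x ≤
          ENNReal.ofReal (M * 2 ^ P.I.scale) := hd
        gcongr
    _ ≤ _ := by
        rw [← ENNReal.ofReal_mul hθ.le, ← ENNReal.ofReal_add (by positivity) (by positivity),
          ← ENNReal.ofReal_mul (by positivity)]
        refine ENNReal.ofReal_le_ofReal ?_
        have e1 : a * (2 ^ P.I.scale)⁻¹ * ε * (θ * (M * 2 ^ P.I.scale) + 128 * lam * 2 ^ P.I.scale) =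
            a * ε * (θ * M + 128 * lam) := by field_simp
        rw [e1]
        calc a * ε * (θ * M + 128 * lam) ≤ a * ε * (lam + 128 * lam) := by gcongr
          _ = _ := by ring

lemma integrable_mul_coeff (hn : 0 ≤ n) (hmn : 1 ≤ m + n) (hs : 1 ≤ s) (hθ : 0 < θ) (hlam : 0 ≤ lam)
    (hM : 0 ≤ M) (hθM : θ * M ≤ lam) (hN : 2 ≤ N) (hP : L.Unselected n s θ lam P)
    (hd : P.DensityLE N L.f M) (hφ : IsWavePacket A P φ) :
    Integrable fun x => L.f x * (starRingEnd ℂ) (L.coeff m n P x * φ x) := by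
  refine ⟨(L.measurable_f.mul (RCLike.continuous_conj.measurable.comp
    ((L.measurable_coeff P).mul hφ.smooth.continuous.measurable))).aestronglyMeasurable, ?_⟩
  have h := lintegral_tail_le (m := m) hn hmn hs hθ hlam hM hθM hN hP hd hφ MeasurableSet.univ
    zero_le_one fun x _ => pow_le_one₀ (P.I.chi_pos x).le (P.I.chi_le_one x)
  rw [setLIntegral_univ] at h
  refine lt_of_le_of_lt (le_trans (le_of_eq (lintegral_congr fun x => ?_)) h) ENNReal.ofReal_lt_top
  rw [enorm_mul]
  congr 1
  rw [← ofReal_norm, ← ofReal_norm, RCLike.norm_conj]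

/-! ### Frequency windows of trees -/

/-- The upper frequency intervals of the tiles in `S` of scale larger than `k`. -/
def window (n : ℤ) (S : Finset Tile) (k : ℤ) : Set ℝ :=
  {y | ∃ Q ∈ S, k < Q.I.scale ∧ y ∈ (Q.upper n).toSet}

lemma measurableSet_window (S : Finset Tile) (k : ℤ) : MeasurableSet (window n S k) := by
  have : window n S k = ⋃ Q ∈ S, {y | k < Q.I.scale ∧ y ∈ (Q.upper n).toSet} := by
    ext y; simp only [window, mem_iUnion, mem_ofPred_eq, exists_prop]
  rw [this]
  refine Finset.measurableSet_biUnion _ fun Q _ => (MeasurableSet.const _).inter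
    (s₂ := (Q.upper n).toSet) ?_
  rw [Q.upper_toSet]; exact measurableSet_dyI _ _

/-- The frequency geometry common to the overlapping trees and to the parts into which the lacunary
trees are divided: the tiles of a given scale share their frequency interval, and the upper frequency
intervals of the longer tiles are close to those of the shorter ones. -/
structure FreqTree (n : ℤ) (S : Finset Tile) (ξ : ℝ) : Prop where
  ω_eq : ∀ P ∈ S, ∀ Q ∈ S, P.I.scale = Q.I.scale → P.ω = Q.ω
  upper_subset : ∀ P ∈ S, ∀ Q ∈ S, P.I.scale ≤ Q.I.scale → (Q.upper n).toSet ⊆ P.omegaTilde n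
  mem : ∀ P ∈ S, ξ ∈ P.omegaTilde n

/-- The visible mass near an unselected tile of a tree. -/
lemma lintegral_visible_window_le {S : Finset Tile} {ξ : ℝ} (hT : FreqTree n S ξ) (hn : 0 ≤ n)
    (hs : 1 ≤ s) (hθ : 0 < θ) {k p : ℤ} (hP : P ∈ S)
    (hun : L.Unselected n s θ lam P) (hnear : P.Near (k + 1) p) :
    ∫⁻ x in dyI (k + 1) p, L.visible s (window n S k) x ≤
      ENNReal.ofReal θ * volume (Function.support L.f ∩ dyI (k + 1) p) +
        ENNReal.ofReal ((4 * n + 201) * lam * 2 ^ (k + 1)) := by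
  classical
  set l := -(k + 1) - 1 with hl
  set R := Finset.Icc (dy l ξ - (2 * n + 100)) (dy l ξ + (2 * n + 100)) with hR
  have hcard : R.card = (4 * n + 201).toNat := by rw [hR, Int.card_Icc]; congr 1; ring
  set R' := R.filter fun r => dyI l r ⊆ P.omegaTilde n with hR'
  have hcard' : (R'.card : ℝ≥0∞) ≤ ENNReal.ofReal (4 * n + 201) := by
    have h1 : R'.card ≤ (4 * n + 201).toNat := hcard ▸ Finset.card_filter_le _ _
    have h2 : ((4 * n + 201).toNat : ℝ) = 4 * n + 201 := by
      have : (((4 * n + 201).toNat : ℤ) : ℝ) = ((4 * n + 201 : ℤ) : ℝ) := by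
        rw [Int.toNat_of_nonneg (by omega)]
      push_cast at this
      exact this
    rw [← h2, ENNReal.ofReal_natCast]
    exact_mod_cast h1
  -- the window is covered by few dyadic intervals inside the enlarged frequency interval of `P`
  have hcover : window n S k ⊆ ⋃ r ∈ R', dyI l r := by
    rintro y ⟨Q, hQ, hkQ, hy⟩
    have hPQ : P.I.scale ≤ Q.I.scale := by have := hnear.1; omega
    have hyP := hT.upper_subset P hP Q hQ hPQ hy
    have hyQ := hT.upper_subset Q hQ Q hQ le_rfl hy
    rw [Q.mem_omegaTilde hn] at hyQ
    have hξQ := (Q.mem_omegaTilde hn).1 (hT.mem Q hQ)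
    have h1 := abs_dy_sub_le_of_le (show -Q.I.scale - 1 ≤ l by omega) y ξ
    have h2 : |dy (-Q.I.scale - 1) y - dy (-Q.I.scale - 1) ξ| ≤ 2 * n + 100 := by
      rw [abs_le]; omega
    have h3 := abs_le.1 (h1.trans h2)
    refine mem_biUnion (x := dy l y) ?_ (mem_dyI_dy _ _)
    refine Finset.mem_coe.2 (Finset.mem_filter.2 ⟨Finset.mem_Icc.2 (by omega), ?_⟩)
    exact P.dyI_subset_omegaTilde hn (by have := hnear.1; omega) rfl hyP
  have hFm : MeasurableSet (Function.support L.f) := measurableSet_support L.measurable_f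
  calc ∫⁻ x in dyI (k + 1) p, L.visible s (window n S k) x
      ≤ ∫⁻ x in dyI (k + 1) p, (ENNReal.ofReal θ * (Function.support L.f).indicator 1 x +
          ∑ r ∈ R', L.mass s θ (dyI l r) x) := by
        refine lintegral_mono fun x => (L.visible_le hs hθ _ x).trans ?_
        exact add_le_add le_rfl ((L.mass_mono θ hcover x).trans (L.mass_biUnion_le θ R' _ x))
    _ = ENNReal.ofReal θ * volume (Function.support L.f ∩ dyI (k + 1) p) +
          ∑ r ∈ R', ∫⁻ x in dyI (k + 1) p, L.mass s θ (dyI l r) x := by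
        have hm : Measurable ((Function.support L.f).indicator (1 : ℝ → ℝ≥0∞)) :=
          measurable_one.indicator hFm
        rw [lintegral_add_left (hm.const_mul _), lintegral_const_mul _ hm, lintegral_indicator_one hFm,
          Measure.restrict_apply hFm,
          lintegral_finsetSum _ fun r _ => L.measurable_mass θ (measurableSet_dyI _ _)]
    _ ≤ ENNReal.ofReal θ * volume (Function.support L.f ∩ dyI (k + 1) p) +
          ∑ r ∈ R', ENNReal.ofReal (lam * 2 ^ (k + 1)) := by
        gcongr with r hr
        exact hun.lintegral_mass_le hnear (Finset.mem_filter.1 hr).2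
    _ ≤ _ := by
        have hn' : (0 : ℝ) ≤ n := by exact_mod_cast hn
        have hk := two_zpow_pos (k + 1)
        rw [Finset.sum_const, nsmul_eq_mul, mul_assoc (4 * (n : ℝ) + 201),
          ENNReal.ofReal_mul (p := 4 * (n : ℝ) + 201) (by positivity)]
        gcongr

end Linearization

namespace Tile

variable (P : Tile) {m n : ℤ} {y : ℝ}

lemma mem_omegaTilde_iff (hn : 0 ≤ n) : y ∈ P.omegaTilde n ↔
    (2 * P.ω.pos - 49) * 2 ^ (-P.I.scale - 1) ≤ y ∧
      y < (2 * (P.ω.pos + n) + 51) * 2 ^ (-P.I.scale - 1) := by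
  rw [mem_omegaTilde P hn, ← mem_Ico_iff_dy, mem_Ico]
  push_cast
  rfl

lemma mem_dilate_upper_iff : y ∈ (P.upper n).dilate 50 ↔
    (2 * (P.ω.pos + n) - 49) * 2 ^ (-P.I.scale - 1) ≤ y ∧
      y < (2 * (P.ω.pos + n) + 51) * 2 ^ (-P.I.scale - 1) := by
  rw [dilate_upper_eq, mem_Ico]
  push_cast
  rfl

lemma mem_upper_iff : y ∈ (P.upper n).toSet ↔
    2 * (P.ω.pos + n) * 2 ^ (-P.I.scale - 1) ≤ y ∧
      y < 2 * (P.ω.pos + n + 1) * 2 ^ (-P.I.scale - 1) := by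
  have h : (2 : ℝ) ^ (-P.I.scale) = 2 * 2 ^ (-P.I.scale - 1) := by
    rw [← two_zpow_succ, sub_add_cancel]
  rw [mem_upper, dy_eq_iff, h]
  push_cast
  constructor <;> rintro ⟨h1, h2⟩ <;> constructor <;> linarith

lemma mem_lower_iff : y ∈ P.lower m ↔ y < 2 * (P.ω.pos + 1 - m) * 2 ^ (-P.I.scale - 1) := by
  have h : (2 : ℝ) ^ (-P.I.scale) = 2 * 2 ^ (-P.I.scale - 1) := by
    rw [← two_zpow_succ, sub_add_cancel]
  rw [mem_lower, h, ← mul_assoc, mul_comm _ (2 : ℝ)]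

lemma upper_subset_omegaTilde (hn : 0 ≤ n) : (P.upper n).toSet ⊆ P.omegaTilde n := by
  intro y hy
  rw [mem_upper] at hy
  rw [P.mem_omegaTilde hn]
  have := dy_sub_one_eq (-P.I.scale) y
  omega

end Tile

lemma Sparse.gap {C₀ : ℝ} (hC₀ : 1 ≤ C₀) {𝔓 : Set Tile} (h : Sparse C₀ 𝔓) {P Q : Tile}
    (hP : P ∈ 𝔓) (hQ : Q ∈ 𝔓) (hPQ : P.I.scale < Q.I.scale) :
    C₀ * 2 ^ (-Q.I.scale - 1) < 2 ^ (-P.I.scale - 1) := by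
  have h1 := h.lt_of_scale_lt hC₀ hP hQ hPQ
  rw [zpow_sub₀ two_ne_zero, zpow_sub₀ two_ne_zero, zpow_one]
  linarith

namespace Linearization

variable {L : Linearization} {m n : ℤ} {s θ lam M : ℝ} {A : ℕ → ℕ → ℝ} {φ : Tile → ℝ → ℂ} {N : ℕ}
  {S : Finset Tile} {ξ : ℝ}

/-- The standing assumptions on a finite set of tiles in the tree estimates. -/
structure Admissible (L : Linearization) (m n : ℤ) (s θ lam M : ℝ) (A : ℕ → ℕ → ℝ) (N : ℕ)
    (φ : Tile → ℝ → ℂ) (S : Finset Tile) : Prop where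
  m_le : 501 ≤ m
  n_le : 501 ≤ n
  one_le_s : 1 ≤ s
  θ_pos : 0 < θ
  lam_pos : 0 < lam
  M_pos : 0 < M
  θM_le : θ * M ≤ lam
  N_le : 2 ≤ N
  packet : ∀ P ∈ S, IsWavePacket A P (φ P)
  unselected : ∀ P ∈ S, L.Unselected n s θ lam P
  density : ∀ P ∈ S, P.DensityLE N L.f M

lemma Admissible.mono {S' : Finset Tile} (h : L.Admissible m n s θ lam M A N φ S) (hS : S' ⊆ S) :
    L.Admissible m n s θ lam M A N φ S' :=
  { h with
    packet := fun P hP => h.packet P (hS hP)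
    unselected := fun P hP => h.unselected P (hS hP)
    density := fun P hP => h.density P (hS hP) }

/-- The constant in the hypotheses of the tree estimate, in terms of the constant `κ` in the bound
for linear combinations. -/
noncomputable def treeHypConst (A : ℕ → ℕ → ℝ) (N : ℕ) (n : ℤ) (κ : ℝ) : ℝ :=
  129 * |A 0 (2 * (N + 3))| + (4 * |(n : ℝ)| + 201) + 25 ^ N + |κ|

lemma treeHypConst_pos (A : ℕ → ℕ → ℝ) (N : ℕ) (n : ℤ) (κ : ℝ) : 0 < treeHypConst A N n κ := by
  unfold treeHypConst; positivity

lemma FreqTree.injOn (hT : FreqTree n S ξ) : Set.InjOn Tile.I (S : Set Tile) := fun P hP Q hQ h =>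
  Tile.ext_of_I_of_ω h (hT.ω_eq P hP Q hQ (by rw [h]))

/-- A tree satisfies the hypotheses of the tree estimate as soon as linear combinations of its
modified wave packets are controlled. -/
lemma Admissible.treeHyp (h : L.Admissible m n s θ lam M A N φ S) (hT : FreqTree n S ξ) {τ κ : ℝ}
    (hκ : 0 ≤ κ)
    (main : ∀ (t : Tile → ℝ) (a : Tile → ℂ), (∀ P, 0 ≤ t P) → (∀ P ∈ S, ‖a P‖ ≤ t P ^ (τ - 1)) →
      ∀ η : ℝ, 0 < η → ∃ W : ℝ → ℝ≥0∞, Measurable W ∧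
        ∫⁻ y, W y ≤ ENNReal.ofReal (κ * (η⁻¹ * ∑ P ∈ S, 2 ^ P.I.scale * t P ^ τ)) ∧
        ∀ (k : ℤ) (x y : ℝ), dy k x = dy k y →
          ‖L.f x‖ₑ * ‖∑ P ∈ S with k < P.I.scale, a P * ((2 : ℝ) ^ P.I.scale : ℝ) *
            (L.coeff m n P x * φ P x)‖ₑ ≤
            L.visible s (window n S k) x * (ENNReal.ofReal (κ * η ^ (τ - 1)) + W y)) :
    TreeHyp (treeHypConst A N n κ) lam θ M τ S L.f (fun P x => L.coeff m n P x * φ P x)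
      (fun k => L.visible s (window n S k)) := by
  have hn : 0 ≤ n := by have := h.n_le; omega
  have hmn : 1 ≤ m + n := by have := h.n_le; have := h.m_le; omega
  have hlam := h.lam_pos
  have hM := h.M_pos
  set a₀ := |A 0 (2 * (N + 3))| with ha₀
  have ha₀' : 0 ≤ a₀ := abs_nonneg _
  have hn' : (0 : ℝ) ≤ n := by exact_mod_cast hn
  have hK : treeHypConst A N n κ = 129 * a₀ + (4 * n + 201) + 25 ^ N + κ := by
    rw [treeHypConst, abs_of_nonneg hn', abs_of_nonneg hκ]
  have hN : (0 : ℝ) < 25 ^ N := by positivity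
  have hK1 : 129 * a₀ ≤ treeHypConst A N n κ := by linarith
  have hK2 : 4 * n + 201 ≤ treeHypConst A N n κ := by linarith
  have hK3 : 25 ^ N ≤ treeHypConst A N n κ := by linarith
  have hK4 : κ ≤ treeHypConst A N n κ := by linarith
  constructor
  · exact hT.injOn
  · exact L.measurable_f
  · exact fun P hP => integrable_mul_coeff hn hmn h.one_le_s h.θ_pos hlam.le hM.le h.θM_le h.N_le
      (h.unselected P hP) (h.density P hP) (h.packet P hP)
  · exact fun k => L.measurable_visible (measurableSet_window S k)
  · rintro k p ⟨P, hP, hnear⟩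
    refine (lintegral_visible_window_le hT hn h.one_le_s h.θ_pos hP (h.unselected P hP) hnear).trans ?_
    have := two_zpow_pos (k + 1)
    gcongr
  · intro P hP E ε hE hε hEε
    refine (lintegral_tail_le hn hmn h.one_le_s h.θ_pos hlam.le hM.le h.θM_le h.N_le
      (h.unselected P hP) (h.density P hP) (h.packet P hP) hE hε hEε).trans ?_
    gcongr
  · intro P hP
    refine ((h.density P hP).volume_le L.measurable_f).trans ?_
    have := two_zpow_pos P.I.scale
    gcongr
  · intro t a ht ha η hη
    obtain ⟨W, h1, h2, h3⟩ := main t a ht ha η hη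
    have h0 : 0 ≤ ∑ P ∈ S, 2 ^ P.I.scale * t P ^ τ := Finset.sum_nonneg fun P _ =>
      mul_nonneg (two_zpow_pos _).le (Real.rpow_nonneg (ht P) _)
    refine ⟨W, h1, h2.trans ?_, fun k x y hxy => (h3 k x y hxy).trans ?_⟩
    · gcongr
    · gcongr

/-! ### Overlapping trees -/

lemma overlapping_bounds (hn : 0 ≤ n) {P : Tile} (h : ξ ∈ P.omegaTilde n \ (P.upper n).dilate 50) :
    (2 * P.ω.pos - 49) * 2 ^ (-P.I.scale - 1) ≤ ξ ∧
      ξ < (2 * (P.ω.pos + n) - 49) * 2 ^ (-P.I.scale - 1) := by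
  obtain ⟨h1, h2⟩ := h
  rw [P.mem_omegaTilde_iff hn] at h1
  rw [P.mem_dilate_upper_iff] at h2
  exact ⟨h1.1, by by_contra hcon; exact h2 ⟨not_lt.1 hcon, h1.2⟩⟩

/-- The upper frequency intervals of an overlapping tree are to the right of the top frequency, and
close to it. -/
lemma overlapping_near (hn : 0 ≤ n) {C₀ : ℝ} (hC : 2 * n + 200 ≤ C₀) {𝔓 : Set Tile}
    (hsp : Sparse C₀ 𝔓) {P Q : Tile} (hP : P ∈ 𝔓) (hQ : Q ∈ 𝔓) (hPQ : P.I.scale < Q.I.scale)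
    (hξ : ξ ∈ Q.omegaTilde n \ (Q.upper n).dilate 50) {y : ℝ} (hy : y ∈ (Q.upper n).toSet) :
    ξ ≤ y ∧ y < ξ + 2 ^ (-P.I.scale - 1) := by
  have hn' : (0 : ℝ) ≤ n := by exact_mod_cast hn
  have h1 := overlapping_bounds hn hξ
  have h2 := Q.mem_upper_iff.1 hy
  have h3 := hsp.gap (by linarith) hP hQ hPQ
  have hv := two_zpow_pos (-Q.I.scale - 1)
  constructor
  · nlinarith
  · nlinarith

lemma freqTree_of_overlapping (hn : 0 ≤ n) {C₀ : ℝ} (hC : 2 * n + 200 ≤ C₀) {𝔓 : Set Tile}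
    (hsp : Sparse C₀ 𝔓) (hS : (S : Set Tile) ⊆ 𝔓)
    (hξ : ∀ P ∈ S, ξ ∈ P.omegaTilde n \ (P.upper n).dilate 50) : FreqTree n S ξ := by
  have hn' : (0 : ℝ) ≤ n := by exact_mod_cast hn
  have hω : ∀ P ∈ S, ∀ Q ∈ S, P.I.scale = Q.I.scale → P.ω = Q.ω := by
    intro P hP Q hQ hPQ
    refine hsp.eq_of_scale_eq (by linarith) (hS hP) (hS hQ) hPQ ?_
    have h1 := (P.mem_omegaTilde hn).1 (hξ P hP).1
    have h2 := (Q.mem_omegaTilde hn).1 (hξ Q hQ).1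
    rw [hPQ] at h1
    have h3 : |P.ω.pos - Q.ω.pos| ≤ n + 50 := by rw [abs_le]; omega
    have h4 : |((P.ω.pos - Q.ω.pos : ℤ) : ℝ)| ≤ n + 50 := by exact_mod_cast h3
    linarith
  refine ⟨hω, fun P hP Q hQ hPQ y hy => ?_, fun P hP => (hξ P hP).1⟩
  rcases hPQ.eq_or_lt with h | h
  · refine P.upper_subset_omegaTilde hn ?_
    rw [Tile.mem_upper] at hy ⊢
    rw [hω P hP Q hQ h, h]; exact hy
  · have h1 := overlapping_near hn hC hsp (hS hP) (hS hQ) h (hξ Q hQ) hy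
    have h2 := overlapping_bounds hn (hξ P hP)
    have hv := two_zpow_pos (-P.I.scale - 1)
    rw [P.mem_omegaTilde_iff hn]
    constructor <;> nlinarith

/-- At a given point, an overlapping tree is only active at a single scale. -/
lemma scale_eq_of_overlapping (hm : 501 ≤ m) (hn : 501 ≤ n) {C₀ : ℝ} (hC : 2 * n + 200 ≤ C₀)
    {𝔓 : Set Tile} (hsp : Sparse C₀ 𝔓) {P Q : Tile} (hP : P ∈ 𝔓) (hQ : Q ∈ 𝔓)
    (hξP : ξ ∈ P.omegaTilde n \ (P.upper n).dilate 50)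
    (hξQ : ξ ∈ Q.omegaTilde n \ (Q.upper n).dilate 50) {i j : ℕ} {x : ℝ}
    (hi : L.Active m n P i x) (hj : L.Active m n Q j x) : ¬ P.I.scale < Q.I.scale := by
  intro hPQ
  have h1 := overlapping_near (by omega) hC hsp hP hQ hPQ hξQ hj.2.2
  have h2 := overlapping_bounds (by omega) hξP
  have hv := two_zpow_pos (-P.I.scale - 1)
  have h3 := P.mem_upper_iff.1 hi.2.2
  have h4 := P.mem_lower_iff.1 hi.2.1
  have hm' : (501 : ℝ) ≤ m := by exact_mod_cast hm
  -- `N_j` is close to the top frequency `ξ` and `N_i` is well above it, so that `j < i`; but then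
  -- `N_j ≤ N_{i-1}` is in the lower half line of `P`, which is to the left of `ξ`
  have h5 : L.Nf j x < L.Nf i x := by nlinarith
  have h6 : j < i := by
    by_contra hcon
    exact absurd h5 (not_lt.2 (L.monotone_Nf x (not_lt.1 hcon)))
  have h7 : L.Nf j x ≤ L.Nf (i - 1) x := L.monotone_Nf x (show j ≤ i - 1 by omega)
  nlinarith

/-- The tree estimate for overlapping trees. -/
theorem overlapping_estimate (h : L.Admissible m n s θ lam M A N φ S) {C₀ : ℝ}
    (hC : 2 * n + 200 ≤ C₀) {𝔓 : Set Tile} (hsp : Sparse C₀ 𝔓) (hS : (S : Set Tile) ⊆ 𝔓)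
    (hξ : ∀ P ∈ S, ξ ∈ P.omegaTilde n \ (P.upper n).dilate 50) (k p : ℤ) :
    ∑ P ∈ S with P.I.scale ≤ k ∧ dy k P.I.center = p, 2 ^ P.I.scale *
        ‖∫ x, L.f x * (starRingEnd ℂ) (L.coeff m n P x * φ P x)‖ ^ (1 : ℝ) ≤
      treeConst (treeHypConst A N n (|A 0 (2 * 1)| * chiSum)) 1 * lam ^ (1 : ℝ) * 2 ^ k := by
  classical
  have hn := h.n_le
  have hm := h.m_le
  have hmn : 1 ≤ m + n := by omega
  have hT := freqTree_of_overlapping (by omega) hC hsp hS hξ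
  set a₀ := |A 0 (2 * 1)|
  have hcs := chiSum_nonneg
  refine tree_estimate (h.treeHyp hT (by positivity) ?_) (treeHypConst_pos _ _ _ _) h.lam_pos
    h.θ_pos.le h.M_pos h.θM_le le_rfl k p
  intro t a ht ha η hη
  -- only one scale contributes at a given point, so no majorant beyond a constant is needed
  refine ⟨0, measurable_zero, by simp, fun k x y _ => ?_⟩
  rw [sub_self, Real.rpow_zero, mul_one, Pi.zero_apply, add_zero]
  by_cases hex : ∃ P ∈ S, k < P.I.scale ∧ L.coeff m n P x ≠ 0
  · obtain ⟨P₀, hP₀, hk₀, hc₀⟩ := hex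
    have hterm : ∀ P ∈ S.filter fun P => k < P.I.scale,
        ‖L.f x‖ₑ * ‖a P * ((2 : ℝ) ^ P.I.scale : ℝ) * (L.coeff m n P x * φ P x)‖ₑ ≤
        if P.I.scale = P₀.I.scale then
          L.visible s (window n S k) x * ENNReal.ofReal (a₀ * P.I.chi x) else 0 := by
      intro P hP
      obtain ⟨hPS, hPk⟩ := Finset.mem_filter.1 hP
      split_ifs with hsc
      · have h1 : ‖L.f x‖ₑ * ‖L.coeff m n P x‖ₑ ≤ L.visible s (window n S k) x :=
          L.enorm_mul_coeff_le hmn h.one_le_s (Ω := window n S k) (fun y hy => ⟨P, hPS, hPk, hy⟩) x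
        have h2 : ‖a P * ((2 : ℝ) ^ P.I.scale : ℝ) * φ P x‖ₑ ≤ ENNReal.ofReal (a₀ * P.I.chi x) := by
          rw [← ofReal_norm]
          refine ENNReal.ofReal_le_ofReal ?_
          have h3 := (h.packet P hPS).norm_le 1 x
          have h4 := ha P hPS
          rw [sub_self, Real.rpow_zero] at h4
          have hl := two_zpow_pos P.I.scale
          rw [DyadicInterval.length, pow_one] at h3
          rw [norm_mul, norm_mul, Complex.norm_real, Real.norm_of_nonneg hl.le]
          calc ‖a P‖ * 2 ^ P.I.scale * ‖φ P x‖ ≤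
              1 * 2 ^ P.I.scale * (a₀ * (2 ^ P.I.scale)⁻¹ * P.I.chi x) := by gcongr
            _ = a₀ * P.I.chi x := by field_simp
        calc _ = (‖L.f x‖ₑ * ‖L.coeff m n P x‖ₑ) * ‖a P * ((2 : ℝ) ^ P.I.scale : ℝ) * φ P x‖ₑ := by
              simp only [enorm_mul]; ring
          _ ≤ _ := mul_le_mul' h1 h2
      · have hc : L.coeff m n P x = 0 := by
          rcases L.coeff_cases hmn P x with ⟨i, -, hi, -⟩ | hc
          · rcases L.coeff_cases hmn P₀ x with ⟨j, -, hj, -⟩ | hc'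
            · have h1 := scale_eq_of_overlapping hm hn hC hsp (hS hPS) (hS hP₀) (hξ P hPS)
                (hξ P₀ hP₀) hi hj
              have h2 := scale_eq_of_overlapping hm hn hC hsp (hS hP₀) (hS hPS) (hξ P₀ hP₀)
                (hξ P hPS) hj hi
              omega
            · exact absurd hc' hc₀
          · exact hc
        rw [hc]; simp
    calc ‖L.f x‖ₑ * ‖∑ P ∈ S with k < P.I.scale, a P * ((2 : ℝ) ^ P.I.scale : ℝ) *
          (L.coeff m n P x * φ P x)‖ₑ
        ≤ ∑ P ∈ S with k < P.I.scale, ‖L.f x‖ₑ * ‖a P * ((2 : ℝ) ^ P.I.scale : ℝ) *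
          (L.coeff m n P x * φ P x)‖ₑ := by
          rw [← Finset.mul_sum]
          gcongr
          exact enorm_sum_le _ _
      _ ≤ ∑ P ∈ S with k < P.I.scale, if P.I.scale = P₀.I.scale then
          L.visible s (window n S k) x * ENNReal.ofReal (a₀ * P.I.chi x) else 0 :=
          Finset.sum_le_sum hterm
      _ ≤ _ := by
          rw [← Finset.sum_filter, ← Finset.mul_sum, ← ENNReal.ofReal_sum_of_nonneg fun P _ => by
            have := P.I.chi_pos x; positivity, ← Finset.mul_sum]
          gcongr
          exact sum_chi_le _ Tile.I (hT.injOn.mono fun P hP =>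
            (Finset.mem_filter.1 (Finset.mem_filter.1 hP).1).1) _
            (fun P hP => (Finset.mem_filter.1 hP).2) x
  · rw [Finset.sum_eq_zero fun P hP => ?_]
    · simp
    · obtain ⟨hPS, hPk⟩ := Finset.mem_filter.1 hP
      have : L.coeff m n P x = 0 := by
        by_contra hc
        exact hex ⟨P, hPS, hPk, hc⟩
      rw [this]; simp

end Linearization

/-! ### Modulated wave packets are adapted -/

/-- The constant with which the modulated wave packets of a lacunary tree are adapted. -/
noncomputable def packetConst (A : ℕ → ℕ → ℝ) (n : ℤ) : ℝ :=
  16 * ((|(n : ℝ)| + 26) * |A 0 (2 * 2)| + |A 1 (2 * 2)|) + |A 0 (2 * 2)|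

lemma packetConst_nonneg (A : ℕ → ℕ → ℝ) (n : ℤ) : 0 ≤ packetConst A n := by
  unfold packetConst; positivity

/-- The wave packet of `P`, modulated to the frequency zero from the frequency `ξ` and normalized in
`L^∞`. -/
noncomputable def modulated (P : Tile) (ξ : ℝ) (φ : ℝ → ℂ) (x : ℝ) : ℂ :=
  ((2 : ℝ) ^ P.I.scale : ℝ) * (Complex.exp (-(Complex.I * ξ * x)) * φ x)

lemma norm_exp_neg_I_mul (a x : ℝ) : ‖Complex.exp (-(Complex.I * a * x))‖ = 1 := by
  rw [show -(Complex.I * a * x) = ((-(a * x) : ℝ) : ℂ) * Complex.I by push_cast; ring]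
  exact Complex.norm_exp_ofReal_mul_I _

/-- The mean of the modulated wave packet is a value of the Fourier transform, which vanishes since `ξ`
is outside the frequency support; the other properties follow from the decay estimates. -/
lemma IsWavePacket.adapted {A : ℕ → ℕ → ℝ} {P : Tile} {φ : ℝ → ℂ} (h : IsWavePacket A P φ) {n : ℤ}
    {ξ : ℝ} (hξ : |P.ω.center - ξ| ≤ (|(n : ℝ)| + 26) * P.ω.length) (hξ' : ξ ∉ P.ω.dilate (5 / 4)) :
    Adapted (packetConst A n) P.I (modulated P ξ φ) := by
  set a₀ := |A 0 (2 * 2)| with ha₀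
  set a₁ := |A 1 (2 * 2)| with ha₁
  set D := |(n : ℝ)| + 26 with hD
  have ha₀' : 0 ≤ a₀ := abs_nonneg _
  have ha₁' : 0 ≤ a₁ := abs_nonneg _
  have hD' : 0 ≤ D := by positivity
  have hC : packetConst A n = 16 * (D * a₀ + a₁) + a₀ := rfl
  have hl : 0 < P.I.length := P.I.length_pos
  have hl' : (2 : ℝ) ^ P.I.scale = P.I.length := rfl
  have hωl : P.ω.length = P.I.length⁻¹ := by
    rw [P.ω_length, zpow_neg, hl']
  set h₀ : ℝ → ℂ := fun y => Complex.exp (-(Complex.I * P.ω.center * y)) * φ y with hh₀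
  have hφd : Differentiable ℝ φ := h.smooth.differentiable (by simp)
  have hexpd : ∀ c : ℝ, Differentiable ℝ fun y : ℝ => Complex.exp (-(Complex.I * c * y)) := fun c =>
    (((Complex.ofRealCLM.differentiable).const_mul (Complex.I * c)).neg).cexp
  have hh₀d : Differentiable ℝ h₀ := (hexpd _).mul hφd
  have hb₀ : ∀ x, ‖h₀ x‖ ≤ a₀ * P.I.length⁻¹ * P.I.chi x ^ 2 := fun x => by
    simp only [hh₀]
    rw [norm_mul, norm_exp_neg_I_mul, one_mul]
    exact h.norm_le 2 x
  have hb₁ : ∀ x, ‖deriv h₀ x‖ ≤ a₁ * (P.I.length ^ 2)⁻¹ * P.I.chi x ^ 2 := fun x => by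
    have h1 := h.bound 1 (2 * 2) x
    rw [iteratedDeriv_one, ← P.I.chi_pow_eq] at h1
    refine h1.trans ?_
    have := P.I.chi_pos x
    gcongr
    exact le_abs_self _
  -- the modulated packet in terms of the packet modulated from the center of its frequency interval
  set e : ℝ → ℂ := fun x => Complex.exp (-(Complex.I * (ξ - P.ω.center : ℝ) * x)) with he
  have hed : ∀ x, HasDerivAt e (-(Complex.I * (ξ - P.ω.center : ℝ)) * e x) x := by
    intro x
    have h1 : HasDerivAt (fun x : ℝ => -(Complex.I * (ξ - P.ω.center : ℝ) * (x : ℂ)))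
        (-(Complex.I * (ξ - P.ω.center : ℝ))) x := by
      have := ((Complex.ofRealCLM.hasDerivAt (x := x)).const_mul
        (Complex.I * (ξ - P.ω.center : ℝ))).neg
      rw [Complex.ofRealCLM_apply, Complex.ofReal_one, mul_one] at this
      exact this
    rw [mul_comm (-(Complex.I * (ξ - P.ω.center : ℝ)))]
    exact h1.cexp
  have hg : modulated P ξ φ = fun x => (P.I.length : ℂ) * (e x * h₀ x) := by
    ext x
    simp only [modulated, he, hh₀, hl']
    rw [← mul_assoc (Complex.exp _) (Complex.exp _), ← Complex.exp_add]
    congr 3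
    push_cast
    ring_nf
  have hen : ∀ x, ‖e x‖ = 1 := fun x => norm_exp_neg_I_mul _ _
  have hgd : ∀ x, HasDerivAt (modulated P ξ φ) ((P.I.length : ℂ) *
      (-(Complex.I * (ξ - P.ω.center : ℝ)) * e x * h₀ x + e x * deriv h₀ x)) x := by
    intro x
    rw [hg]
    exact ((hed x).mul (hh₀d x).hasDerivAt).const_mul _
  have hgb : ∀ x, ‖(P.I.length : ℂ) *
      (-(Complex.I * (ξ - P.ω.center : ℝ)) * e x * h₀ x + e x * deriv h₀ x)‖ ≤
      (D * a₀ + a₁) * P.I.length⁻¹ * P.I.chi x ^ 2 := by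
    intro x
    rw [norm_mul, Complex.norm_real, Real.norm_of_nonneg hl.le]
    have h1 : ‖-(Complex.I * (ξ - P.ω.center : ℝ)) * e x * h₀ x + e x * deriv h₀ x‖ ≤
        D * P.I.length⁻¹ * (a₀ * P.I.length⁻¹ * P.I.chi x ^ 2) +
          a₁ * (P.I.length ^ 2)⁻¹ * P.I.chi x ^ 2 := by
      refine (norm_add_le _ _).trans ?_
      rw [norm_mul _ (h₀ x), norm_mul _ (e x), norm_mul (e x), norm_neg, norm_mul, Complex.norm_I,
        one_mul, hen, mul_one, one_mul, Complex.norm_real, Real.norm_eq_abs, abs_sub_comm]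
      rw [hωl] at hξ
      have hc := P.I.chi_pos x
      have := hb₀ x
      have := hb₁ x
      gcongr
    calc P.I.length * ‖-(Complex.I * (ξ - P.ω.center : ℝ)) * e x * h₀ x + e x * deriv h₀ x‖
        ≤ P.I.length * (D * P.I.length⁻¹ * (a₀ * P.I.length⁻¹ * P.I.chi x ^ 2) +
          a₁ * (P.I.length ^ 2)⁻¹ * P.I.chi x ^ 2) := by gcongr
      _ = _ := by field_simp
  refine ⟨?_, fun x => ?_, fun x y hxy => ?_, ?_⟩
  · exact continuous_iff_continuousAt.2 fun x => (hgd x).continuousAt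
  · rw [hg]
    have hc := P.I.chi_pos x
    rw [norm_mul, norm_mul, hen, one_mul, Complex.norm_real, Real.norm_of_nonneg hl.le]
    calc P.I.length * ‖h₀ x‖ ≤ P.I.length * (a₀ * P.I.length⁻¹ * P.I.chi x ^ 2) := by
          have := hb₀ x
          gcongr
      _ = a₀ * P.I.chi x ^ 2 := by field_simp
      _ ≤ _ := by
          rw [hC]
          gcongr
          have : 0 ≤ D * a₀ + a₁ := by positivity
          linarith
  · have hc := P.I.chi_pos x
    have hbd : ∀ z ∈ uIcc x y, ‖(P.I.length : ℂ) *
        (-(Complex.I * (ξ - P.ω.center : ℝ)) * e z * h₀ z + e z * deriv h₀ z)‖ ≤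
        16 * (D * a₀ + a₁) * P.I.length⁻¹ * P.I.chi x := by
      intro z hz
      refine (hgb z).trans ?_
      have hzx : |z - x| ≤ P.I.length := by
        rw [abs_sub_comm] at hxy
        exact (abs_sub_left_of_mem_uIcc hz).trans hxy
      have h1 := P.I.chi_le_four_mul hzx
      have hz := P.I.chi_pos z
      have h2 : P.I.chi z ^ 2 ≤ 16 * P.I.chi x := by
        calc P.I.chi z ^ 2 ≤ (4 * P.I.chi x) ^ 2 := by gcongr
          _ = 16 * P.I.chi x ^ 2 := by ring
          _ ≤ 16 * P.I.chi x := by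
            have := P.I.chi_pow_le_chi_pow x one_le_two
            rw [pow_one] at this
            gcongr
      calc (D * a₀ + a₁) * P.I.length⁻¹ * P.I.chi z ^ 2
          ≤ (D * a₀ + a₁) * P.I.length⁻¹ * (16 * P.I.chi x) := by gcongr
        _ = _ := by ring
    have h1 := (convex_uIcc x y).norm_image_sub_le_of_norm_hasDerivWithin_le
      (fun z hz => (hgd z).hasDerivWithinAt) hbd right_mem_uIcc left_mem_uIcc
    refine h1.trans ?_
    rw [Real.norm_eq_abs, hC]
    calc 16 * (D * a₀ + a₁) * P.I.length⁻¹ * P.I.chi x * |x - y|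
        = 16 * (D * a₀ + a₁) * (|x - y| / P.I.length) * P.I.chi x := by
          rw [div_eq_mul_inv]; ring
      _ ≤ _ := by
          gcongr
          linarith
  · have h1 : fourierHat φ ξ = 0 := by
      by_contra hcon
      exact hξ' (h.fourier_support hcon)
    unfold fourierHat at h1
    have h2 : ((Real.sqrt (2 * Real.pi))⁻¹ : ℝ) ≠ 0 := by
      have := Real.pi_pos
      positivity
    have h3 := (mul_eq_zero.1 h1).resolve_left (by exact_mod_cast h2)
    unfold modulated
    rw [integral_const_mul]
    refine mul_eq_zero_of_right _ (Eq.trans (integral_congr_ae (Filter.Eventually.of_forall fun x => ?_)) h3)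
    dsimp only
    rw [mul_comm]
    ring_nf

/-! ### Exponents -/

/-- For sequences, the norms decrease in the exponent. -/
lemma rpow_sum_rpow_anti {ι : Type*} (T : Finset ι) (v : ι → ℝ) (hv : ∀ i ∈ T, 0 ≤ v i) {s r : ℝ} (hs : 0 < s)
    (hsr : s ≤ r) : (∑ i ∈ T, v i ^ r) ^ (1 / r) ≤ (∑ i ∈ T, v i ^ s) ^ (1 / s) := by
  have hr : 0 < r := hs.trans_le hsr
  set X := (∑ i ∈ T, v i ^ s) ^ (1 / s) with hX
  have hsum : 0 ≤ ∑ i ∈ T, v i ^ s := Finset.sum_nonneg fun i hi => Real.rpow_nonneg (hv i hi) _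
  have hX0 : 0 ≤ X := Real.rpow_nonneg hsum _
  have hXs : X ^ s = ∑ i ∈ T, v i ^ s := by
    rw [hX, ← Real.rpow_mul hsum, one_div_mul_cancel hs.ne', Real.rpow_one]
  have hvX : ∀ i ∈ T, v i ≤ X := by
    intro i hi
    rw [← Real.rpow_le_rpow_iff (hv i hi) hX0 hs, hXs]
    exact Finset.single_le_sum (f := fun i => v i ^ s) (fun i hi => Real.rpow_nonneg (hv i hi) _) hi
  have h1 : ∑ i ∈ T, v i ^ r ≤ X ^ r := by
    calc ∑ i ∈ T, v i ^ r ≤ ∑ i ∈ T, X ^ (r - s) * v i ^ s := by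
          refine Finset.sum_le_sum fun i hi => ?_
          have h2 := hv i hi
          calc v i ^ r = v i ^ (r - s) * v i ^ s := by
                rw [← Real.rpow_add_of_nonneg h2 (by linarith) hs.le, sub_add_cancel]
            _ ≤ _ := by
                have := hvX i hi
                have : 0 ≤ r - s := by linarith
                gcongr
      _ = X ^ r := by
          rw [← Finset.mul_sum, ← hXs, ← Real.rpow_add_of_nonneg hX0 (by linarith) hs.le, sub_add_cancel]
  calc (∑ i ∈ T, v i ^ r) ^ (1 / r) ≤ (X ^ r) ^ (1 / r) := by
        have h0 : 0 ≤ ∑ i ∈ T, v i ^ r := Finset.sum_nonneg fun i hi => Real.rpow_nonneg (hv i hi) _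
        gcongr
    _ = X := by rw [← Real.rpow_mul hX0, mul_one_div_cancel hr.ne', Real.rpow_one]

/-- The variation estimates in the form in which they enter the estimate of lacunary trees: the
variation exponent is dual to an exponent not less than `s`. -/
lemma exists_variation_exponent {s : ℝ} (hs1 : 1 ≤ s) (hs2 : s ≠ 2) :
    ∃ r' r : ℝ, r'.HolderConjugate r ∧ s ≤ r' ∧ ∀ C : ℝ, 0 ≤ C → ∃ K : ℝ, 0 ≤ K ∧
    ∀ (S : Finset Tile) (a : Tile → ℂ) (g : Tile → ℝ → ℂ) (k₁ : ℤ),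
    Set.InjOn Tile.I (S : Set Tile) → (∀ P ∈ S, Adapted C P.I (g P)) →
    ∀ t : Tile → ℝ, (∀ P, 0 ≤ t P) → (∀ P ∈ S, ‖a P‖ ≤ t P ^ (max 2 s - 1)) → ∀ η : ℝ, 0 < η →
    ∃ W : ℝ → ℝ≥0∞, Measurable W ∧
      IsVariationMajorant S Tile.I a g r k₁ (fun y => ENNReal.ofReal (η ^ (max 2 s - 1)) + W y) ∧
      ∫⁻ y, W y ≤ ENNReal.ofReal (K * (η⁻¹ * ∑ P ∈ S, 2 ^ P.I.scale * t P ^ max 2 s)) := by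
  rcases lt_or_gt_of_ne hs2 with hs | hs
  · rw [max_eq_left hs.le]
    -- any exponent in `[s, 2)` serves, as long as it is larger than one
    have hr' : 1 < (s + 2) / 2 := by linarith
    refine ⟨(s + 2) / 2, _, Real.HolderConjugate.conjExponent hr', by linarith, fun C hC => ?_⟩
    have hr : 2 < Real.conjExponent ((s + 2) / 2) := by
      rw [Real.conjExponent, lt_div_iff₀ (by linarith)]; linarith
    obtain ⟨K, hK, hvar⟩ := exists_variation_majorant_of_two_lt hC hr
    refine ⟨K, hK, fun S a g k₁ hinj hg t ht ha η hη => ?_⟩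
    obtain ⟨W, hW1, hW2, hW3⟩ := hvar S Tile.I a g k₁ hinj hg η hη
    norm_num at ha ⊢
    refine ⟨W, hW1, hW2, hW3.trans (ENNReal.ofReal_le_ofReal ?_)⟩
    rw [show (1 : ℝ) - 2 = -1 by norm_num, Real.rpow_neg_one]
    gcongr with P hP
    · exact le_rfl
    · simp only [Real.rpow_two]
      have := ha P hP
      gcongr
  · rw [max_eq_right hs.le]
    have hs' : 1 < s := by linarith
    refine ⟨s, _, Real.HolderConjugate.conjExponent hs', le_rfl, fun C hC => ?_⟩
    set r := Real.conjExponent s with hr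
    have hr' : r = s / (s - 1) := rfl
    have hpos : 0 < s - 1 := by linarith
    have hr1 : 1 < r := by rw [hr', lt_div_iff₀ hpos]; linarith
    have hr2 : r < 2 := by rw [hr', div_lt_iff₀ hpos]; linarith
    have e1 : (s - 1) * (1 - r) = -1 := by rw [hr']; field_simp; ring
    have e2 : (s - 1) * r = s := by rw [hr']; field_simp
    obtain ⟨K, hK, hvar⟩ := exists_variation_majorant_of_lt_two hC hr1 hr2
    refine ⟨K, hK, fun S a g k₁ hinj hg t ht ha η hη => ?_⟩
    obtain ⟨W, hW1, hW2, hW3⟩ := hvar S Tile.I a g k₁ hinj hg (η ^ (s - 1)) (by positivity)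
    refine ⟨W, hW1, hW2, hW3.trans (ENNReal.ofReal_le_ofReal ?_)⟩
    rw [← Real.rpow_mul hη.le, e1, Real.rpow_neg_one]
    gcongr with P hP
    · exact le_rfl
    · calc ‖a P‖ ^ r ≤ (t P ^ (s - 1)) ^ r := by
            have := ha P hP
            gcongr
        _ = t P ^ s := by rw [← Real.rpow_mul (ht P), e2]

/-! ### Lacunary trees -/

/-- The distance of two dyadic indices shrinks and keeps its sign when the scale increases. -/
lemma dy_sub_of_le {k l : ℤ} (h : k ≤ l) (x y : ℝ) :
    (0 ≤ dy k x - dy k y → 0 ≤ dy l x - dy l y ∧ dy l x - dy l y ≤ dy k x - dy k y) ∧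
      (dy k x - dy k y ≤ 0 → dy k x - dy k y ≤ dy l x - dy l y ∧ dy l x - dy l y ≤ 0) := by
  induction l, h using Int.leInduction with
  | base => exact ⟨fun h => ⟨h, le_rfl⟩, fun h => ⟨le_rfl, h⟩⟩
  | succ l _ ih =>
    rw [dy_succ, dy_succ]
    constructor
    · intro h
      have := ih.1 h
      omega
    · intro h
      have := ih.2 h
      omega

lemma dy_sub_eq_of_between {k₁ k k₂ : ℤ} (h₁ : k₁ ≤ k) (h₂ : k ≤ k₂) {x y : ℝ} {c : ℤ}
    (hc₁ : dy k₁ x - dy k₁ y = c) (hc₂ : dy k₂ x - dy k₂ y = c) : dy k x - dy k y = c := by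
  have e1 := dy_sub_of_le h₁ x y
  have e2 := dy_sub_of_le h₂ x y
  rcases le_total 0 c with hc | hc
  · have := e1.1 (by omega)
    have := e2.1 (by omega)
    omega
  · have := e1.2 (by omega)
    have := e2.2 (by omega)
    omega

/-- Points at a fixed number of dyadic intervals to the left of a given point move towards it. -/
lemma dy_sub_mul_mono {B : ℤ} (hB : 0 ≤ B) (ξ : ℝ) {l l' : ℤ} (h : l ≤ l') :
    ((dy (-l) ξ : ℝ) - B) * 2 ^ (-l) ≤ (dy (-l') ξ - B) * 2 ^ (-l') := by
  induction l', h using Int.leInduction with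
  | base => exact le_rfl
  | succ l' _ ih =>
    refine ih.trans ?_
    have h1 := dy_succ (-(l' + 1)) ξ
    rw [show -(l' + 1) + 1 = -l' by ring] at h1
    have h2 : (2 : ℝ) ^ (-l') = 2 * 2 ^ (-(l' + 1)) := by
      rw [← two_zpow_succ]; congr 1; ring
    have h3 : 2 * dy (-l') ξ ≤ dy (-(l' + 1)) ξ := by omega
    have h4 : 2 * (dy (-l') ξ : ℝ) ≤ dy (-(l' + 1)) ξ := by exact_mod_cast h3
    have h5 := two_zpow_pos (-(l' + 1))
    have h6 : (0 : ℝ) ≤ B := by exact_mod_cast hB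
    rw [h2]
    nlinarith [mul_le_mul_of_nonneg_right h4 h5.le]

namespace Linearization

variable {L : Linearization} {m n : ℤ} {s θ lam M : ℝ} {A : ℕ → ℕ → ℝ} {φ : Tile → ℝ → ℂ} {N : ℕ}
  {S : Finset Tile} {ξ : ℝ} {c : ℤ}

/-- The index `j` is active for the tiles of scale `l` in the lacunary tree with top frequency `ξ` and
offset `c`. -/
def ActiveAt (L : Linearization) (m n : ℤ) (ξ : ℝ) (c : ℤ) (j : ℕ) (x : ℝ) (l : ℤ) : Prop :=
  ENNReal.ofReal (2 ^ l) ≤ L.α j x ∧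
    L.Nf (j - 1) x < (dy (-l) ξ - (n + c + m - 1 : ℤ)) * 2 ^ (-l) ∧
    dy (-l) ξ - dy (-l) (L.Nf j x) = c

lemma active_iff {P : Tile} (hc : dy (-P.I.scale) ξ = P.ω.pos + n + c) (j : ℕ) (x : ℝ) :
    L.Active m n P j x ↔ L.ActiveAt m n ξ c j x P.I.scale := by
  unfold Active ActiveAt
  rw [P.mem_lower, P.mem_upper, DyadicInterval.length]
  have e1 : (dy (-P.I.scale) ξ : ℝ) - ((n + c + m - 1 : ℤ) : ℝ) = P.ω.pos + 1 - m := by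
    rw [hc]; push_cast; ring
  rw [e1]
  refine and_congr_right fun _ => and_congr_right fun _ => ?_
  omega

/-- The scales at which a given index is active form an interval. -/
lemma ActiveAt.of_between (hB : 0 ≤ n + c + m - 1) {j : ℕ} {x : ℝ} {l₁ l l₂ : ℤ} (h₁ : l₁ ≤ l) (h₂ : l ≤ l₂)
    (ha₁ : L.ActiveAt m n ξ c j x l₁) (ha₂ : L.ActiveAt m n ξ c j x l₂) :
    L.ActiveAt m n ξ c j x l :=
  ⟨(ENNReal.ofReal_le_ofReal (two_zpow_mono h₂)).trans ha₂.1,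
    ha₁.2.1.trans_le (dy_sub_mul_mono hB ξ h₁),
    dy_sub_eq_of_between (neg_le_neg h₂) (neg_le_neg h₁) ha₂.2.2 ha₁.2.2⟩

/-- At a given scale, at most one index is active. -/
lemma ActiveAt.unique (hmn : 1 ≤ m + n) {i j : ℕ} {x : ℝ} {l : ℤ}
    (hi : L.ActiveAt m n ξ c i x l) (hj : L.ActiveAt m n ξ c j x l) : i = j := by
  have key : ∀ {i j : ℕ}, L.ActiveAt m n ξ c i x l → L.ActiveAt m n ξ c j x l → ¬ i < j := by
    intro i j hi hj hij
    have h1 := (dy_bounds (-l) (L.Nf i x)).1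
    have h2 := hj.2.1
    have h3 : L.Nf i x ≤ L.Nf (j - 1) x := L.monotone_Nf x (show i ≤ j - 1 by omega)
    have h4 : dy (-l) (L.Nf i x) = dy (-l) ξ - c := by have := hi.2.2; omega
    rw [h4] at h1
    have h5 := two_zpow_pos (-l)
    have h6 : (1 : ℝ) ≤ m + n := by exact_mod_cast hmn
    push_cast at h1 h2
    nlinarith
  have h1 := key hi hj
  have h2 := key hj hi
  omega

/-- The tiles of a lacunary tree that have the same offset from the top frequency form a tree with
controlled frequency geometry. -/
lemma freqTree_of_lacunary (hn : 501 ≤ n) {C₀ : ℝ} (hC : 2 * n + 200 ≤ C₀) {𝔓 : Set Tile}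
    (hsp : Sparse C₀ 𝔓) (hS : (S : Set Tile) ⊆ 𝔓) (hξ : ∀ P ∈ S, ξ ∈ (P.upper n).dilate 50)
    (hc : ∀ P ∈ S, dy (-P.I.scale) ξ = P.ω.pos + n + c) : FreqTree n S ξ := by
  have hn' : (501 : ℝ) ≤ n := by exact_mod_cast hn
  have hω : ∀ P ∈ S, ∀ Q ∈ S, P.I.scale = Q.I.scale → P.ω = Q.ω := by
    intro P hP Q hQ hPQ
    have h1 := hc P hP
    have h2 := hc Q hQ
    have h3 : P.ω.scale = Q.ω.scale := by rw [P.ω_scale, Q.ω_scale, hPQ]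
    rw [hPQ] at h1
    have h4 : P.ω.pos = Q.ω.pos := by omega
    cases hP' : P.ω; cases hQ' : Q.ω
    simp only [hP', hQ'] at h3 h4
    rw [h3, h4]
  have hmem : ∀ P ∈ S, ξ ∈ P.omegaTilde n := fun P hP =>
    subset_convexHull ℝ _ (Or.inr (hξ P hP))
  refine ⟨hω, fun P hP Q hQ hPQ y hy => ?_, hmem⟩
  rcases hPQ.eq_or_lt with h | h
  · refine P.upper_subset_omegaTilde (by omega) ?_
    rw [Tile.mem_upper] at hy ⊢
    rw [hω P hP Q hQ h, h]; exact hy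
  · have hgap := hsp.gap (by linarith) (hS hP) (hS hQ) h
    have hv := two_zpow_pos (-Q.I.scale - 1)
    have hv' := two_zpow_pos (-P.I.scale - 1)
    have h1 := Q.mem_upper_iff.1 hy
    have h2 := Q.mem_dilate_upper_iff.1 (hξ Q hQ)
    have h3 := P.mem_dilate_upper_iff.1 (hξ P hP)
    have hy1 : ξ - 2 ^ (-P.I.scale - 1) < y := by nlinarith
    have hy2 : y < ξ + 2 ^ (-P.I.scale - 1) := by nlinarith
    rcases le_or_gt 0 c with hc0 | hc0
    · -- the interval is not to the right of the dyadic interval that contains the top frequency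
      have e1 : dy (-Q.I.scale) y ≤ dy (-Q.I.scale) ξ := by
        have := Q.mem_upper n |>.1 hy
        have := hc Q hQ
        omega
      have e2 : dy (-P.I.scale - 1) y ≤ dy (-P.I.scale - 1) ξ := by
        have hle : -Q.I.scale ≤ -P.I.scale - 1 := by omega
        rcases le_total (dy (-Q.I.scale) ξ) (dy (-Q.I.scale) y) with h' | h'
        · exact (dy_congr_of_le hle (le_antisymm e1 h')).le
        · have := ((dy_sub_of_le hle y ξ).2 (by omega)).2
          omega
      have e3 := (P.mem_dilate_upper n).1 (hξ P hP)
      have e4 : y < (2 * (P.ω.pos + n) + 51) * 2 ^ (-P.I.scale - 1) := by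
        have h5 := (dy_bounds (-P.I.scale - 1) y).2
        have h6 : dy (-P.I.scale - 1) y + 1 ≤ 2 * (P.ω.pos + n) + 51 := by omega
        have h7 : (dy (-P.I.scale - 1) y : ℝ) + 1 ≤ 2 * (P.ω.pos + n) + 51 := by exact_mod_cast h6
        exact h5.trans_le (mul_le_mul_of_nonneg_right h7 hv'.le)
      rw [P.mem_omegaTilde_iff (by omega)]
      exact ⟨by nlinarith, e4⟩
    · have e1 := (dy_bounds (-P.I.scale) ξ).2
      rw [hc P hP] at e1
      have e2 : (P.ω.pos + n + c : ℤ) + 1 ≤ P.ω.pos + n := by omega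
      have e3 : ((P.ω.pos + n + c : ℤ) : ℝ) + 1 ≤ P.ω.pos + n := by exact_mod_cast e2
      have e4 : (2 : ℝ) ^ (-P.I.scale) = 2 * 2 ^ (-P.I.scale - 1) := by
        rw [← two_zpow_succ, sub_add_cancel]
      rw [e4] at e1
      rw [P.mem_omegaTilde_iff (by omega)]
      exact ⟨by nlinarith, by nlinarith⟩

/-- A sum of modified wave packets of a lacunary tree is a sum over the active indices of sums of
unmodified wave packets over intervals of scales. -/
lemma exists_scale_intervals (hmn : 1 ≤ m + n) (hB : 0 ≤ n + c + m - 1)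
    (hc : ∀ P ∈ S, dy (-P.I.scale) ξ = P.ω.pos + n + c) {k₁ : ℤ} (hk₁ : ∀ P ∈ S, P.I.scale ≤ k₁)
    (a : Tile → ℂ) (k : ℤ) (x : ℝ) :
    ∃ (T : Finset ℕ) (lo hi : ℕ → ℤ), T ⊆ Finset.Icc 1 (L.K x) ∧
      (∀ j ∈ T, L.Nf j x ∈ window n S k) ∧ (∀ j ∈ T, k ≤ lo j ∧ lo j ≤ hi j ∧ hi j ≤ k₁) ∧
      (∀ i ∈ T, ∀ j ∈ T, i ≠ j → Disjoint (Ioc (lo i) (hi i)) (Ioc (lo j) (hi j))) ∧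
      ∑ P ∈ S with k < P.I.scale, a P * ((2 : ℝ) ^ P.I.scale : ℝ) * (L.coeff m n P x * φ P x) =
        ∑ j ∈ T, L.d j x * (Complex.exp (Complex.I * ξ * x) *
          scaleSum S Tile.I a (fun P => modulated P ξ (φ P)) (lo j) (hi j) x) := by
  classical
  set act : ℕ → Finset Tile := fun j => S.filter fun P => k < P.I.scale ∧ L.Active m n P j x with hact
  set T := (Finset.Icc 1 (L.K x)).filter fun j => (act j).Nonempty with hT
  have hex : ∀ j, ∃ lo hi : ℤ, j ∈ T → (k ≤ lo ∧ lo ≤ hi ∧ hi ≤ k₁) ∧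
      (∀ l ∈ Ioc lo hi, L.ActiveAt m n ξ c j x l) ∧
      (S.filter fun P => lo < P.I.scale ∧ P.I.scale ≤ hi) = act j := by
    intro j
    by_cases hj : j ∈ T
    · have hne := (Finset.mem_filter.1 hj).2
      obtain ⟨P₁, hP₁, hmin⟩ := Finset.exists_min_image (act j) (fun P => P.I.scale) hne
      obtain ⟨P₂, hP₂, hmax⟩ := Finset.exists_max_image (act j) (fun P => P.I.scale) hne
      obtain ⟨hS₁, hk, ha₁⟩ := Finset.mem_filter.1 hP₁
      obtain ⟨hS₂, -, ha₂⟩ := Finset.mem_filter.1 hP₂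
      rw [active_iff (hc _ hS₁)] at ha₁
      rw [active_iff (hc _ hS₂)] at ha₂
      have hbet : ∀ l ∈ Ioc (P₁.I.scale - 1) P₂.I.scale, L.ActiveAt m n ξ c j x l := fun l hl =>
        ha₁.of_between hB (by have := hl.1; omega) hl.2 ha₂
      have h12 := hmin P₂ hP₂
      refine ⟨P₁.I.scale - 1, P₂.I.scale, fun _ => ⟨⟨by omega, by omega, hk₁ _ hS₂⟩, hbet, ?_⟩⟩
      ext P
      simp only [hact, Finset.mem_filter]
      refine and_congr_right fun hPS => ⟨fun h => ⟨by omega, ?_⟩, fun h => ?_⟩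
      · rw [active_iff (hc _ hPS)]
        exact hbet _ h
      · have hP : P ∈ act j := Finset.mem_filter.2 ⟨hPS, h⟩
        have := hmin P hP
        have := hmax P hP
        omega
    · exact ⟨0, 0, fun h => absurd h hj⟩
  choose lo hi hlohi using hex
  refine ⟨T, lo, hi, Finset.filter_subset _ _, fun j hj => ?_, fun j hj => (hlohi j hj).1,
    fun i hi' j hj hij => ?_, ?_⟩
  · obtain ⟨P, hP⟩ := (Finset.mem_filter.1 hj).2
    obtain ⟨hPS, hk, ha⟩ := Finset.mem_filter.1 hP
    exact ⟨P, hPS, hk, ha.2.2⟩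
  · refine Set.disjoint_left.2 fun l h1 h2 => hij ?_
    exact ((hlohi i hi').2.1 l h1).unique hmn ((hlohi j hj).2.1 l h2)
  · calc ∑ P ∈ S with k < P.I.scale, a P * ((2 : ℝ) ^ P.I.scale : ℝ) * (L.coeff m n P x * φ P x)
        = ∑ P ∈ S with k < P.I.scale, ∑ j ∈ Finset.Icc 1 (L.K x),
          if L.Active m n P j x then L.d j x * (a P * ((2 : ℝ) ^ P.I.scale : ℝ) * φ P x) else 0 := by
          refine Finset.sum_congr rfl fun P _ => ?_
          unfold coeff
          rw [Finset.sum_mul, Finset.mul_sum]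
          refine Finset.sum_congr rfl fun j _ => ?_
          split_ifs
          · ring
          · ring
      _ = ∑ j ∈ Finset.Icc 1 (L.K x), ∑ P ∈ act j, L.d j x * (a P * ((2 : ℝ) ^ P.I.scale : ℝ) * φ P x) := by
          rw [Finset.sum_comm]
          refine Finset.sum_congr rfl fun j _ => ?_
          rw [← Finset.sum_filter, Finset.filter_filter]
      _ = ∑ j ∈ T, ∑ P ∈ act j, L.d j x * (a P * ((2 : ℝ) ^ P.I.scale : ℝ) * φ P x) := by
          rw [hT, Finset.sum_filter]
          refine Finset.sum_congr rfl fun j _ => ?_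
          split_ifs with h
          · rfl
          · rw [Finset.not_nonempty_iff_eq_empty.1 h, Finset.sum_empty]
      _ = _ := by
          refine Finset.sum_congr rfl fun j hj => ?_
          rw [scaleSum, (hlohi j hj).2.2, ← Finset.mul_sum]
          congr 1
          rw [Finset.mul_sum]
          refine Finset.sum_congr rfl fun P _ => ?_
          unfold modulated
          have : Complex.exp (Complex.I * ξ * x) * Complex.exp (-(Complex.I * ξ * x)) = 1 := by
            rw [← Complex.exp_add, add_neg_cancel, Complex.exp_zero]
          calc a P * ((2 : ℝ) ^ P.I.scale : ℝ) * φ P x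
              = (Complex.exp (Complex.I * ξ * x) * Complex.exp (-(Complex.I * ξ * x))) *
                (a P * ((2 : ℝ) ^ P.I.scale : ℝ) * φ P x) := by rw [this, one_mul]
            _ = _ := by ring

/-- The tree estimate for a lacunary tree whose tiles all have the same offset from the top
frequency. -/
theorem exists_lacunary_estimate (A : ℕ → ℕ → ℝ) (N : ℕ) (n : ℤ) {s : ℝ} (hs1 : 1 ≤ s) (hs2 : s ≠ 2) :
    ∃ κ : ℝ, ∀ {L : Linearization} {m : ℤ} {θ lam M : ℝ} {φ : Tile → ℝ → ℂ} {S : Finset Tile} {ξ : ℝ}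
      {c : ℤ}, L.Admissible m n s θ lam M A N φ S → ∀ {C₀ : ℝ}, 2 * n + 200 ≤ C₀ →
      ∀ {𝔓 : Set Tile}, Sparse C₀ 𝔓 → (S : Set Tile) ⊆ 𝔓 → (∀ P ∈ S, ξ ∈ (P.upper n).dilate 50) →
      (∀ P ∈ S, dy (-P.I.scale) ξ = P.ω.pos + n + c) → ∀ k p : ℤ,
      ∑ P ∈ S with P.I.scale ≤ k ∧ dy k P.I.center = p, 2 ^ P.I.scale *
          ‖∫ x, L.f x * (starRingEnd ℂ) (L.coeff m n P x * φ P x)‖ ^ max 2 s ≤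
        treeConst (treeHypConst A N n κ) (max 2 s) * lam ^ max 2 s * 2 ^ k := by
  obtain ⟨r', r, hrr, hsr, hvar⟩ := exists_variation_exponent hs1 hs2
  obtain ⟨K, hK, hvar⟩ := hvar (packetConst A n) (packetConst_nonneg A n)
  refine ⟨K + 1, ?_⟩
  intro L m θ lam M φ S ξ c h C₀ hC 𝔓 hsp hS hξ hc k p
  classical
  rcases S.eq_empty_or_nonempty with rfl | ⟨P₀, hP₀⟩
  · rw [Finset.filter_empty, Finset.sum_empty]
    have h1 := chiSum_nonneg
    have h2 := geomInt_nonneg (r := 1 / 2) (by norm_num)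
    have h3 := chiMass_nonneg
    have h4 := treeHypConst_pos A N n (K + 1)
    have h5 := h.lam_pos
    have h6 := two_zpow_pos k
    unfold treeConst
    positivity
  have hn := h.n_le
  have hm := h.m_le
  have hn' : (501 : ℝ) ≤ n := by exact_mod_cast hn
  have hmn : 1 ≤ m + n := by omega
  have hB : 0 ≤ n + c + m - 1 := by
    have h1 := (P₀.mem_dilate_upper n).1 (hξ P₀ hP₀)
    have h2 := hc P₀ hP₀
    have h3 := dy_sub_one_eq (-P₀.I.scale) ξ
    omega
  have hT := freqTree_of_lacunary hn hC hsp hS hξ hc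
  have hadapted : ∀ P ∈ S, Adapted (packetConst A n) P.I (modulated P ξ (φ P)) := by
    intro P hP
    have h1 := P.mem_dilate_upper_iff.1 (hξ P hP)
    have hv := two_zpow_pos (-P.I.scale - 1)
    refine (h.packet P hP).adapted ?_ fun hcon => ?_
    · rw [abs_of_nonneg (show (0 : ℝ) ≤ n by linarith), abs_le, DyadicInterval.center, P.ω_length_eq]
      constructor <;> nlinarith
    · have h2 := hcon.2
      rw [DyadicInterval.center, P.ω_length_eq] at h2
      nlinarith
  obtain ⟨k₁, hk₁⟩ : ∃ k₁ : ℤ, ∀ P ∈ S, P.I.scale ≤ k₁ := by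
    obtain ⟨b, hb⟩ := (S.image fun P => P.I.scale).bddAbove
    exact ⟨b, fun P hP =>
      hb (Finset.mem_coe.2 (Finset.mem_image_of_mem (fun P : Tile => P.I.scale) hP))⟩
  refine tree_estimate (h.treeHyp hT (by positivity) ?_) (treeHypConst_pos _ _ _ _) h.lam_pos
    h.θ_pos.le h.M_pos h.θM_le (le_max_of_le_left one_le_two) k p
  intro t a ht ha η hη
  obtain ⟨W, hW1, hW2, hW3⟩ := hvar S a (fun P => modulated P ξ (φ P)) k₁ hT.injOn hadapted t ht ha η hη
  have h0 : 0 ≤ ∑ P ∈ S, 2 ^ P.I.scale * t P ^ max 2 s := Finset.sum_nonneg fun P _ =>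
    mul_nonneg (two_zpow_pos _).le (Real.rpow_nonneg (ht P) _)
  refine ⟨W, hW1, hW3.trans (ENNReal.ofReal_le_ofReal ?_), fun k x y hxy => ?_⟩
  · gcongr
    linarith
  obtain ⟨T, lo, hi, hTK, hTw, hlohi, hdisj, heq⟩ :=
    exists_scale_intervals (L := L) (φ := φ) hmn hB hc hk₁ a k x
  rw [heq]
  set V : ℕ → ℂ := fun j => scaleSum S Tile.I a (fun P => modulated P ξ (φ P)) (lo j) (hi j) x with hV
  -- Hölder's inequality in the index, with the variation exponent on the wave packets
  have h1 : ‖∑ j ∈ T, L.d j x * (Complex.exp (Complex.I * ξ * x) * V j)‖ ≤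
      (∑ j ∈ T, ‖L.d j x‖ ^ s) ^ (1 / s) * (∑ j ∈ T, ‖V j‖ ^ r) ^ (1 / r) := by
    have hexp : ‖Complex.exp (Complex.I * ξ * x)‖ = 1 := by
      rw [show Complex.I * ξ * x = ((ξ * x : ℝ) : ℂ) * Complex.I by push_cast; ring]
      exact Complex.norm_exp_ofReal_mul_I _
    calc ‖∑ j ∈ T, L.d j x * (Complex.exp (Complex.I * ξ * x) * V j)‖
        ≤ ∑ j ∈ T, ‖L.d j x‖ * ‖V j‖ := by
          refine (norm_sum_le _ _).trans (Finset.sum_le_sum fun j _ => ?_)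
          rw [norm_mul, norm_mul, hexp, one_mul]
      _ ≤ (∑ j ∈ T, ‖L.d j x‖ ^ r') ^ (1 / r') * (∑ j ∈ T, ‖V j‖ ^ r) ^ (1 / r) :=
          Real.inner_le_Lp_mul_Lq_of_nonneg T hrr (fun _ _ => norm_nonneg _) fun _ _ => norm_nonneg _
      _ ≤ _ := by
          have := rpow_sum_rpow_anti T (fun j => ‖L.d j x‖) (fun _ _ => norm_nonneg _)
            (by linarith : 0 < s) hsr
          have h2 : 0 ≤ ∑ j ∈ T, ‖V j‖ ^ r := Finset.sum_nonneg fun j _ =>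
            Real.rpow_nonneg (norm_nonneg _) _
          gcongr
  have h2 : ENNReal.ofReal ((∑ j ∈ T, ‖V j‖ ^ r) ^ (1 / r)) ≤
      ENNReal.ofReal (η ^ (max 2 s - 1)) + W y := hW2 k x y hxy T lo hi hlohi hdisj
  have h3 : ‖L.f x‖ₑ * ENNReal.ofReal ((∑ j ∈ T, ‖L.d j x‖ ^ s) ^ (1 / s)) ≤
      L.visible s (window n S k) x := by
    unfold visible
    have hs0 : 0 ≤ 1 / s := by positivity
    rw [← ENNReal.ofReal_rpow_of_nonneg (Finset.sum_nonneg fun j _ =>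
      Real.rpow_nonneg (norm_nonneg _) _) hs0]
    gcongr
    rw [ENNReal.ofReal_sum_of_nonneg fun j _ => Real.rpow_nonneg (norm_nonneg _) _]
    refine le_trans (Finset.sum_le_sum fun j hj => ?_)
      (Finset.sum_le_sum_of_subset hTK)
    rw [indicator_of_mem (hTw j hj), ← ofReal_norm, ENNReal.ofReal_rpow_of_nonneg (norm_nonneg _)
      (by linarith)]
  calc ‖L.f x‖ₑ * ‖∑ j ∈ T, L.d j x * (Complex.exp (Complex.I * ξ * x) * V j)‖ₑ
      ≤ ‖L.f x‖ₑ * (ENNReal.ofReal ((∑ j ∈ T, ‖L.d j x‖ ^ s) ^ (1 / s)) *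
        ENNReal.ofReal ((∑ j ∈ T, ‖V j‖ ^ r) ^ (1 / r))) := by
        gcongr
        have h4 : 0 ≤ ∑ j ∈ T, ‖L.d j x‖ ^ s := Finset.sum_nonneg fun j _ =>
          Real.rpow_nonneg (norm_nonneg _) _
        rw [← ENNReal.ofReal_mul (by positivity), ← ofReal_norm]
        exact ENNReal.ofReal_le_ofReal h1
    _ ≤ L.visible s (window n S k) x * (ENNReal.ofReal (η ^ (max 2 s - 1)) + W y) := by
        rw [← mul_assoc]
        exact mul_le_mul' h3 h2
    _ ≤ _ := by
        gcongr
        exact le_mul_of_one_le_left (by positivity) (by linarith)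

end Linearization

/-! ### Sizes outside the exceptional set -/

lemma scale_le_of_subset {J J' : DyadicInterval} (h : J.toSet ⊆ J'.toSet) :
    J.scale ≤ J'.scale ∧ dy J'.scale J.center = J'.pos := by
  rw [J.toSet_eq, J'.toSet_eq] at h
  constructor
  · by_contra hcon
    have h1 := measure_mono (μ := volume) h
    rw [volume_dyI, volume_dyI, ENNReal.ofReal_le_ofReal_iff (two_zpow_pos _).le] at h1
    exact absurd (zpow_lt_zpow_right₀ (one_lt_two (α := ℝ)) (not_le.1 hcon)) (not_lt.2 h1)
  · exact h (show J.center ∈ dyI J.scale J.pos from J.dy_center)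

open scoped Classical in
/-- Averages over trees inside a finite collection are finite sums. -/
lemma tree_average_le {𝔓 : Finset Tile} {S : Set Tile} (hS : S ⊆ 𝔓) {g : Tile → ℂ} {τ B : ℝ}
    (hτ : 0 < τ) (J : DyadicInterval)
    (h : ∑ P ∈ 𝔓 with P ∈ S ∧ g P ≠ 0, 2 ^ P.I.scale * ‖g P‖ ^ τ ≤ B * 2 ^ J.scale) :
    (ENNReal.ofReal J.length)⁻¹ * ∑' P : S, ‖g P‖ₑ ^ τ * ENNReal.ofReal P.1.I.length ≤
      ENNReal.ofReal B := by
  have h1 : ∑' P : S, ‖g P‖ₑ ^ τ * ENNReal.ofReal P.1.I.length =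
      ENNReal.ofReal (∑ P ∈ 𝔓 with P ∈ S ∧ g P ≠ 0, 2 ^ P.I.scale * ‖g P‖ ^ τ) := by
    rw [tsum_subtype S fun P => ‖g P‖ₑ ^ τ * ENNReal.ofReal P.I.length,
      tsum_eq_sum (s := 𝔓.filter fun P => P ∈ S ∧ g P ≠ 0), ENNReal.ofReal_sum_of_nonneg]
    · refine Finset.sum_congr rfl fun P hP => ?_
      have hPS := (Finset.mem_filter.1 hP).2.1
      rw [indicator_of_mem hPS, mul_comm, ENNReal.ofReal_mul (two_zpow_pos _).le, ← ofReal_norm,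
        ENNReal.ofReal_rpow_of_nonneg (norm_nonneg _) hτ.le]
      rfl
    · exact fun P _ => mul_nonneg (two_zpow_pos _).le (Real.rpow_nonneg (norm_nonneg _) _)
    · intro P hP
      by_cases hPS : P ∈ S
      · rw [indicator_of_mem hPS]
        have : g P = 0 := by
          by_contra hg
          exact hP (Finset.mem_filter.2 ⟨hS hPS, hPS, hg⟩)
        rw [this, enorm_zero, ENNReal.zero_rpow_of_pos hτ, zero_mul]
      · rw [indicator_of_notMem hPS]
  have hl : 0 < J.length := J.length_pos
  rw [h1, ← ENNReal.ofReal_inv_of_pos hl, ← ENNReal.ofReal_mul (by positivity)]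
  refine ENNReal.ofReal_le_ofReal ?_
  rw [inv_mul_le_iff₀ hl, mul_comm]
  exact h

namespace Linearization

/-- The exceptional set: the tiles near selected rectangles. -/
def exceptional (L : Linearization) (n : ℤ) (s θ lam : ℝ) (𝔓 : Set Tile) : Set Tile :=
  {P ∈ 𝔓 | ¬ L.Unselected n s θ lam P}

open scoped Classical in
/-- Outside the exceptional set, the size is controlled. -/
theorem exists_outsup_le (A : ℕ → ℕ → ℝ) (N : ℕ) (n : ℤ) {s : ℝ} (hs1 : 1 ≤ s) (hs2 : s ≠ 2) :
    ∃ C : ℝ, 0 < C ∧ ∀ {L : Linearization} {m : ℤ} {θ lam M : ℝ} {φ : Tile → ℝ → ℂ} {𝔓 : Finset Tile}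
      {q' : ℝ≥0∞}, q' ≠ ∞ → q'.toReal = max 2 s →
      L.Admissible m n s θ lam M A N φ (𝔓.filter fun P => L.Unselected n s θ lam P) →
      ∀ {C₀ : ℝ}, 2 * n + 200 ≤ C₀ → Sparse C₀ (𝔓 : Set Tile) →
      outsup (generatingSets n 𝔓) (embedSize n q') (((𝔓 : Set Tile) \
        L.exceptional n s θ lam 𝔓).indicator (T₂ m n φ L.K L.Nf L.d L.α L.f)) ≤
        ENNReal.ofReal (C * lam) := by
  obtain ⟨κ, hlac⟩ := exists_lacunary_estimate A N n hs1 hs2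
  set τ := max 2 s with hτ
  have hτ0 : 0 < τ := lt_max_of_lt_left two_pos
  set C₁ := |treeConst (treeHypConst A N n (|A 0 (2 * 1)| * chiSum)) 1| with hC₁
  set C₂ := |treeConst (treeHypConst A N n κ) τ| with hC₂
  refine ⟨C₁ + (51 * C₂) ^ (1 / τ) + 1, by positivity, ?_⟩
  intro L m θ lam M φ 𝔓 q' hq' hq'τ h C₀ hC hsp
  have hlam := h.lam_pos
  have hn := h.n_le
  have hn' : (501 : ℝ) ≤ n := by exact_mod_cast hn
  set U := 𝔓.filter fun P => L.Unselected n s θ lam P with hU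
  set g := ((𝔓 : Set Tile) \ L.exceptional n s θ lam 𝔓).indicator
    (T₂ m n φ L.K L.Nf L.d L.α L.f) with hg
  have hgT : ∀ P, g P ≠ 0 → P ∈ U ∧
      g P = ∫ x, L.f x * (starRingEnd ℂ) (L.coeff m n P x * φ P x) := by
    intro P hP
    have h1 : P ∈ (𝔓 : Set Tile) \ L.exceptional n s θ lam 𝔓 := mem_of_indicator_ne_zero hP
    refine ⟨Finset.mem_filter.2 ⟨h1.1, ?_⟩, ?_⟩
    · by_contra hcon
      exact h1.2 ⟨h1.1, hcon⟩
    · rw [hg, indicator_of_mem h1, T₂_eq]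
  -- the tiles of a tree on which the function does not vanish
  have hsub : ∀ {S : Set Tile}, S ⊆ 𝔓 → ∀ {J : DyadicInterval} {ξ : ℝ}, IsGenerating n S J ξ →
      ∀ P ∈ 𝔓.filter fun P => P ∈ S ∧ g P ≠ 0, P ∈ U ∧ P ∈ S ∧ P.I.scale ≤ J.scale ∧
        dy J.scale P.I.center = J.pos ∧
        g P = ∫ x, L.f x * (starRingEnd ℂ) (L.coeff m n P x * φ P x) := by
    intro S hS J ξ hgen P hP
    obtain ⟨hP1, hP2, hP3⟩ := Finset.mem_filter.1 hP
    have h1 := scale_le_of_subset (hgen.2 P hP2).1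
    exact ⟨(hgT P hP3).1, hP2, h1.1, h1.2, (hgT P hP3).2⟩
  have hUP : (U : Set Tile) ⊆ 𝔓 := Finset.coe_subset.2 (Finset.filter_subset _ _)
  unfold outsup
  refine iSup₂_le fun E hE => ?_
  unfold embedSize
  have hover : treeSize (IsOverlapping n) 1 g E ≤ ENNReal.ofReal (C₁ * lam) := by
    unfold treeSize
    rw [if_neg ENNReal.one_ne_top]
    refine iSup₂_le fun S hSE => iSup₂_le fun J ξ => iSup_le fun hS => ?_
    have hS𝔓 := hSE.trans hE.1
    rw [ENNReal.toReal_one, one_div_one, ENNReal.rpow_one]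
    refine tree_average_le hS𝔓 one_pos J ?_
    set S₀ := 𝔓.filter fun P => P ∈ S ∧ g P ≠ 0 with hS₀
    have hin := hsub hS𝔓 hS.1
    have h1 := overlapping_estimate (S := S₀) (h.mono fun P hP => (hin P hP).1) hC hsp
      (fun P hP => hUP (hin P hP).1) (fun P hP => hS.2 P (hin P hP).2.1) J.scale J.pos
    rw [Finset.filter_true_of_mem fun P hP => ⟨(hin P hP).2.2.1, (hin P hP).2.2.2.1⟩] at h1
    rw [Finset.sum_congr rfl fun P hP => by rw [(hin P hP).2.2.2.2]]
    refine h1.trans ?_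
    rw [Real.rpow_one]
    have := two_zpow_pos J.scale
    gcongr
    exact le_abs_self _
  have hlacu : treeSize (IsLacunary n) q' g E ≤ ENNReal.ofReal ((51 * C₂) ^ (1 / τ) * lam) := by
    unfold treeSize
    rw [if_neg hq', hq'τ]
    refine iSup₂_le fun S hSE => iSup₂_le fun J ξ => iSup_le fun hS => ?_
    have hS𝔓 := hSE.trans hE.1
    set S₀ := 𝔓.filter fun P => P ∈ S ∧ g P ≠ 0 with hS₀
    have hin := hsub hS𝔓 hS.1
    have hsum : ∑ P ∈ S₀, 2 ^ P.I.scale * ‖g P‖ ^ τ ≤ 51 * C₂ * lam ^ τ * 2 ^ J.scale := by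
      -- the top frequency is in one of 51 dyadic intervals around the upper interval of a tile
      set off : Tile → ℤ := fun P => dy (-P.I.scale) ξ - P.ω.pos - n with hoff
      have hmaps : ∀ P ∈ S₀, off P ∈ Finset.Icc (-25 : ℤ) 25 := by
        intro P hP
        have h1 := (P.mem_dilate_upper n).1 (hS.2 P (hin P hP).2.1)
        have h2 := dy_sub_one_eq (-P.I.scale) ξ
        simp only [hoff, Finset.mem_Icc]
        omega
      rw [← Finset.sum_fiberwise_of_maps_to hmaps]
      calc _ ≤ ∑ c ∈ Finset.Icc (-25 : ℤ) 25, C₂ * lam ^ τ * 2 ^ J.scale := by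
            refine Finset.sum_le_sum fun c _ => ?_
            have hsc : (S₀.filter fun P => off P = c) ⊆ S₀ := Finset.filter_subset _ _
            have h1 := hlac (S := S₀.filter fun P => off P = c) (ξ := ξ) (c := c)
              (h.mono fun P hP => (hin P (hsc hP)).1) hC hsp
              (fun P hP => hUP (hin P (hsc hP)).1) (fun P hP => hS.2 P (hin P (hsc hP)).2.1)
              (fun P hP => by
                have := (Finset.mem_filter.1 hP).2
                simp only [hoff] at this
                omega) J.scale J.pos
            rw [Finset.filter_true_of_mem fun P hP =>
              ⟨(hin P (hsc hP)).2.2.1, (hin P (hsc hP)).2.2.2.1⟩] at h1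
            rw [Finset.sum_congr rfl fun P hP => by rw [(hin P (hsc hP)).2.2.2.2]]
            refine h1.trans ?_
            have := two_zpow_pos J.scale
            gcongr
            exact le_abs_self _
        _ = _ := by
            rw [Finset.sum_const, Int.card_Icc, nsmul_eq_mul,
              show ((25 : ℤ) + 1 - -25).toNat = 51 from rfl]
            push_cast
            ring
    have hC₂0 : 0 ≤ C₂ := abs_nonneg _
    calc ((ENNReal.ofReal J.length)⁻¹ *
          ∑' P : S, ‖g P‖ₑ ^ τ * ENNReal.ofReal P.1.I.length) ^ (1 / τ)
        ≤ ENNReal.ofReal (51 * C₂ * lam ^ τ) ^ (1 / τ) := by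
          gcongr
          exact tree_average_le hS𝔓 hτ0 J hsum
      _ = _ := by
          rw [ENNReal.ofReal_rpow_of_nonneg (by positivity) (by positivity),
            Real.mul_rpow (by positivity) (by positivity), ← Real.rpow_mul hlam.le,
            mul_one_div_cancel hτ0.ne', Real.rpow_one]
  refine (add_le_add hover hlacu).trans ?_
  rw [← ENNReal.ofReal_add (by positivity) (by positivity)]
  refine ENNReal.ofReal_le_ofReal ?_
  nlinarith

end Linearization

/-! ### The outer measure of the exceptional set -/

/-- The outer measure is at most the sum of the top lengths of a finite family of generating sets. -/
lemma tileMeasure_le_sum {n : ℤ} {𝔓 F : Set Tile} {ι : Type*} (R : Finset ι)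
    (E : ι → Set Tile) (J : ι → DyadicInterval) (ξ : ι → ℝ) (hE𝔓 : ∀ b ∈ R, E b ⊆ 𝔓)
    (hE : ∀ b ∈ R, ∀ P ∈ E b, P.I.toSet ⊆ (J b).toSet ∧
      Ioo (ξ b - 1 / (2 * (J b).length)) (ξ b + 1 / (2 * (J b).length)) ⊆ P.omegaTilde n)
    (hF : F ⊆ ⋃ b ∈ R, E b) :
    tileMeasure n 𝔓 F ≤ ∑ b ∈ R, ENNReal.ofReal (J b).length := by
  classical
  set R' := (R.filter fun b => (E b).Nonempty).image fun b => (E b, J b, ξ b) with hR'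
  have hmem : ∀ T ∈ (R' : Set (Set Tile × DyadicInterval × ℝ)),
      ∃ b ∈ R, (E b).Nonempty ∧ T = (E b, J b, ξ b) := by
    intro T hT
    obtain ⟨b, hb, rfl⟩ := Finset.mem_image.1 (Finset.mem_coe.1 hT)
    exact ⟨b, (Finset.mem_filter.1 hb).1, (Finset.mem_filter.1 hb).2, rfl⟩
  unfold tileMeasure
  refine (iInf₂_le (R' : Set (Set Tile × DyadicInterval × ℝ)) R'.countable_toSet).trans ?_
  refine (iInf₂_le ?_ ?_).trans ?_
  · intro T hT
    obtain ⟨b, hb, hne, rfl⟩ := hmem T hT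
    exact ⟨hE𝔓 b hb, hne, hE b hb⟩
  · intro P hP
    obtain ⟨b, hb, hPb⟩ := mem_iUnion₂.1 (hF hP)
    refine mem_iUnion₂.2 ⟨(E b, J b, ξ b), ?_, hPb⟩
    exact Finset.mem_coe.2 (Finset.mem_image_of_mem _ (Finset.mem_filter.2 ⟨hb, ⟨P, hPb⟩⟩))
  · rw [Finset.tsum_subtype' R' fun T => ENNReal.ofReal T.2.1.length]
    calc ∑ T ∈ R', ENNReal.ofReal T.2.1.length
        ≤ ∑ b ∈ R.filter fun b => (E b).Nonempty, ENNReal.ofReal (J b).length := by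
          rw [← Finset.sum_fiberwise_of_maps_to (t := R') (g := fun b => (E b, J b, ξ b))
            fun b hb => Finset.mem_image_of_mem _ hb]
          refine Finset.sum_le_sum fun T hT => ?_
          obtain ⟨b, hb, rfl⟩ := Finset.mem_image.1 hT
          exact Finset.single_le_sum (f := fun b => ENNReal.ofReal (J b).length) (fun _ _ => zero_le)
            (Finset.mem_filter.2 ⟨hb, rfl⟩)
      _ ≤ _ := Finset.sum_le_sum_of_subset (Finset.filter_subset _ _)

namespace Linearization

variable {L : Linearization} {n : ℤ} {s θ lam : ℝ}

lemma sum_mass_le {ι : Type*} (R : Finset ι) (Ω : ι → Set ℝ) (hΩ : (R : Set ι).PairwiseDisjoint Ω)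
    (θ : ℝ) (x : ℝ) : ∑ r ∈ R, L.mass s θ (Ω r) x ≤ L.mass s θ univ x := by
  classical
  have h1 : ∑ r ∈ R, L.freqSum s (Ω r) x ≤ L.freqSum s univ x := by
    unfold freqSum
    rw [Finset.sum_comm]
    refine Finset.sum_le_sum fun j _ => ?_
    rw [indicator_univ]
    by_cases h : ∃ r ∈ R, L.Nf j x ∈ Ω r
    · obtain ⟨r, hr, hj⟩ := h
      rw [Finset.sum_eq_single_of_mem r hr fun r' hr' hne => indicator_of_notMem (fun hcon =>
        (hΩ hr' hr hne).notMem_of_mem_left hcon hj) _]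
      exact indicator_le_self _ _ _
    · rw [Finset.sum_eq_zero fun r hr => indicator_of_notMem (fun hcon => h ⟨r, hr, hcon⟩) _]
      exact zero_le
  unfold mass
  by_cases h : x ∈ {x | ENNReal.ofReal θ < L.visible s univ x}
  · simp only [indicator_of_mem h]
    rw [← Finset.mul_sum, ← Finset.mul_sum]
    gcongr
  · simp only [indicator_of_notMem h, Finset.sum_const_zero, le_refl]

/-- Every exceptional tile is near a selected rectangle of maximal length, and these rectangles are
disjoint. -/
theorem tileMeasure_exceptional_le (hn : 0 ≤ n) (hlam : 0 < lam) (𝔓 : Finset Tile) :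
    tileMeasure n 𝔓 (L.exceptional n s θ lam 𝔓) ≤
      ENNReal.ofReal (6 / lam) * ∫⁻ x, L.mass s θ univ x := by
  classical
  set X := ∫⁻ x, L.mass s θ univ x with hX
  rcases eq_or_ne X ∞ with hinf | hfin
  · rw [hinf, ENNReal.mul_top (by simpa using hlam)]
    exact le_top
  set good : Tile → ℤ → ℤ → ℤ → Prop := fun P k p r =>
    P.Near k p ∧ dyI (-k - 1) r ⊆ P.omegaTilde n ∧ L.Selected s θ lam k p r with hgood
  obtain ⟨b, hb⟩ : ∃ b : ℕ, X.toReal / lam < 2 ^ b := pow_unbounded_of_one_lt _ one_lt_two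
  have hbdd : ∀ {P k p r}, good P k p r → k ≤ b := by
    rintro P k p r ⟨-, -, h⟩
    have h1 : ENNReal.ofReal (lam * 2 ^ k) < X := by
      refine lt_of_lt_of_le h ((setLIntegral_le_lintegral _ _).trans (lintegral_mono fun x => ?_))
      exact L.mass_mono θ (subset_univ _) x
    rw [ENNReal.ofReal_lt_iff_lt_toReal (by have := two_zpow_pos k; positivity) hfin] at h1
    rw [div_lt_iff₀ hlam] at hb
    by_contra hcon
    have h2 : (2 : ℝ) ^ (b : ℤ) ≤ 2 ^ k := two_zpow_mono (by omega)
    rw [zpow_natCast] at h2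
    nlinarith
  have hex : ∀ P, ∃ k p r, P ∈ L.exceptional n s θ lam 𝔓 → good P k p r ∧
      ∀ k' p' r', good P k' p' r' → k' ≤ k := by
    intro P
    by_cases hP : P ∈ L.exceptional n s θ lam 𝔓
    · have h1 : ∃ k p r, good P k p r := by
        have h2 := hP.2
        unfold Unselected at h2
        push Not at h2
        exact h2
      obtain ⟨k, ⟨p, r, h⟩, hk⟩ := Int.exists_greatest_of_bdd (P := fun k => ∃ p r, good P k p r)
        ⟨b, fun k ⟨p, r, h⟩ => hbdd h⟩ h1
      exact ⟨k, p, r, fun _ => ⟨h, fun k' p' r' h' => hk k' ⟨p', r', h'⟩⟩⟩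
    · exact ⟨0, 0, 0, fun h => absurd h hP⟩
  choose k p r hkpr using hex
  set R := (𝔓.filter fun P => P ∈ L.exceptional n s θ lam 𝔓).image fun P => (k P, p P, r P) with hR
  have hRmem : ∀ t ∈ R, ∃ P ∈ L.exceptional n s θ lam 𝔓, t = (k P, p P, r P) := by
    intro t ht
    obtain ⟨P, hP, rfl⟩ := Finset.mem_image.1 ht
    exact ⟨P, (Finset.mem_filter.1 hP).2, rfl⟩
  -- nested rectangles contradict maximality
  have hdisj : ∀ t ∈ R, ∀ t' ∈ R, ∀ x y, x ∈ dyI t.1 t.2.1 → x ∈ dyI t'.1 t'.2.1 →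
      y ∈ dyI (-t.1 - 1) t.2.2 → y ∈ dyI (-t'.1 - 1) t'.2.2 → t.1 ≤ t'.1 → t = t' := by
    intro t ht t' ht' x y hx hx' hy hy' hle
    obtain ⟨P, hP, rfl⟩ := hRmem t ht
    obtain ⟨P', hP', rfl⟩ := hRmem t' ht'
    simp only at hx hx' hy hy' hle
    obtain ⟨⟨hn1, hs1, -⟩, hmax⟩ := hkpr P hP
    obtain ⟨⟨-, -, hsel'⟩, -⟩ := hkpr P' hP'
    have hx1 : dy (k P) x = p P := hx
    have hx2 : dy (k P') x = p P' := hx'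
    have hy1 : dy (-k P - 1) y = r P := hy
    have hy2 : dy (-k P' - 1) y = r P' := hy'
    have hgood' : good P (k P') (p P') (r P') := by
      refine ⟨?_, fun z hz => hs1 ?_, hsel'⟩
      · rw [← hx2]
        rw [← hx1] at hn1
        exact hn1.mono hle
      · have hz2 : dy (-k P' - 1) z = r P' := hz
        change dy (-k P - 1) z = r P
        rw [← hy1]
        exact dy_congr_of_le (by omega) (hz2.trans hy2.symm)
    have hk : k P = k P' := le_antisymm hle (hmax _ _ _ hgood')
    rw [hk] at hx1 hy1
    rw [hk, ← hx1, ← hx2, ← hy1, ← hy2]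
  have hsum : ∑ t ∈ R, ENNReal.ofReal (lam * 2 ^ t.1) ≤ X := by
    calc ∑ t ∈ R, ENNReal.ofReal (lam * 2 ^ t.1)
        ≤ ∑ t ∈ R, ∫⁻ x in dyI t.1 t.2.1, L.mass s θ (dyI (-t.1 - 1) t.2.2) x := by
          refine Finset.sum_le_sum fun t ht => ?_
          obtain ⟨P, hP, rfl⟩ := hRmem t ht
          exact le_of_lt (hkpr P hP).1.2.2
      _ = ∫⁻ x, ∑ t ∈ R, (dyI t.1 t.2.1).indicator (L.mass s θ (dyI (-t.1 - 1) t.2.2)) x := by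
          rw [lintegral_finsetSum _ fun t _ =>
            (L.measurable_mass θ (measurableSet_dyI _ _)).indicator (measurableSet_dyI _ _)]
          exact Finset.sum_congr rfl fun t _ => (lintegral_indicator (measurableSet_dyI _ _) _).symm
      _ ≤ X := by
          refine lintegral_mono fun x => ?_
          have h1 : ∑ t ∈ R, (dyI t.1 t.2.1).indicator (L.mass s θ (dyI (-t.1 - 1) t.2.2)) x =
              ∑ t ∈ R with x ∈ dyI t.1 t.2.1, L.mass s θ (dyI (-t.1 - 1) t.2.2) x := by
            rw [Finset.sum_filter]
            refine Finset.sum_congr rfl fun t _ => ?_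
            split_ifs with h
            · exact indicator_of_mem h _
            · exact indicator_of_notMem h _
          rw [h1]
          refine L.sum_mass_le _ (fun t : ℤ × ℤ × ℤ => dyI (-t.1 - 1) t.2.2) ?_ θ x
          intro t ht t' ht' hne
          obtain ⟨ht1, ht2⟩ := Finset.mem_filter.1 (Finset.mem_coe.1 ht)
          obtain ⟨ht1', ht2'⟩ := Finset.mem_filter.1 (Finset.mem_coe.1 ht')
          refine Set.disjoint_left.2 fun y hy hy' => hne ?_
          rcases le_total t.1 t'.1 with hle | hle
          · exact hdisj t ht1 t' ht1' x y ht2 ht2' hy hy' hle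
          · exact (hdisj t' ht1' t ht1 x y ht2' ht2 hy' hy hle).symm
  -- cover by the trees whose tops are next to the selected rectangles
  set B := R ×ˢ (Finset.Icc (-1 : ℤ) 1 ×ˢ Finset.Icc (0 : ℤ) 1) with hB
  set J : (ℤ × ℤ × ℤ) × ℤ × ℤ → DyadicInterval := fun b => ⟨b.1.1, b.1.2.1 + b.2.1⟩ with hJ
  set ξ : (ℤ × ℤ × ℤ) × ℤ × ℤ → ℝ := fun b => (b.1.2.2 + b.2.2) * 2 ^ (-b.1.1 - 1) with hξ
  set E : (ℤ × ℤ × ℤ) × ℤ × ℤ → Set Tile := fun b => {P ∈ (𝔓 : Set Tile) | P.I.toSet ⊆ (J b).toSet ∧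
    Ioo (ξ b - 1 / (2 * (J b).length)) (ξ b + 1 / (2 * (J b).length)) ⊆ P.omegaTilde n} with hE
  have hcover : L.exceptional n s θ lam 𝔓 ⊆ ⋃ b ∈ B, E b := by
    intro P hP
    obtain ⟨⟨hnear, hsub, -⟩, -⟩ := hkpr P hP
    have hPR : (k P, p P, r P) ∈ R :=
      Finset.mem_image_of_mem (fun P => (k P, p P, r P)) (Finset.mem_filter.2 ⟨hP.1, hP⟩)
    obtain ⟨hsc, hnear⟩ := hnear
    set i := dy (k P) P.I.center - p P with hi
    have hiI : i ∈ Finset.Icc (-1 : ℤ) 1 := by rw [Finset.mem_Icc]; exact abs_le.1 hnear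
    have hPJ : ∀ e, P.I.toSet ⊆ (J ((k P, p P, r P), i, e)).toSet := by
      intro e z hz
      rw [P.I.toSet_eq] at hz
      rw [DyadicInterval.toSet_eq]
      change dy (k P) z = p P + i
      have : dy P.I.scale z = dy P.I.scale P.I.center := by rw [P.I.dy_center]; exact hz
      rw [dy_congr_of_le hsc this, hi]
      ring
    set l := -k P - 1 with hl
    have hv := two_zpow_pos l
    have hlen : 1 / (2 * (2 : ℝ) ^ k P) = 2 ^ l := by
      rw [hl, zpow_sub₀ two_ne_zero, zpow_neg, zpow_one]
      field_simp
    have hvl : (2 : ℝ) ^ l ≤ 2 ^ (-P.I.scale - 1) := two_zpow_mono (by omega)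
    have hn' : (0 : ℝ) ≤ n := by exact_mod_cast hn
    have hΩ : P.omegaTilde n = Ico ((2 * (P.ω.pos : ℝ) - 49) * 2 ^ (-P.I.scale - 1))
        ((2 * ((P.ω.pos : ℝ) + n) + 51) * 2 ^ (-P.I.scale - 1)) := by
      ext y; exact P.mem_omegaTilde_iff hn
    rw [dyI_eq_Ico, hΩ, Ico_subset_Ico_iff (by nlinarith)] at hsub
    obtain ⟨h1, h2⟩ := hsub
    by_cases hcase : (2 * P.ω.pos - 49) * 2 ^ (-P.I.scale - 1) ≤ ((r P : ℝ) - 1) * 2 ^ l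
    · refine mem_iUnion₂.2 ⟨((k P, p P, r P), i, 0), Finset.mem_product.2 ⟨hPR,
        Finset.mem_product.2 ⟨hiI, by simp⟩⟩, hP.1, hPJ 0, ?_⟩
      have e1 : ξ ((k P, p P, r P), i, 0) = r P * 2 ^ l := by
        change ((r P : ℝ) + ((0 : ℤ) : ℝ)) * 2 ^ l = _
        rw [Int.cast_zero, add_zero]
      have e2 : (J ((k P, p P, r P), i, 0)).length = 2 ^ k P := rfl
      rw [e1, e2, hlen, hΩ]
      rintro y ⟨hy1, hy2⟩
      constructor <;> nlinarith
    · refine mem_iUnion₂.2 ⟨((k P, p P, r P), i, 1), Finset.mem_product.2 ⟨hPR,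
        Finset.mem_product.2 ⟨hiI, by simp⟩⟩, hP.1, hPJ 1, ?_⟩
      have e1 : ξ ((k P, p P, r P), i, 1) = (r P + 1) * 2 ^ l := by
        change ((r P : ℝ) + ((1 : ℤ) : ℝ)) * 2 ^ l = _
        rw [Int.cast_one]
      have e2 : (J ((k P, p P, r P), i, 1)).length = 2 ^ k P := rfl
      rw [e1, e2, hlen, hΩ]
      rintro y ⟨hy1, hy2⟩
      constructor <;> nlinarith
  calc tileMeasure n 𝔓 (L.exceptional n s θ lam 𝔓)
      ≤ ∑ b ∈ B, ENNReal.ofReal (J b).length :=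
        tileMeasure_le_sum B E J ξ (fun b _ P hP => hP.1) (fun b _ P hP => hP.2) hcover
    _ = 6 * ∑ t ∈ R, ENNReal.ofReal (2 ^ t.1) := by
        rw [hB, Finset.sum_product, Finset.mul_sum]
        refine Finset.sum_congr rfl fun t _ => ?_
        have : ∀ b ∈ Finset.Icc (-1 : ℤ) 1 ×ˢ Finset.Icc (0 : ℤ) 1,
            ENNReal.ofReal (J (t, b)).length = ENNReal.ofReal (2 ^ t.1) := fun _ _ => rfl
        rw [Finset.sum_congr rfl this, Finset.sum_const, Finset.card_product, nsmul_eq_mul]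
        simp
    _ = ENNReal.ofReal (6 / lam) * ∑ t ∈ R, ENNReal.ofReal (lam * 2 ^ t.1) := by
        rw [Finset.mul_sum, Finset.mul_sum]
        refine Finset.sum_congr rfl fun t _ => ?_
        have := two_zpow_pos t.1
        rw [← ENNReal.ofReal_mul (by positivity), show (6 : ℝ≥0∞) = ENNReal.ofReal 6 by simp,
          ← ENNReal.ofReal_mul (by norm_num)]
        congr 1
        field_simp
    _ ≤ _ := by gcongr

end Linearization

/-! ### From the super level estimate to outer norms -/

/-- The weak-type bound that follows from a super level estimate. -/
lemma iSup_superLevel_le {Λ : ℝ≥0∞ → ℝ≥0∞} {g : ℝ → ℝ} {s B D : ℝ} (hs : 1 ≤ s)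
    (hB : 0 ≤ B)
    (h : ∀ t : ℝ, 0 < t → Λ (ENNReal.ofReal t) ≤ ENNReal.ofReal (B * t ^ (-s)) *
      ∫⁻ x in {x | t < D * g x}, ENNReal.ofReal (g x ^ s)) :
    ⨆ (t : ℝ) (_ : 0 < t), ENNReal.ofReal t * Λ (ENNReal.ofReal t) ^ (1 / s) ≤
      ENNReal.ofReal (B ^ (1 / s)) * (∫⁻ x, ENNReal.ofReal (g x ^ s)) ^ (1 / s) := by
  have hs0 : 0 < s := by linarith
  refine iSup₂_le fun t ht => ?_
  calc ENNReal.ofReal t * Λ (ENNReal.ofReal t) ^ (1 / s)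
      ≤ ENNReal.ofReal t * (ENNReal.ofReal (B * t ^ (-s)) *
          ∫⁻ x, ENNReal.ofReal (g x ^ s)) ^ (1 / s) := by
        gcongr
        exact (h t ht).trans (mul_le_mul_right (setLIntegral_le_lintegral _ _) _)
    _ = _ := by
        rw [ENNReal.mul_rpow_of_nonneg _ _ (by positivity), ← mul_assoc,
          ENNReal.ofReal_rpow_of_nonneg (by positivity) (by positivity), ← ENNReal.ofReal_mul ht.le]
        congr 2
        rw [Real.mul_rpow hB (by positivity), ← Real.rpow_mul ht.le, neg_mul,
          mul_one_div_cancel hs0.ne', Real.rpow_neg_one]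
        field_simp

/-- The strong-type bound that follows from a super level estimate. -/
lemma lintegral_superLevel_le {Λ : ℝ≥0∞ → ℝ≥0∞} {g : ℝ → ℝ} {s p B D : ℝ} (hs : 1 ≤ s) (hp : s < p)
    (hB : 0 ≤ B) (hD : 0 < D) (hg : Measurable g) (hg0 : ∀ x, 0 ≤ g x)
    (h : ∀ t : ℝ, 0 < t → Λ (ENNReal.ofReal t) ≤ ENNReal.ofReal (B * t ^ (-s)) *
      ∫⁻ x in {x | t < D * g x}, ENNReal.ofReal (g x ^ s)) :
    ∫⁻ t in Ioi (0 : ℝ), ENNReal.ofReal (t ^ (p - 1)) * Λ (ENNReal.ofReal t) ≤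
      ENNReal.ofReal (B * D ^ (p - s) / (p - s)) * ∫⁻ x, ENNReal.ofReal (g x ^ p) := by
  have hps : 0 < p - s := by linarith
  have hgs : Measurable fun x => ENNReal.ofReal (g x ^ s) := (hg.pow_const s).ennreal_ofReal
  set ν := volume.withDensity fun x => ENNReal.ofReal (g x ^ s) with hν
  have hlayer := lintegral_rpow_eq_lintegral_meas_lt_mul ν (f := fun x => D * g x)
    (Filter.Eventually.of_forall fun x => mul_nonneg hD.le (hg0 x))
    (hg.const_mul D).aemeasurable hps
  have hdens : ∫⁻ x, ENNReal.ofReal ((D * g x) ^ (p - s)) ∂ν =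
      ENNReal.ofReal (D ^ (p - s)) * ∫⁻ x, ENNReal.ofReal (g x ^ p) := by
    rw [hν, lintegral_withDensity_eq_lintegral_mul _ hgs
      ((hg.const_mul D).pow_const (p - s)).ennreal_ofReal,
      ← lintegral_const_mul _ (hg.pow_const p).ennreal_ofReal]
    refine lintegral_congr fun x => ?_
    rw [Pi.mul_apply, ← ENNReal.ofReal_mul (Real.rpow_nonneg (hg0 x) _),
      ← ENNReal.ofReal_mul (Real.rpow_nonneg hD.le _)]
    congr 1
    rw [Real.mul_rpow hD.le (hg0 x), mul_left_comm, ← Real.rpow_add_of_nonneg (hg0 x) (by linarith)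
      hps.le]
    ring_nf
  have hps' : ENNReal.ofReal (p - s) ≠ 0 := by simpa using hps
  calc ∫⁻ t in Ioi (0 : ℝ), ENNReal.ofReal (t ^ (p - 1)) * Λ (ENNReal.ofReal t)
      ≤ ∫⁻ t in Ioi (0 : ℝ), ENNReal.ofReal B *
          (ν {x | t < D * g x} * ENNReal.ofReal (t ^ (p - s - 1))) := by
        refine setLIntegral_mono' measurableSet_Ioi fun t ht => ?_
        have ht' : 0 < t := ht
        refine (mul_le_mul_right (h t ht) _).trans (le_of_eq ?_)
        rw [hν, withDensity_apply _ (measurableSet_lt measurable_const (hg.const_mul D)), ← mul_assoc,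
          ← ENNReal.ofReal_mul (Real.rpow_nonneg ht'.le _), mul_comm (∫⁻ x in _, _),
          ← mul_assoc (ENNReal.ofReal B), ← ENNReal.ofReal_mul hB]
        congr 2
        rw [mul_left_comm, ← Real.rpow_add ht']
        ring_nf
    _ = ENNReal.ofReal B * ∫⁻ t in Ioi (0 : ℝ),
          ν {x | t < D * g x} * ENNReal.ofReal (t ^ (p - s - 1)) :=
        lintegral_const_mul' _ _ ENNReal.ofReal_ne_top
    _ = ENNReal.ofReal B * ((ENNReal.ofReal (p - s))⁻¹ * (ENNReal.ofReal (D ^ (p - s)) *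
          ∫⁻ x, ENNReal.ofReal (g x ^ p))) := by
        rw [← hdens, hlayer, ← mul_assoc (ENNReal.ofReal (p - s))⁻¹,
          ENNReal.inv_mul_cancel hps' ENNReal.ofReal_ne_top, one_mul]
    _ = _ := by
        rw [← ENNReal.ofReal_inv_of_pos hps, ← mul_assoc, ← mul_assoc,
          ← ENNReal.ofReal_mul (by positivity), ← ENNReal.ofReal_mul (by positivity)]
        congr 2
        ring

/-! ### The super level estimate -/

/-- Sizes depend only on the values at the tiles of the collection. -/
lemma outsup_congr {n : ℤ} {t : ℝ≥0∞} {𝔓 : Set Tile} {g g' : Tile → ℂ} (h : EqOn g g' 𝔓) :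
    outsup (generatingSets n 𝔓) (embedSize n t) g = outsup (generatingSets n 𝔓) (embedSize n t) g' := by
  have hsize : ∀ (Q : Set Tile → DyadicInterval → ℝ → Prop) (t : ℝ≥0∞) (E : Set Tile), E ⊆ 𝔓 →
      treeSize Q t g E = treeSize Q t g' E := by
    intro Q t E hE
    unfold treeSize
    split_ifs
    · exact iSup_congr fun P => iSup_congr fun hP => by rw [h (hE hP)]
    · refine iSup_congr fun S => iSup_congr fun hS => iSup_congr fun I => iSup_congr fun ξ => iSup_congr fun _ => ?_
      congr 2
      exact tsum_congr fun P => by rw [h (hE (hS P.2))]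
  unfold outsup embedSize
  exact iSup_congr fun E => iSup_congr fun hE => by rw [hsize _ _ _ hE.1, hsize _ _ _ hE.1]

namespace Linearization

variable {L : Linearization} {s : ℝ}

lemma visible_univ (hs : 1 ≤ s) (x : ℝ) :
    L.visible s univ x = ENNReal.ofReal ‖weighted s L.K L.d L.f x‖ := by
  have h0 : ∀ j ∈ Finset.Icc 1 (L.K x), 0 ≤ ‖L.d j x‖ ^ s := fun j _ =>
    Real.rpow_nonneg (norm_nonneg _) _
  have h1 := Finset.sum_nonneg h0
  unfold visible freqSum weighted
  rw [norm_mul, Complex.norm_real, Real.norm_of_nonneg (Real.rpow_nonneg h1 _),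
    ENNReal.ofReal_mul (norm_nonneg _), ofReal_norm,
    ← ENNReal.ofReal_rpow_of_nonneg h1 (by positivity), ENNReal.ofReal_sum_of_nonneg h0]
  congr 2
  refine Finset.sum_congr rfl fun j _ => ?_
  rw [indicator_univ, ← ofReal_norm, ENNReal.ofReal_rpow_of_nonneg (norm_nonneg _) (by linarith)]

lemma measurable_norm_weighted (L : Linearization) (hs : 1 ≤ s) :
    Measurable fun x => ‖weighted s L.K L.d L.f x‖ := by
  have h : (fun x => ‖weighted s L.K L.d L.f x‖) = fun x => (L.visible s univ x).toReal := by
    ext x; rw [visible_univ hs, ENNReal.toReal_ofReal (norm_nonneg _)]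
  rw [h]
  exact (L.measurable_visible MeasurableSet.univ).ennreal_toReal

lemma lintegral_mass_univ (hs : 1 ≤ s) {θ : ℝ} (hθ : 0 < θ) :
    ∫⁻ x, L.mass s θ univ x = ENNReal.ofReal (θ ^ (1 - s)) *
      ∫⁻ x in {x | θ < ‖weighted s L.K L.d L.f x‖},
        ENNReal.ofReal (‖weighted s L.K L.d L.f x‖ ^ s) := by
  have hm := L.measurable_norm_weighted hs
  have hset : {x | ENNReal.ofReal θ < L.visible s univ x} =
      {x | θ < ‖weighted s L.K L.d L.f x‖} := by
    ext x
    rw [mem_ofPred_eq, mem_ofPred_eq, visible_univ hs, ENNReal.ofReal_lt_ofReal_iff_of_nonneg hθ.le]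
  simp_rw [L.mass_univ hs, hset]
  rw [lintegral_const_mul' _ _ ENNReal.ofReal_ne_top,
    lintegral_indicator (measurableSet_lt measurable_const hm)]
  congr 1
  refine lintegral_congr fun x => ?_
  rw [visible_univ hs, ENNReal.ofReal_rpow_of_nonneg (norm_nonneg _) (by linarith)]

/-- The standing hypotheses on the linearizing data and the collection of tiles, with the density of
the support of `f` bounded by `M`. -/
structure Standard (L : Linearization) (m n : ℤ) (M : ℝ) (A : ℕ → ℕ → ℝ) (N : ℕ)
    (φ : Tile → ℝ → ℂ) (𝔓 : Finset Tile) : Prop where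
  m_le : 501 ≤ m
  n_le : 501 ≤ n
  M_pos : 0 < M
  packet : ∀ P ∈ 𝔓, IsWavePacket A P (φ P)
  density : ∀ P ∈ 𝔓, P.DensityLE N L.f M
  sparse : Sparse (2 * |(n : ℝ)| + 200) (𝔓 : Set Tile)

/-- The super level estimate, and its limiting case: if the weighted function is at most `θ`, then no
rectangle is selected and the size is bounded everywhere. -/
theorem exists_superLevel_le (A : ℕ → ℕ → ℝ) {N : ℕ} (hN : 2 ≤ N) (n : ℤ) (hs1 : 1 ≤ s)
    (hs2 : s ≠ 2) :
    ∃ C : ℝ, 0 < C ∧ ∀ {L : Linearization} {m : ℤ} {M : ℝ} {φ : Tile → ℝ → ℂ} {𝔓 : Finset Tile}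
      {q' : ℝ≥0∞}, q' ≠ ∞ → q'.toReal = max 2 s → L.Standard m n M A N φ 𝔓 →
      (∀ t : ℝ, 0 < t → superLevel (𝔓 : Set Tile) (tileMeasure n 𝔓) (generatingSets n 𝔓)
        (embedSize n q') (T₂ m n φ L.K L.Nf L.d L.α L.f) (ENNReal.ofReal t) ≤
        ENNReal.ofReal (6 * C ^ s * M ^ (s - 1) * t ^ (-s)) *
          ∫⁻ x in {x | t < C * M * ‖weighted s L.K L.d L.f x‖},
            ENNReal.ofReal (‖weighted s L.K L.d L.f x‖ ^ s)) ∧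
      (∀ θ : ℝ, 0 < θ → (∀ᵐ x, ‖weighted s L.K L.d L.f x‖ ≤ θ) →
        outsup (generatingSets n 𝔓) (embedSize n q') (T₂ m n φ L.K L.Nf L.d L.α L.f) ≤
          ENNReal.ofReal (C * M * θ)) := by
  classical
  obtain ⟨C, hC, hout⟩ := exists_outsup_le A N n hs1 hs2
  refine ⟨C, hC, ?_⟩
  intro L m M φ 𝔓 q' hq' hq's h
  have hM := h.M_pos
  have hmain : ∀ θ : ℝ, 0 < θ → outsup (generatingSets n 𝔓) (embedSize n q') (((𝔓 : Set Tile) \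
      L.exceptional n s θ (θ * M) 𝔓).indicator (T₂ m n φ L.K L.Nf L.d L.α L.f)) ≤
        ENNReal.ofReal (C * (θ * M)) := by
    intro θ hθ
    refine hout hq' hq's ⟨h.m_le, h.n_le, hs1, hθ, by positivity, hM, le_rfl, hN, ?_, ?_, ?_⟩ ?_
      h.sparse
    · exact fun P hP => h.packet P (Finset.mem_filter.1 hP).1
    · exact fun P hP => (Finset.mem_filter.1 hP).2
    · exact fun P hP => h.density P (Finset.mem_filter.1 hP).1
    · have := le_abs_self (n : ℝ); linarith
  constructor
  · intro t ht
    -- the threshold for the weighted function that corresponds to the level `t`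
    set θ := t / (C * M) with hθdef
    have hθ : 0 < θ := by positivity
    have hCt : C * (θ * M) = t := by rw [hθdef]; field_simp
    have h1 := hmain θ hθ
    rw [hCt] at h1
    have hn := h.n_le
    have hsub : L.exceptional n s θ (θ * M) 𝔓 ⊆ 𝔓 := fun P hP => hP.1
    unfold superLevel
    refine (iInf₂_le_of_le (L.exceptional n s θ (θ * M) 𝔓) hsub (iInf_le _ h1)).trans ?_
    refine (tileMeasure_exceptional_le (by omega) (by positivity) 𝔓).trans (le_of_eq ?_)
    rw [lintegral_mass_univ hs1 hθ, ← mul_assoc, ← ENNReal.ofReal_mul (by positivity)]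
    have hset : {x | θ < ‖weighted s L.K L.d L.f x‖} =
        {x | t < C * M * ‖weighted s L.K L.d L.f x‖} := by
      ext x
      rw [mem_ofPred_eq, mem_ofPred_eq, hθdef, div_lt_iff₀' (by positivity)]
    rw [hset]
    congr 2
    have e1 : t = C * M * θ := by rw [← hCt]; ring
    have e2 : ∀ y : ℝ, 0 < y → y ^ (1 - s) = y * y ^ (-s) := fun y hy => by
      rw [sub_eq_add_neg, Real.rpow_add hy, Real.rpow_one]
    rw [e1, Real.mul_rpow (by positivity) hθ.le, Real.mul_rpow hC.le hM.le, e2 θ hθ,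
      Real.rpow_neg hC.le, Real.rpow_neg hM.le, Real.rpow_sub_one hM.ne']
    have := Real.rpow_pos_of_pos hC s
    have := Real.rpow_pos_of_pos hM s
    field_simp
  · intro θ hθ hle
    have h0 : ∫⁻ x, L.mass s θ univ x = 0 := by
      rw [lintegral_mass_univ hs1 hθ, Measure.restrict_eq_zero.2, lintegral_zero_measure, mul_zero]
      have := ae_iff.1 hle
      simpa only [not_le] using this
    have hexc : L.exceptional n s θ (θ * M) 𝔓 = ∅ := by
      refine eq_empty_of_forall_notMem fun P hP => hP.2 fun k p r _ _ hsel => ?_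
      refine absurd (hsel.trans_le ((setLIntegral_le_lintegral _ _).trans
        (lintegral_mono fun x => L.mass_mono θ (subset_univ _) x))) ?_
      rw [h0]
      exact not_lt.2 zero_le
    have h1 := hmain θ hθ
    rw [hexc, sdiff_empty] at h1
    rw [outsup_congr (g' := (𝔓 : Set Tile).indicator (T₂ m n φ L.K L.Nf L.d L.α L.f))
      fun P hP => (indicator_of_mem hP _).symm, mul_assoc, mul_comm M]
    exact h1

end Linearization

/-! ### The embedding theorem -/

lemma one_div_toReal_of_holderConjugate {p p' : ℝ≥0∞} (h : ENNReal.HolderConjugate p p') :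
    1 / p'.toReal = 1 - 1 / p.toReal := by
  have h1 := ENNReal.holderConjugate_iff.1 h
  have hp : p⁻¹ ≠ ∞ := ne_top_of_le_ne_top ENNReal.one_ne_top (h1 ▸ self_le_add_right _ _)
  have hp' : p'⁻¹ ≠ ∞ := ne_top_of_le_ne_top ENNReal.one_ne_top (h1 ▸ self_le_add_left _ _)
  have h2 := congrArg ENNReal.toReal h1
  rw [ENNReal.toReal_add hp hp', ENNReal.toReal_inv, ENNReal.toReal_inv, ENNReal.toReal_one] at h2
  rw [one_div, one_div]
  linarith

/-- The exponent dual to `min 2 s'` is `max 2 s`. -/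
lemma eq_ofReal_max_of_holderConjugate {s : ℝ} {s' q q' : ℝ≥0∞}
    (hs : ENNReal.HolderConjugate (ENNReal.ofReal s) s') (hq : q = min 2 s')
    (hqq' : ENNReal.HolderConjugate q q') : q' = ENNReal.ofReal (max 2 s) := by
  have h1 := ENNReal.holderConjugate_iff.1 hs
  have h2 := ENNReal.holderConjugate_iff.1 hqq'
  have e2 : (2 : ℝ≥0∞) = ENNReal.ofReal 2 := by simp
  have hfin : (2 : ℝ≥0∞)⁻¹ ≠ ∞ := by simp
  have hsum := ENNReal.inv_two_add_inv_two
  rcases le_total s 2 with hle | hle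
  · have hs2 : ENNReal.ofReal s ≤ 2 := by rw [e2]; exact ENNReal.ofReal_le_ofReal hle
    have h3 : 2 ≤ s' := by
      rw [← ENNReal.inv_le_inv]
      have : 2⁻¹ ≤ (ENNReal.ofReal s)⁻¹ := ENNReal.inv_le_inv.2 hs2
      rw [← ENNReal.add_le_add_iff_left hfin, hsum, ← h1]
      gcongr
    rw [hq, min_eq_left h3, ← hsum, ENNReal.add_right_inj hfin, inv_inj] at h2
    rw [max_eq_left hle, h2, e2]
  · have hs2 : 2 ≤ ENNReal.ofReal s := by rw [e2]; exact ENNReal.ofReal_le_ofReal hle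
    have h3 : s' ≤ 2 := by
      rw [← ENNReal.inv_le_inv]
      have : (ENNReal.ofReal s)⁻¹ ≤ 2⁻¹ := ENNReal.inv_le_inv.2 hs2
      rw [← ENNReal.add_le_add_iff_left hfin, hsum, ← h1]
      gcongr
    have hs' : s'⁻¹ ≠ ∞ := ne_top_of_le_ne_top ENNReal.one_ne_top (h1 ▸ self_le_add_left _ _)
    rw [hq, min_eq_right h3, ← h1, add_comm (ENNReal.ofReal s)⁻¹, ENNReal.add_right_inj hs',
      inv_inj] at h2
    rw [max_eq_right hle, h2]

lemma tileMax_anti {N N' : ℕ} (h : N ≤ N') (𝔓 : Set Tile) (g : ℝ → ℝ≥0∞) :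
    tileMax N' 𝔓 g ≤ tileMax N 𝔓 g := by
  unfold tileMax
  refine iSup₂_mono fun P _ => ?_
  gcongr _ * ∫⁻ x, ENNReal.ofReal ?_ * _ with x
  exact P.I.chi_pow_le_chi_pow x h

lemma tileMax_ne_top {N : ℕ} (hN : 1 ≤ N) (𝔓 : Set Tile) (f : ℝ → ℂ) :
    tileMax N 𝔓 ((Function.support f).indicator 1) ≠ ∞ := by
  refine ne_top_of_le_ne_top ENNReal.ofReal_ne_top (b := ENNReal.ofReal chiMass) ?_
  refine iSup₂_le fun P _ => ?_
  have hl := P.I.length_pos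
  calc (ENNReal.ofReal P.I.length)⁻¹ *
        ∫⁻ x, ENNReal.ofReal (P.I.chi x ^ N) * (Function.support f).indicator 1 x
      ≤ (ENNReal.ofReal P.I.length)⁻¹ * ∫⁻ x, ENNReal.ofReal (P.I.chi x) := by
        gcongr with x
        refine (mul_le_of_le_one_right zero_le (indicator_le_self' (fun _ _ => zero_le) x)).trans ?_
        have := P.I.chi_pow_le_chi_pow x hN
        rw [pow_one] at this
        exact ENNReal.ofReal_le_ofReal this
    _ = ENNReal.ofReal chiMass := by
        rw [P.I.lintegral_chi, ← ENNReal.ofReal_inv_of_pos hl, ← ENNReal.ofReal_mul (by positivity),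
          inv_mul_cancel_left₀ hl.ne']

/-- The density of the support is measured by a positive number `M` which is the tile maximal average
unless `f` vanishes almost everywhere. -/
lemma exists_density {N : ℕ} (hN : 1 ≤ N) {𝔓 : Finset Tile} (h𝔓 : 𝔓.Nonempty) {f : ℝ → ℂ}
    (hf : Measurable f) : ∃ M : ℝ, 0 < M ∧ (∀ P ∈ 𝔓, P.DensityLE N f M) ∧
      (ENNReal.ofReal M = tileMax N (𝔓 : Set Tile) ((Function.support f).indicator 1) ∨
        f =ᵐ[volume] 0) := by
  set X := tileMax N (𝔓 : Set Tile) ((Function.support f).indicator 1) with hX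
  have hXtop : X ≠ ∞ := tileMax_ne_top hN _ f
  have hle : ∀ M : ℝ, X ≤ ENNReal.ofReal M → ∀ P ∈ 𝔓, P.DensityLE N f M := by
    intro M hM P hP
    have h1 := (le_iSup₂ (f := fun (P : Tile) (_ : P ∈ (𝔓 : Set Tile)) =>
      (ENNReal.ofReal P.I.length)⁻¹ * ∫⁻ x : ℝ, ENNReal.ofReal (P.I.chi x ^ N) *
        (Function.support f).indicator 1 x) P hP).trans hM
    have hl := P.I.length_pos
    have hl' : ENNReal.ofReal P.I.length ≠ 0 := by simpa using hl
    rw [ENNReal.inv_mul_le_iff hl' ENNReal.ofReal_ne_top, mul_comm,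
      ← ENNReal.ofReal_mul' hl.le] at h1
    exact h1
  rcases eq_or_ne X 0 with h0 | h0
  · refine ⟨1, one_pos, hle 1 (h0 ▸ zero_le), Or.inr ?_⟩
    obtain ⟨P, hP⟩ := h𝔓
    have h1 : P.DensityLE N f 0 := hle 0 (by rw [h0]; exact zero_le) P hP
    unfold Tile.DensityLE at h1
    rw [zero_mul, ENNReal.ofReal_zero, nonpos_iff_eq_zero, lintegral_eq_zero_iff] at h1
    · filter_upwards [h1] with x hx
      by_contra hfx
      rw [indicator_of_mem (show x ∈ Function.support f from hfx), Pi.one_apply, mul_one] at hx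
      have := pow_pos (P.I.chi_pos x) N
      simp only [Pi.zero_apply, ENNReal.ofReal_eq_zero] at hx
      linarith
    · exact ((P.I.continuous_chi.measurable.pow_const N).ennreal_ofReal).mul
        (measurable_one.indicator (measurableSet_support hf))
  · have hM := ENNReal.ofReal_toReal hXtop
    exact ⟨X.toReal, ENNReal.toReal_pos h0 hXtop, hle _ hM.ge, Or.inl hM⟩

lemma generatingSets_empty (n : ℤ) : generatingSets n ∅ = ∅ := by
  refine eq_empty_of_forall_notMem fun E hE => ?_
  obtain ⟨hE, I, ξ, ⟨P, hP⟩, -⟩ := hE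
  exact hE hP

lemma superLevel_empty (n : ℤ) (S : (Tile → ℂ) → Set Tile → ℝ≥0∞) (g : Tile → ℂ) (t : ℝ≥0∞) :
    superLevel ∅ (tileMeasure n ∅) (generatingSets n ∅) S g t = 0 := by
  have h1 : tileMeasure n ∅ ∅ = 0 := by
    refine nonpos_iff_eq_zero.1 ((tileMeasure_le_sum (∅ : Finset Unit) (fun _ => ∅)
      (fun _ => ⟨0, 0⟩) (fun _ => 0) (by simp) (by simp) (by simp)).trans (by simp))
  rw [← nonpos_iff_eq_zero, ← h1]
  refine iInf₂_le_of_le ∅ subset_rfl (iInf_le _ ?_)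
  rw [generatingSets_empty]
  simp [outsup]

namespace Linearization

variable {s : ℝ}

lemma eLpNorm_weighted {K : ℝ → ℕ} {d : ℕ → ℝ → ℂ} {f : ℝ → ℂ} {p : ℝ≥0∞} (hp0 : p ≠ 0)
    (hp : p ≠ ∞) : eLpNorm (weighted s K d f) p volume =
      (∫⁻ x, ENNReal.ofReal (‖weighted s K d f x‖ ^ p.toReal)) ^ (1 / p.toReal) := by
  rw [eLpNorm_eq_lintegral_rpow_enorm_toReal hp0 hp]
  congr 1
  refine lintegral_congr fun x => ?_
  rw [← ofReal_norm, ENNReal.ofReal_rpow_of_nonneg (norm_nonneg _) ENNReal.toReal_nonneg]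

lemma rpow_one_div_toReal_mul {M p : ℝ} (hM : 0 < M) (hp : 0 < p) :
    (M ^ (p - 1)) ^ (1 / p) = M ^ (1 - 1 / p) := by
  rw [← Real.rpow_mul hM.le]
  congr 1
  field_simp

/-- The strong-type estimate in terms of the density of the support. -/
theorem exists_outerLp_le (A : ℕ → ℕ → ℝ) {N : ℕ} (hN : 2 ≤ N) (n : ℤ) (hs1 : 1 ≤ s) (hs2 : s ≠ 2)
    {p : ℝ≥0∞} (hp : ENNReal.ofReal s < p) :
    ∃ C : ℝ≥0, ∀ {L : Linearization} {m : ℤ} {M : ℝ} {φ : Tile → ℝ → ℂ} {𝔓 : Finset Tile},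
      L.Standard m n M A N φ 𝔓 →
      outerLp (𝔓 : Set Tile) (tileMeasure n 𝔓) (generatingSets n 𝔓)
        (embedSize n (ENNReal.ofReal (max 2 s))) p (T₂ m n φ L.K L.Nf L.d L.α L.f) ≤
        C * ENNReal.ofReal M ^ (1 - 1 / p.toReal) * eLpNorm (weighted s L.K L.d L.f) p volume := by
  obtain ⟨C, hC, hmain⟩ := exists_superLevel_le A hN n hs1 hs2
  have hq : (ENNReal.ofReal (max 2 s)).toReal = max 2 s :=
    ENNReal.toReal_ofReal (le_max_of_le_left zero_le_two)
  rcases eq_or_ne p ∞ with rfl | hptop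
  · refine ⟨C.toNNReal, ?_⟩
    intro L m M φ 𝔓 h
    have hM := h.M_pos
    have hbd := (hmain ENNReal.ofReal_ne_top hq h).2
    rw [outerLp, if_pos rfl, ENNReal.toReal_top, div_zero, sub_zero, ENNReal.rpow_one,
      eLpNorm_exponent_top]
    change _ ≤ ENNReal.ofReal C * _ * _
    set Y := eLpNormEssSup (weighted s L.K L.d L.f) volume with hY
    rw [← ENNReal.ofReal_mul hC.le]
    rcases eq_or_ne Y ∞ with hYtop | hYtop
    · rw [hYtop, ENNReal.mul_top (by have := mul_pos hC hM; simpa using this)]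
      exact le_top
    have hae : ∀ᵐ x, ‖weighted s L.K L.d L.f x‖ ≤ Y.toReal := by
      filter_upwards [enorm_ae_le_eLpNormEssSup (weighted s L.K L.d L.f) volume] with x hx
      rw [← toReal_enorm]
      exact ENNReal.toReal_mono hYtop hx
    refine ENNReal.le_of_forall_pos_le_add fun ε hε _ => ?_
    -- a threshold slightly above the essential supremum, so that it is positive
    set θ := Y.toReal + ε / (C * M) with hθ
    have hε' : (0 : ℝ) < ε / (C * M) := div_pos (NNReal.coe_pos.2 hε) (mul_pos hC hM)
    have hθ0 : 0 < θ := add_pos_of_nonneg_of_pos ENNReal.toReal_nonneg hε'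
    refine (hbd θ hθ0 (hae.mono fun x hx => by linarith)).trans (le_of_eq ?_)
    have : C * M * θ = C * M * Y.toReal + ε := by rw [hθ]; field_simp
    rw [this, ENNReal.ofReal_add (by positivity) ε.coe_nonneg, ENNReal.ofReal_mul (by positivity),
      ENNReal.ofReal_toReal hYtop, ENNReal.ofReal_coe_nnreal]
  · have hsp : s < p.toReal := by
      rwa [ENNReal.ofReal_lt_iff_lt_toReal (by linarith) hptop] at hp
    set P := p.toReal with hP
    have hP0 : 0 < P := by linarith
    have hpP : p = ENNReal.ofReal P := (ENNReal.ofReal_toReal hptop).symm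
    have hps : 0 < P - s := by linarith
    refine ⟨((P * (6 / (P - s))) ^ (1 / P) * C).toNNReal, ?_⟩
    intro L m M φ 𝔓 h
    have hM := h.M_pos
    have hbd := lintegral_superLevel_le (p := P) (B := 6 * C ^ s * M ^ (s - 1)) (D := C * M)
      hs1 hsp (by positivity) (by positivity) (L.measurable_norm_weighted hs1)
      (fun x => norm_nonneg _) (hmain ENNReal.ofReal_ne_top hq h).1
    rw [outerLp, if_neg hptop, eLpNorm_weighted (by rw [hpP]; simpa using hP0) hptop, ← hP]
    change _ ≤ ENNReal.ofReal _ * _ * _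
    calc _ ≤ (p * (ENNReal.ofReal (6 * C ^ s * M ^ (s - 1) * (C * M) ^ (P - s) / (P - s)) *
          ∫⁻ x, ENNReal.ofReal (‖weighted s L.K L.d L.f x‖ ^ P))) ^ (1 / P) := by gcongr
      _ = _ := by
        rw [hpP, ← mul_assoc, ← ENNReal.ofReal_mul hP0.le,
          ENNReal.mul_rpow_of_nonneg _ _ (by positivity),
          ENNReal.ofReal_rpow_of_nonneg (by positivity) (by positivity),
          ENNReal.ofReal_rpow_of_pos hM, ← ENNReal.ofReal_mul (by positivity)]
        congr 2
        have e1 : P * (6 * C ^ s * M ^ (s - 1) * (C * M) ^ (P - s) / (P - s)) =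
            P * (6 / (P - s)) * C ^ P * M ^ (P - 1) := by
          have hCP : C ^ P = C ^ s * C ^ (P - s) := by rw [← Real.rpow_add hC]; ring_nf
          have hMP : M ^ (P - 1) = M ^ (s - 1) * M ^ (P - s) := by
            rw [← Real.rpow_add hM]; ring_nf
          rw [Real.mul_rpow hC.le hM.le, hCP, hMP]
          ring
        rw [e1, Real.mul_rpow (by positivity) (by positivity),
          Real.mul_rpow (by positivity) (by positivity), ← Real.rpow_mul hC.le,
          mul_one_div_cancel hP0.ne', Real.rpow_one, rpow_one_div_toReal_mul hM hP0]

/-- The weak-type estimate in terms of the density of the support. -/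
theorem exists_outerWeakLp_le (A : ℕ → ℕ → ℝ) {N : ℕ} (hN : 2 ≤ N) (n : ℤ) (hs1 : 1 ≤ s)
    (hs2 : s ≠ 2) :
    ∃ C : ℝ≥0, ∀ {L : Linearization} {m : ℤ} {M : ℝ} {φ : Tile → ℝ → ℂ} {𝔓 : Finset Tile},
      L.Standard m n M A N φ 𝔓 →
      outerWeakLp (𝔓 : Set Tile) (tileMeasure n 𝔓) (generatingSets n 𝔓)
        (embedSize n (ENNReal.ofReal (max 2 s))) (ENNReal.ofReal s)
        (T₂ m n φ L.K L.Nf L.d L.α L.f) ≤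
        C * ENNReal.ofReal M ^ (1 - 1 / s) *
          eLpNorm (weighted s L.K L.d L.f) (ENNReal.ofReal s) volume := by
  obtain ⟨C, hC, hmain⟩ := exists_superLevel_le A hN n hs1 hs2
  have hs0 : 0 < s := by linarith
  have hq : (ENNReal.ofReal (max 2 s)).toReal = max 2 s :=
    ENNReal.toReal_ofReal (le_max_of_le_left zero_le_two)
  refine ⟨((6 : ℝ) ^ (1 / s) * C).toNNReal, ?_⟩
  intro L m M φ 𝔓 h
  have hM := h.M_pos
  have hbd := iSup_superLevel_le hs1 (B := 6 * C ^ s * M ^ (s - 1)) (by positivity)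
    (hmain ENNReal.ofReal_ne_top hq h).1
  rw [outerWeakLp, if_neg ENNReal.ofReal_ne_top,
    eLpNorm_weighted (by simpa using hs0) ENNReal.ofReal_ne_top, ENNReal.toReal_ofReal hs0.le]
  refine hbd.trans (le_of_eq ?_)
  change _ = ENNReal.ofReal _ * _ * _
  rw [ENNReal.ofReal_rpow_of_pos hM, ← ENNReal.ofReal_mul (by positivity)]
  congr 2
  rw [Real.mul_rpow (by positivity) (by positivity), Real.mul_rpow (by positivity) (by positivity),
    ← Real.rpow_mul hC.le, mul_one_div_cancel hs0.ne', Real.rpow_one, rpow_one_div_toReal_mul hM hs0]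

/-- The density of the support can be replaced by the tile maximal average. The larger exponent `N + 2`
makes the maximal average finite and the tails integrable; it only decreases the average. -/
lemma le_tileMax_of_standard {A : ℕ → ℕ → ℝ} {N : ℕ} {L : Linearization} {m n : ℤ}
    {φ : Tile → ℝ → ℂ} {𝔓 : Finset Tile} (h𝔓 : 𝔓.Nonempty)
    (hsp : Sparse (2 * |(n : ℝ)| + 200) (𝔓 : Set Tile)) (hsep : ∀ P ∈ 𝔓, P.Separated m n)
    (hφ : ∀ P ∈ 𝔓, IsWavePacket A P (φ P)) {Φ p : ℝ≥0∞} {C : ℝ≥0} {e : ℝ} (he : 0 ≤ e)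
    (h : ∀ M : ℝ, L.Standard m n M A (N + 2) φ 𝔓 →
      Φ ≤ C * ENNReal.ofReal M ^ e * eLpNorm (weighted s L.K L.d L.f) p volume) :
    Φ ≤ C * tileMax N (𝔓 : Set Tile) ((Function.support L.f).indicator 1) ^ e *
      eLpNorm (weighted s L.K L.d L.f) p volume := by
  obtain ⟨P, hP⟩ := h𝔓
  obtain ⟨hm, hn⟩ := (hsep P hP).bounds
  obtain ⟨M, hM, hdens, hMX⟩ := exists_density (N := N + 2) (by omega) ⟨P, hP⟩ L.measurable_f
  have h1 := h M ⟨hm, hn, hM, hφ, hdens, hsp⟩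
  rcases hMX with hMX | hf
  · refine h1.trans ?_
    rw [hMX]
    gcongr
    exact tileMax_anti (by omega) _ _
  · have h2 : weighted s L.K L.d L.f =ᵐ[volume] 0 := by
      filter_upwards [hf] with x hx
      simp only [weighted, hx, Pi.zero_apply, zero_mul]
    rw [eLpNorm_congr_ae h2, eLpNorm_zero, mul_zero] at h1
    exact h1.trans zero_le

end Linearization

end OuterEmbedding

theorem theoremt (m n : ℤ) :
    -- sufficient sparseness depends only on the rigidity parameters
    ∃ C₀ : ℝ, 1 ≤ C₀ ∧
    ∀ (A : ℕ → ℕ → ℝ) (N : ℕ) (s : ℝ) (s' q q' : ℝ≥0∞), 1 ≤ s → s ≠ 2 →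
      ENNReal.HolderConjugate (ENNReal.ofReal s) s' → q = min 2 s' →
      ENNReal.HolderConjugate q q' →
      -- strong type for all exponents in `(s, ∞]`
      (∀ p p' : ℝ≥0∞, ENNReal.ofReal s < p → ENNReal.HolderConjugate p p' →
        ∃ C : ℝ≥0, ∀ (𝔓 : Finset Tile) (φ : Tile → ℝ → ℂ) (K : ℝ → ℕ) (Nf : ℕ → ℝ → ℝ)
          (d : ℕ → ℝ → ℂ) (α : ℕ → ℝ → ℝ≥0∞) (f : ℝ → ℂ),
          Sparse C₀ (𝔓 : Set Tile) → (∀ P ∈ 𝔓, P.Separated m n) →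
          (∀ P ∈ 𝔓, IsWavePacket A P (φ P)) →
          Measurable K → (∀ j, Measurable (Nf j)) → (∀ x, Monotone fun j => Nf j x) →
          (∀ j, Measurable (d j)) → (∀ j, Measurable (α j)) → Measurable f →
          outerLp (𝔓 : Set Tile) (tileMeasure n (𝔓 : Set Tile))
              (generatingSets n (𝔓 : Set Tile)) (embedSize n q') p (T₂ m n φ K Nf d α f) ≤
            C * tileMax N (𝔓 : Set Tile) ((Function.support f).indicator 1) ^ (1 / p'.toReal) *
              eLpNorm (weighted s K d f) p volume) ∧
      -- weak type at the exponent `s`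
      (∃ C : ℝ≥0, ∀ (𝔓 : Finset Tile) (φ : Tile → ℝ → ℂ) (K : ℝ → ℕ) (Nf : ℕ → ℝ → ℝ)
          (d : ℕ → ℝ → ℂ) (α : ℕ → ℝ → ℝ≥0∞) (f : ℝ → ℂ),
          Sparse C₀ (𝔓 : Set Tile) → (∀ P ∈ 𝔓, P.Separated m n) →
          (∀ P ∈ 𝔓, IsWavePacket A P (φ P)) →
          Measurable K → (∀ j, Measurable (Nf j)) → (∀ x, Monotone fun j => Nf j x) →
          (∀ j, Measurable (d j)) → (∀ j, Measurable (α j)) → Measurable f →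
          outerWeakLp (𝔓 : Set Tile) (tileMeasure n (𝔓 : Set Tile))
              (generatingSets n (𝔓 : Set Tile)) (embedSize n q') (ENNReal.ofReal s)
              (T₂ m n φ K Nf d α f) ≤
            C * tileMax N (𝔓 : Set Tile) ((Function.support f).indicator 1) ^ (1 / s'.toReal) *
              eLpNorm (weighted s K d f) (ENNReal.ofReal s) volume) := by
  refine ⟨2 * |(n : ℝ)| + 200, by have := abs_nonneg (n : ℝ); linarith, ?_⟩
  intro A N s s' q q' hs1 hs2 hss' hq hqq'
  have hs0 : 0 < s := by linarith
  have hq' := eq_ofReal_max_of_holderConjugate hss' hq hqq'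
  subst hq'
  constructor
  · intro p p' hp hpp'
    obtain ⟨C, hC⟩ := Linearization.exists_outerLp_le A (N := N + 2) (by omega) n hs1 hs2 hp
    refine ⟨C, ?_⟩
    intro 𝔓 φ K Nf d α f hsp hsep hφ hK hNf hmono hd hα hf
    have hp1 : 1 ≤ p := by
      rw [← ENNReal.ofReal_one]
      exact (ENNReal.ofReal_le_ofReal hs1).trans hp.le
    rcases 𝔓.eq_empty_or_nonempty with rfl | h𝔓
    · refine le_trans (le_of_eq ?_) zero_le
      unfold outerLp
      rw [Finset.coe_empty]
      split_ifs with htop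
      · rw [generatingSets_empty]
        simp [outsup]
      · have : 0 < p.toReal := ENNReal.toReal_pos (one_pos.trans_le hp1).ne' htop
        simp only [superLevel_empty, mul_zero, lintegral_zero]
        exact ENNReal.zero_rpow_of_pos (by positivity)
    · rw [one_div_toReal_of_holderConjugate hpp']
      have he : 0 ≤ 1 - 1 / p.toReal := by
        rw [← one_div_toReal_of_holderConjugate hpp']
        positivity
      set L : Linearization := ⟨K, Nf, d, α, f, hK, hNf, hmono, hd, hα, hf⟩
      exact L.le_tileMax_of_standard h𝔓 hsp hsep hφ he fun M hM => hC (L := L) hM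
  · obtain ⟨C, hC⟩ := Linearization.exists_outerWeakLp_le A (N := N + 2) (by omega) n hs1 hs2
    refine ⟨C, ?_⟩
    intro 𝔓 φ K Nf d α f hsp hsep hφ hK hNf hmono hd hα hf
    rcases 𝔓.eq_empty_or_nonempty with rfl | h𝔓
    · refine le_trans (le_of_eq ?_) zero_le
      unfold outerWeakLp
      rw [Finset.coe_empty, if_neg ENNReal.ofReal_ne_top, ENNReal.toReal_ofReal hs0.le]
      simp only [superLevel_empty, ENNReal.zero_rpow_of_pos (one_div_pos.2 hs0), mul_zero]
      simp
    · rw [one_div_toReal_of_holderConjugate hss', ENNReal.toReal_ofReal hs0.le]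
      have he : 0 ≤ 1 - 1 / s := by
        rw [sub_nonneg, div_le_one hs0]
        exact hs1
      set L : Linearization := ⟨K, Nf, d, α, f, hK, hNf, hmono, hd, hα, hf⟩
      exact L.le_tileMax_of_standard h𝔓 hsp hsep hφ he fun M hM => hC (L := L) hM
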